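/- Let $G$ be an abelian group of $n$-qubit Pauli operators of order $2^n$ generated by $n$ commuting independent signed Pauli strings $g_1,\dots,g_n$, let $H_0=-\sum_{P\in G}\alpha_P P$ with $\alpha_P\in\mathbb R$ be a stabilizer Hamiltonian, let $\delta H=\sum_{i=1}^k\gamma_iP_i$ with $\gamma_i\in\mathbb R$ and distinct, possibly non-commuting $n$-qubit Pauli strings $P_1,\dots,P_k$, and let $H=H_0+\delta H$. Let $|K|$ be the dimension of the group $K=\langle P_1,\dots,P_k\rangle$, that is, its number of independent generators modulo phases. The stabilizer eigenstates of $H_0$ are the states $\psi_s$, $s\in\{0,1\}^n$, with $g_j\psi_s=(-1)^{s_j}\psi_s$ for all $j$; let $S(a,b)$ be the set of those whose $H_0$-energy lies in $[a,b]$. There is a classical algorithm with the following property. For all $n,k$, all $H=H_0+\delta H$ as above and all $E_0<E_1$, it takes as input $g_1,\dots,g_n$, the $P_i$ and $\gamma_i$, $E_0$, $E_1$ and a list without repetition of the members of $S(E_0-\|\delta H\|,E_1+\|\delta H\|)$ (operator norm; each member is given by its bit string $s$), together with query access to the map sending $s$ to the $H_0$-energy of $\psi_s$, and it outputs all eigenstates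 of $H$ with energy in $[E_0,E_1]$. More precisely, it outputs a number $r\le\min(n,|K|)$, a Clifford circuit $C$, and a list of triples $(x,\varphi,E)$, where $x\in\{0,1\}^{n-r}$, $\varphi$ is the list of amplitudes of an $r$-qubit vector and $E\in[E_0,E_1]$, such that the vectors $C(|x\rangle\otimes|\varphi\rangle)$ are orthonormal, each satisfies $H\,C(|x\rangle\otimes|\varphi\rangle)=E\,C(|x\rangle\otimes|\varphi\rangle)$, and every eigenvector of $H$ with eigenvalue in $[E_0,E_1]$ is a linear combination of them. Its runtime is at most $$c\,\bigl(1+|S(E_0-\|\delta H\|,E_1+\|\delta H\|)|\cdot(n^3+2^{3|K|})\bigr)$$ with an absolute constant $c$. Runtime is counted on a random access machine with exact complex arithmetic (real RAM): unit cost for incrementing, decrementing, comparing, loading and storing natural numbers, and for arithmetic operations on complex numbers and comparisons of their real parts; cost $(d+1)^2$ for extracting one real root of a real polynomial of degree at most $d$ given by its coefficients; cost $n+1$ for an energy query. -/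

import Mathlib

namespace StabPert

noncomputable section

/-! ## Pauli operators on `n` qubits -/

/-- A Pauli string on `n` qubits: on each qubit a pair `(x, z)`, with
`I = (0,0)`, `X = (1,0)`, `Z = (0,1)`, `Y = (1,1)`. As an additive group (an `𝔽₂`-vector space)
this is the `n`-qubit Pauli group modulo phases. -/
abbrev Pauli (n : ℕ) : Type := Fin n → ZMod 2 × ZMod 2

/-- Computational basis labels of `n` qubits. -/
abbrev Label (n : ℕ) : Type := Fin n → Bool

/-- The Hilbert space of `n` qubits. -/
abbrev Qubits (n : ℕ) : Type := EuclideanSpace ℂ (Label n)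

/-- The `2 × 2` Pauli matrices `I, X, Z, Y`; `false` and `true` stand for `|0⟩` and `|1⟩`. -/
def pauliEntry (p : ZMod 2 × ZMod 2) (a b : Bool) : ℂ :=
  if p = (0, 0) then (if a = b then 1 else 0)
  else if p = (1, 0) then (if a = b then 0 else 1)
  else if p = (0, 1) then (if a = b then (if a then -1 else 1) else 0)
  else (if a = b then 0 else (if a then Complex.I else -Complex.I))

/-- The matrix of a Pauli string: the Kronecker product of its one-qubit matrices. -/
def Pauli.matrix {n : ℕ} (p : Pauli n) : Matrix (Label n) (Label n) ℂ :=
  Matrix.of fun a b => ∏ q, pauliEntry (p q) (a q) (b q)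

/-- A matrix as a bounded operator on the Hilbert space. -/
abbrev asOperator {n : ℕ} (A : Matrix (Label n) (Label n) ℂ) : Qubits n →L[ℂ] Qubits n :=
  Matrix.toEuclideanCLM (𝕜 := ℂ) A

/-! ## Perturbed stabilizer Hamiltonians -/

/-- The data of `H = H₀ + δH` on `n` qubits. The group `G`, of size `2 ^ n`, is generated by the
commuting independent signed Pauli strings `(-1) ^ sgn j * gen j`, its elements are the products
`∏ j, g j ^ v j`, and `α v` is the coefficient of that element. The perturbation is
`δH = ∑ i, γ i * P i` with distinct Pauli strings `P i`. -/
structure Model (n k : ℕ) where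
  gen : Fin n → Pauli n
  sgn : Fin n → Bool
  gen_independent : LinearIndependent (ZMod 2) gen
  gen_commute : ∀ i j, Commute (gen i).matrix (gen j).matrix
  α : Label n → ℝ
  P : Fin k → Pauli n
  P_injective : Function.Injective P
  γ : Fin k → ℝ

namespace Model

variable {n k : ℕ} (M : Model n k)

/-- The signed generators of `G`. -/
def g (j : Fin n) : Matrix (Label n) (Label n) ℂ :=
  (if M.sgn j then (-1 : ℂ) else 1) • (M.gen j).matrix

/-- The element `∏ j, g j ^ v j` of `G` (the factors commute). -/
def groupElement (v : Label n) : Matrix (Label n) (Label n) ℂ :=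
  (List.ofFn fun j => if v j then M.g j else 1).prod

/-- `H₀ = - ∑_{P ∈ G} α_P P`. -/
def H₀ : Matrix (Label n) (Label n) ℂ :=
  -∑ v : Label n, (M.α v : ℂ) • M.groupElement v

/-- `δH = ∑ i, γ_i P_i`. -/
def δH : Matrix (Label n) (Label n) ℂ :=
  ∑ i : Fin k, (M.γ i : ℂ) • (M.P i).matrix

/-- `H = H₀ + δH`. -/
def H : Matrix (Label n) (Label n) ℂ := M.H₀ + M.δH

/-- The operator norm of `δH`. -/
def normδH : ℝ := ‖asOperator M.δH‖

/-- The dimension `|K|` of the group `K` generated by the `P i`: the number of independent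
generators, phases being disregarded. -/
def dimK : ℕ := Module.finrank (ZMod 2) (Submodule.span (ZMod 2) (Set.range M.P))

/-- The stabilizer eigenstates of `H₀` are labelled by their syndromes: `s` stands for the state
(unique up to a phase) with `g j ψ = (-1) ^ s j ψ` for all `j`. On it the group element with
exponents `v` is `(-1) ^ (v · s)`, which gives its `H₀`-energy. -/
def energy (s : Label n) : ℝ :=
  -∑ v : Label n, M.α v * ∏ j, (if v j && s j then (-1 : ℝ) else 1)

/-- A state with syndrome `s` is an eigenstate of `H₀` with eigenvalue `energy s`. -/
theorem H₀_mulVec (s : Label n) (ψ : Label n → ℂ)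
    (h : ∀ j, (M.g j).mulVec ψ = (if s j then (-1 : ℂ) else 1) • ψ) :
    M.H₀.mulVec ψ = (M.energy s : ℂ) • ψ := by
  have key : ∀ v : Label n, (M.groupElement v).mulVec ψ =
      (∏ j, (if v j && s j then (-1 : ℂ) else 1)) • ψ := by
    intro v
    rw [← List.prod_ofFn]
    unfold groupElement
    have : ∀ l : List (Fin n), (l.map fun j => if v j then M.g j else 1).prod.mulVec ψ
        = (l.map fun j => (if v j && s j then (-1 : ℂ) else 1)).prod • ψ := by
      intro l
      induction l with
      | nil => simp
      | cons a l ih =>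
        simp only [List.map_cons, List.prod_cons, ← Matrix.mulVec_mulVec, ih, Matrix.mulVec_smul]
        by_cases hv : v a <;> simp [hv, h, smul_smul, mul_comm]
    simpa [List.ofFn_eq_map] using this (List.finRange n)
  unfold H₀ energy
  rw [Matrix.neg_mulVec, Matrix.sum_mulVec]
  simp only [Matrix.smul_mulVec, key]
  push_cast
  rw [neg_smul, Finset.sum_smul]
  simp [smul_smul, apply_ite]

/-- `S(a, b)`: the stabilizer eigenstates of `H₀` with `H₀`-energy in `[a, b]`, as syndromes. -/
def S (a b : ℝ) : Set (Label n) := {s | a ≤ M.energy s ∧ M.energy s ≤ b}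

end Model

/-! ## The machine model

A successor random access machine with exact complex arithmetic (a real RAM), programmed in a
structured language. Memory: natural number registers, number registers, and two-dimensional
arrays of both kinds. Naturals can only be incremented and decremented, so that they cannot be
used to pack data. Unit cost throughout, except for the extraction of a real root of an explicitly
given real polynomial of degree `d`, which costs `(d + 1) ^ 2`, and for a query to the oracle,
which reads a bit string of length `w` and costs `w + 1`. -/

/-- A memory configuration. -/
structure Memory where
  reg : ℕ → ℕ
  arr : ℕ → ℕ → ℕ → ℕ
  num : ℕ → ℂ
  numArr : ℕ → ℕ → ℕ → ℂ

/-- Branching conditions: comparison of natural registers, comparison of the real parts of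
number registers. -/
inductive Condition where
  | eq (x y : ℕ)
  | lt (x y : ℕ)
  | numLe (x y : ℕ)

/-- Programs. The arguments `x y z i j d` name registers, `a` names an array. -/
inductive Program where
  | skip
  | zero (x : ℕ)
  | copy (x y : ℕ)
  | succ (x : ℕ)
  | pred (x : ℕ)
  | load (x a i j : ℕ)
  | store (a i j x : ℕ)
  | numOne (x : ℕ)
  | numI (x : ℕ)
  | numCopy (x y : ℕ)
  | numAdd (x y z : ℕ)
  | numSub (x y z : ℕ)
  | numMul (x y z : ℕ)
  | numDiv (x y z : ℕ)
  | numConj (x y : ℕ)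
  | numLoad (x a i j : ℕ)
  | numStore (a i j x : ℕ)
  | root (x a i d j : ℕ)
  | query (x a i : ℕ)
  | seq (p q : Program)
  | ite (c : Condition) (p q : Program)
  | while (c : Condition) (p : Program)

/-- An oracle: a real function of bit strings of length `w`. -/
structure Oracle where
  w : ℕ
  value : (Fin w → Bool) → ℝ

/-- The bit stored in a natural number cell. -/
def toBit (m : ℕ) : Bool := decide (m ≠ 0)

/-- The natural number `0` or `1` that stands for a bit. -/
def ofBit (b : Bool) : ℕ := if b then 1 else 0

/-- The `j`-th smallest real root, counted from `0` and with multiplicity, of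
`∑ t ≤ d, c t * X ^ t`; it is `0` if there is no such root. -/
def realRoot (c : ℕ → ℝ) (d j : ℕ) : ℝ :=
  ((∑ t ∈ Finset.range (d + 1),
    Polynomial.C (c t) * Polynomial.X ^ t : Polynomial ℝ).roots.sort (· ≤ ·)).getD j 0

namespace Memory

def setReg (σ : Memory) (x v : ℕ) : Memory :=
  { σ with reg := Function.update σ.reg x v }

def setNum (σ : Memory) (x : ℕ) (v : ℂ) : Memory :=
  { σ with num := Function.update σ.num x v }

def setArr (σ : Memory) (a i j v : ℕ) : Memory :=
  { σ with arr := fun a' i' j' => if a' = a ∧ i' = i ∧ j' = j then v else σ.arr a' i' j' }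

def setNumArr (σ : Memory) (a i j : ℕ) (v : ℂ) : Memory :=
  { σ with numArr := fun a' i' j' => if a' = a ∧ i' = i ∧ j' = j then v else σ.numArr a' i' j' }

end Memory

/-- Truth of a condition. -/
def Condition.Holds (σ : Memory) : Condition → Prop
  | .eq x y => σ.reg x = σ.reg y
  | .lt x y => σ.reg x < σ.reg y
  | .numLe x y => (σ.num x).re ≤ (σ.num y).re

/-- `Run O p σ σ' t`: started on `σ`, the program `p` with oracle `O` halts on `σ'` after `t`
steps. -/
inductive Run (O : Oracle) : Program → Memory → Memory → ℕ → Prop where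
  | skip (σ : Memory) : Run O .skip σ σ 1
  | zero (σ : Memory) (x : ℕ) : Run O (.zero x) σ (σ.setReg x 0) 1
  | copy (σ : Memory) (x y : ℕ) : Run O (.copy x y) σ (σ.setReg x (σ.reg y)) 1
  | succ (σ : Memory) (x : ℕ) : Run O (.succ x) σ (σ.setReg x (σ.reg x + 1)) 1
  | pred (σ : Memory) (x : ℕ) : Run O (.pred x) σ (σ.setReg x (σ.reg x - 1)) 1
  | load (σ : Memory) (x a i j : ℕ) :
      Run O (.load x a i j) σ (σ.setReg x (σ.arr a (σ.reg i) (σ.reg j))) 1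
  | store (σ : Memory) (a i j x : ℕ) :
      Run O (.store a i j x) σ (σ.setArr a (σ.reg i) (σ.reg j) (σ.reg x)) 1
  | numOne (σ : Memory) (x : ℕ) : Run O (.numOne x) σ (σ.setNum x 1) 1
  | numI (σ : Memory) (x : ℕ) : Run O (.numI x) σ (σ.setNum x Complex.I) 1
  | numCopy (σ : Memory) (x y : ℕ) : Run O (.numCopy x y) σ (σ.setNum x (σ.num y)) 1
  | numAdd (σ : Memory) (x y z : ℕ) :
      Run O (.numAdd x y z) σ (σ.setNum x (σ.num y + σ.num z)) 1
  | numSub (σ : Memory) (x y z : ℕ) :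
      Run O (.numSub x y z) σ (σ.setNum x (σ.num y - σ.num z)) 1
  | numMul (σ : Memory) (x y z : ℕ) :
      Run O (.numMul x y z) σ (σ.setNum x (σ.num y * σ.num z)) 1
  | numDiv (σ : Memory) (x y z : ℕ) :
      Run O (.numDiv x y z) σ (σ.setNum x (σ.num y / σ.num z)) 1
  | numConj (σ : Memory) (x y : ℕ) :
      Run O (.numConj x y) σ (σ.setNum x (starRingEnd ℂ (σ.num y))) 1
  | numLoad (σ : Memory) (x a i j : ℕ) :
      Run O (.numLoad x a i j) σ (σ.setNum x (σ.numArr a (σ.reg i) (σ.reg j))) 1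
  | numStore (σ : Memory) (a i j x : ℕ) :
      Run O (.numStore a i j x) σ (σ.setNumArr a (σ.reg i) (σ.reg j) (σ.num x)) 1
  | root (σ : Memory) (x a i d j : ℕ) :
      Run O (.root x a i d j) σ
        (σ.setNum x
          ((realRoot (fun t => (σ.numArr a (σ.reg i) t).re) (σ.reg d) (σ.reg j) : ℝ) : ℂ))
        ((σ.reg d + 1) ^ 2)
  | query (σ : Memory) (x a i : ℕ) :
      Run O (.query x a i) σ
        (σ.setNum x ((O.value fun q => toBit (σ.arr a (σ.reg i) q) : ℝ) : ℂ)) (O.w + 1)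
  | seq {p q : Program} {σ σ₁ σ₂ : Memory} {t₁ t₂ : ℕ} :
      Run O p σ σ₁ t₁ → Run O q σ₁ σ₂ t₂ → Run O (.seq p q) σ σ₂ (t₁ + t₂)
  | iteTrue {c : Condition} {p q : Program} {σ σ' : Memory} {t : ℕ} :
      c.Holds σ → Run O p σ σ' t → Run O (.ite c p q) σ σ' (t + 1)
  | iteFalse {c : Condition} {p q : Program} {σ σ' : Memory} {t : ℕ} :
      ¬ c.Holds σ → Run O q σ σ' t → Run O (.ite c p q) σ σ' (t + 1)
  | whileFalse {c : Condition} {p : Program} {σ : Memory} :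
      ¬ c.Holds σ → Run O (.while c p) σ σ 1
  | whileTrue {c : Condition} {p : Program} {σ σ₁ σ₂ : Memory} {t₁ t₂ : ℕ} :
      c.Holds σ → Run O p σ σ₁ t₁ → Run O (.while c p) σ₁ σ₂ t₂ →
        Run O (.while c p) σ σ₂ (t₁ + t₂ + 1)

/-! ## Input -/

/-- `H₀` is accessed through the energies of its stabilizer eigenstates. -/
def Model.oracle {n k : ℕ} (M : Model n k) : Oracle := ⟨n, M.energy⟩

/-- The initial memory: `n`, `k`, the generators of `G` (arrays 0, 1, 2: `x` bits, `z` bits,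
signs), the perturbing Pauli strings (arrays 3, 4) and their coefficients, the two energies, and a
list `L` of syndromes (its length in register 2, its members in array 5). All other cells are 0. -/
def Model.input {n k : ℕ} (M : Model n k) (E₀ E₁ : ℝ) (L : List (Label n)) : Memory where
  reg x := if x = 0 then n else if x = 1 then k else if x = 2 then L.length else 0
  arr a i j :=
    if a = 0 then (if h : i < n ∧ j < n then (M.gen ⟨i, h.1⟩ ⟨j, h.2⟩).1.val else 0)
    else if a = 1 then (if h : i < n ∧ j < n then (M.gen ⟨i, h.1⟩ ⟨j, h.2⟩).2.val else 0)
    else if a = 2 then (if h : i = 0 ∧ j < n then ofBit (M.sgn ⟨j, h.2⟩) else 0)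
    else if a = 3 then (if h : i < k ∧ j < n then (M.P ⟨i, h.1⟩ ⟨j, h.2⟩).1.val else 0)
    else if a = 4 then (if h : i < k ∧ j < n then (M.P ⟨i, h.1⟩ ⟨j, h.2⟩).2.val else 0)
    else if a = 5 then
      (if h : i < L.length ∧ j < n then ofBit (L.get ⟨i, h.1⟩ ⟨j, h.2⟩) else 0)
    else 0
  num x := if x = 0 then (E₀ : ℂ) else if x = 1 then (E₁ : ℂ) else 0
  numArr a i j := if h : a = 0 ∧ i = 0 ∧ j < k then (M.γ ⟨j, h.2.2⟩ : ℂ) else 0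

/-! ## Output

The machine outputs a Clifford circuit `C` and a list of triples (bit string `x` of length
`n - r`, amplitudes of a vector `φ` of `r` qubits, energy); a triple stands for the vector
`C (|x⟩ ⊗ |φ⟩)`. -/

/-- Clifford gates. -/
inductive Gate (n : ℕ) where
  | idle
  | hadamard (q : Fin n)
  | phase (q : Fin n)
  | cnot (c t : Fin n) (h : c ≠ t)

/-- The action of a gate on the vector with amplitudes `ψ`. -/
def Gate.act {n : ℕ} : Gate n → (Label n → ℂ) → Label n → ℂ
  | .idle, ψ => ψ
  | .hadamard q, ψ => fun b =>
      (ψ (Function.update b q false) + (if b q then -1 else 1) * ψ (Function.update b q true))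
        / (Real.sqrt 2 : ℂ)
  | .phase q, ψ => fun b => (if b q then Complex.I else 1) * ψ b
  | .cnot c t _, ψ => fun b => ψ (Function.update b t (xor (b t) (b c)))

/-- Decoding of a gate from a code and two qubit numbers. -/
def decodeGate (n code q q' : ℕ) : Gate n :=
  if h : q < n then
    if code = 0 then .hadamard ⟨q, h⟩
    else if code = 1 then .phase ⟨q, h⟩
    else if h' : q' < n then
      if hne : (⟨q, h⟩ : Fin n) ≠ ⟨q', h'⟩ then .cnot ⟨q, h⟩ ⟨q', h'⟩ hne else .idle
    else .idle
  else .idle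

/-- The circuit in the output: its length is in register 5, its gates, in the order of their
application, are the rows of array 6. -/
def circuit (n : ℕ) (σ : Memory) : List (Gate n) :=
  (List.range (σ.reg 5)).map fun t => decodeGate n (σ.arr 6 t 0) (σ.arr 6 t 1) (σ.arr 6 t 2)

/-- The vector `|x⟩ ⊗ |φ⟩`, with `x` on the first `n - r` qubits and `φ` on the last `r`; the
basis label `b` of the latter is read as the binary number `∑ m, b m * 2 ^ m`. -/
def productVector (n r : ℕ) (x : ℕ → Bool) (φ : ℕ → ℂ) (b : Label n) : ℂ :=
  if ∀ q : Fin n, (q : ℕ) < n - r → b q = x q then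
    φ (∑ q : Fin n, if n - r ≤ (q : ℕ) ∧ b q then 2 ^ ((q : ℕ) - (n - r)) else 0)
  else 0

/-- The `i`-th vector in the output: `r` is in register 4, `x` in row `i` of array 7, and the
amplitudes of `φ` in row `i` of number array 1. -/
def outputVector (n : ℕ) (σ : Memory) (i : ℕ) : Qubits n :=
  WithLp.toLp 2 <| (circuit n σ).foldl (fun ψ u => u.act ψ)
    (productVector n (σ.reg 4) (fun q => toBit (σ.arr 7 i q)) (σ.numArr 1 i))

/-- The output lists all eigenstates of `H` with energy in `[E₀, E₁]`: its vectors (their number is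
in register 3) are orthonormal eigenvectors of `H` whose energies are listed in number array 2 and
lie in `[E₀, E₁]`, and every eigenvector of `H` with eigenvalue in `[E₀, E₁]` is a linear
combination of them. The non-Clifford part has at most `min n |K|` qubits. -/
structure Model.IsOutput {n k : ℕ} (M : Model n k) (E₀ E₁ : ℝ) (σ : Memory) : Prop where
  size : σ.reg 4 ≤ n ∧ σ.reg 4 ≤ M.dimK
  orthonormal : Orthonormal ℂ fun i : Fin (σ.reg 3) => outputVector n σ i
  eigenstates : ∀ i : Fin (σ.reg 3), ∃ E : ℝ, σ.numArr 2 0 i = (E : ℂ) ∧ E₀ ≤ E ∧ E ≤ E₁ ∧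
    asOperator M.H (outputVector n σ i) = (E : ℂ) • outputVector n σ i
  complete : ∀ (E : ℝ) (ψ : Qubits n), E₀ ≤ E → E ≤ E₁ → asOperator M.H ψ = (E : ℂ) • ψ →
    ψ ∈ Submodule.span ℂ (Set.range fun i : Fin (σ.reg 3) => outputVector n σ i)

end

end StabPert

/-! Frame. Conjugation by a Clifford circuit makes the commuting generators diagonal, so that the
stabilizer eigenstates become computational basis vectors and `H₀` becomes a diagonal matrix: its
entry at a label is the energy of the syndrome of that label. Further CNOT gates permute the labels,
keep diagonal strings diagonal, and confine the `x` parts of all conjugated perturbing strings to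
the last `r` qubits. Each of these `r` qubits is the leading qubit of some pivot row, and the pivot
rows come from independent strings among the `P i`; hence `r ≤ |K|`. All this is
`Prog.reduction_spec`, with the result packaged as `Model.Reduced`. In this frame every term of the
Hamiltonian leaves the first `n - r` bits of a label alone, so the Hamiltonian is block diagonal
with blocks of dimension `N = 2 ^ r`.

Which blocks matter. Let `φ` be the nonzero component in a block of an eigenvector with eigenvalue
`E`. It is itself an eigenvector, so `δH φ = (E - H₀) φ`. If all unperturbed energies of the block
were further than `‖δH‖` from `E`, the right side would be longer than `‖δH‖ ‖φ‖`, which is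
impossible. Hence every block met by a wanted eigenvector contains a member of the list
(`Model.Reduced.exists_energy_near`), and it suffices to diagonalize the blocks of the list members.
Each block must be treated once only, and neither a search through the list nor the norm of `δH` is
affordable. Instead, the least and greatest energies on the list give an interval that recognizes
list members by their energies, and a member stands for its block if it is the first label of the
block with energy in that interval (`Setting.First`).

Exact diagonalization. A Lanczos process with restarts gives an orthogonal basis of the block that
is divided into chains, on each of which the matrix is tridiagonal. The three-term recurrence
defines real polynomials along a chain. The last one has only real simple roots, as many as the
chain has members (`Lanczos.roots_nodup`), and each root yields an explicit eigenvector
(`Lanczos.apply_lanczosVector`). Eigenvectors from one chain belong to different eigenvalues, those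
from different chains lie in orthogonal subspaces; so they are `N` nonzero orthogonal eigenvectors
in dimension `N`, and they exhaust the spectrum (`Lanczos.eigenvector_complete`). This takes `O(N ^
3)` operations, including `N` root extractions of cost `O(N ^ 2)`.

Machine and time. The algorithm is written in a small language of expressions and counted loops
whose semantics is a function on memories; `Cmd.run` transfers it to the machine. Time is read off
the syntax (`Cmd.cost_le`): a loop over the list contributes a factor `Λ`, every other loop a factor
`B`, where `B` is about `n + 3 * 2 ^ |K|`. At most three loops of the second kind and one of the
first are nested, which gives `B ^ 3 * Λ`. Here `k ≤ 2 ^ |K|` because the strings `P i` are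
distinct. Only the computation of `2 ^ r` and the copying of the circuit need separate arguments
(`Prog.main_cost`). -/

namespace StabPert

noncomputable section

/-! ## A language with expressions and bounded loops

Variables are the registers below `tempBase`; the registers from `tempBase` on hold temporaries. -/

/-- The first register used for intermediate results. -/
def tempBase : ℕ := 64

/-- Natural number expressions. -/
inductive NExp where
  | lit (m : ℕ)
  | var (x : ℕ)
  | arr (a : ℕ) (i j : NExp)
  | succ (e : NExp)
  | pred (e : NExp)
  | ite (e₁ e₂ e₃ e₄ : NExp)

/-- Complex number expressions. -/
inductive CExp where
  | zero
  | one
  | imag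
  | var (x : ℕ)
  | arr (a : ℕ) (i j : NExp)
  | add (c d : CExp)
  | sub (c d : CExp)
  | mul (c d : CExp)
  | div (c d : CExp)
  | conj (c : CExp)
  | ite (e₁ e₂ : NExp) (c d : CExp)

/-- Tests. -/
inductive Test where
  | eq (e₁ e₂ : NExp)
  | lt (e₁ e₂ : NExp)
  | le (c d : CExp)

/-- Commands. The command `loop x y b` runs `b` with the counter `x` at `0, 1, …, y - 1`. -/
inductive Cmd where
  | skip
  | setN (x : ℕ) (e : NExp)
  | setA (a : ℕ) (i j e : NExp)
  | setC (x : ℕ) (c : CExp)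
  | setCA (a : ℕ) (i j : NExp) (c : CExp)
  | root (x a : ℕ) (i : NExp) (d : ℕ) (j : NExp)
  | query (x a : ℕ) (i : NExp)
  | seq (p q : Cmd)
  | ite (b : Test) (p q : Cmd)
  | loop (x y : ℕ) (b : Cmd)

/-- Sequential composition. -/
infixr:60 " ;; " => Cmd.seq

def NExp.eval (σ : Memory) : NExp → ℕ
  | .lit m => m
  | .var x => σ.reg x
  | .arr a i j => σ.arr a (i.eval σ) (j.eval σ)
  | .succ e => e.eval σ + 1
  | .pred e => e.eval σ - 1
  | .ite e₁ e₂ e₃ e₄ => if e₁.eval σ = e₂.eval σ then e₃.eval σ else e₄.eval σ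

def CExp.eval (σ : Memory) : CExp → ℂ
  | .zero => 0
  | .one => 1
  | .imag => Complex.I
  | .var x => σ.num x
  | .arr a i j => σ.numArr a (i.eval σ) (j.eval σ)
  | .add c d => c.eval σ + d.eval σ
  | .sub c d => c.eval σ - d.eval σ
  | .mul c d => c.eval σ * d.eval σ
  | .div c d => c.eval σ / d.eval σ
  | .conj c => starRingEnd ℂ (c.eval σ)
  | .ite e₁ e₂ c d => if e₁.eval σ = e₂.eval σ then c.eval σ else d.eval σ

def Test.Holds (σ : Memory) : Test → Prop
  | .eq e₁ e₂ => e₁.eval σ = e₂.eval σ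
  | .lt e₁ e₂ => e₁.eval σ < e₂.eval σ
  | .le c d => (c.eval σ).re ≤ (d.eval σ).re

/-- The memory before round `i` of a loop with counter `x` and body `f`. -/
def loopState (f : Memory → Memory) (x : ℕ) (σ : Memory) : ℕ → Memory
  | 0 => σ.setReg x 0
  -- The counter is overwritten rather than incremented. This agrees with the compiled code because
  -- `Cmd.ok` forbids the body to write the counter.
  | i + 1 => (f (loopState f x σ i)).setReg x (i + 1)

open Classical in
/-- The effect of a command. -/
def Cmd.exec (O : Oracle) : Cmd → Memory → Memory
  | .skip, σ => σ
  | .setN x e, σ => σ.setReg x (e.eval σ)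
  | .setA a i j e, σ => σ.setArr a (i.eval σ) (j.eval σ) (e.eval σ)
  | .setC x c, σ => σ.setNum x (c.eval σ)
  | .setCA a i j c, σ => σ.setNumArr a (i.eval σ) (j.eval σ) (c.eval σ)
  | .root x a i d j, σ => σ.setNum x
      ((realRoot (fun t => (σ.numArr a (i.eval σ) t).re) (σ.reg d) (j.eval σ) : ℝ) : ℂ)
  | .query x a i, σ => σ.setNum x ((O.value fun q => toBit (σ.arr a (i.eval σ) q) : ℝ) : ℂ)
  | .seq p q, σ => q.exec O (p.exec O σ)
  | .ite b p q, σ => if b.Holds σ then p.exec O σ else q.exec O σ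
  | .loop x y b, σ => loopState (b.exec O) x σ (σ.reg y)

/-! ### Compilation -/

/-- The value is left in register `t`, and only registers from `t` on are used. Operands already
computed below `t`, and the variables below `tempBase`, therefore survive. -/
def NExp.code : NExp → ℕ → Program
  | .lit m, t => Nat.rec (.zero t) (fun _ p => .seq p (.succ t)) m
  | .var x, t => .copy t x
  | .arr a i j, t => .seq (i.code t) (.seq (j.code (t + 1)) (.load t a t (t + 1)))
  | .succ e, t => .seq (e.code t) (.succ t)
  | .pred e, t => .seq (e.code t) (.pred t)
  | .ite e₁ e₂ e₃ e₄, t => .seq (e₁.code t) (.seq (e₂.code (t + 1))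
      (.ite (.eq t (t + 1)) (e₃.code t) (e₄.code t)))

/-- An upper bound, not the exact time: both branches of an `ite` are charged, so that the cost does
not depend on the memory. -/
def NExp.cost : NExp → ℕ
  | .lit m => m + 1
  | .var _ => 1
  | .arr _ i j => i.cost + j.cost + 1
  | .succ e => e.cost + 1
  | .pred e => e.cost + 1
  | .ite e₁ e₂ e₃ e₄ => e₁.cost + e₂.cost + e₃.cost + e₄.cost + 1

/-- All registers of the expression are variables. -/
def NExp.ok : NExp → Bool
  | .lit _ => true
  | .var x => x < tempBase
  | .arr _ i j => i.ok && j.ok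
  | .succ e => e.ok
  | .pred e => e.ok
  | .ite e₁ e₂ e₃ e₄ => e₁.ok && e₂.ok && e₃.ok && e₄.ok

/-- The value goes to number register `t`; array indices use natural registers from `t` on. Zero is
produced as `1 - 1`. -/
def CExp.code : CExp → ℕ → Program
  | .zero, t => .seq (.numOne t) (.numSub t t t)
  | .one, t => .numOne t
  | .imag, t => .numI t
  | .var x, t => .numCopy t x
  | .arr a i j, t => .seq (i.code t) (.seq (j.code (t + 1)) (.numLoad t a t (t + 1)))
  | .add c d, t => .seq (c.code t) (.seq (d.code (t + 1)) (.numAdd t t (t + 1)))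
  | .sub c d, t => .seq (c.code t) (.seq (d.code (t + 1)) (.numSub t t (t + 1)))
  | .mul c d, t => .seq (c.code t) (.seq (d.code (t + 1)) (.numMul t t (t + 1)))
  | .div c d, t => .seq (c.code t) (.seq (d.code (t + 1)) (.numDiv t t (t + 1)))
  | .conj c, t => .seq (c.code t) (.numConj t t)
  | .ite e₁ e₂ c d, t => .seq (e₁.code t) (.seq (e₂.code (t + 1))
      (.ite (.eq t (t + 1)) (c.code t) (d.code t)))

def CExp.cost : CExp → ℕ
  | .zero => 2
  | .one => 1
  | .imag => 1
  | .var _ => 1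
  | .arr _ i j => i.cost + j.cost + 1
  | .add c d => c.cost + d.cost + 1
  | .sub c d => c.cost + d.cost + 1
  | .mul c d => c.cost + d.cost + 1
  | .div c d => c.cost + d.cost + 1
  | .conj c => c.cost + 1
  | .ite e₁ e₂ c d => e₁.cost + e₂.cost + c.cost + d.cost + 1

def CExp.ok : CExp → Bool
  | .zero => true
  | .one => true
  | .imag => true
  | .var x => x < tempBase
  | .arr _ i j => i.ok && j.ok
  | .add c d => c.ok && d.ok
  | .sub c d => c.ok && d.ok
  | .mul c d => c.ok && d.ok
  | .div c d => c.ok && d.ok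
  | .conj c => c.ok
  | .ite e₁ e₂ c d => e₁.ok && e₂.ok && c.ok && d.ok

/-- The memories agree on arrays and on the registers below `t`. -/
structure Below (t : ℕ) (σ τ : Memory) : Prop where
  reg : ∀ x < t, τ.reg x = σ.reg x
  num : ∀ x < t, τ.num x = σ.num x
  arr : τ.arr = σ.arr
  numArr : τ.numArr = σ.numArr

theorem Below.refl (t : ℕ) (σ : Memory) : Below t σ σ := ⟨fun _ _ => rfl, fun _ _ => rfl, rfl, rfl⟩

theorem Below.trans {t : ℕ} {σ τ υ : Memory} (h : Below t σ τ) (h' : Below t τ υ) : Below t σ υ :=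
  ⟨fun x hx => (h'.reg x hx).trans (h.reg x hx), fun x hx => (h'.num x hx).trans (h.num x hx),
    h'.arr.trans h.arr, h'.numArr.trans h.numArr⟩

theorem Below.mono {t t' : ℕ} {σ τ : Memory} (h : Below t σ τ) (ht : t' ≤ t) : Below t' σ τ :=
  ⟨fun x hx => h.reg x (hx.trans_le ht), fun x hx => h.num x (hx.trans_le ht), h.arr, h.numArr⟩

theorem Below.setReg {t x : ℕ} {σ τ : Memory} (h : Below t σ τ) (hx : t ≤ x) (v : ℕ) :
    Below t σ (τ.setReg x v) :=
  ⟨fun y hy => by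
    have : y ≠ x := by omega
    simpa [Memory.setReg, this] using h.reg y hy, h.num, h.arr, h.numArr⟩

theorem Below.setNum {t x : ℕ} {σ τ : Memory} (h : Below t σ τ) (hx : t ≤ x) (v : ℂ) :
    Below t σ (τ.setNum x v) :=
  ⟨h.reg, fun y hy => by
    have : y ≠ x := by omega
    simpa [Memory.setNum, this] using h.num y hy, h.arr, h.numArr⟩

theorem Below.setReg_both {σ τ : Memory} (h : Below tempBase σ τ) {x v : ℕ} :
    Below tempBase (σ.setReg x v) (τ.setReg x v) :=
  ⟨fun y hy => by by_cases e : y = x <;> simp [Memory.setReg, e, h.reg y hy], h.num, h.arr,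
    h.numArr⟩

theorem Below.setNum_both {σ τ : Memory} (h : Below tempBase σ τ) {x : ℕ} {v : ℂ} :
    Below tempBase (σ.setNum x v) (τ.setNum x v) :=
  ⟨h.reg, fun y hy => by by_cases e : y = x <;> simp [Memory.setNum, e, h.num y hy], h.arr,
    h.numArr⟩

theorem NExp.eval_congr {σ τ : Memory} (h : Below tempBase σ τ) :
    ∀ {e : NExp}, e.ok → e.eval τ = e.eval σ
  | .lit _, _ => rfl
  | .var x, hx => h.reg x (by simpa [NExp.ok] using hx)
  | .arr a i j, hx => by
    simp only [NExp.ok, Bool.and_eq_true] at hx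
    simp [NExp.eval, eval_congr h hx.1, eval_congr h hx.2, h.arr]
  | .succ e, hx => by simp [NExp.eval, eval_congr h (e := e) hx]
  | .pred e, hx => by simp [NExp.eval, eval_congr h (e := e) hx]
  | .ite e₁ e₂ e₃ e₄, hx => by
    simp only [NExp.ok, Bool.and_eq_true] at hx
    simp [NExp.eval, eval_congr h hx.1.1.1, eval_congr h hx.1.1.2, eval_congr h hx.1.2,
      eval_congr h hx.2]

theorem CExp.eval_congr {σ τ : Memory} (h : Below tempBase σ τ) :
    ∀ {e : CExp}, e.ok → e.eval τ = e.eval σ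
  | .zero, _ => rfl
  | .one, _ => rfl
  | .imag, _ => rfl
  | .var x, hx => h.num x (by simpa [CExp.ok] using hx)
  | .arr a i j, hx => by
    simp only [CExp.ok, Bool.and_eq_true] at hx
    simp [CExp.eval, NExp.eval_congr h hx.1, NExp.eval_congr h hx.2, h.numArr]
  | .add c d, hx => by
    simp only [CExp.ok, Bool.and_eq_true] at hx
    simp [CExp.eval, eval_congr h hx.1, eval_congr h hx.2]
  | .sub c d, hx => by
    simp only [CExp.ok, Bool.and_eq_true] at hx
    simp [CExp.eval, eval_congr h hx.1, eval_congr h hx.2]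
  | .mul c d, hx => by
    simp only [CExp.ok, Bool.and_eq_true] at hx
    simp [CExp.eval, eval_congr h hx.1, eval_congr h hx.2]
  | .div c d, hx => by
    simp only [CExp.ok, Bool.and_eq_true] at hx
    simp [CExp.eval, eval_congr h hx.1, eval_congr h hx.2]
  | .conj c, hx => by simp [CExp.eval, eval_congr h (e := c) hx]
  | .ite e₁ e₂ c d, hx => by
    simp only [CExp.ok, Bool.and_eq_true] at hx
    simp [CExp.eval, NExp.eval_congr h hx.1.1.1, NExp.eval_congr h hx.1.1.2,
      eval_congr h hx.1.2, eval_congr h hx.2]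

/-- The conclusion `Below t σ τ` carries the induction: a second operand is computed from `t + 1`
on, so the first is still in `t`, and the variables are intact when it is evaluated. -/
theorem NExp.run (O : Oracle) : ∀ (e : NExp), e.ok → ∀ (t : ℕ), tempBase ≤ t → ∀ σ : Memory,
    ∃ τ T, Run O (e.code t) σ τ T ∧ T ≤ e.cost ∧ τ.reg t = e.eval σ ∧ Below t σ τ
  | .lit m, _, t, _, σ => by
    induction m with
    | zero => exact ⟨_, _, .zero σ t, le_rfl, by simp [Memory.setReg, eval],
        (Below.refl t σ).setReg le_rfl 0⟩
    | succ m ih =>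
      obtain ⟨τ, T, h₁, h₂, h₃, h₄⟩ := ih rfl
      exact ⟨_, _, .seq h₁ (.succ τ t), by simp only [cost] at *; omega,
        by simp [Memory.setReg, eval, h₃], h₄.setReg le_rfl _⟩
  | .var x, _, t, _, σ => ⟨_, _, .copy σ t x, le_rfl, by simp [Memory.setReg, eval],
      (Below.refl t σ).setReg le_rfl _⟩
  | .arr a i j, hx, t, ht, σ => by
    simp only [NExp.ok, Bool.and_eq_true] at hx
    obtain ⟨τ, T, h₁, h₂, h₃, h₄⟩ := run O i hx.1 t ht σ
    obtain ⟨τ', T', h₁', h₂', h₃', h₄'⟩ := run O j hx.2 (t + 1) (by omega) τ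
    refine ⟨_, _, .seq h₁ (.seq h₁' (.load τ' t a t (t + 1))), by simp only [cost]; omega, ?_,
      (h₄.trans (h₄'.mono (by omega))).setReg le_rfl _⟩
    simp [Memory.setReg, eval, h₃', h₄'.reg t (by omega), h₃, h₄'.arr, h₄.arr,
      eval_congr (h₄.mono ht) hx.2]
  | .succ e, hx, t, ht, σ => by
    obtain ⟨τ, T, h₁, h₂, h₃, h₄⟩ := run O e hx t ht σ
    exact ⟨_, _, .seq h₁ (.succ τ t), by simp only [cost]; omega,
        by simp [Memory.setReg, eval, h₃], h₄.setReg le_rfl _⟩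
  | .pred e, hx, t, ht, σ => by
    obtain ⟨τ, T, h₁, h₂, h₃, h₄⟩ := run O e hx t ht σ
    exact ⟨_, _, .seq h₁ (.pred τ t), by simp only [cost]; omega,
        by simp [Memory.setReg, eval, h₃], h₄.setReg le_rfl _⟩
  | .ite e₁ e₂ e₃ e₄, hx, t, ht, σ => by
    simp only [NExp.ok, Bool.and_eq_true] at hx
    obtain ⟨τ, T, h₁, h₂, h₃, h₄⟩ := run O e₁ hx.1.1.1 t ht σ
    obtain ⟨τ', T', h₁', h₂', h₃', h₄'⟩ := run O e₂ hx.1.1.2 (t + 1) (by omega) τ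
    have hb := h₄.trans (h₄'.mono (by omega))
    have he : Condition.Holds τ' (.eq t (t + 1)) ↔ e₁.eval σ = e₂.eval σ := by
      simp [Condition.Holds, h₃', h₄'.reg t (by omega), h₃, eval_congr (h₄.mono ht) hx.1.1.2]
    by_cases h : e₁.eval σ = e₂.eval σ
    · obtain ⟨υ, U, k₁, k₂, k₃, k₄⟩ := run O e₃ hx.1.2 t ht τ'
      refine ⟨_, _, .seq h₁ (.seq h₁' (.iteTrue (he.2 h) k₁)), by simp only [cost]; omega, ?_,
        hb.trans k₄⟩
      simp [eval, h, k₃, eval_congr (hb.mono ht) hx.1.2]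
    · obtain ⟨υ, U, k₁, k₂, k₃, k₄⟩ := run O e₄ hx.2 t ht τ'
      refine ⟨_, _, .seq h₁ (.seq h₁' (.iteFalse (he.not.2 h) k₁)), by simp only [cost]; omega, ?_,
        hb.trans k₄⟩
      simp [eval, h, k₃, eval_congr (hb.mono ht) hx.2]

/-- The common argument for the four arithmetic operations. The operand `d` runs in a memory that
already holds the value of `c`, which is why its hypothesis ranges over all `σ'` that agree with `σ`
below `t`. -/
theorem CExp.run_binary (O : Oracle) {c d : CExp} {t : ℕ} {σ : Memory} (op : ℂ → ℂ → ℂ)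
    (p : Program) (hp : ∀ τ, Run O p τ (τ.setNum t (op (τ.num t) (τ.num (t + 1)))) 1)
    (hc : ∃ τ T, Run O (c.code t) σ τ T ∧ T ≤ c.cost ∧ τ.num t = c.eval σ ∧ Below t σ τ)
    (hd : ∀ σ', Below t σ σ' → ∃ τ T, Run O (d.code (t + 1)) σ' τ T ∧ T ≤ d.cost ∧
      τ.num (t + 1) = d.eval σ ∧ Below (t + 1) σ' τ) :
    ∃ τ T, Run O (.seq (c.code t) (.seq (d.code (t + 1)) p)) σ τ T ∧ T ≤ c.cost + d.cost + 1 ∧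
      τ.num t = op (c.eval σ) (d.eval σ) ∧ Below t σ τ := by
  obtain ⟨τ, T, h₁, h₂, h₃, h₄⟩ := hc
  obtain ⟨τ', T', h₁', h₂', h₃', h₄'⟩ := hd τ h₄
  refine ⟨_, _, .seq h₁ (.seq h₁' (hp τ')), by omega, ?_,
    (h₄.trans (h₄'.mono (by omega))).setNum le_rfl _⟩
  simp [Memory.setNum, h₃', h₄'.num t (by omega), h₃]

theorem CExp.run (O : Oracle) : ∀ (e : CExp), e.ok → ∀ (t : ℕ), tempBase ≤ t → ∀ σ : Memory,
    ∃ τ T, Run O (e.code t) σ τ T ∧ T ≤ e.cost ∧ τ.num t = e.eval σ ∧ Below t σ τ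
  | .zero, _, t, _, σ => ⟨_, _, .seq (.numOne σ t) (.numSub _ t t t), le_rfl,
      by simp [Memory.setNum, eval], ((Below.refl t σ).setNum le_rfl _).setNum le_rfl _⟩
  | .one, _, t, _, σ => ⟨_, _, .numOne σ t, le_rfl, by simp [Memory.setNum, eval],
      (Below.refl t σ).setNum le_rfl _⟩
  | .imag, _, t, _, σ => ⟨_, _, .numI σ t, le_rfl, by simp [Memory.setNum, eval],
      (Below.refl t σ).setNum le_rfl _⟩
  | .var x, _, t, _, σ => ⟨_, _, .numCopy σ t x, le_rfl, by simp [Memory.setNum, eval],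
      (Below.refl t σ).setNum le_rfl _⟩
  | .arr a i j, hx, t, ht, σ => by
    simp only [CExp.ok, Bool.and_eq_true] at hx
    obtain ⟨τ, T, h₁, h₂, h₃, h₄⟩ := i.run O hx.1 t ht σ
    obtain ⟨τ', T', h₁', h₂', h₃', h₄'⟩ := j.run O hx.2 (t + 1) (by omega) τ
    refine ⟨_, _, .seq h₁ (.seq h₁' (.numLoad τ' t a t (t + 1))), by simp only [cost]; omega, ?_,
      (h₄.trans (h₄'.mono (by omega))).setNum le_rfl _⟩
    simp [Memory.setNum, eval, h₃', h₄'.reg t (by omega), h₃, h₄'.numArr, h₄.numArr,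
      NExp.eval_congr (h₄.mono ht) hx.2]
  | .add c d, hx, t, ht, σ => by
    simp only [CExp.ok, Bool.and_eq_true] at hx
    refine run_binary O (· + ·) _ (fun τ => .numAdd τ t t (t + 1)) (run O c hx.1 t ht σ) ?_
    intro σ' h
    rw [← eval_congr (h.mono ht) hx.2]
    exact run O d hx.2 (t + 1) (by omega) σ'
  | .sub c d, hx, t, ht, σ => by
    simp only [CExp.ok, Bool.and_eq_true] at hx
    refine run_binary O (· - ·) _ (fun τ => .numSub τ t t (t + 1)) (run O c hx.1 t ht σ) ?_
    intro σ' h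
    rw [← eval_congr (h.mono ht) hx.2]
    exact run O d hx.2 (t + 1) (by omega) σ'
  | .mul c d, hx, t, ht, σ => by
    simp only [CExp.ok, Bool.and_eq_true] at hx
    refine run_binary O (· * ·) _ (fun τ => .numMul τ t t (t + 1)) (run O c hx.1 t ht σ) ?_
    intro σ' h
    rw [← eval_congr (h.mono ht) hx.2]
    exact run O d hx.2 (t + 1) (by omega) σ'
  | .div c d, hx, t, ht, σ => by
    simp only [CExp.ok, Bool.and_eq_true] at hx
    refine run_binary O (· / ·) _ (fun τ => .numDiv τ t t (t + 1)) (run O c hx.1 t ht σ) ?_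
    intro σ' h
    rw [← eval_congr (h.mono ht) hx.2]
    exact run O d hx.2 (t + 1) (by omega) σ'
  | .conj c, hx, t, ht, σ => by
    obtain ⟨τ, T, h₁, h₂, h₃, h₄⟩ := run O c hx t ht σ
    exact ⟨_, _, .seq h₁ (.numConj τ t t), by simp only [cost]; omega,
        by simp [Memory.setNum, eval, h₃], h₄.setNum le_rfl _⟩
  | .ite e₁ e₂ c d, hx, t, ht, σ => by
    simp only [CExp.ok, Bool.and_eq_true] at hx
    obtain ⟨τ, T, h₁, h₂, h₃, h₄⟩ := e₁.run O hx.1.1.1 t ht σ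
    obtain ⟨τ', T', h₁', h₂', h₃', h₄'⟩ := e₂.run O hx.1.1.2 (t + 1) (by omega) τ
    have hb := h₄.trans (h₄'.mono (by omega))
    have he : Condition.Holds τ' (.eq t (t + 1)) ↔ e₁.eval σ = e₂.eval σ := by
      simp [Condition.Holds, h₃', h₄'.reg t (by omega), h₃, NExp.eval_congr (h₄.mono ht) hx.1.1.2]
    by_cases h : e₁.eval σ = e₂.eval σ
    · obtain ⟨υ, U, k₁, k₂, k₃, k₄⟩ := run O c hx.1.2 t ht τ'
      refine ⟨_, _, .seq h₁ (.seq h₁' (.iteTrue (he.2 h) k₁)), by simp only [cost]; omega, ?_,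
        hb.trans k₄⟩
      simp [eval, h, k₃, eval_congr (hb.mono ht) hx.1.2]
    · obtain ⟨υ, U, k₁, k₂, k₃, k₄⟩ := run O d hx.2 t ht τ'
      refine ⟨_, _, .seq h₁ (.seq h₁' (.iteFalse (he.not.2 h) k₁)), by simp only [cost]; omega, ?_,
        hb.trans k₄⟩
      simp [eval, h, k₃, eval_congr (hb.mono ht) hx.2]

/-- The code of a branching on the test `b`. -/
def Test.code (b : Test) (p q : Program) : Program :=
  match b with
  | .eq e₁ e₂ => .seq (e₁.code tempBase) (.seq (e₂.code (tempBase + 1))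
      (.ite (.eq tempBase (tempBase + 1)) p q))
  | .lt e₁ e₂ => .seq (e₁.code tempBase) (.seq (e₂.code (tempBase + 1))
      (.ite (.lt tempBase (tempBase + 1)) p q))
  | .le c d => .seq (c.code tempBase) (.seq (d.code (tempBase + 1))
      (.ite (.numLe tempBase (tempBase + 1)) p q))

def Test.cost : Test → ℕ
  | .eq e₁ e₂ => e₁.cost + e₂.cost + 1
  | .lt e₁ e₂ => e₁.cost + e₂.cost + 1
  | .le c d => c.cost + d.cost + 1

def Test.ok : Test → Bool
  | .eq e₁ e₂ => e₁.ok && e₂.ok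
  | .lt e₁ e₂ => e₁.ok && e₂.ok
  | .le c d => c.ok && d.ok

theorem Test.holds_congr {σ τ : Memory} (h : Below tempBase σ τ) {b : Test} (hb : b.ok) :
    b.Holds τ ↔ b.Holds σ := by
  cases b <;> simp only [ok, Bool.and_eq_true] at hb <;>
    simp [Holds, NExp.eval_congr h, CExp.eval_congr h, hb]

open Classical in
-- Stated with the run of the chosen branch as a continuation, which separates the time of the test
-- from that of the branch.
theorem Test.run (O : Oracle) {b : Test} (hb : b.ok) (p q : Program) (σ : Memory) :
    ∃ τ T, T ≤ b.cost ∧ Below tempBase σ τ ∧ ∀ υ U,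
      Run O (if b.Holds σ then p else q) τ υ U → Run O (b.code p q) σ υ (T + U) := by
  have key : ∀ (c : Condition) (σ₁ σ₂ : Memory) (T₁ T₂ : ℕ) (p₁ p₂ : Program),
      Run O p₁ σ σ₁ T₁ → Run O p₂ σ₁ σ₂ T₂ → (c.Holds σ₂ ↔ b.Holds σ) →
      ∀ υ U, Run O (if b.Holds σ then p else q) σ₂ υ U →
        Run O (.seq p₁ (.seq p₂ (.ite c p q))) σ υ (T₁ + T₂ + 1 + U) := by
    intro c σ₁ σ₂ T₁ T₂ p₁ p₂ h₁ h₂ hc υ U hU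
    have : T₁ + T₂ + 1 + U = T₁ + (T₂ + (U + 1)) := by ring
    rw [this]
    by_cases h : b.Holds σ
    · rw [if_pos h] at hU
      exact .seq h₁ (.seq h₂ (.iteTrue (hc.2 h) hU))
    · rw [if_neg h] at hU
      exact .seq h₁ (.seq h₂ (.iteFalse (hc.not.2 h) hU))
  cases b with
  | eq e₁ e₂ =>
    simp only [ok, Bool.and_eq_true] at hb
    obtain ⟨τ, T, h₁, h₂, h₃, h₄⟩ := e₁.run O hb.1 tempBase le_rfl σ
    obtain ⟨τ', T', h₁', h₂', h₃', h₄'⟩ := e₂.run O hb.2 (tempBase + 1) (by omega) τ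
    refine ⟨τ', T + T' + 1, by simp only [cost]; omega, h₄.trans (h₄'.mono (by omega)),
      key _ _ _ _ _ _ _ h₁ h₁' ?_⟩
    simp [Condition.Holds, Holds, h₃', h₄'.reg tempBase (by omega), h₃, NExp.eval_congr h₄ hb.2]
  | lt e₁ e₂ =>
    simp only [ok, Bool.and_eq_true] at hb
    obtain ⟨τ, T, h₁, h₂, h₃, h₄⟩ := e₁.run O hb.1 tempBase le_rfl σ
    obtain ⟨τ', T', h₁', h₂', h₃', h₄'⟩ := e₂.run O hb.2 (tempBase + 1) (by omega) τ
    refine ⟨τ', T + T' + 1, by simp only [cost]; omega, h₄.trans (h₄'.mono (by omega)),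
      key _ _ _ _ _ _ _ h₁ h₁' ?_⟩
    simp [Condition.Holds, Holds, h₃', h₄'.reg tempBase (by omega), h₃, NExp.eval_congr h₄ hb.2]
  | le e₁ e₂ =>
    simp only [ok, Bool.and_eq_true] at hb
    obtain ⟨τ, T, h₁, h₂, h₃, h₄⟩ := e₁.run O hb.1 tempBase le_rfl σ
    obtain ⟨τ', T', h₁', h₂', h₃', h₄'⟩ := e₂.run O hb.2 (tempBase + 1) (by omega) τ
    refine ⟨τ', T + T' + 1, by simp only [cost]; omega, h₄.trans (h₄'.mono (by omega)),
      key _ _ _ _ _ _ _ h₁ h₁' ?_⟩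
    simp [Condition.Holds, Holds, h₃', h₄'.num tempBase (by omega), h₃, CExp.eval_congr h₄ hb.2]

/-! ### Commands: compilation, frames and loop invariants. -/

namespace Cmd

/-- A counted loop becomes a `while` that compares counter and bound in every round. This matches
`exec` only for commands that pass `ok`, as a body could otherwise tamper with either register. -/
def code : Cmd → Program
  | .skip => .skip
  | .setN x e => .seq (e.code tempBase) (.copy x tempBase)
  | .setA a i j e => .seq (i.code tempBase) (.seq (j.code (tempBase + 1))
      (.seq (e.code (tempBase + 2)) (.store a tempBase (tempBase + 1) (tempBase + 2))))
  | .setC x c => .seq (c.code tempBase) (.numCopy x tempBase)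
  | .setCA a i j c => .seq (i.code tempBase) (.seq (j.code (tempBase + 1))
      (.seq (c.code (tempBase + 2)) (.numStore a tempBase (tempBase + 1) (tempBase + 2))))
  | .root x a i d j => .seq (i.code tempBase) (.seq (j.code (tempBase + 1))
      (.root x a tempBase d (tempBase + 1)))
  | .query x a i => .seq (i.code tempBase) (.query x a tempBase)
  | .seq p q => .seq p.code q.code
  | .ite b p q => b.code p.code q.code
  | .loop x y b => .seq (.zero x) (.while (.lt x y) (.seq b.code (.succ x)))

/-- The registers that a command may change. -/
def wr : Cmd → ℕ → Bool
  | .setN x _, z => x == z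
  | .seq p q, z => p.wr z || q.wr z
  | .ite _ p q, z => p.wr z || q.wr z
  | .loop x _ b, z => x == z || b.wr z
  | _, _ => false

/-- The arrays that a command may change. -/
def wrArr : Cmd → ℕ → Bool
  | .setA a _ _ _, z => a == z
  | .seq p q, z => p.wrArr z || q.wrArr z
  | .ite _ p q, z => p.wrArr z || q.wrArr z
  | .loop _ _ b, z => b.wrArr z
  | _, _ => false

/-- The number registers that a command may change. -/
def wrNum : Cmd → ℕ → Bool
  | .setC x _, z => x == z
  | .root x _ _ _ _, z => x == z
  | .query x _ _, z => x == z
  | .seq p q, z => p.wrNum z || q.wrNum z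
  | .ite _ p q, z => p.wrNum z || q.wrNum z
  | .loop _ _ b, z => b.wrNum z
  | _, _ => false

/-- The number arrays that a command may change. -/
def wrNumArr : Cmd → ℕ → Bool
  | .setCA a _ _ _, z => a == z
  | .seq p q, z => p.wrNumArr z || q.wrNumArr z
  | .ite _ p q, z => p.wrNumArr z || q.wrNumArr z
  | .loop _ _ b, z => b.wrNumArr z
  | _, _ => false

/-- All registers are variables, and loop bodies change neither the counter nor the bound. -/
def ok : Cmd → Bool
  | .skip => true
  | .setN x e => decide (x < tempBase) && e.ok
  | .setA _ i j e => i.ok && j.ok && e.ok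
  | .setC x c => decide (x < tempBase) && c.ok
  | .setCA _ i j c => i.ok && j.ok && c.ok
  | .root x _ i d j => decide (x < tempBase) && i.ok && decide (d < tempBase) && j.ok
  | .query x _ i => decide (x < tempBase) && i.ok
  | .seq p q => p.ok && q.ok
  | .ite b p q => b.ok && p.ok && q.ok
  | .loop x y b => decide (x < tempBase) && decide (y < tempBase) && !(x == y) && !b.wr x &&
      !b.wr y && b.ok

open Classical in
/-- A bound on the running time of a command. -/
def cost (O : Oracle) : Cmd → Memory → ℕ
  | .skip, _ => 1
  | .setN _ e, _ => e.cost + 1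
  | .setA _ i j e, _ => i.cost + j.cost + e.cost + 1
  | .setC _ c, _ => c.cost + 1
  | .setCA _ i j c, _ => i.cost + j.cost + c.cost + 1
  | .root _ _ i d j, σ => i.cost + j.cost + (σ.reg d + 1) ^ 2
  | .query _ _ i, _ => i.cost + (O.w + 1)
  | .seq p q, σ => p.cost O σ + q.cost O (p.exec O σ)
  | .ite b p q, σ => b.cost + if b.Holds σ then p.cost O σ else q.cost O σ
  | .loop x y b, σ => (∑ i ∈ Finset.range (σ.reg y), (b.cost O (loopState (b.exec O) x σ i) + 2)) + 2

/-- The parts of the memory that a command does not change. -/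
structure Frame (c : Cmd) (σ τ : Memory) : Prop where
  reg : ∀ x, c.wr x = false → τ.reg x = σ.reg x
  arr : ∀ a, c.wrArr a = false → τ.arr a = σ.arr a
  num : ∀ x, c.wrNum x = false → τ.num x = σ.num x
  numArr : ∀ a, c.wrNumArr a = false → τ.numArr a = σ.numArr a

theorem Frame.refl (c : Cmd) (σ : Memory) : Frame c σ σ :=
  ⟨fun _ _ => rfl, fun _ _ => rfl, fun _ _ => rfl, fun _ _ => rfl⟩

theorem Frame.trans {c : Cmd} {σ τ υ : Memory} (h : Frame c σ τ) (h' : Frame c τ υ) :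
    Frame c σ υ :=
  ⟨fun x hx => (h'.reg x hx).trans (h.reg x hx), fun x hx => (h'.arr x hx).trans (h.arr x hx),
    fun x hx => (h'.num x hx).trans (h.num x hx),
    fun x hx => (h'.numArr x hx).trans (h.numArr x hx)⟩

theorem Frame.mono {c d : Cmd} {σ τ : Memory} (h : Frame c σ τ)
    (h₁ : ∀ x, d.wr x = false → c.wr x = false) (h₂ : ∀ x, d.wrArr x = false → c.wrArr x = false)
    (h₃ : ∀ x, d.wrNum x = false → c.wrNum x = false)
    (h₄ : ∀ x, d.wrNumArr x = false → c.wrNumArr x = false) : Frame d σ τ :=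
  ⟨fun x hx => h.reg x (h₁ x hx), fun x hx => h.arr x (h₂ x hx), fun x hx => h.num x (h₃ x hx),
    fun x hx => h.numArr x (h₄ x hx)⟩

theorem Frame.setReg_loop {x y : ℕ} {b : Cmd} {σ τ : Memory} (h : Frame (.loop x y b) σ τ) (v : ℕ) :
    Frame (.loop x y b) σ (τ.setReg x v) :=
  ⟨fun z hz => by
    have : z ≠ x := by rintro rfl; simp [wr] at hz
    simpa [Memory.setReg, this] using h.reg z hz, h.arr, h.num, h.numArr⟩

theorem Frame.loop_of_body {x y : ℕ} {b : Cmd} {σ τ : Memory} (h : Frame b σ τ) :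
    Frame (.loop x y b) σ τ :=
  h.mono (by simp [wr]) (by simp [wrArr]) (by simp [wrNum]) (by simp [wrNumArr])

/-- What is never the target of an assignment keeps its value. Since `wr`, `wrArr`, `wrNum` and
`wrNumArr` are computable, each later use for a concrete program is discharged by `rfl`. -/
theorem exec_frame (O : Oracle) : ∀ (c : Cmd) (σ : Memory), Frame c σ (c.exec O σ)
  | .skip, σ => Frame.refl _ _
  | .setN x e, σ => ⟨fun z hz => by
      have : z ≠ x := by rintro rfl; simp [wr] at hz
      simp [exec, Memory.setReg, this], fun _ _ => rfl, fun _ _ => rfl, fun _ _ => rfl⟩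
  | .setA a i j e, σ => ⟨fun _ _ => rfl, fun z hz => by
      have : z ≠ a := by rintro rfl; simp [wrArr] at hz
      funext; simp [exec, Memory.setArr, this], fun _ _ => rfl, fun _ _ => rfl⟩
  | .setC x c, σ => ⟨fun _ _ => rfl, fun _ _ => rfl, fun z hz => by
      have : z ≠ x := by rintro rfl; simp [wrNum] at hz
      simp [exec, Memory.setNum, this], fun _ _ => rfl⟩
  | .setCA a i j c, σ => ⟨fun _ _ => rfl, fun _ _ => rfl, fun _ _ => rfl, fun z hz => by
      have : z ≠ a := by rintro rfl; simp [wrNumArr] at hz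
      funext; simp [exec, Memory.setNumArr, this]⟩
  | .root x a i d j, σ => ⟨fun _ _ => rfl, fun _ _ => rfl, fun z hz => by
      have : z ≠ x := by rintro rfl; simp [wrNum] at hz
      simp [exec, Memory.setNum, this], fun _ _ => rfl⟩
  | .query x a i, σ => ⟨fun _ _ => rfl, fun _ _ => rfl, fun z hz => by
      have : z ≠ x := by rintro rfl; simp [wrNum] at hz
      simp [exec, Memory.setNum, this], fun _ _ => rfl⟩
  | .seq p q, σ => by
    have h₁ := exec_frame O p σ
    have h₂ := exec_frame O q (p.exec O σ)
    exact (h₁.mono (d := .seq p q) (by simp +contextual [wr]) (by simp +contextual [wrArr])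
      (by simp +contextual [wrNum]) (by simp +contextual [wrNumArr])).trans
      (h₂.mono (by simp +contextual [wr]) (by simp +contextual [wrArr])
      (by simp +contextual [wrNum]) (by simp +contextual [wrNumArr]))
  | .ite b p q, σ => by
    unfold exec
    split_ifs
    · exact (exec_frame O p σ).mono (by simp +contextual [wr]) (by simp +contextual [wrArr])
        (by simp +contextual [wrNum]) (by simp +contextual [wrNumArr])
    · exact (exec_frame O q σ).mono (by simp +contextual [wr]) (by simp +contextual [wrArr])
        (by simp +contextual [wrNum]) (by simp +contextual [wrNumArr])
  | .loop x y b, σ => by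
    unfold exec
    induction σ.reg y with
    | zero => exact (Frame.refl _ _).setReg_loop 0
    | succ i ih => exact (ih.trans (Frame.loop_of_body (exec_frame O b _))).setReg_loop _

theorem loopState_frame (O : Oracle) (x y : ℕ) (b : Cmd) (σ : Memory) (i : ℕ) :
    Frame (.loop x y b) σ (loopState (b.exec O) x σ i) := by
  induction i with
  | zero => exact (Frame.refl _ _).setReg_loop 0
  | succ i ih => exact (ih.trans (Frame.loop_of_body (exec_frame O b _))).setReg_loop _

theorem loopState_counter (f : Memory → Memory) (x : ℕ) (σ : Memory) (i : ℕ) :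
    (loopState f x σ i).reg x = i := by
  cases i <;> simp [loopState, Memory.setReg]

/-- The induction step also receives the frame of the whole loop, so that an invariant only has to
mention what the loop changes. -/
theorem loopState_inv (O : Oracle) {x y : ℕ} {b : Cmd} (I : ℕ → Memory → Prop) (σ : Memory)
    (h₀ : I 0 (σ.setReg x 0))
    (hs : ∀ i < σ.reg y, ∀ τ, Frame (.loop x y b) σ τ → τ.reg x = i → I i τ →
      I (i + 1) ((b.exec O τ).setReg x (i + 1))) :
    ∀ i ≤ σ.reg y, I i (loopState (b.exec O) x σ i) := by
  intro i
  induction i with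
  | zero => exact fun _ => h₀
  | succ i ih =>
    exact fun hi => hs i (by omega) _ (loopState_frame O x y b σ i)
      (loopState_counter _ _ _ _) (ih (by omega))

/-- Loop invariants. -/
theorem loop_inv (O : Oracle) {x y : ℕ} {b : Cmd} (I : ℕ → Memory → Prop) (σ : Memory)
    (h₀ : I 0 (σ.setReg x 0))
    (hs : ∀ i < σ.reg y, ∀ τ, Frame (.loop x y b) σ τ → τ.reg x = i → I i τ →
      I (i + 1) ((b.exec O τ).setReg x (i + 1))) : I (σ.reg y) ((Cmd.loop x y b).exec O σ) :=
  loopState_inv O I σ h₀ hs _ le_rfl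

/-- Correctness of the compilation. -/
theorem run (O : Oracle) : ∀ (c : Cmd), c.ok → ∀ σ σ' : Memory, Below tempBase σ σ' →
    ∃ τ T, Run O c.code σ' τ T ∧ T ≤ c.cost O σ ∧ Below tempBase (c.exec O σ) τ
  | .skip, _, σ, σ', h => ⟨_, _, .skip σ', le_rfl, h⟩
  | .setN x e, hk, σ, σ', h => by
    simp only [ok, Bool.and_eq_true, decide_eq_true_eq] at hk
    obtain ⟨τ, T, h₁, h₂, h₃, h₄⟩ := e.run O hk.2 tempBase le_rfl σ'
    refine ⟨_, _, .seq h₁ (.copy τ x tempBase), by simp only [cost]; omega, ?_⟩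
    rw [h₃, NExp.eval_congr h hk.2]
    exact Below.setReg_both (h.trans h₄)
  | .setA a i j e, hk, σ, σ', h => by
    simp only [ok, Bool.and_eq_true] at hk
    obtain ⟨τ, T, h₁, h₂, h₃, h₄⟩ := i.run O hk.1.1 tempBase le_rfl σ'
    obtain ⟨τ', T', h₁', h₂', h₃', h₄'⟩ := j.run O hk.1.2 (tempBase + 1) (by omega) τ
    obtain ⟨υ, U, k₁, k₂, k₃, k₄⟩ := e.run O hk.2 (tempBase + 2) (by omega) τ'
    refine ⟨_, _, .seq h₁ (.seq h₁' (.seq k₁ (.store υ a _ _ _))), by simp only [cost]; omega, ?_⟩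
    have b₁ := h.trans h₄
    have b₂ := b₁.trans (h₄'.mono (by omega))
    have b₃ := b₂.trans (k₄.mono (by omega))
    rw [k₃, k₄.reg _ (by omega), k₄.reg _ (by omega), h₃', h₄'.reg _ (by omega), h₃,
      NExp.eval_congr h hk.1.1, NExp.eval_congr b₁ hk.1.2, NExp.eval_congr b₂ hk.2]
    exact ⟨b₃.reg, b₃.num, by simp [exec, Memory.setArr, b₃.arr], b₃.numArr⟩
  | .setC x e, hk, σ, σ', h => by
    simp only [ok, Bool.and_eq_true, decide_eq_true_eq] at hk
    obtain ⟨τ, T, h₁, h₂, h₃, h₄⟩ := e.run O hk.2 tempBase le_rfl σ'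
    refine ⟨_, _, .seq h₁ (.numCopy τ x tempBase), by simp only [cost]; omega, ?_⟩
    rw [h₃, CExp.eval_congr h hk.2]
    exact Below.setNum_both (h.trans h₄)
  | .setCA a i j e, hk, σ, σ', h => by
    simp only [ok, Bool.and_eq_true] at hk
    obtain ⟨τ, T, h₁, h₂, h₃, h₄⟩ := i.run O hk.1.1 tempBase le_rfl σ'
    obtain ⟨τ', T', h₁', h₂', h₃', h₄'⟩ := j.run O hk.1.2 (tempBase + 1) (by omega) τ
    obtain ⟨υ, U, k₁, k₂, k₃, k₄⟩ := e.run O hk.2 (tempBase + 2) (by omega) τ'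
    refine ⟨_, _, .seq h₁ (.seq h₁' (.seq k₁ (.numStore υ a _ _ _))),
      by simp only [cost]; omega, ?_⟩
    have b₁ := h.trans h₄
    have b₂ := b₁.trans (h₄'.mono (by omega))
    have b₃ := b₂.trans (k₄.mono (by omega))
    rw [k₃, k₄.reg _ (by omega), k₄.reg _ (by omega), h₃', h₄'.reg _ (by omega), h₃,
      NExp.eval_congr h hk.1.1, NExp.eval_congr b₁ hk.1.2, CExp.eval_congr b₂ hk.2]
    exact ⟨b₃.reg, b₃.num, b₃.arr, by simp [exec, Memory.setNumArr, b₃.numArr]⟩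
  | .root x a i d j, hk, σ, σ', h => by
    simp only [ok, Bool.and_eq_true, decide_eq_true_eq] at hk
    obtain ⟨τ, T, h₁, h₂, h₃, h₄⟩ := i.run O hk.1.1.2 tempBase le_rfl σ'
    obtain ⟨τ', T', h₁', h₂', h₃', h₄'⟩ := j.run O hk.2 (tempBase + 1) (by omega) τ
    have b₁ := h.trans h₄
    have b₂ := b₁.trans (h₄'.mono (by omega))
    refine ⟨_, _, .seq h₁ (.seq h₁' (.root τ' x a _ d _)), ?_, ?_⟩
    · rw [b₂.reg d hk.1.2]
      simp only [cost]; omega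
    · rw [h₃', h₄'.reg _ (by omega), h₃, b₂.numArr, b₂.reg d hk.1.2,
        NExp.eval_congr h hk.1.1.2, NExp.eval_congr b₁ hk.2]
      exact Below.setNum_both b₂
  | .query x a i, hk, σ, σ', h => by
    simp only [ok, Bool.and_eq_true, decide_eq_true_eq] at hk
    obtain ⟨τ, T, h₁, h₂, h₃, h₄⟩ := i.run O hk.2 tempBase le_rfl σ'
    have b₁ := h.trans h₄
    refine ⟨_, _, .seq h₁ (.query τ x a _), by simp only [cost]; omega, ?_⟩
    rw [h₃, b₁.arr, NExp.eval_congr h hk.2]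
    exact Below.setNum_both b₁
  | .seq p q, hk, σ, σ', h => by
    simp only [ok, Bool.and_eq_true] at hk
    obtain ⟨τ, T, h₁, h₂, h₃⟩ := run O p hk.1 σ σ' h
    obtain ⟨τ', T', h₁', h₂', h₃'⟩ := run O q hk.2 _ τ h₃
    exact ⟨_, _, .seq h₁ h₁', by simp only [cost]; omega, h₃'⟩
  | .ite b p q, hk, σ, σ', h => by
    simp only [ok, Bool.and_eq_true] at hk
    obtain ⟨τ, T, h₁, h₂, h₃⟩ := Test.run O hk.1.1 p.code q.code σ'
    rw [Test.holds_congr h hk.1.1] at h₃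
    by_cases hb : b.Holds σ
    · obtain ⟨τ', T', h₁', h₂', h₃'⟩ := run O p hk.1.2 σ τ (h.trans h₂)
      refine ⟨_, _, h₃ _ _ (by rw [if_pos hb]; exact h₁'), ?_, ?_⟩
      · simp only [cost, if_pos hb]; omega
      · simpa only [exec, if_pos hb] using h₃'
    · obtain ⟨τ', T', h₁', h₂', h₃'⟩ := run O q hk.2 σ τ (h.trans h₂)
      refine ⟨_, _, h₃ _ _ (by rw [if_neg hb]; exact h₁'), ?_, ?_⟩
      · simp only [cost, if_neg hb]; omega
      · simpa only [exec, if_neg hb] using h₃'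
  | .loop x y b, hk, σ, σ', h => by
    simp only [ok, Bool.and_eq_true, decide_eq_true_eq, Bool.not_eq_true', beq_eq_false_iff_ne]
      at hk
    obtain ⟨⟨⟨⟨⟨hx, hy⟩, hxy⟩, hbx⟩, hby⟩, hb⟩ := hk
    have hwy : (Cmd.loop x y b).wr y = false := by simp [wr, hxy, hby]
    -- Induction on the number `m` of rounds still to be run, the machine being about to begin round
    -- `i` in a memory that agrees with `loopState` on the variables.
    suffices ∀ m i, i + m = σ.reg y → ∀ τ, Below tempBase (loopState (b.exec O) x σ i) τ →
        ∃ υ T, Run O (.while (.lt x y) (.seq b.code (.succ x))) τ υ T ∧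
          T ≤ (∑ l ∈ Finset.range m, (b.cost O (loopState (b.exec O) x σ (i + l)) + 2)) + 1 ∧
          Below tempBase (loopState (b.exec O) x σ (σ.reg y)) υ by
      obtain ⟨υ, T, h₁, h₂, h₃⟩ := this (σ.reg y) 0 (by simp) (σ'.setReg x 0) (Below.setReg_both h)
      refine ⟨υ, _, .seq (.zero σ' x) h₁, ?_, h₃⟩
      simp only [zero_add] at h₂
      simp only [cost]
      omega
    intro m
    induction m with
    | zero =>
      intro i hi τ hτ
      refine ⟨τ, 1, .whileFalse ?_, by simp, ?_⟩
      · simp only [Condition.Holds]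
        rw [hτ.reg x hx, hτ.reg y hy, loopState_counter, (loopState_frame O x y b σ i).reg y hwy]
        omega
      · rwa [← hi]
    | succ m ih =>
      intro i hi τ hτ
      obtain ⟨τ', T', h₁', h₂', h₃'⟩ := run O b hb _ τ hτ
      -- The body has not touched the counter, so the increment produces the value `i + 1` that
      -- `loopState` prescribes.
      have hc : τ'.reg x = i := by
        rw [h₃'.reg x hx, (exec_frame O b _).reg x hbx, loopState_counter]
      have h₄ : Below tempBase (loopState (b.exec O) x σ (i + 1)) (τ'.setReg x (τ'.reg x + 1)) := by
        rw [hc]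
        exact Below.setReg_both h₃'
      obtain ⟨υ, U, k₁, k₂, k₃⟩ := ih (i + 1) (by omega) _ h₄
      refine ⟨υ, _, .whileTrue ?_ (.seq h₁' (.succ τ' x)) k₁, ?_, k₃⟩
      · simp only [Condition.Holds]
        rw [hτ.reg x hx, hτ.reg y hy, loopState_counter, (loopState_frame O x y b σ i).reg y hwy]
        omega
      · rw [Finset.sum_range_succ']
        simp only [add_zero]
        have : ∀ l, i + 1 + l = i + (l + 1) := fun l => by ring
        simp only [this] at k₂
        omega

/-! ### Running time -/

/-- The command changes no register of `S` and not register 2, and its loop bounds and polynomial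
degrees are in such registers. -/
def sized (S : ℕ → Bool) : Cmd → Bool
  | .setN x _ => !S x && !(x == 2)
  | .root _ _ _ d _ => S d
  | .seq p q => p.sized S && q.sized S
  | .ite _ p q => p.sized S && q.sized S
  | .loop x y b => !S x && !(x == 2) && (S y || y == 2) && b.sized S
  | _ => true

/-- The exponent of `B` in `cost_le`: a loop not over the list gives one factor, a root extraction
two because of its cost `(d + 1) ^ 2`, a query one because of its cost `w + 1`. -/
def degree : Cmd → ℕ
  | .root _ _ _ _ _ => 2
  | .query _ _ _ => 1
  | .seq p q => max p.degree q.degree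
  | .ite _ p q => max p.degree q.degree
  | .loop _ y b => if y = 2 then b.degree else b.degree + 1
  | _ => 0

/-- The nesting depth of the loops bounded by register 2. -/
def depth : Cmd → ℕ
  | .seq p q => max p.depth q.depth
  | .ite _ p q => max p.depth q.depth
  | .loop _ y b => if y = 2 then b.depth + 1 else b.depth
  | _ => 0

/-- The constant factor in `cost_le`. The summands 4 and 2 for `root` and `query` come from `(d + 1)
^ 2 ≤ 4 * B ^ 2` and `w + 1 ≤ 2 * B`; the 4 for a loop pays for two steps per round and two steps at
its ends. -/
def coeff : Cmd → ℕ
  | .skip => 1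
  | .setN _ e => e.cost + 1
  | .setA _ i j e => i.cost + j.cost + e.cost + 1
  | .setC _ c => c.cost + 1
  | .setCA _ i j c => i.cost + j.cost + c.cost + 1
  | .root _ _ i _ j => i.cost + j.cost + 4
  | .query _ _ i => i.cost + 2
  | .seq p q => p.coeff + q.coeff
  | .ite b p q => b.cost + p.coeff + q.coeff
  | .loop _ _ b => b.coeff + 4

/-- The registers that bound loops are never written, so bounds that hold at the start hold
throughout the run. -/
theorem sized_reg {S : ℕ → Bool} {y : ℕ} (hy : S y = true ∨ y = 2) : ∀ {c : Cmd}, c.sized S →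
    c.wr y = false
  | .skip, _ => rfl
  | .setN x e, h => by
    simp only [sized, Bool.and_eq_true, Bool.not_eq_true', beq_eq_false_iff_ne] at h
    simp only [wr, beq_eq_false_iff_ne]
    rintro rfl
    rcases hy with hy | hy
    · simp [hy] at h
    · exact h.2 hy
  | .setA .., _ => rfl
  | .setC .., _ => rfl
  | .setCA .., _ => rfl
  | .root .., _ => rfl
  | .query .., _ => rfl
  | .seq p q, h => by
    simp only [sized, Bool.and_eq_true] at h
    simp [wr, sized_reg hy h.1, sized_reg hy h.2]
  | .ite b p q, h => by
    simp only [sized, Bool.and_eq_true] at h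
    simp [wr, sized_reg hy h.1, sized_reg hy h.2]
  | .loop x z b, h => by
    simp only [sized, Bool.and_eq_true, Bool.not_eq_true', beq_eq_false_iff_ne] at h
    simp only [wr, Bool.or_eq_false_iff, beq_eq_false_iff_ne]
    refine ⟨?_, sized_reg hy h.2⟩
    rintro rfl
    rcases hy with hy | hy
    · simp [hy] at h
    · exact h.1.1.2 hy

/-- Every loop multiplies the cost of its body by its bound, which is at most `Λ` for loops over the
list and at most `B` otherwise; compositions only add coefficients. The running time can thus be
read off the syntax. -/
theorem cost_le (O : Oracle) {S : ℕ → Bool} {B Λ : ℕ} (hB : 1 ≤ B) (hΛ : 1 ≤ Λ) (hw : O.w ≤ B) :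
    ∀ (c : Cmd), c.sized S → ∀ σ : Memory, (∀ y, S y → σ.reg y ≤ B) → σ.reg 2 ≤ Λ →
      c.cost O σ ≤ c.coeff * (B ^ c.degree * Λ ^ c.depth) := by
  have mono : ∀ {c d i i' j j' : ℕ}, c ≤ d → i ≤ i' → j ≤ j' →
      c * (B ^ i * Λ ^ j) ≤ d * (B ^ i' * Λ ^ j') := fun h₁ h₂ h₃ => by gcongr
  have one : ∀ c i j : ℕ, c ≤ c * (B ^ i * Λ ^ j) := fun c i j =>
    Nat.le_mul_of_pos_right _ (by positivity)
  intro c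
  induction c with
  | skip => simp [cost, coeff, degree, depth]
  | setN x e => simp [cost, coeff, degree, depth]
  | setA a i j e => simp [cost, coeff, degree, depth]
  | setC x c => simp [cost, coeff, degree, depth]
  | setCA a i j c => simp [cost, coeff, degree, depth]
  | root x a i d j =>
    intro h σ hS _
    have hd := hS d h
    simp only [cost, coeff, degree, depth, pow_zero, mul_one]
    have : 1 ≤ B ^ 2 := Nat.one_le_pow _ _ hB
    nlinarith [Nat.zero_le (i.cost + j.cost)]
  | query x a i =>
    intro h σ hS _
    simp only [cost, coeff, degree, depth, pow_zero, mul_one, pow_one]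
    nlinarith [Nat.zero_le i.cost]
  | seq p q ihp ihq =>
    intro h σ hS hσ
    simp only [sized, Bool.and_eq_true] at h
    simp only [cost, coeff, degree, depth, add_mul]
    refine add_le_add ((ihp h.1 σ hS hσ).trans (mono le_rfl (le_max_left _ _) (le_max_left _ _)))
      ((ihq h.2 _ ?_ ?_).trans (mono le_rfl (le_max_right _ _) (le_max_right _ _)))
    · intro y hy
      rw [(exec_frame O p σ).reg y (sized_reg (.inl hy) h.1)]
      exact hS y hy
    · rw [(exec_frame O p σ).reg 2 (sized_reg (.inr rfl) h.1)]
      exact hσ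
  | ite b p q ihp ihq =>
    intro h σ hS hσ
    simp only [sized, Bool.and_eq_true] at h
    simp only [cost, coeff, degree, depth, add_mul]
    have h₁ := (ihp h.1 σ hS hσ).trans (mono le_rfl (le_max_left _ q.degree) (le_max_left _ q.depth))
    have h₂ := (ihq h.2 σ hS hσ).trans
      (mono le_rfl (le_max_right p.degree _) (le_max_right p.depth _))
    have h₃ := one b.cost (max p.degree q.degree) (max p.depth q.depth)
    split_ifs <;> omega
  | loop x y b ih =>
    intro h σ hS hσ
    have hsz := h
    simp only [sized, Bool.and_eq_true, Bool.or_eq_true, beq_iff_eq] at h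
    have hreg : ∀ i, b.cost O (loopState (b.exec O) x σ i) ≤
        b.coeff * (B ^ b.degree * Λ ^ b.depth) := by
      intro i
      have hF := loopState_frame O x y b σ i
      refine ih h.2 _ (fun z hz => ?_) ?_
      · rw [hF.reg z (sized_reg (.inl hz) hsz)]
        exact hS z hz
      · rw [hF.reg 2 (sized_reg (.inr rfl) hsz)]
        exact hσ
    simp only [cost, coeff, degree, depth]
    set K := B ^ b.degree * Λ ^ b.depth with hK
    have hK1 : 1 ≤ K := Nat.one_le_iff_ne_zero.2 (by positivity)
    have hsum : ∑ i ∈ Finset.range (σ.reg y), (b.cost O (loopState (b.exec O) x σ i) + 2) ≤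
        σ.reg y * ((b.coeff + 2) * K) := by
      refine (Finset.sum_le_card_nsmul _ _ ((b.coeff + 2) * K) fun i _ => ?_).trans (by simp)
      have := hreg i
      nlinarith
    by_cases hy : y = 2
    · subst hy
      simp only [if_true]
      have e : B ^ b.degree * Λ ^ (b.depth + 1) = Λ * K := by rw [hK]; ring
      rw [e]
      have : σ.reg 2 * ((b.coeff + 2) * K) ≤ Λ * ((b.coeff + 2) * K) := by gcongr
      have : 1 ≤ Λ * K := Nat.one_le_iff_ne_zero.2 (by positivity)
      nlinarith
    · simp only [hy, if_false]
      have e : B ^ (b.degree + 1) * Λ ^ b.depth = B * K := by rw [hK]; ring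
      rw [e]
      have hyB : σ.reg y ≤ B := hS y (h.1.2.resolve_right hy)
      have : σ.reg y * ((b.coeff + 2) * K) ≤ B * ((b.coeff + 2) * K) := by gcongr
      have : 1 ≤ B * K := Nat.one_le_iff_ne_zero.2 (by positivity)
      nlinarith

/-- The command changes register `x` only by increments. -/
def incrementsOnly (x : ℕ) : Cmd → Bool
  | .setN y e => !(y == x) || (match e with
    | .succ (.var z) => z == x
    | _ => false)
  | .seq p q => p.incrementsOnly x && q.incrementsOnly x
  | .ite _ p q => p.incrementsOnly x && q.incrementsOnly x
  | .loop y _ b => !(y == x) && b.incrementsOnly x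
  | _ => true

/-- Every increment takes time, so such a register cannot outgrow the cost. It bounds the number of
gates, which later serves as a loop bound. -/
theorem reg_le_cost (O : Oracle) (x : ℕ) : ∀ (c : Cmd), c.incrementsOnly x → ∀ σ : Memory,
    (c.exec O σ).reg x ≤ σ.reg x + c.cost O σ := by
  intro c
  induction c with
  | skip => simp [exec]
  | setA a i j e => simp [exec, Memory.setArr]
  | setC x c => simp [exec, Memory.setNum]
  | setCA a i j c => simp [exec, Memory.setNumArr]
  | root x a i d j => simp [exec, Memory.setNum]
  | query x a i => simp [exec, Memory.setNum]
  | setN y e =>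
    intro h σ
    by_cases hy : y = x
    · subst hy
      simp only [incrementsOnly, beq_self_eq_true, Bool.not_true, Bool.false_or] at h
      split at h
      · simp only [beq_iff_eq] at h
        subst h
        simp only [exec, Memory.setReg, Function.update_self, NExp.eval, cost]
        omega
      · cases h
    · simp [exec, Memory.setReg, Function.update_of_ne (Ne.symm hy)]
  | seq p q ihp ihq =>
    intro h σ
    simp only [incrementsOnly, Bool.and_eq_true] at h
    have h₁ := ihp h.1 σ
    have h₂ := ihq h.2 (p.exec O σ)
    simp only [exec, cost]
    omega
  | ite b p q ihp ihq =>
    intro h σ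
    simp only [incrementsOnly, Bool.and_eq_true] at h
    have h₁ := ihp h.1 σ
    have h₂ := ihq h.2 σ
    simp only [exec, cost]
    split_ifs <;> omega
  | loop y z b ih =>
    intro h σ
    simp only [incrementsOnly, Bool.and_eq_true, Bool.not_eq_true', beq_eq_false_iff_ne] at h
    simp only [exec, cost]
    suffices ∀ m, (loopState (b.exec O) y σ m).reg x ≤ σ.reg x +
        ∑ i ∈ Finset.range m, (b.cost O (loopState (b.exec O) y σ i) + 2) by
      have := this (σ.reg z)
      omega
    intro m
    induction m with
    | zero => simp [loopState, Memory.setReg, Function.update_of_ne (Ne.symm h.1)]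
    | succ m ihm =>
      have := ih h.2 (loopState (b.exec O) y σ m)
      rw [Finset.sum_range_succ]
      simp only [loopState, Memory.setReg, Function.update_of_ne (Ne.symm h.1)]
      omega

end Cmd

/-! ## The algorithm

Arrays: 0, 1, 2 hold the `x` bits, `z` bits and signs of the tableau, whose rows are the generators
followed by the perturbing Pauli strings; 8 the gates found so far; 9 the labels of the members of
the list; 10, 11, 12 the tables of `2 * y`, `y / 2` and `y % 2`; 13, 14 the labels and syndromes of
the current block. Number arrays: 3, 4 the energies and the matrix of the block; 5, 6 the Lanczos
vectors and their square norms; 10, 11 the Lanczos polynomials.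

Registers: 10 the number of rows, 11 the pivot, 12 the current row or list member, 20 the number of
gates, 21 and 22 the qubits of a gate, 30 the dimension `N` of a block, 31 `N + 1`, 32 `3 * N`. -/

/-- Exclusive or of bits. -/
def NExp.xor (e f : NExp) : NExp := .ite e (.lit 0) f (.ite f (.lit 0) (.lit 1) (.lit 0))

/-- Conjunction of bits. -/
def NExp.and (e f : NExp) : NExp := .ite e (.lit 0) (.lit 0) f

/-- Negation of a bit. -/
def NExp.not (e : NExp) : NExp := .ite e (.lit 0) (.lit 1) (.lit 0)

namespace Prog

open Cmd

def xBit (i q : ℕ) : NExp := .arr 0 (.var i) (.var q)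

def zBit (i q : ℕ) : NExp := .arr 1 (.var i) (.var q)

def sBit (i : ℕ) : NExp := .arr 2 (.lit 0) (.var i)

/-- Append the perturbing Pauli strings to the tableau. -/
def copyRows : Cmd :=
  setN 10 (.var 0) ;;
  loop 13 1 (
    loop 14 0 (
      setA 0 (.var 10) (.var 14) (.arr 3 (.var 13) (.var 14)) ;;
      setA 1 (.var 10) (.var 14) (.arr 4 (.var 13) (.var 14))) ;;
    setN 10 (.succ (.var 10)))

/-- Append a gate to the list of gates. -/
def record (code : ℕ) : Cmd :=
  setA 8 (.var 20) (.lit 0) (.lit code) ;;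
  setA 8 (.var 20) (.lit 1) (.var 21) ;;
  setA 8 (.var 20) (.lit 2) (.var 22) ;;
  setN 20 (.succ (.var 20))

/-- Conjugation by a Hadamard gate exchanges `X` and `Z` and negates `Y`, hence the sign flip by `x
&& z`. The sign is updated first, from the old bits; register 25 serves for the exchange. -/
def rowH : Cmd :=
  setA 2 (.lit 0) (.var 23) (.xor (sBit 23) (.and (xBit 23 21) (zBit 23 21))) ;;
  setN 25 (xBit 23 21) ;;
  setA 0 (.var 23) (.var 21) (zBit 23 21) ;;
  setA 1 (.var 23) (.var 21) (.var 25)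

/-- For the phase gate `U`, the conjugation `U† · U` maps `X` to `-Y` and `Y` to `X`, hence the sign
flip by `x && !z`. -/
def rowS : Cmd :=
  setA 2 (.lit 0) (.var 23) (.xor (sBit 23) (.and (xBit 23 21) (.not (zBit 23 21)))) ;;
  setA 1 (.var 23) (.var 21) (.xor (zBit 23 21) (xBit 23 21))

/-- A CNOT copies `x` bits from control to target and `z` bits from target to control. The sign
changes exactly if `x_c` and `z_t` are set and `x_t = z_c`, in terms of the old bits. -/
def rowCX : Cmd :=
  setA 2 (.lit 0) (.var 23) (.xor (sBit 23) (.and (.and (xBit 23 21) (zBit 23 22))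
    (.not (.xor (xBit 23 22) (zBit 23 21))))) ;;
  setA 0 (.var 23) (.var 22) (.xor (xBit 23 22) (xBit 23 21)) ;;
  setA 1 (.var 23) (.var 21) (.xor (zBit 23 21) (zBit 23 22))

/-- Apply a Hadamard gate to qubit `reg 21`. -/
def gateH : Cmd := record 0 ;; loop 23 10 rowH

/-- Apply a phase gate to qubit `reg 21`. -/
def gateS : Cmd := record 1 ;; loop 23 10 rowS

/-- Apply a CNOT gate to the qubits `reg 21` and `reg 22`. -/
def gateCX : Cmd :=
  record 2 ;; loop 23 10 rowCX ;;
  loop 24 2 (setA 9 (.var 24) (.var 22)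
    (.xor (.arr 9 (.var 24) (.var 22)) (.arr 9 (.var 24) (.var 21))))

/-- Make the `x` part of row `reg 12`, on the qubits up to `reg 11`, the unit vector at `reg 11`. -/
def reduce : Cmd :=
  loop 21 0 (ite (.eq (xBit 12 11) (.lit 0))
    (ite (.eq (xBit 12 21) (.lit 0)) skip
      (ite (.lt (.var 21) (.var 11)) (setN 22 (.var 11) ;; gateCX) skip)) skip) ;;
  loop 22 0 (ite (.eq (xBit 12 22) (.lit 0)) skip
    (ite (.lt (.var 22) (.var 11)) (setN 21 (.var 11) ;; gateCX) skip))

/-- Make row `reg 12` free of `z` bits on the qubits up to `reg 11`. -/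
def clearZ : Cmd :=
  loop 21 0 (ite (.eq (zBit 12 21) (.lit 0)) skip
    (ite (.lt (.var 11) (.var 21)) skip
      (ite (.eq (xBit 12 21) (.lit 0)) gateH gateS)))

/-- Make the generators diagonal. -/
def diagonalize : Cmd :=
  setN 11 (.var 0) ;;
  loop 12 0 (
    -- On the qubits up to the pivot the row becomes a pure `x` string, then a single `X` at the
    -- pivot, and finally a `Z` there.
    setN 11 (.pred (.var 11)) ;; clearZ ;; reduce ;; setN 21 (.var 11) ;; gateH)

/-- Find the label of member `reg 13` of the list. -/
def solveRow : Cmd :=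
  loop 14 0 (setA 9 (.var 13) (.var 14) (.lit 0)) ;;
  setN 11 (.var 0) ;;
  loop 12 0 (
    setN 11 (.pred (.var 11)) ;;
    setN 25 (.xor (.arr 5 (.var 13) (.var 12)) (sBit 12)) ;;
    loop 14 0 (setN 25 (.xor (.var 25) (.and (zBit 12 14) (.arr 9 (.var 13) (.var 14))))) ;;
    setA 9 (.var 13) (.var 11) (.var 25))

def solve : Cmd := loop 13 2 solveRow

/-- Set register 26 if the `x` part of row `reg 12` is not zero on the qubits before `reg 11`. -/
def hasX : Cmd :=
  setN 26 (.lit 0) ;;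
  loop 27 0 (ite (.lt (.var 27) (.var 11))
    (ite (.eq (xBit 12 27) (.lit 0)) skip (setN 26 (.lit 1))) skip)

/-- Move the `x` parts of all rows to the last qubits. -/
def compress : Cmd :=
  setN 11 (.var 0) ;;
  loop 12 10 (
    hasX ;;
    ite (.eq (.var 26) (.lit 0)) skip
      (setN 11 (.pred (.var 11)) ;; reduce ;; setN 4 (.succ (.var 4))))

/-- Output the circuit, in the reverse order. -/
def writeCircuit : Cmd :=
  setN 21 (.var 20) ;;
  loop 23 20 (
    setN 21 (.pred (.var 21)) ;;
    setA 6 (.var 23) (.lit 0) (.arr 8 (.var 21) (.lit 0)) ;;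
    setA 6 (.var 23) (.lit 1) (.arr 8 (.var 21) (.lit 1)) ;;
    setA 6 (.var 23) (.lit 2) (.arr 8 (.var 21) (.lit 2))) ;;
  setN 5 (.var 20)

/-- Compute `N = 2 ^ r`. -/
def power : Cmd :=
  setN 30 (.lit 1) ;;
  -- Naturals can only be incremented; a number is doubled by counting up from itself as many times
  -- as a copy of it says.
  loop 13 4 (setN 31 (.var 30) ;; loop 14 31 (setN 30 (.succ (.var 30))))

/-- The value `3 * N` bounds the number of Lanczos rounds. The value 2 is the degree of `X ^ 2 - c`,
from which square roots are extracted; the root command takes its degree from a register. -/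
def sizes : Cmd :=
  setN 31 (.succ (.var 30)) ;;
  setN 32 (.var 30) ;;
  loop 13 30 (setN 32 (.succ (.succ (.var 32)))) ;;
  setN 33 (.lit 2)

/-- Doubling and halving are not machine operations; tabulating them by counting makes each later
use a single load. -/
def tables : Cmd :=
  setN 34 (.lit 0) ;;
  loop 13 30 (setA 10 (.lit 0) (.var 13) (.var 34) ;; setN 34 (.succ (.succ (.var 34)))) ;;
  setN 34 (.lit 0) ;;
  setN 35 (.lit 0) ;;
  loop 13 30 (
    setA 11 (.lit 0) (.var 13) (.var 34) ;;
    setA 12 (.lit 0) (.var 13) (.var 35) ;;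
    ite (.eq (.var 35) (.lit 0)) (setN 35 (.lit 1))
      (setN 35 (.lit 0) ;; setN 34 (.succ (.var 34))))

/-- The range of the energies of the list. -/
def window : Cmd :=
  query 2 5 (.lit 0) ;;
  query 3 5 (.lit 0) ;;
  loop 13 2 (
    query 4 5 (.var 13) ;;
    ite (.le (.var 4) (.var 2)) (setC 2 (.var 4)) skip ;;
    ite (.le (.var 3) (.var 4)) (setC 3 (.var 4)) skip)

/-- The labels of the block of member `reg 12` of the list. -/
def blockLabels : Cmd :=
  loop 13 30 (
    setN 34 (.var 13) ;;
    loop 14 0 (ite (.lt (.var 14) (.var 11))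
      (setA 13 (.var 13) (.var 14) (.arr 9 (.var 12) (.var 14)))
      (setA 13 (.var 13) (.var 14) (.arr 12 (.lit 0) (.var 34)) ;;
        setN 34 (.arr 11 (.lit 0) (.var 34)))))

/-- The syndromes and energies of the block. -/
def blockEnergies : Cmd :=
  loop 13 30 (
    loop 14 0 (
      setN 25 (sBit 14) ;;
      loop 15 0 (setN 25 (.xor (.var 25) (.and (zBit 14 15) (.arr 13 (.var 13) (.var 15))))) ;;
      setA 14 (.var 13) (.var 14) (.var 25)) ;;
    query 4 14 (.var 13) ;;
    setCA 3 (.lit 0) (.var 13) (.var 4))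

/-- Set register 37 if the list member is the first member of the list in its block. -/
def isFirst : Cmd :=
  setN 36 (.lit 0) ;;
  setN 37 (.lit 0) ;;
  loop 13 30 (
    ite (.eq (.var 36) (.lit 0))
      (ite (.le (.var 2) (.arr 3 (.lit 0) (.var 13)))
        (ite (.le (.arr 3 (.lit 0) (.var 13)) (.var 3))
          (setN 36 (.lit 1) ;;
            setN 37 (.lit 1) ;;
            loop 14 0 (ite (.eq (.xor (.arr 14 (.var 13) (.var 14)) (.arr 5 (.var 12) (.var 14)))
              (.lit 0)) skip (setN 37 (.lit 0))))
          skip) skip) skip)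

/-- The entry of row `reg 38` of the tableau at the block label `reg 13`. -/
def phaseProd : Cmd :=
  setC 6 (.var 5) ;;
  loop 14 0 (setC 6 (.mul (.var 6) (.ite (zBit 38 14) (.lit 0) .one
    (.mul (.ite (xBit 38 14) (.lit 0) .one (.sub .zero .imag))
      (.ite (.arr 13 (.var 13) (.var 14)) (.lit 0) .one (.sub .zero .one))))))

/-- The index to which row `reg 38` of the tableau moves the block label `reg 13`. -/
def target : Cmd :=
  setN 34 (.lit 0) ;;
  setN 35 (.var 0) ;;
  loop 14 0 (
    setN 35 (.pred (.var 35)) ;;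
    ite (.lt (.var 35) (.var 11)) skip
      (setN 34 (.arr 10 (.lit 0) (.var 34)) ;;
        ite (.eq (.xor (.arr 13 (.var 13) (.var 35)) (xBit 38 35)) (.lit 0)) skip
          (setN 34 (.succ (.var 34)))))

/-- The matrix of the block. -/
def blockMatrix : Cmd :=
  loop 13 30 (loop 14 30 (setCA 4 (.var 13) (.var 14) .zero)) ;;
  loop 13 30 (setCA 4 (.var 13) (.var 13) (.arr 3 (.lit 0) (.var 13))) ;;
  setN 38 (.var 0) ;;
  loop 15 1 (
    setC 5 (.ite (sBit 38) (.lit 0) (.arr 0 (.lit 0) (.var 15))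
      (.sub .zero (.arr 0 (.lit 0) (.var 15)))) ;;
    loop 13 30 (
      phaseProd ;; target ;;
      setCA 4 (.var 13) (.var 34) (.add (.arr 4 (.var 13) (.var 34)) (.var 6))) ;;
    setN 38 (.succ (.var 38)))

/-- Number register 6 becomes entry `reg 13` of the matrix applied to vector `reg t`. -/
def applyMatrix (t : ℕ) : Cmd :=
  setC 6 .zero ;;
  loop 14 30 (setC 6 (.add (.var 6)
    (.mul (.arr 4 (.var 13) (.var 14)) (.arr 5 (.var t) (.var 14)))))

/-- Register 41 tells whether a chain is being continued. If so, the matrix is applied to the last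
vector found; otherwise the next standard basis vector, numbered by register 42, is tried as the
start of a new chain. -/
def candidate : Cmd :=
  ite (.eq (.var 41) (.lit 0))
    (loop 13 30 (setCA 7 (.lit 0) (.var 13) (.ite (.var 42) (.var 13) .one .zero)) ;;
      setN 42 (.succ (.var 42)))
    (setN 43 (.pred (.var 40)) ;;
      loop 13 30 (applyMatrix 43 ;; setCA 7 (.lit 0) (.var 13) (.var 6)))

/-- Gram–Schmidt against the `reg 40` vectors found so far. Dividing by the stored square norms
makes normalization, and thus square roots, unnecessary at this stage. -/
def orthogonalize : Cmd :=
  loop 16 30 (ite (.lt (.var 16) (.var 40))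
    (setC 6 .zero ;;
      loop 13 30 (setC 6 (.add (.var 6)
        (.mul (.conj (.arr 5 (.var 16) (.var 13))) (.arr 7 (.lit 0) (.var 13))))) ;;
      setC 6 (.div (.var 6) (.arr 6 (.lit 0) (.var 16))) ;;
      loop 13 30 (setCA 7 (.lit 0) (.var 13)
        (.sub (.arr 7 (.lit 0) (.var 13)) (.mul (.var 6) (.arr 5 (.var 16) (.var 13))))))
    skip)

/-- Number register 6 becomes the square norm of row 0 of number array `a`. -/
def squareNorm (a : ℕ) : Cmd :=
  setC 6 .zero ;;
  loop 13 30 (setC 6 (.add (.var 6)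
    (.mul (.conj (.arr a (.lit 0) (.var 13))) (.arr a (.lit 0) (.var 13)))))

/-- A zero remainder ends the current chain or discards the current basis vector. Array 15 records,
for each stored vector, whether it continues a chain. Number register 6 holds a square norm, so the
test `≤ 0` means equality. -/
def append : Cmd :=
  ite (.le (.var 6) .zero) (setN 41 (.lit 0))
    (loop 13 30 (setCA 5 (.var 40) (.var 13) (.arr 7 (.lit 0) (.var 13))) ;;
      setCA 6 (.lit 0) (.var 40) (.var 6) ;;
      setA 15 (.lit 0) (.var 40) (.var 41) ;;
      setN 41 (.lit 1) ;;
      setN 40 (.succ (.var 40)))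

/-- The Lanczos process. -/
def lanczos : Cmd :=
  setN 40 (.lit 0) ;;
  setN 41 (.lit 0) ;;
  setN 42 (.lit 0) ;;
  loop 15 32 (candidate ;; orthogonalize ;; squareNorm 7 ;; append)

/-- Number register 7 becomes the diagonal Lanczos coefficient. -/
def diagCoeff : Cmd :=
  setC 7 .zero ;;
  loop 13 30 (applyMatrix 15 ;;
    setC 7 (.add (.var 7) (.mul (.conj (.arr 5 (.var 15) (.var 13))) (.var 6)))) ;;
  setC 7 (.div (.var 7) (.arr 6 (.lit 0) (.var 15)))

/-- The Lanczos polynomials. -/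
def polynomials : Cmd :=
  setN 44 (.lit 0) ;;
  setN 45 (.lit 0) ;;
  loop 15 30 (
    diagCoeff ;;
    ite (.eq (.arr 15 (.lit 0) (.var 15)) (.lit 0))
      (setN 44 (.var 15) ;;
        setN 45 (.lit 0) ;;
        setC 8 .zero ;;
        loop 13 31 (setCA 10 (.var 15) (.var 13) (.ite (.var 13) (.lit 0) .one .zero)))
      (setN 45 (.succ (.var 45)) ;;
        setC 8 (.div (.arr 6 (.lit 0) (.var 15)) (.arr 6 (.lit 0) (.pred (.var 15)))) ;;
        loop 13 31 (setCA 10 (.var 15) (.var 13) (.arr 11 (.pred (.var 15)) (.var 13)))) ;;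
    loop 13 31 (setCA 11 (.var 15) (.var 13)
      (.sub (.sub (.ite (.var 13) (.lit 0) .zero (.arr 10 (.var 15) (.pred (.var 13))))
        (.mul (.var 7) (.arr 10 (.var 15) (.var 13))))
        (.mul (.var 8) (.arr 10 (.pred (.var 15)) (.var 13))))) ;;
    setA 16 (.lit 0) (.var 15) (.var 44) ;;
    setA 18 (.lit 0) (.var 15) (.var 45) ;;
    setA 17 (.lit 0) (.var 44) (.var 15))

/-- Number register 7 becomes the eigenvalue with number `reg 15`. -/
def eigenvalue : Cmd :=
  setN 44 (.arr 16 (.lit 0) (.var 15)) ;;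
  setN 46 (.arr 17 (.lit 0) (.var 44)) ;;
  root 7 11 (.var 46) 30 (.arr 18 (.lit 0) (.var 15))

/-- Number register 8 becomes the value of polynomial `reg 16`. -/
def evaluate : Cmd :=
  setC 8 .zero ;;
  setC 9 .one ;;
  loop 13 31 (
    setC 8 (.add (.var 8) (.mul (.arr 10 (.var 16) (.var 13)) (.var 9))) ;;
    setC 9 (.mul (.var 9) (.var 7)))

def eigenvector : Cmd :=
  loop 13 30 (setCA 13 (.lit 0) (.var 13) .zero) ;;
  loop 16 30 (ite (.eq (.arr 16 (.lit 0) (.var 16)) (.var 44))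
    (evaluate ;;
      setC 8 (.div (.var 8) (.arr 6 (.lit 0) (.var 16))) ;;
      loop 13 30 (setCA 13 (.lit 0) (.var 13)
        (.add (.arr 13 (.lit 0) (.var 13)) (.mul (.var 8) (.arr 5 (.var 16) (.var 13))))))
    skip)

/-- Number register 6 becomes its square root. -/
def squareRoot : Cmd :=
  setCA 12 (.lit 0) (.lit 0) (.sub .zero (.var 6)) ;;
  setCA 12 (.lit 0) (.lit 1) .zero ;;
  setCA 12 (.lit 0) (.lit 2) .one ;;
  root 6 12 (.lit 0) 33 (.lit 1)

def writeState : Cmd :=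
  ite (.le (.var 0) (.var 7))
    (ite (.le (.var 7) (.var 1))
      (loop 14 0 (setA 7 (.var 3) (.var 14) (.arr 9 (.var 12) (.var 14))) ;;
        loop 13 30 (setCA 1 (.var 3) (.var 13) (.div (.arr 13 (.lit 0) (.var 13)) (.var 6))) ;;
        setCA 2 (.lit 0) (.var 3) (.var 7) ;;
        setN 3 (.succ (.var 3)))
      skip) skip

def eigenstates : Cmd :=
  loop 15 30 (eigenvalue ;; eigenvector ;; squareNorm 13 ;; squareRoot ;; writeState)

def solveBlock : Cmd := blockMatrix ;; lanczos ;; polynomials ;; eigenstates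

def blocks : Cmd :=
  loop 12 2 (blockLabels ;; blockEnergies ;; isFirst ;;
    ite (.eq (.var 37) (.lit 0)) skip solveBlock)

/-- The labels are computed between the two passes: after `diagonalize` the generators are
triangular, so that a label is found by back substitution, and afterwards `compress` uses only
CNOTs, which carry the labels along. -/
def reduction : Cmd := diagonalize ;; solve ;; compress

def main : Cmd :=
  copyRows ;; reduction ;; writeCircuit ;; power ;; sizes ;; tables ;; window ;; blocks

/-- With an empty list there is no member from which the energy window could be computed, and the
untouched input memory already is a correct output. -/
def all : Cmd := ite (.eq (.var 2) (.lit 0)) skip main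

theorem all_ok : all.ok = true := by decide +kernel

end Prog

/-! ## Conjugation of Pauli strings by Clifford gates -/

/-- The sign `(-1) ^ b`. -/
def bitSign (b : Bool) : ℂ := if b then -1 else 1

@[simp] theorem bitSign_false : bitSign false = 1 := rfl

@[simp] theorem bitSign_true : bitSign true = -1 := rfl

theorem bitSign_xor (a b : Bool) : bitSign (a ^^ b) = bitSign a * bitSign b := by
  cases a <;> cases b <;> simp

theorem bitSign_injective : Function.Injective bitSign := by
  intro a b h
  have : (1 : ℂ) ≠ -1 := by norm_num
  cases a <;> cases b <;> simp_all [eq_comm]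

theorem bitSign_ne_zero (b : Bool) : bitSign b ≠ 0 := by cases b <;> simp

/-- The parity of the number of `i < m` with `f i`. -/
def parity (f : ℕ → Bool) : ℕ → Bool
  | 0 => false
  | m + 1 => parity f m ^^ f m

theorem bitSign_parity (f : ℕ → Bool) (m : ℕ) :
    bitSign (parity f m) = ∏ q : Fin m, bitSign (f q) := by
  rw [Fin.prod_univ_eq_prod_range (fun q => bitSign (f q))]
  induction m with
  | zero => simp [parity]
  | succ m ih => rw [parity, bitSign_xor, ih, Finset.prod_range_succ]

theorem parity_congr {f g : ℕ → Bool} {m : ℕ} (h : ∀ q < m, f q = g q) :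
    parity f m = parity g m := by
  induction m with
  | zero => rfl
  | succ m ih => rw [parity, parity, ih fun q hq => h q (by omega), h m (by omega)]

theorem parity_xor (f g : ℕ → Bool) (m : ℕ) :
    parity (fun q => f q ^^ g q) m = (parity f m ^^ parity g m) := by
  induction m with
  | zero => rfl
  | succ m ih =>
    rw [parity, parity, parity, ih]
    cases parity f m <;> cases parity g m <;> cases f m <;> cases g m <;> rfl

theorem parity_eq_of_unique {f : ℕ → Bool} {m p : ℕ} (hp : p < m)
    (h : ∀ q < m, q ≠ p → f q = false) : parity f m = f p := by
  induction m with
  | zero => omega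
  | succ m ih =>
    rw [parity]
    rcases eq_or_ne p m with rfl | hpm
    · have : ∀ l ≤ p, parity f l = false := by
        intro l
        induction l with
        | zero => exact fun _ => rfl
        | succ l ihl => intro hl; rw [parity, ihl (by omega), h l (by omega) (by omega)]; rfl
      simp [this p le_rfl]
    · rw [ih (by omega) fun q hq => h q (by omega), h m (by omega) hpm.symm]
      simp

/-- A signed Pauli string given by its sign, `x` bits and `z` bits. -/
@[ext] structure Row where
  s : Bool
  x : ℕ → Bool
  z : ℕ → Bool

/-- The nonzero entry of a one-qubit Pauli matrix in row `a`. -/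
def phaseFactor (x z a : Bool) : ℂ :=
  if z then (if x then -Complex.I else 1) * (if a then -1 else 1) else 1

theorem phaseFactor_ne_zero (x z a : Bool) : phaseFactor x z a ≠ 0 := by
  cases x <;> cases z <;> cases a <;> simp [phaseFactor]

theorem phaseFactor_xor (x z a b : Bool) :
    phaseFactor x z (a ^^ b) = phaseFactor x z a * bitSign (z && b) := by
  cases x <;> cases z <;> cases a <;> cases b <;> simp [phaseFactor]

/-! ### Signed Pauli strings as operators on vectors. -/

namespace Row

variable {n : ℕ}

def phase (R : Row) (a : Label n) : ℂ :=
  bitSign R.s * ∏ q : Fin n, phaseFactor (R.x q) (R.z q) (a q)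

/-- The label to which a Pauli string moves the label `a`. -/
def move (R : Row) (a : Label n) : Label n := fun q => a q ^^ R.x q

/-- The action of a signed Pauli string on vectors. -/
def act (R : Row) (ψ : Label n → ℂ) : Label n → ℂ := fun a => R.phase a * ψ (R.move a)

/-- The unsigned Pauli string. -/
def pauli (n : ℕ) (R : Row) : Pauli n := fun q => (if R.x q then 1 else 0, if R.z q then 1 else 0)

theorem phase_ne_zero (R : Row) (a : Label n) : R.phase a ≠ 0 :=
  mul_ne_zero (bitSign_ne_zero _) (Finset.prod_ne_zero_iff.2 fun _ _ => phaseFactor_ne_zero _ _ _)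

/-- Only the `z` bits of `R` see the displacement by the `x` bits of `S`; the two such products for
a pair of strings differ exactly if the strings anticommute. -/
theorem phase_move (R S : Row) (a : Label n) :
    R.phase (S.move a) = R.phase a * ∏ q : Fin n, bitSign (R.z q && S.x q) := by
  simp only [phase, move, phaseFactor_xor, Finset.prod_mul_distrib, mul_assoc]

/-- Both products are applied to the constant vector 1 and compared at the label 0. The common
nonzero phases cancel, and what remains is the vanishing of the symplectic form. -/
theorem prod_eq_of_act_comm (R S : Row)
    (h : ∀ ψ : Label n → ℂ, R.act (S.act ψ) = S.act (R.act ψ)) :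
    ∏ q : Fin n, bitSign (R.z q && S.x q) = ∏ q : Fin n, bitSign (S.z q && R.x q) := by
  have := congrFun (h fun _ => 1) fun _ => false
  simp only [act, phase_move] at this
  have h₁ := R.phase_ne_zero (fun _ : Fin n => false)
  have h₂ := S.phase_ne_zero (fun _ : Fin n => false)
  have h₃ : R.phase (fun _ : Fin n => false) * S.phase (fun _ : Fin n => false) *
      ∏ q : Fin n, bitSign (R.z q && S.x q) = R.phase (fun _ : Fin n => false) *
      S.phase (fun _ : Fin n => false) * ∏ q : Fin n, bitSign (S.z q && R.x q) := by
    linear_combination -this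
  exact mul_left_cancel₀ (mul_ne_zero h₁ h₂) h₃

theorem act_of_x_eq_false {R : Row} (h : ∀ q < n, R.x q = false) (ψ : Label n → ℂ)
    (a : Label n) :
    R.act ψ a = bitSign (R.s ^^ parity (fun q => R.z q && if h : q < n then a ⟨q, h⟩ else false) n)
      * ψ a := by
  have : R.move a = a := by
    funext q
    simp [move, h q q.2]
  rw [act, this, bitSign_xor, bitSign_parity, phase]
  congr 2
  refine Finset.prod_congr rfl fun q _ => ?_
  rw [h q q.2]
  cases R.z q <;> simp [phaseFactor, bitSign]

end Row

theorem pauliEntry_eq (p : ZMod 2 × ZMod 2) (a b : Bool) : pauliEntry p a b =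
    if b = (a ^^ decide (p.1 ≠ 0)) then phaseFactor (decide (p.1 ≠ 0)) (decide (p.2 ≠ 0)) a
      else 0 := by
  obtain ⟨x, z⟩ := p
  have h : ∀ y : ZMod 2, y = 0 ∨ y = 1 := by decide
  rcases h x with rfl | rfl <;> rcases h z with rfl | rfl <;> cases a <;> cases b <;>
    simp [pauliEntry, phaseFactor]

/-- The matrix of a Pauli string has exactly one nonzero entry in row `a`, namely `R.phase a` in
column `R.move a`. -/
theorem Pauli.matrix_mulVec {n : ℕ} (p : Pauli n) {R : Row} (hs : R.s = false)
    (hx : ∀ q : Fin n, R.x q = decide ((p q).1 ≠ 0))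
    (hz : ∀ q : Fin n, R.z q = decide ((p q).2 ≠ 0)) (ψ : Label n → ℂ) :
    p.matrix.mulVec ψ = R.act ψ := by
  funext a
  have key : ∀ b : Label n, p.matrix a b = if b = R.move a then R.phase a else 0 := by
    intro b
    simp only [Pauli.matrix, Matrix.of_apply, pauliEntry_eq, Row.phase, hs, bitSign_false, one_mul]
    split_ifs with h
    · subst h
      refine Finset.prod_congr rfl fun q _ => ?_
      rw [if_pos (by simp [Row.move, hx]), hx, hz]
    · obtain ⟨q, hq⟩ : ∃ q, b q ≠ R.move a q := by
        by_contra! hc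
        exact h (funext hc)
      refine Finset.prod_eq_zero (Finset.mem_univ q) (if_neg ?_)
      simpa [Row.move, hx] using hq
  simp [Matrix.mulVec, dotProduct, key, Row.act]

namespace Gate

variable {n : ℕ}

/-- `u.conj R` stands for `U† R U`, where `U` is the gate `u`. -/
def conj : Gate n → Row → Row
  | .idle, R => R
  | .hadamard q, R => ⟨R.s ^^ (R.x q && R.z q), Function.update R.x q (R.z q),
      Function.update R.z q (R.x q)⟩
  | .phase q, R => ⟨R.s ^^ (R.x q && !R.z q), R.x, Function.update R.z q (R.z q ^^ R.x q)⟩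
  | .cnot c t _, R => ⟨R.s ^^ ((R.x c && R.z t) && !(R.x t ^^ R.z c)),
      Function.update R.x t (R.x t ^^ R.x c), Function.update R.z c (R.z c ^^ R.z t)⟩

theorem prod_split (f : Fin n → ℂ) (q : Fin n) :
    ∏ i, f i = f q * ∏ i ∈ Finset.univ.erase q, f i :=
  (Finset.mul_prod_erase _ _ (Finset.mem_univ q)).symm

theorem prod_split₂ (f : Fin n → ℂ) {c t : Fin n} (h : c ≠ t) :
    ∏ i, f i = f c * f t * ∏ i ∈ (Finset.univ.erase c).erase t, f i := by
  rw [prod_split f c, ← Finset.mul_prod_erase _ _ (Finset.mem_erase.2 ⟨h.symm, Finset.mem_univ t⟩),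
    mul_assoc]

theorem val_ne {i q : Fin n} (h : i ≠ q) : (i : ℕ) ≠ q := fun e => h (Fin.ext e)

/-- The relation `R U = U (U† R U)`. The factors on the qubits that the gate does not touch are
split off as `W`; the rest is a finite check over the bits on the one or two qubits of the gate. -/
theorem conj_act (u : Gate n) (R : Row) (ψ : Label n → ℂ) :
    R.act (u.act ψ) = u.act ((u.conj R).act ψ) := by
  cases u with
  | idle => rfl
  | hadamard q =>
    funext a
    have hp : ∀ b c : Bool, (conj (.hadamard q) R).phase (Function.update a q b) =
        bitSign (R.s ^^ (R.x q && R.z q)) * (phaseFactor (R.z q) (R.x q) b *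
          ∏ i ∈ Finset.univ.erase q, phaseFactor (R.x i) (R.z i) (a i)) := by
      intro b _
      rw [Row.phase, prod_split _ q]
      congr 2
      · simp [conj]
      · refine Finset.prod_congr rfl fun i hi => ?_
        have := val_ne (Finset.ne_of_mem_erase hi)
        simp [conj, Function.update_of_ne this, Function.update_of_ne (Finset.ne_of_mem_erase hi)]
    have hm : ∀ b : Bool, (conj (.hadamard q) R).move (Function.update a q b) =
        Function.update (R.move a) q (b ^^ R.z q) := by
      intro b
      funext i
      rcases eq_or_ne i q with rfl | hi
      · simp [conj, Row.move]
      · simp [conj, Row.move, Function.update_of_ne (val_ne hi), Function.update_of_ne hi]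
    simp only [act, Row.act, hp _ true, hm]
    rw [Row.phase, prod_split _ q]
    set W := ∏ i ∈ Finset.univ.erase q, phaseFactor (R.x i) (R.z i) (a i)
    have hq : R.move a q = (a q ^^ R.x q) := rfl
    rw [hq]
    cases R.x q <;> cases R.z q <;> cases a q <;> cases R.s <;>
      simp [phaseFactor] <;> ring
  | phase q =>
    funext a
    have hp : (conj (.phase q) R).phase a =
        bitSign (R.s ^^ (R.x q && !R.z q)) * (phaseFactor (R.x q) (R.z q ^^ R.x q) (a q) *
          ∏ i ∈ Finset.univ.erase q, phaseFactor (R.x i) (R.z i) (a i)) := by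
      rw [Row.phase, prod_split _ q]
      congr 2
      · simp [conj]
      · refine Finset.prod_congr rfl fun i hi => ?_
        simp [conj, Function.update_of_ne (val_ne (Finset.ne_of_mem_erase hi))]
    have hm : (conj (.phase q) R).move a = R.move a := rfl
    simp only [act, Row.act, hp, hm]
    rw [Row.phase, prod_split _ q]
    set W := ∏ i ∈ Finset.univ.erase q, phaseFactor (R.x i) (R.z i) (a i)
    have hq : R.move a q = (a q ^^ R.x q) := rfl
    rw [hq]
    cases R.x q <;> cases R.z q <;> cases a q <;> cases R.s <;>
      simp [phaseFactor] <;> first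
        | linear_combination (W * ψ (R.move a)) * Complex.I_mul_I
        | linear_combination -(W * ψ (R.move a)) * Complex.I_mul_I
        | ring
  | cnot c t h =>
    funext a
    have hv := val_ne h
    have hp : (conj (.cnot c t h) R).phase (Function.update a t (a t ^^ a c)) =
        bitSign (R.s ^^ ((R.x c && R.z t) && !(R.x t ^^ R.z c))) *
          (phaseFactor (R.x c) (R.z c ^^ R.z t) (a c) *
          phaseFactor (R.x t ^^ R.x c) (R.z t) (a t ^^ a c) *
          ∏ i ∈ (Finset.univ.erase c).erase t, phaseFactor (R.x i) (R.z i) (a i)) := by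
      rw [Row.phase, prod_split₂ _ h]
      congr 2
      · simp [conj, Function.update_of_ne hv, Function.update_of_ne hv.symm,
          Function.update_of_ne h]
      · refine Finset.prod_congr rfl fun i hi => ?_
        have h₁ := Finset.ne_of_mem_erase hi
        have h₂ := Finset.ne_of_mem_erase (Finset.mem_of_mem_erase hi)
        simp [conj, Function.update_of_ne (val_ne h₁), Function.update_of_ne (val_ne h₂),
          Function.update_of_ne h₁]
    have hm : (conj (.cnot c t h) R).move (Function.update a t (a t ^^ a c)) =
        Function.update (R.move a) t (R.move a t ^^ R.move a c) := by
      funext i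
      rcases eq_or_ne i t with rfl | hi
      · simp only [Row.move, conj, Function.update_self]
        cases a i <;> cases a c <;> cases R.x i <;> cases R.x c <;> rfl
      · simp [conj, Row.move, Function.update_of_ne (val_ne hi), Function.update_of_ne hi]
    simp only [act, Row.act]
    rw [hp, hm]
    rw [Row.phase, prod_split₂ _ h]
    set W := ∏ i ∈ (Finset.univ.erase c).erase t, phaseFactor (R.x i) (R.z i) (a i)
    set Y := ψ (Function.update (R.move a) t (R.move a t ^^ R.move a c))
    have key : bitSign R.s * (phaseFactor (R.x c) (R.z c) (a c) *
        phaseFactor (R.x t) (R.z t) (a t)) =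
        bitSign (R.s ^^ ((R.x c && R.z t) && !(R.x t ^^ R.z c))) *
          (phaseFactor (R.x c) (R.z c ^^ R.z t) (a c) *
          phaseFactor (R.x t ^^ R.x c) (R.z t) (a t ^^ a c)) := by
      cases R.x c <;> cases R.z c <;> cases R.x t <;> cases R.z t <;> cases a c <;> cases a t <;>
        cases R.s <;> simp [phaseFactor]
    linear_combination W * Y * key

/-- The action of conjugation on unsigned Pauli strings. -/
def conjPauli : Gate n → Pauli n → Pauli n
  | .idle, p => p
  | .hadamard q, p => Function.update p q ((p q).2, (p q).1)
  | .phase q, p => Function.update p q ((p q).1, (p q).2 + (p q).1)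
  | .cnot c t _, p => Function.update (Function.update p t ((p t).1 + (p c).1, (p t).2)) c
      ((p c).1, (p c).2 + (p t).2)

theorem conj_pauli (u : Gate n) (R : Row) : (u.conj R).pauli n = u.conjPauli (R.pauli n) := by
  have hx : ∀ a b : Bool, (if (a ^^ b) = true then 1 else 0 : ZMod 2) =
      (if a = true then 1 else 0) + if b = true then 1 else 0 := by decide
  cases u with
  | idle => rfl
  | hadamard q =>
    funext i
    rcases eq_or_ne i q with rfl | hi
    · simp [Row.pauli, conj, conjPauli]
    · simp [Row.pauli, conj, conjPauli, Function.update_of_ne (val_ne hi),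
        Function.update_of_ne hi]
  | phase q =>
    funext i
    rcases eq_or_ne i q with rfl | hi
    · simp only [Row.pauli, conj, conjPauli, Function.update_self, hx]
      rfl
    · simp only [Row.pauli, conj, conjPauli, Function.update_of_ne (val_ne hi),
        Function.update_of_ne hi]
      rfl
  | cnot c t h =>
    have hv := val_ne h
    funext i
    rcases eq_or_ne i c with rfl | hc
    · simp only [Row.pauli, conj, conjPauli, Function.update_of_ne hv, Function.update_self, hx]
    · rcases eq_or_ne i t with rfl | ht
      · simp only [Row.pauli, conj, conjPauli, Function.update_of_ne hv.symm,
          Function.update_of_ne hc, Function.update_self, hx]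
      · simp only [Row.pauli, conj, conjPauli, Function.update_of_ne (val_ne hc),
          Function.update_of_ne (val_ne ht), Function.update_of_ne hc, Function.update_of_ne ht]

theorem conjPauli_add (u : Gate n) (p p' : Pauli n) :
    u.conjPauli (p + p') = u.conjPauli p + u.conjPauli p' := by
  cases u with
  | idle => rfl
  | hadamard q =>
    funext i
    rcases eq_or_ne i q with rfl | hi
    · simp [conjPauli]
    · simp [conjPauli, Function.update_of_ne hi]
  | phase q =>
    funext i
    rcases eq_or_ne i q with rfl | hi
    · simp [conjPauli]; ring
    · simp [conjPauli, Function.update_of_ne hi]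
  | cnot c t h =>
    funext i
    rcases eq_or_ne i c with rfl | hc
    · simp [conjPauli]; ring
    · rcases eq_or_ne i t with rfl | ht
      · simp [conjPauli, Function.update_of_ne hc]; ring
      · simp [conjPauli, Function.update_of_ne hc, Function.update_of_ne ht]

/-- Modulo phases every gate acts as an involution, even the phase gate, whose square is a Pauli
operator and changes only signs. This gives the injectivity of `conjLinear`. -/
theorem conjPauli_conjPauli (u : Gate n) (p : Pauli n) : u.conjPauli (u.conjPauli p) = p := by
  have h2 : ∀ a b : ZMod 2, a + b + b = a := by decide
  cases u with
  | idle => rfl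
  | hadamard q =>
    funext i
    rcases eq_or_ne i q with rfl | hi
    · simp [conjPauli]
    · simp [conjPauli, Function.update_of_ne hi]
  | phase q =>
    funext i
    rcases eq_or_ne i q with rfl | hi
    · simp [conjPauli, h2]
    · simp [conjPauli, Function.update_of_ne hi]
  | cnot c t h =>
    funext i
    rcases eq_or_ne i c with rfl | hc
    · simp [conjPauli, Function.update_of_ne h.symm, h2]
    · rcases eq_or_ne i t with rfl | ht
      · simp [conjPauli, Function.update_of_ne hc, h2]
      · simp [conjPauli, Function.update_of_ne hc, Function.update_of_ne ht]

/-- Conjugation as a linear map of unsigned Pauli strings. -/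
def conjLinear (u : Gate n) : Pauli n →ₗ[ZMod 2] Pauli n :=
  (AddMonoidHom.mk' u.conjPauli u.conjPauli_add).toZModLinearMap 2

theorem conjLinear_injective (u : Gate n) : Function.Injective u.conjLinear :=
  Function.LeftInverse.injective (g := u.conjPauli) u.conjPauli_conjPauli

theorem act_add (u : Gate n) (ψ φ : Label n → ℂ) : u.act (ψ + φ) = u.act ψ + u.act φ := by
  cases u with
  | idle => rfl
  | cnot c t h => rfl
  | _ => funext b; simp only [act, Pi.add_apply]; split_ifs <;> ring

theorem act_smul (u : Gate n) (c : ℂ) (ψ : Label n → ℂ) : u.act (c • ψ) = c • u.act ψ := by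
  cases u with
  | idle => rfl
  | cnot c t h => rfl
  | _ => funext b; simp only [act, Pi.smul_apply, smul_eq_mul]; split_ifs <;> ring

/-- A phase gate multiplies by units and a CNOT permutes the labels. For a Hadamard gate the labels
are paired by flipping bit `q`, and the parallelogram law holds on each pair; summing over all
labels counts each pair twice on both sides. -/
theorem sum_norm_act (u : Gate n) (ψ : Label n → ℂ) : ∑ b, ‖u.act ψ b‖ ^ 2 = ∑ b, ‖ψ b‖ ^ 2 := by
  cases u with
  | idle => rfl
  | phase q =>
    refine Finset.sum_congr rfl fun b _ => ?_
    simp only [act]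
    split_ifs <;> simp
  | cnot c t h =>
    have hinv : Function.Involutive fun b : Label n => Function.update b t (b t ^^ b c) := by
      intro b
      funext i
      rcases eq_or_ne i t with rfl | hi
      · simp [Function.update_of_ne h]
      · simp [Function.update_of_ne hi]
    exact Equiv.sum_comp hinv.toPerm fun b => ‖ψ b‖ ^ 2
  | hadamard q =>
    have hinv : Function.Involutive fun b : Label n => Function.update b q (!b q) := by
      intro b
      funext i
      rcases eq_or_ne i q with rfl | hi
      · simp
      · simp [Function.update_of_ne hi]
    have hsum : ∀ f : Label n → ℝ, ∑ b, f (Function.update b q (!b q)) = ∑ b, f b := fun f =>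
      Equiv.sum_comp hinv.toPerm f
    have key : ∀ x y : ℂ, ‖(x + y) / (Real.sqrt 2 : ℂ)‖ ^ 2 + ‖(x + -1 * y) / (Real.sqrt 2 : ℂ)‖ ^ 2
        = ‖x‖ ^ 2 + ‖y‖ ^ 2 := by
      intro x y
      have hs : ‖(Real.sqrt 2 : ℂ)‖ ^ 2 = 2 := by
        rw [Complex.norm_real, Real.norm_eq_abs, sq_abs, Real.sq_sqrt (by norm_num)]
      have hp := parallelogram_law_with_norm ℝ x y
      rw [norm_div, norm_div, div_pow, div_pow, hs]
      have : x + -1 * y = x - y := by ring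
      rw [this]
      linarith [hp, sq ‖x + y‖, sq ‖x - y‖, sq ‖x‖, sq ‖y‖]
    have h₁ : ∑ b, (‖(act (.hadamard q) ψ) b‖ ^ 2 +
        ‖(act (.hadamard q) ψ) (Function.update b q (!b q))‖ ^ 2) =
        ∑ b, (‖ψ b‖ ^ 2 + ‖ψ (Function.update b q (!b q))‖ ^ 2) := by
      refine Finset.sum_congr rfl fun b _ => ?_
      simp only [act, Function.update_idem, Function.update_self]
      have hb : b = Function.update b q (b q) := by simp
      cases hq : b q
      · rw [hq] at hb
        have := key (ψ (Function.update b q false)) (ψ (Function.update b q true))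
        rw [← hb] at this ⊢
        simpa using this
      · rw [hq] at hb
        have := key (ψ (Function.update b q false)) (ψ (Function.update b q true))
        rw [← hb] at this ⊢
        simp only [Bool.not_true, if_true, Bool.false_eq_true, if_false, one_mul]
        linarith
    rw [Finset.sum_add_distrib, Finset.sum_add_distrib, hsum fun b => ‖(act (.hadamard q) ψ) b‖ ^ 2,
      hsum fun b => ‖ψ b‖ ^ 2] at h₁
    linarith

/-- A gate as an isometry. -/
def isometry (u : Gate n) : Qubits n →ₗᵢ[ℂ] Qubits n where
  toFun ψ := WithLp.toLp 2 (u.act ψ.ofLp)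
  map_add' ψ φ := by simp [act_add]
  map_smul' c ψ := by simp [act_smul]
  norm_map' ψ := by
    simp only [LinearMap.coe_mk, AddHom.coe_mk, EuclideanSpace.norm_eq]
    rw [sum_norm_act]

end Gate

/-- The action of a list of gates, the last gate being applied first. -/
def circuitAct {n : ℕ} (l : List (Gate n)) (ψ : Label n → ℂ) : Label n → ℂ :=
  l.foldr Gate.act ψ

/-- A list of gates as an isometry, the last gate being applied first. -/
def circuitIsometry {n : ℕ} (l : List (Gate n)) : Qubits n →ₗᵢ[ℂ] Qubits n :=
  l.foldr (fun u C => u.isometry.comp C) LinearIsometry.id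

theorem circuitIsometry_apply {n : ℕ} (l : List (Gate n)) (ψ : Qubits n) :
    circuitIsometry l ψ = WithLp.toLp 2 (circuitAct l ψ.ofLp) := by
  induction l with
  | nil => rfl
  | cons u l ih =>
    change u.isometry (circuitIsometry l ψ) = _
    rw [ih]
    rfl

theorem circuitAct_append {n : ℕ} (l : List (Gate n)) (u : Gate n) (ψ : Label n → ℂ) :
    circuitAct (l ++ [u]) ψ = circuitAct l (u.act ψ) := by
  simp [circuitAct]

theorem circuitIsometry_surjective {n : ℕ} (l : List (Gate n)) :
    Function.Surjective (circuitIsometry l) :=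
  LinearMap.surjective_of_injective (f := (circuitIsometry l).toLinearMap)
    (circuitIsometry l).injective

/-! ## Evaluation rules -/

namespace Memory

variable (σ : Memory)

@[simp] theorem setReg_reg (x v y : ℕ) : (σ.setReg x v).reg y = if y = x then v else σ.reg y := by
  simp [setReg, Function.update_apply]

@[simp] theorem setReg_arr (x v : ℕ) : (σ.setReg x v).arr = σ.arr := rfl

@[simp] theorem setReg_num (x v : ℕ) : (σ.setReg x v).num = σ.num := rfl

@[simp] theorem setReg_numArr (x v : ℕ) : (σ.setReg x v).numArr = σ.numArr := rfl

@[simp] theorem setNum_reg (x : ℕ) (v : ℂ) : (σ.setNum x v).reg = σ.reg := rfl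

@[simp] theorem setNum_arr (x : ℕ) (v : ℂ) : (σ.setNum x v).arr = σ.arr := rfl

@[simp] theorem setNum_num (x : ℕ) (v : ℂ) (y : ℕ) :
    (σ.setNum x v).num y = if y = x then v else σ.num y := by
  simp [setNum, Function.update_apply]

@[simp] theorem setNum_numArr (x : ℕ) (v : ℂ) : (σ.setNum x v).numArr = σ.numArr := rfl

@[simp] theorem setArr_reg (a i j v : ℕ) : (σ.setArr a i j v).reg = σ.reg := rfl

@[simp] theorem setArr_arr (a i j v a' i' j' : ℕ) : (σ.setArr a i j v).arr a' i' j' =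
    if a' = a ∧ i' = i ∧ j' = j then v else σ.arr a' i' j' := rfl

@[simp] theorem setArr_num (a i j v : ℕ) : (σ.setArr a i j v).num = σ.num := rfl

@[simp] theorem setArr_numArr (a i j v : ℕ) : (σ.setArr a i j v).numArr = σ.numArr := rfl

@[simp] theorem setNumArr_reg (a i j : ℕ) (v : ℂ) : (σ.setNumArr a i j v).reg = σ.reg := rfl

@[simp] theorem setNumArr_arr (a i j : ℕ) (v : ℂ) : (σ.setNumArr a i j v).arr = σ.arr := rfl

@[simp] theorem setNumArr_num (a i j : ℕ) (v : ℂ) : (σ.setNumArr a i j v).num = σ.num := rfl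

@[simp] theorem setNumArr_numArr (a i j : ℕ) (v : ℂ) (a' i' j' : ℕ) :
    (σ.setNumArr a i j v).numArr a' i' j' =
    if a' = a ∧ i' = i ∧ j' = j then v else σ.numArr a' i' j' := rfl

end Memory

namespace Cmd

variable (O : Oracle) (σ : Memory)

@[simp] theorem exec_skip : skip.exec O σ = σ := rfl

@[simp] theorem exec_setN (x : ℕ) (e : NExp) : (setN x e).exec O σ = σ.setReg x (e.eval σ) := rfl

@[simp] theorem exec_setA (a : ℕ) (i j e : NExp) :
    (setA a i j e).exec O σ = σ.setArr a (i.eval σ) (j.eval σ) (e.eval σ) := rfl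

@[simp] theorem exec_setC (x : ℕ) (e : CExp) : (setC x e).exec O σ = σ.setNum x (e.eval σ) := rfl

@[simp] theorem exec_setCA (a : ℕ) (i j : NExp) (e : CExp) :
    (setCA a i j e).exec O σ = σ.setNumArr a (i.eval σ) (j.eval σ) (e.eval σ) := rfl

@[simp] theorem exec_seq (p q : Cmd) : (p ;; q).exec O σ = q.exec O (p.exec O σ) := rfl

theorem exec_ite_pos {O : Oracle} {σ : Memory} {b : Test} (h : b.Holds σ) (p q : Cmd) :
    (ite b p q).exec O σ = p.exec O σ := if_pos h

theorem exec_ite_neg {O : Oracle} {σ : Memory} {b : Test} (h : ¬ b.Holds σ) (p q : Cmd) :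
    (ite b p q).exec O σ = q.exec O σ := if_neg h

end Cmd

@[simp] theorem NExp.eval_lit (σ : Memory) (m : ℕ) : (NExp.lit m).eval σ = m := rfl

@[simp] theorem NExp.eval_var (σ : Memory) (x : ℕ) : (NExp.var x).eval σ = σ.reg x := rfl

@[simp] theorem NExp.eval_arr (σ : Memory) (a : ℕ) (i j : NExp) :
    (NExp.arr a i j).eval σ = σ.arr a (i.eval σ) (j.eval σ) := rfl

@[simp] theorem NExp.eval_succ (σ : Memory) (e : NExp) : e.succ.eval σ = e.eval σ + 1 := rfl

@[simp] theorem NExp.eval_pred (σ : Memory) (e : NExp) : e.pred.eval σ = e.eval σ - 1 := rfl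

@[simp] theorem Test.holds_eq (σ : Memory) (e f : NExp) :
    (Test.eq e f).Holds σ ↔ e.eval σ = f.eval σ := Iff.rfl

@[simp] theorem Test.holds_lt (σ : Memory) (e f : NExp) :
    (Test.lt e f).Holds σ ↔ e.eval σ < f.eval σ := Iff.rfl

@[simp] theorem Test.holds_le (σ : Memory) (c d : CExp) :
    (Test.le c d).Holds σ ↔ (c.eval σ).re ≤ (d.eval σ).re := Iff.rfl

theorem toBit_eq_false {m : ℕ} : toBit m = false ↔ m = 0 := by simp [toBit]

theorem toBit_eq_true {m : ℕ} : toBit m = true ↔ m ≠ 0 := by simp [toBit]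

@[simp] theorem toBit_zero : toBit 0 = false := rfl

@[simp] theorem toBit_one : toBit 1 = true := rfl

theorem NExp.toBit_xor (σ : Memory) (e f : NExp) :
    toBit ((e.xor f).eval σ) = (toBit (e.eval σ) ^^ toBit (f.eval σ)) := by
  by_cases h₁ : e.eval σ = 0 <;> by_cases h₂ : f.eval σ = 0 <;>
    simp [NExp.xor, NExp.eval, toBit, h₁, h₂]

theorem NExp.toBit_and (σ : Memory) (e f : NExp) :
    toBit ((e.and f).eval σ) = (toBit (e.eval σ) && toBit (f.eval σ)) := by
  by_cases h₁ : e.eval σ = 0 <;> simp [NExp.and, NExp.eval, toBit, h₁]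

theorem NExp.toBit_not (σ : Memory) (e : NExp) :
    toBit (e.not.eval σ) = !toBit (e.eval σ) := by
  by_cases h₁ : e.eval σ = 0 <;> simp [NExp.not, NExp.eval, toBit, h₁]

/-! ## Gates -/

/-- The bit in a cell. -/
def Memory.bit (σ : Memory) (a i j : ℕ) : Bool := toBit (σ.arr a i j)

/-- Row `i` of the tableau. -/
def Memory.row (σ : Memory) (i : ℕ) : Row := ⟨σ.bit 2 0 i, σ.bit 0 i, σ.bit 1 i⟩

/-- The gates found so far. -/
def Memory.gates (n : ℕ) (σ : Memory) : List (Gate n) :=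
  (List.range (σ.reg 20)).map fun t => decodeGate n (σ.arr 8 t 0) (σ.arr 8 t 1) (σ.arr 8 t 2)

/-- The effect of a CNOT gate on labels. -/
def Gate.moveLabel {n : ℕ} : Gate n → (ℕ → Bool) → ℕ → Bool
  | .cnot c t _, b => Function.update b t (b t ^^ b c)
  | _, b => b

/-- A gate is appended and the tableau and the labels are changed accordingly. -/
structure GateStep {n : ℕ} (u : Gate n) (σ τ : Memory) : Prop where
  gates : τ.gates n = σ.gates n ++ [u]
  row : ∀ i < σ.reg 10, τ.row i = u.conj (σ.row i)
  label : ∀ l < σ.reg 2, τ.bit 9 l = u.moveLabel (σ.bit 9 l)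

namespace Prog

open Cmd

variable (O : Oracle) (σ : Memory) {n : ℕ}

theorem record_gates (code : ℕ) : ((record code).exec O σ).gates n =
    σ.gates n ++ [decodeGate n code (σ.reg 21) (σ.reg 22)] := by
  simp only [Memory.gates, record, exec_seq, exec_setA, exec_setN, NExp.eval_var, NExp.eval_lit,
    NExp.eval_succ, Memory.setArr_reg, Memory.setReg_reg, if_true, Memory.setReg_arr,
    List.range_succ, List.map_append, List.map_cons, List.map_nil]
  congr 1
  · refine List.map_congr_left fun t ht => ?_
    have : t ≠ σ.reg 20 := (List.mem_range.1 ht).ne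
    simp [this]
  · simp

theorem record_row (code i : ℕ) : ((record code).exec O σ).row i = σ.row i := by
  simp [record, Memory.row, Memory.bit, Row.ext_iff, funext_iff]

theorem row_loop {b : Cmd} {f : Row → Row}
    (hb : b.wr 21 = false ∧ b.wr 22 = false ∧ b.wr 23 = false)
    (h : ∀ τ, τ.reg 21 = σ.reg 21 → τ.reg 22 = σ.reg 22 → ∀ i,
      (b.exec O τ).row i = if i = τ.reg 23 then f (τ.row i) else τ.row i) :
    ∀ i, ((loop 23 10 b).exec O σ).row i = if i < σ.reg 10 then f (σ.row i) else σ.row i := by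
  refine loop_inv O (fun j τ => ∀ i, τ.row i = if i < j then f (σ.row i) else σ.row i) σ ?_ ?_
  · intro i
    rw [if_neg (by omega)]
    rfl
  · intro j _ τ hF hj ih i
    have h₁ : τ.reg 21 = σ.reg 21 := hF.reg 21 (by simpa [wr] using hb.1)
    have h₂ : τ.reg 22 = σ.reg 22 := hF.reg 22 (by simpa [wr] using hb.2.1)
    have := h τ h₁ h₂ i
    rw [hj] at this
    change (b.exec O τ).row i = _
    rw [this, ih]
    rcases lt_trichotomy i j with h | h | h
    · rw [if_neg h.ne, if_pos h, if_pos (by omega)]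
    · rw [if_pos h, if_neg (by omega), if_pos (by omega)]
    · rw [if_neg (by omega), if_neg (by omega), if_neg (by omega)]

theorem rowH_row (h : σ.reg 21 < n) (i : ℕ) : (rowH.exec O σ).row i =
    if i = σ.reg 23 then (Gate.hadamard ⟨σ.reg 21, h⟩ : Gate n).conj (σ.row i) else σ.row i := by
  split_ifs with hi
  · subst hi
    ext q
    · simp [rowH, Memory.row, Memory.bit, Gate.conj, NExp.toBit_xor, NExp.toBit_and, xBit, zBit,
        sBit]
    · by_cases hq : q = σ.reg 21 <;>
        simp [rowH, Memory.row, Memory.bit, Gate.conj, xBit, zBit, hq]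
    · by_cases hq : q = σ.reg 21 <;>
        simp [rowH, Memory.row, Memory.bit, Gate.conj, xBit, zBit, hq]
  · ext q <;> simp [rowH, Memory.row, Memory.bit, hi]

theorem rowS_row (h : σ.reg 21 < n) (i : ℕ) : (rowS.exec O σ).row i =
    if i = σ.reg 23 then (Gate.phase ⟨σ.reg 21, h⟩ : Gate n).conj (σ.row i) else σ.row i := by
  split_ifs with hi
  · subst hi
    ext q
    · simp [rowS, Memory.row, Memory.bit, Gate.conj, NExp.toBit_xor, NExp.toBit_and, NExp.toBit_not,
        xBit, zBit, sBit]
    · simp [rowS, Memory.row, Memory.bit, Gate.conj]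
    · by_cases hq : q = σ.reg 21 <;>
        simp [rowS, Memory.row, Memory.bit, Gate.conj, xBit, zBit, NExp.toBit_xor, hq]
  · ext q <;> simp [rowS, Memory.row, Memory.bit, hi]

theorem rowCX_row (hc : σ.reg 21 < n) (ht : σ.reg 22 < n)
    (hne : (⟨σ.reg 21, hc⟩ : Fin n) ≠ ⟨σ.reg 22, ht⟩) (i : ℕ) : (rowCX.exec O σ).row i =
    if i = σ.reg 23 then (Gate.cnot ⟨σ.reg 21, hc⟩ ⟨σ.reg 22, ht⟩ hne).conj (σ.row i)
      else σ.row i := by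
  have hv : σ.reg 21 ≠ σ.reg 22 := fun e => hne (Fin.ext e)
  split_ifs with hi
  · subst hi
    ext q
    · simp [rowCX, Memory.row, Memory.bit, Gate.conj, NExp.toBit_xor, NExp.toBit_and,
        NExp.toBit_not, xBit, zBit, sBit]
    · by_cases hq : q = σ.reg 22 <;>
        simp [rowCX, Memory.row, Memory.bit, Gate.conj, xBit, NExp.toBit_xor, hq]
    · by_cases hq : q = σ.reg 21 <;>
        simp [rowCX, Memory.row, Memory.bit, Gate.conj, zBit, NExp.toBit_xor, hq]
  · ext q <;> simp [rowCX, Memory.row, Memory.bit, hi]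

theorem gates_congr {σ τ : Memory} (h₁ : τ.reg 20 = σ.reg 20) (h₂ : τ.arr 8 = σ.arr 8) :
    τ.gates n = σ.gates n := by
  simp only [Memory.gates, h₁, h₂]

theorem gateH_step (h : σ.reg 21 < n) :
    GateStep (Gate.hadamard ⟨σ.reg 21, h⟩ : Gate n) σ (gateH.exec O σ) where
  gates := by
    rw [gateH, exec_seq, gates_congr ((exec_frame O _ _).reg 20 rfl) ((exec_frame O _ _).arr 8 rfl),
      record_gates]
    simp [decodeGate, h]
  row i hi := by
    have hF := exec_frame O (record 0) σ
    rw [gateH, exec_seq, row_loop O _ ⟨rfl, rfl, rfl⟩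
      (f := (Gate.hadamard ⟨σ.reg 21, h⟩ : Gate n).conj), record_row, if_pos]
    · rwa [hF.reg 10 rfl]
    · intro τ h₁ _ j
      rw [hF.reg 21 rfl] at h₁
      rw [rowH_row O τ (n := n) (by rwa [h₁])]
      simp only [h₁]
  label l _ := by
    have := (exec_frame O gateH σ).arr 9 rfl
    funext q
    simp [Memory.bit, this, Gate.moveLabel]

theorem gateS_step (h : σ.reg 21 < n) :
    GateStep (Gate.phase ⟨σ.reg 21, h⟩ : Gate n) σ (gateS.exec O σ) where
  gates := by
    rw [gateS, exec_seq, gates_congr ((exec_frame O _ _).reg 20 rfl) ((exec_frame O _ _).arr 8 rfl),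
      record_gates]
    simp [decodeGate, h]
  row i hi := by
    have hF := exec_frame O (record 1) σ
    rw [gateS, exec_seq, row_loop O _ ⟨rfl, rfl, rfl⟩
      (f := (Gate.phase ⟨σ.reg 21, h⟩ : Gate n).conj), record_row, if_pos]
    · rwa [hF.reg 10 rfl]
    · intro τ h₁ _ j
      rw [hF.reg 21 rfl] at h₁
      rw [rowS_row O τ (n := n) (by rwa [h₁])]
      simp only [h₁]
  label l _ := by
    have := (exec_frame O gateS σ).arr 9 rfl
    funext q
    simp [Memory.bit, this, Gate.moveLabel]

theorem label_loop : ∀ l q, ((loop 24 2 (setA 9 (.var 24) (.var 22)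
    (.xor (.arr 9 (.var 24) (.var 22)) (.arr 9 (.var 24) (.var 21))))).exec O σ).bit 9 l q =
    if l < σ.reg 2 ∧ q = σ.reg 22 then (σ.bit 9 l (σ.reg 22) ^^ σ.bit 9 l (σ.reg 21))
      else σ.bit 9 l q := by
  refine loop_inv O (fun j τ => ∀ l q, τ.bit 9 l q = if l < j ∧ q = σ.reg 22 then
    (σ.bit 9 l (σ.reg 22) ^^ σ.bit 9 l (σ.reg 21)) else σ.bit 9 l q) σ ?_ ?_
  · intro l q
    simp [Memory.bit]
  · intro j _ τ hF hj ih l q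
    have h₁ := hF.reg 21 rfl
    have h₂ := hF.reg 22 rfl
    have e₁ := ih j (σ.reg 22)
    have e₂ := ih j (σ.reg 21)
    simp only [lt_irrefl, false_and, if_false, Memory.bit] at e₁ e₂
    by_cases hl : l = j ∧ q = σ.reg 22
    · obtain ⟨rfl, rfl⟩ := hl
      simp [Memory.bit, hj, h₂, h₁, NExp.toBit_xor, e₁, e₂]
    · have := ih l q
      simp only [Memory.bit] at this ⊢
      simp only [exec_setA, Memory.setReg_arr, Memory.setArr_arr, NExp.eval_var, hj, h₂, true_and,
        hl, if_false, this]
      congr 1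
      simp only [eq_iff_iff]
      constructor
      · exact fun h => ⟨by omega, h.2⟩
      · exact fun h => ⟨by have := fun e => hl ⟨e, h.2⟩; omega, h.2⟩

theorem gateCX_step (hc : σ.reg 21 < n) (ht : σ.reg 22 < n)
    (hne : (⟨σ.reg 21, hc⟩ : Fin n) ≠ ⟨σ.reg 22, ht⟩) :
    GateStep (Gate.cnot ⟨σ.reg 21, hc⟩ ⟨σ.reg 22, ht⟩ hne) σ (gateCX.exec O σ) where
  gates := by
    rw [gateCX, exec_seq, exec_seq,
      gates_congr ((exec_frame O _ _).reg 20 rfl) ((exec_frame O _ _).arr 8 rfl),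
      gates_congr ((exec_frame O _ _).reg 20 rfl) ((exec_frame O _ _).arr 8 rfl), record_gates]
    simp [decodeGate, hc, ht, Fin.ext_iff] at hne ⊢
    simp [hne]
  row i hi := by
    have hF := exec_frame O (record 2) σ
    rw [gateCX, exec_seq, exec_seq]
    set σ' := (loop 23 10 rowCX).exec O ((record 2).exec O σ) with hσ'
    have hL : ∀ c : Cmd, c.wrArr 0 = false → c.wrArr 1 = false → c.wrArr 2 = false →
        (c.exec O σ').row i = σ'.row i := by
      intro c h₀ h₁ h₂
      have := exec_frame O c σ'
      ext q <;> simp [Memory.row, Memory.bit, this.arr _ h₀, this.arr _ h₁, this.arr _ h₂]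
    rw [hL _ rfl rfl rfl, hσ', row_loop O _ ⟨rfl, rfl, rfl⟩
      (f := (Gate.cnot ⟨σ.reg 21, hc⟩ ⟨σ.reg 22, ht⟩ hne).conj), record_row, if_pos]
    · rwa [hF.reg 10 rfl]
    · intro τ h₁ h₂ j
      rw [hF.reg 21 rfl] at h₁
      rw [hF.reg 22 rfl] at h₂
      rw [rowCX_row O τ (n := n) (by rwa [h₁]) (by rwa [h₂]) (by simpa [h₁, h₂] using hne)]
      simp only [h₁, h₂]
  label l hl := by
    rw [gateCX, exec_seq, exec_seq]
    set σ' := (loop 23 10 rowCX).exec O ((record 2).exec O σ) with hσ'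
    have hF := exec_frame O (record 2 ;; loop 23 10 rowCX) σ
    rw [exec_seq, ← hσ'] at hF
    have hb : ∀ q, σ'.bit 9 l q = σ.bit 9 l q := fun q => by simp [Memory.bit, hF.arr 9 rfl]
    funext q
    rw [label_loop, hF.reg 2 rfl, hF.reg 22 rfl, hF.reg 21 rfl, hb, hb, hb]
    simp [hl, Gate.moveLabel, Function.update_apply]

end Prog

/-! ## Reduction of the tableau -/

/-- The gates found so far, the rows and the labels of the list members. -/
structure Tableau (n : ℕ) where
  gates : List (Gate n)
  row : ℕ → Row
  label : ℕ → ℕ → Bool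

def Memory.tableau (n : ℕ) (σ : Memory) : Tableau n := ⟨σ.gates n, σ.row, σ.bit 9⟩

namespace Gate

variable {n : ℕ}

/-- The gate acts on the qubits up to `p`. -/
def Within (p : ℕ) : Gate n → Prop
  | .idle => True
  | .hadamard q => (q : ℕ) ≤ p
  | .phase q => (q : ℕ) ≤ p
  | .cnot c t _ => (c : ℕ) ≤ p ∧ (t : ℕ) ≤ p

def IsCnot : Gate n → Prop
  | .cnot _ _ _ => True
  | _ => False

theorem conj_x_of_lt {u : Gate n} {p q : ℕ} (hu : u.Within p) (hq : p < q) (R : Row) :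
    (u.conj R).x q = R.x q := by
  cases u with
  | idle => rfl
  | hadamard a => exact Function.update_of_ne (by simp only [Within] at hu; omega) _ _
  | phase a => rfl
  | cnot c t h => exact Function.update_of_ne (by simp only [Within] at hu; omega) _ _

/-- A CNOT can only copy an `x` bit of its control, so `x` bits outside the range of the gate are
irrelevant if there are none inside. The next lemma is the same for `z` bits and targets. -/
theorem conj_x_of_isCnot {u : Gate n} {p : ℕ} (hu : u.Within p) (hc : u.IsCnot) {R : Row}
    (hR : ∀ q ≤ p, R.x q = false) : (u.conj R).x = R.x := by
  cases u with
  | cnot c t h => simp [conj, hR c hu.1]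
  | _ => cases hc

theorem conj_z_of_isCnot {u : Gate n} {p : ℕ} (hu : u.Within p) (hc : u.IsCnot) {R : Row}
    (hR : ∀ q ≤ p, R.z q = false) : (u.conj R).z = R.z := by
  cases u with
  | cnot c t h => simp [conj, hR t hu.2]
  | _ => cases hc

theorem conj_eq_self {u : Gate n} {p : ℕ} (hu : u.Within p) {R : Row}
    (hx : ∀ q ≤ p, R.x q = false) (hz : ∀ q ≤ p, R.z q = false) : u.conj R = R := by
  cases u with
  | idle => rfl
  | hadamard a =>
    have h₁ := hx a hu
    have h₂ := hz a hu
    ext q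
    · simp [conj, h₁]
    · rcases eq_or_ne q a with rfl | h <;> simp [conj, *]
    · rcases eq_or_ne q a with rfl | h <;> simp [conj, *]
  | phase a =>
    have h₁ := hx a hu
    ext q <;> simp [conj, h₁]
  | cnot c t h =>
    have h₁ := hx c hu.1
    have h₂ := hz t hu.2
    ext q <;> simp [conj, h₁, h₂]

end Gate

/-- The eigenvalue exponent of a diagonal signed Pauli string at a label. -/
def Row.syndrome (n : ℕ) (R : Row) (b : ℕ → Bool) : Bool := R.s ^^ parity (fun q => R.z q && b q) n

theorem parity_update {n p : ℕ} (hp : p < n) (z b : ℕ → Bool) (v : Bool) :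
    parity (fun q => z q && Function.update b p (b p ^^ v) q) n =
      (parity (fun q => z q && b q) n ^^ (z p && v)) := by
  have : parity (fun q => decide (q = p) && (z p && v)) n = (z p && v) := by
    rw [parity_eq_of_unique hp fun q _ hq => by simp [hq]]
    simp
  rw [← this, ← parity_xor]
  refine parity_congr fun q _ => ?_
  rcases eq_or_ne q p with rfl | h
  · cases z q <;> simp
  · simp [h]

theorem parity_update' {n p : ℕ} (hp : p < n) (z b : ℕ → Bool) (v : Bool) :
    parity (fun q => Function.update z p (z p ^^ v) q && b q) n =
      (parity (fun q => z q && b q) n ^^ (v && b p)) := by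
  have := parity_update hp b z v
  simp only [Bool.and_comm (b _)] at this
  exact this

/-- Without `x` bits the sign is unchanged. The pairing of `z` bits with label bits changes twice by
`z_t b_c`, once through the `z` bit of the control and once through the label bit of the target, and
these changes cancel. -/
theorem Gate.syndrome_conj {n : ℕ} {u : Gate n} (hc : u.IsCnot) {R : Row}
    (hR : ∀ q < n, R.x q = false) (b : ℕ → Bool) :
    (u.conj R).syndrome n (u.moveLabel b) = R.syndrome n b := by
  cases u with
  | cnot c t h =>
    have hv : (c : ℕ) ≠ t := fun e => h (Fin.ext e)
    simp only [Row.syndrome, conj, moveLabel, hR c c.2, Bool.false_and, Bool.xor_false]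
    rw [parity_update' c.2, parity_update t.2, Function.update_of_ne hv]
    cases R.s <;> cases parity (fun q => R.z q && b q) n <;> cases R.z t <;> cases b c <;> rfl
  | _ => cases hc

theorem Gate.moveLabel_moveLabel {n : ℕ} (u : Gate n) (b : ℕ → Bool) :
    u.moveLabel (u.moveLabel b) = b := by
  cases u with
  | cnot c t h =>
    have hv : (c : ℕ) ≠ t := fun e => h (Fin.ext e)
    funext q
    rcases eq_or_ne q t with rfl | hq
    · simp [moveLabel, Function.update_of_ne hv]
    · simp [moveLabel, hq]
  | _ => rfl

namespace Tableau

variable {n m Λ : ℕ}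

/-- A gate with property `P` is appended. -/
def Step (m Λ : ℕ) (P : Gate n → Prop) (T T' : Tableau n) : Prop :=
  ∃ u, P u ∧ T'.gates = T.gates ++ [u] ∧ (∀ i < m, T'.row i = u.conj (T.row i)) ∧
    ∀ l < Λ, T'.label l = u.moveLabel (T.label l)

/-- Some gates with property `P` are appended. -/
def Steps (m Λ : ℕ) (P : Gate n → Prop) : Tableau n → Tableau n → Prop :=
  Relation.ReflTransGen (Step m Λ P)

theorem Steps.mono {P Q : Gate n → Prop} (h : ∀ u, P u → Q u) {T T' : Tableau n}
    (hT : Steps m Λ P T T') : Steps m Λ Q T T' := by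
  induction hT with
  | refl => exact .refl
  | tail _ h₂ ih =>
    obtain ⟨u, hu, h'⟩ := h₂
    exact ih.tail ⟨u, h u hu, h'⟩

theorem Steps.induct {P : Gate n → Prop} (I : Tableau n → Prop)
    (h : ∀ T T', Step m Λ P T T' → I T → I T') {T T' : Tableau n} (hT : Steps m Λ P T T')
    (h₀ : I T) : I T' := by
  induction hT with
  | refl => exact h₀
  | tail _ h₂ ih => exact h _ _ h₂ ih

/-- The rows are the conjugates of the rows `R₀` by the circuit. -/
structure Conjugated (m : ℕ) (R₀ : ℕ → Row) (T : Tableau n) : Prop where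
  act : ∀ i < m, ∀ ψ : Label n → ℂ,
    (R₀ i).act (circuitAct T.gates ψ) = circuitAct T.gates ((T.row i).act ψ)
  linear : ∃ Φ : Pauli n →ₗ[ZMod 2] Pauli n, Function.Injective Φ ∧
    ∀ i < m, (T.row i).pauli n = Φ ((R₀ i).pauli n)

theorem Conjugated.step {R₀ : ℕ → Row} {P : Gate n → Prop} {T T' : Tableau n}
    (hT : Conjugated m R₀ T) (h : Step m Λ P T T') : Conjugated m R₀ T' := by
  obtain ⟨u, _, hg, hr, _⟩ := h
  refine ⟨fun i hi ψ => ?_, ?_⟩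
  · rw [hg, circuitAct_append, circuitAct_append, hT.act i hi, hr i hi, Gate.conj_act]
  · obtain ⟨Φ, hΦ, hΦr⟩ := hT.linear
    refine ⟨u.conjLinear ∘ₗ Φ, u.conjLinear_injective.comp hΦ, fun i hi => ?_⟩
    rw [hr i hi, Gate.conj_pauli, hΦr i hi]
    rfl

theorem Conjugated.steps {R₀ : ℕ → Row} {P : Gate n → Prop} {T T' : Tableau n}
    (hT : Conjugated m R₀ T) (h : Steps m Λ P T T') : Conjugated m R₀ T' :=
  h.induct (Conjugated m R₀) (fun _ _ h' hI => hI.step h') hT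

theorem circuitAct_injective (l : List (Gate n)) : Function.Injective (circuitAct l) := by
  intro ψ φ h
  have : circuitIsometry l (WithLp.toLp 2 ψ) = circuitIsometry l (WithLp.toLp 2 φ) := by
    simp [circuitIsometry_apply, h]
  simpa using (circuitIsometry l).injective this

theorem Conjugated.comm {R₀ : ℕ → Row} {T : Tableau n} (hT : Conjugated m R₀ T) {i j : ℕ}
    (hi : i < m) (hj : j < m)
    (h : ∀ ψ : Label n → ℂ, (R₀ i).act ((R₀ j).act ψ) = (R₀ j).act ((R₀ i).act ψ))
    (ψ : Label n → ℂ) : (T.row i).act ((T.row j).act ψ) = (T.row j).act ((T.row i).act ψ) := by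
  apply circuitAct_injective T.gates
  rw [← hT.act i hi, ← hT.act j hj, ← hT.act j hj, ← hT.act i hi, h]

/-- The generators are diagonal, the labels have the prescribed syndromes, and labels are determined
by their syndromes. -/
structure Diagonal (n Λ : ℕ) (L : ℕ → ℕ → Bool) (T : Tableau n) : Prop where
  x_eq_false : ∀ j < n, ∀ q < n, (T.row j).x q = false
  syndrome_label : ∀ l < Λ, ∀ j < n, (T.row j).syndrome n (T.label l) = L l j
  injective : ∀ b b' : ℕ → Bool,
    (∀ j < n, (T.row j).syndrome n b = (T.row j).syndrome n b') → ∀ q < n, b q = b' q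

theorem moveLabel_congr (u : Gate n) {b b' : ℕ → Bool} (h : ∀ q < n, b q = b' q) :
    ∀ q < n, u.moveLabel b q = u.moveLabel b' q := by
  intro q hq
  cases u with
  | cnot c t hct =>
    by_cases e : q = t
    · subst e
      simp [Gate.moveLabel, h c c.2, h t t.2]
    · simp [Gate.moveLabel, e, h q hq]
  | _ => exact h q hq

/-- A CNOT acts on diagonal rows only through the bijection `moveLabel` of labels, under which
syndromes, and hence their injectivity, are transported. -/
theorem Diagonal.step {L : ℕ → ℕ → Bool} {P : Gate n → Prop} (hP : ∀ u, P u → u.IsCnot)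
    (hnm : n ≤ m) {T T' : Tableau n} (hT : Diagonal n Λ L T) (h : Step m Λ P T T') :
    Diagonal n Λ L T' := by
  obtain ⟨u, hu, _, hr, hl⟩ := h
  have hc := hP u hu
  have hs : ∀ j < n, ∀ b, (T'.row j).syndrome n b = (T.row j).syndrome n (u.moveLabel b) := by
    intro j hj b
    rw [hr j (by omega)]
    conv_lhs => rw [← u.moveLabel_moveLabel b]
    exact u.syndrome_conj hc (hT.x_eq_false j hj) _
  refine ⟨fun j hj q hq => ?_, fun l hl' j hj => ?_, fun b b' h q hq => ?_⟩
  · rw [hr j (by omega)]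
    cases u with
    | cnot c t h =>
      have h₁ := hT.x_eq_false j hj c c.2
      simp [Gate.conj, h₁, hT.x_eq_false j hj q hq]
    | _ => cases hc
  · rw [hs j hj, hl l hl', u.moveLabel_moveLabel]
    exact hT.syndrome_label l hl' j hj
  · have := hT.injective (u.moveLabel b) (u.moveLabel b') fun j hj => by
      rw [← hs j hj, ← hs j hj, h j hj]
    have := moveLabel_congr u this q hq
    rwa [u.moveLabel_moveLabel, u.moveLabel_moveLabel] at this

end Tableau

theorem GateStep.step {n : ℕ} {u : Gate n} {σ τ : Memory} (h : GateStep u σ τ) {m Λ : ℕ}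
    (hm : σ.reg 10 = m) (hΛ : σ.reg 2 = Λ) {P : Gate n → Prop} (hu : P u) :
    Tableau.Step m Λ P (σ.tableau n) (τ.tableau n) :=
  ⟨u, hu, h.gates, by subst hm; exact h.row, by subst hΛ; exact h.label⟩

theorem Memory.tableau_setReg {n : ℕ} (σ : Memory) {x : ℕ} (v : ℕ) (hx : x ≠ 20) :
    (σ.setReg x v).tableau n = σ.tableau n := by
  simp [Memory.tableau, Memory.gates, hx.symm]
  exact ⟨rfl, rfl⟩

theorem Memory.tableau_congr {n : ℕ} {σ τ : Memory} (h₀ : τ.reg 20 = σ.reg 20)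
    (h : ∀ a ∈ [0, 1, 2, 8, 9], τ.arr a = σ.arr a) : τ.tableau n = σ.tableau n := by
  have h₁ : τ.gates n = σ.gates n := Prog.gates_congr h₀ (h 8 (by simp))
  have h₂ : τ.row = σ.row := by
    funext i
    ext q <;> simp [Memory.row, Memory.bit, h]
  have h₃ : τ.bit 9 = σ.bit 9 := by
    funext i q
    simp [Memory.bit, h]
  simp [Memory.tableau, h₁, h₂, h₃]

/-! ### Elementary reductions of a single row. -/

namespace Prog

open Cmd

variable (O : Oracle) (σ : Memory) {n : ℕ}

theorem bit_row_x (i q : ℕ) : σ.arr 0 i q = 0 ↔ ((σ.tableau n).row i).x q = false :=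
  toBit_eq_false.symm

theorem bit_row_z (i q : ℕ) : σ.arr 1 i q = 0 ↔ ((σ.tableau n).row i).z q = false :=
  toBit_eq_false.symm

theorem gateCX_steps {m Λ p : ℕ} (hm : σ.reg 10 = m) (hΛ : σ.reg 2 = Λ) (hp : p < n)
    {i c t : ℕ} (hi : i < m) (hc : σ.reg 21 = c) (ht : σ.reg 22 = t) (hcp : c ≤ p) (htp : t ≤ p)
    (hct : c ≠ t) :
    Tableau.Step m Λ (fun u => u.Within p ∧ u.IsCnot) (σ.tableau n) ((gateCX.exec O σ).tableau n) ∧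
    (((gateCX.exec O σ).tableau n).row i).x = Function.update ((σ.tableau n).row i).x t
      (((σ.tableau n).row i).x t ^^ ((σ.tableau n).row i).x c) := by
  subst hc ht
  have h := gateCX_step O σ (n := n) (by omega) (by omega) (by simpa using hct)
  refine ⟨h.step hm hΛ ⟨⟨hcp, htp⟩, trivial⟩, ?_⟩
  have := h.row i (by omega)
  change ((gateCX.exec O σ).row i).x = _
  rw [this]
  rfl

/-- The first loop makes the pivot bit 1: while it is 0, some set bit before the pivot still lies
ahead of the counter, and the first one met is copied to the pivot. The second loop uses the pivot
as control to clear all earlier bits. -/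
theorem reduce_spec {m Λ p i : ℕ} (hn : σ.reg 0 = n) (hm : σ.reg 10 = m) (hΛ : σ.reg 2 = Λ)
    (hp : σ.reg 11 = p) (hpn : p < n) (hi : σ.reg 12 = i) (him : i < m)
    (hx : ∃ q ≤ p, ((σ.tableau n).row i).x q = true) :
    Tableau.Steps m Λ (fun u => u.Within p ∧ u.IsCnot) (σ.tableau n)
      ((reduce.exec O σ).tableau n) ∧
    ∀ q ≤ p, (((reduce.exec O σ).tableau n).row i).x q = decide (q = p) := by
  rw [reduce, exec_seq]
  set b₁ : Cmd := ite (.eq (xBit 12 11) (.lit 0))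
    (ite (.eq (xBit 12 21) (.lit 0)) skip
      (ite (.lt (.var 21) (.var 11)) (setN 22 (.var 11) ;; gateCX) skip)) skip with hb₁
  set b₂ : Cmd := ite (.eq (xBit 12 22) (.lit 0)) skip
    (ite (.lt (.var 22) (.var 11)) (setN 21 (.var 11) ;; gateCX) skip) with hb₂
  set P : Gate n → Prop := fun u => u.Within p ∧ u.IsCnot with hP
  have key₁ : Tableau.Steps m Λ P (σ.tableau n) (((loop 21 0 b₁).exec O σ).tableau n) ∧
      ((((loop 21 0 b₁).exec O σ).tableau n).row i).x p = true := by
    have := loop_inv O (x := 21) (y := 0) (b := b₁) (fun j τ =>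
      Tableau.Steps m Λ P (σ.tableau n) (τ.tableau n) ∧ (((τ.tableau n).row i).x p = true ∨
        ∃ q, j ≤ q ∧ q < p ∧ ((τ.tableau n).row i).x q = true)) σ ?_ ?_
    · obtain ⟨h₁, h₂ | ⟨q, h₃, h₄, _⟩⟩ := this
      · exact ⟨h₁, h₂⟩
      · omega
    · rw [Memory.tableau_setReg _ _ (by decide)]
      refine ⟨Relation.ReflTransGen.refl, ?_⟩
      obtain ⟨q, hq, h⟩ := hx
      rcases hq.lt_or_eq with hq | rfl
      · exact .inr ⟨q, by omega, hq, h⟩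
      · exact .inl h
    · intro j hj τ hF hτ ⟨ih₁, ih₂⟩
      rw [Memory.tableau_setReg _ _ (by decide)]
      have e₁ := (hF.reg 12 rfl).trans hi
      have e₂ := (hF.reg 11 rfl).trans hp
      have e₃ := (hF.reg 10 rfl).trans hm
      have e₄ := (hF.reg 2 rfl).trans hΛ
      by_cases hxp : ((τ.tableau n).row i).x p = true
      · rw [hb₁, exec_ite_neg]
        · exact ⟨ih₁, .inl hxp⟩
        · simp [xBit, e₁, e₂, bit_row_x (n := n), hxp]
      · have ⟨q, hq₁, hq₂, hq₃⟩ := ih₂.resolve_left hxp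
        rw [hb₁, exec_ite_pos (by simpa [xBit, e₁, e₂, bit_row_x (n := n)] using hxp)]
        by_cases hxj : ((τ.tableau n).row i).x j = true
        · rw [exec_ite_neg (by simp [xBit, e₁, hτ, bit_row_x (n := n), hxj]),
            exec_ite_pos (by simp [hτ, e₂]; omega), exec_seq]
          have h := gateCX_steps O ((setN 22 (.var 11)).exec O τ) (m := m) (Λ := Λ) (p := p)
            (c := j) (t := p) (by simp [e₃]) (by simp [e₄]) hpn him (by simp [hτ]) (by simp [e₂])
            (by omega) le_rfl (by omega)
          have e : ((setN 22 (.var 11)).exec O τ).tableau n = τ.tableau n :=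
            Memory.tableau_setReg _ _ (by decide)
          rw [e] at h
          refine ⟨ih₁.tail h.1, .inl ?_⟩
          rw [h.2]
          simp [hxp, hxj]
        · rw [exec_ite_pos (by simpa [xBit, e₁, hτ, bit_row_x (n := n)] using hxj)]
          refine ⟨ih₁, .inr ⟨q, ?_, hq₂, hq₃⟩⟩
          have : q ≠ j := by rintro rfl; exact hxj hq₃
          omega
  set σ₁ := (loop 21 0 b₁).exec O σ with hσ₁
  have hF₁ := exec_frame O (loop 21 0 b₁) σ
  rw [← hσ₁] at hF₁
  have hn₁ : σ₁.reg 0 = n := (hF₁.reg 0 rfl).trans hn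
  have key₂ := loop_inv O (x := 22) (y := 0) (b := b₂) (fun j τ =>
      Tableau.Steps m Λ P (σ.tableau n) (τ.tableau n) ∧ ((τ.tableau n).row i).x p = true ∧
        ∀ q < j, q < p → ((τ.tableau n).row i).x q = false) σ₁ ?_ ?_
  · obtain ⟨h₁, h₂, h₃⟩ := key₂
    refine ⟨h₁, fun q hq => ?_⟩
    rcases hq.lt_or_eq with hq | rfl
    · rw [h₃ q (by omega) hq]
      simp [hq.ne]
    · simp [h₂]
  · rw [Memory.tableau_setReg _ _ (by decide)]
    exact ⟨key₁.1, key₁.2, by omega⟩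
  · intro j hj τ hF hτ ⟨ih₁, ih₂, ih₃⟩
    rw [Memory.tableau_setReg _ _ (by decide)]
    have e₁ := (hF.reg 12 rfl).trans ((hF₁.reg 12 rfl).trans hi)
    have e₂ := (hF.reg 11 rfl).trans ((hF₁.reg 11 rfl).trans hp)
    have e₃ := (hF.reg 10 rfl).trans ((hF₁.reg 10 rfl).trans hm)
    have e₄ := (hF.reg 2 rfl).trans ((hF₁.reg 2 rfl).trans hΛ)
    by_cases hxj : ((τ.tableau n).row i).x j = true
    · rw [hb₂, exec_ite_neg (by simp [xBit, e₁, hτ, bit_row_x (n := n), hxj])]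
      by_cases hjp : j < p
      · rw [exec_ite_pos (by simpa [hτ, e₂] using hjp), exec_seq]
        have h := gateCX_steps O ((setN 21 (.var 11)).exec O τ) (m := m) (Λ := Λ) (p := p)
          (c := p) (t := j) (by simp [e₃]) (by simp [e₄]) hpn him (by simp [e₂]) (by simp [hτ])
          le_rfl (by omega) (by omega)
        have e : ((setN 21 (.var 11)).exec O τ).tableau n = τ.tableau n :=
          Memory.tableau_setReg _ _ (by decide)
        rw [e] at h
        refine ⟨ih₁.tail h.1, ?_, fun q hq hqp => ?_⟩
        · rw [h.2]
          simp [hjp.ne', ih₂]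
        · rw [h.2]
          by_cases hqj : q = j
          · simp [hqj, hxj, ih₂]
          · simp [hqj, ih₃ q (by omega) hqp]
      · rw [exec_ite_neg (by simpa [hτ, e₂] using hjp)]
        exact ⟨ih₁, ih₂, fun q _ hqp => ih₃ q (by omega) hqp⟩
    · rw [hb₂, exec_ite_pos (by simpa [xBit, e₁, hτ, bit_row_x (n := n)] using hxj)]
      refine ⟨ih₁, ih₂, fun q hq hqp => ?_⟩
      by_cases hqj : q = j
      · simpa [hqj] using hxj
      · exact ih₃ q (by omega) hqp

/-- On each qubit a Hadamard gate turns `Z` into `X` and a phase gate turns `Y` into `X` up to sign,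
while `I` and `X` stay. So the new `x` bit is the disjunction of the old bits. -/
theorem clearZ_spec {m Λ p i : ℕ} (hn : σ.reg 0 = n) (hm : σ.reg 10 = m) (hΛ : σ.reg 2 = Λ)
    (hp : σ.reg 11 = p) (hi : σ.reg 12 = i) (him : i < m) :
    Tableau.Steps m Λ (fun u => u.Within p) (σ.tableau n) ((clearZ.exec O σ).tableau n) ∧
    ∀ q < n, q ≤ p → (((clearZ.exec O σ).tableau n).row i).z q = false ∧
      (((clearZ.exec O σ).tableau n).row i).x q =
        (((σ.tableau n).row i).x q || ((σ.tableau n).row i).z q) := by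
  rw [clearZ]
  set b : Cmd := ite (.eq (zBit 12 21) (.lit 0)) skip
    (ite (.lt (.var 11) (.var 21)) skip
      (ite (.eq (xBit 12 21) (.lit 0)) gateH gateS)) with hb
  have key := loop_inv O (x := 21) (y := 0) (b := b) (fun j τ =>
      Tableau.Steps m Λ (fun u => u.Within p) (σ.tableau n) (τ.tableau n) ∧
      ∀ q < n, q ≤ p → ((τ.tableau n).row i).z q =
          (decide (j ≤ q) && ((σ.tableau n).row i).z q) ∧
        ((τ.tableau n).row i).x q = (((σ.tableau n).row i).x q ||
          (decide (q < j) && ((σ.tableau n).row i).z q))) σ ?_ ?_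
  · refine ⟨key.1, fun q hq hqp => ?_⟩
    obtain ⟨h₁, h₂⟩ := key.2 q hq hqp
    rw [hn] at h₁ h₂
    rw [h₁, h₂]
    simp [hq]
  · rw [Memory.tableau_setReg _ _ (by decide)]
    exact ⟨Relation.ReflTransGen.refl, by simp⟩
  · intro j hj τ hF hτ ⟨ih₁, ih₂⟩
    rw [Memory.tableau_setReg _ _ (by decide)]
    have e₁ := (hF.reg 12 rfl).trans hi
    have e₂ := (hF.reg 11 rfl).trans hp
    have e₃ := (hF.reg 10 rfl).trans hm
    have e₄ := (hF.reg 2 rfl).trans hΛ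
    have hjn : j < n := by omega
    -- The rounds without a gate: either the `z` bit at `j` is already 0, or `j` lies beyond `p`.
    have triv : (∀ q < n, q ≤ p → q = j → ((τ.tableau n).row i).z q = false) →
        ∀ q < n, q ≤ p → ((τ.tableau n).row i).z q =
          (decide (j + 1 ≤ q) && ((σ.tableau n).row i).z q) ∧
        ((τ.tableau n).row i).x q = (((σ.tableau n).row i).x q ||
          (decide (q < j + 1) && ((σ.tableau n).row i).z q)) := by
      intro h q hq hqp
      obtain ⟨h₁, h₂⟩ := ih₂ q hq hqp
      by_cases hqj : q = j
      · have h₃ := h q hq hqp hqj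
        subst hqj
        rw [h₁] at h₃
        simp only [le_refl, decide_true, Bool.true_and] at h₃
        simp [h₁, h₂, h₃]
      · have a₁ : decide (j + 1 ≤ q) = decide (j ≤ q) := by simp only [decide_eq_decide]; omega
        have a₂ : decide (q < j + 1) = decide (q < j) := by simp only [decide_eq_decide]; omega
        rw [a₁, a₂]
        exact ⟨h₁, h₂⟩
    by_cases hz : ((τ.tableau n).row i).z j = true
    · rw [hb, exec_ite_neg (by simp [zBit, e₁, hτ, bit_row_z (n := n), hz])]
      by_cases hjp : j ≤ p
      · rw [exec_ite_neg (by simpa [hτ, e₂] using hjp)]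
        obtain ⟨hj₁, hj₂⟩ := ih₂ j hjn hjp
        simp only [le_refl, decide_true, Bool.true_and, lt_irrefl, decide_false, Bool.false_and,
          Bool.or_false] at hj₁ hj₂
        have a₁ : ∀ q, q ≠ j → decide (j + 1 ≤ q) = decide (j ≤ q) := fun q hq => by
          simp only [decide_eq_decide]; omega
        have a₂ : ∀ q, q ≠ j → decide (q < j + 1) = decide (q < j) := fun q hq => by
          simp only [decide_eq_decide]; omega
        by_cases hx : ((τ.tableau n).row i).x j = true
        · rw [exec_ite_neg (by simp [xBit, e₁, hτ, bit_row_x (n := n), hx])]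
          have h := gateS_step O τ (n := n) (by rwa [hτ])
          refine ⟨ih₁.tail (h.step e₃ e₄ (by simpa [Gate.Within, hτ] using hjp)),
            fun q hq hqp => ?_⟩
          have hr : ((gateS.exec O τ).tableau n).row i = _ := h.row i (by omega)
          rw [hr]
          by_cases hqj : q = j
          · subst hqj
            have hx' : (τ.row i).x q = true := hx
            have hz' : (τ.row i).z q = true := hz
            rw [hz] at hj₁
            rw [hx] at hj₂
            simp [Gate.conj, hτ, hx', hz', ← hj₁, ← hj₂]
          · rw [a₁ q hqj, a₂ q hqj]
            have := ih₂ q hq hqp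
            simpa [Gate.conj, hτ, hqj, Memory.tableau] using this
        · rw [exec_ite_pos (by simpa [xBit, e₁, hτ, bit_row_x (n := n)] using hx)]
          have h := gateH_step O τ (n := n) (by rwa [hτ])
          refine ⟨ih₁.tail (h.step e₃ e₄ (by simpa [Gate.Within, hτ] using hjp)),
            fun q hq hqp => ?_⟩
          have hr : ((gateH.exec O τ).tableau n).row i = _ := h.row i (by omega)
          rw [hr]
          by_cases hqj : q = j
          · subst hqj
            have hx' : (τ.row i).x q = false := by simpa [Memory.tableau] using hx
            have hz' : (τ.row i).z q = true := hz
            rw [hz] at hj₁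
            simp [Gate.conj, hτ, hx', hz', ← hj₁]
          · rw [a₁ q hqj, a₂ q hqj]
            have := ih₂ q hq hqp
            simpa [Gate.conj, hτ, hqj, Memory.tableau] using this
      · rw [exec_ite_pos (by simpa [hτ, e₂] using hjp)]
        exact ⟨ih₁, triv fun q _ hqp hqj => by omega⟩
    · rw [hb, exec_ite_pos (by simpa [zBit, e₁, hτ, bit_row_z (n := n)] using hz)]
      exact ⟨ih₁, triv fun q _ _ hqj => by subst hqj; simpa using hz⟩

end Prog

/-! ### Triangular tableaux: consequences of commutation and independence. -/

namespace Tableau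

variable {n m Λ : ℕ}

/-- This protects the generators already treated: their support lies beyond `p`, while the later
gates act on the qubits up to `p`. -/
theorem Steps.conj_eq_self {P : Gate n → Prop} {p i : ℕ} (hP : ∀ u, P u → u.Within p) (hi : i < m)
    {T T' : Tableau n} (h : Steps m Λ P T T') (hx : ∀ q ≤ p, (T.row i).x q = false)
    (hz : ∀ q ≤ p, (T.row i).z q = false) : T'.row i = T.row i := by
  refine h.induct (fun T' => T'.row i = T.row i) (fun T₁ T₂ h₁ ih => ?_) rfl
  obtain ⟨u, hu, _, hr, _⟩ := h₁
  rw [hr i hi, ih, Gate.conj_eq_self (hP u hu) hx hz]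

theorem Steps.x_of_lt {P : Gate n → Prop} {p i q : ℕ} (hP : ∀ u, P u → u.Within p) (hi : i < m)
    (hq : p < q) {T T' : Tableau n} (h : Steps m Λ P T T') : (T'.row i).x q = (T.row i).x q := by
  refine h.induct (fun T' => (T'.row i).x q = (T.row i).x q) (fun T₁ T₂ h₁ ih => ?_) rfl
  obtain ⟨u, hu, _, hr, _⟩ := h₁
  rw [hr i hi, Gate.conj_x_of_lt (hP u hu) hq, ih]

theorem Steps.z_eq_self {p i : ℕ} (hi : i < m) {T T' : Tableau n}
    (h : Steps m Λ (fun u => u.Within p ∧ u.IsCnot) T T')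
    (hz : ∀ q ≤ p, (T.row i).z q = false) : (T'.row i).z = (T.row i).z := by
  refine h.induct (fun T' => (T'.row i).z = (T.row i).z) (fun T₁ T₂ h₁ ih => ?_) rfl
  obtain ⟨u, hu, _, hr, _⟩ := h₁
  rw [hr i hi, Gate.conj_z_of_isCnot hu.1 hu.2 (by rwa [ih]), ih]

theorem Steps.x_eq_self {p i : ℕ} (hi : i < m) {T T' : Tableau n}
    (h : Steps m Λ (fun u => u.Within p ∧ u.IsCnot) T T')
    (hx : ∀ q ≤ p, (T.row i).x q = false) : (T'.row i).x = (T.row i).x := by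
  refine h.induct (fun T' => (T'.row i).x = (T.row i).x) (fun T₁ T₂ h₁ ih => ?_) rfl
  obtain ⟨u, hu, _, hr, _⟩ := h₁
  rw [hr i hi, Gate.conj_x_of_isCnot hu.1 hu.2 (by rwa [ih]), ih]

/-- The row is diagonal, with `z` part beginning at `p`. -/
structure Leading (n p : ℕ) (R : Row) : Prop where
  x_eq_false : ∀ q < n, R.x q = false
  z_of_lt : ∀ q < p, R.z q = false
  z_self : R.z p = true

/-- If the first `j` rows are diagonal with leading qubits `n - 1, n - 2, …`, then the `x` part of
the next row vanishes on these qubits. -/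
theorem Conjugated.x_eq_false {R₀ : ℕ → Row} {T : Tableau n} (hT : Conjugated m R₀ T)
    (hnm : n ≤ m) (hcomm : ∀ i < n, ∀ j < n, ∀ ψ : Label n → ℂ,
      (R₀ i).act ((R₀ j).act ψ) = (R₀ j).act ((R₀ i).act ψ))
    {j : ℕ} (hj : j < n) (hlead : ∀ i < j, Leading n (n - 1 - i) (T.row i)) :
    ∀ i < j, (T.row j).x (n - 1 - i) = false := by
  intro i
  induction i using Nat.strong_induction_on with
  | _ i ih =>
    intro hi
    have hl := hlead i hi
    have h := (T.row i).prod_eq_of_act_comm (T.row j)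
      (hT.comm (by omega) (by omega) (hcomm i (by omega) j hj))
    -- In the commutation relation with row `i` only its leading qubit contributes: before it row
    -- `i` has no `z` bit, and beyond it row `j` has no `x` bit by the induction hypothesis. The
    -- other side is 1 because row `i` has no `x` bits.
    rw [Finset.prod_eq_single (⟨n - 1 - i, by omega⟩ : Fin n)] at h
    · rw [Finset.prod_eq_one fun q _ => by simp [hl.x_eq_false q q.2]] at h
      simp only [hl.z_self, Bool.true_and] at h
      exact bitSign_injective (h.trans bitSign_false.symm)
    · intro q _ hq
      have hq' : (q : ℕ) ≠ n - 1 - i := fun e => hq (Fin.ext e)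
      rcases hq'.lt_or_gt with hlt | hgt
      · simp [hl.z_of_lt q hlt]
      · have e : (q : ℕ) = n - 1 - (n - 1 - q) := by omega
        have := ih (n - 1 - q) (by omega) (by omega)
        rw [← e] at this
        simp [this]
    · simp

/-- The next row does not vanish on the remaining qubits. -/
theorem Conjugated.exists_ne {R₀ : ℕ → Row} {T : Tableau n} (hT : Conjugated m R₀ T)
    (hnm : n ≤ m) (hind : LinearIndependent (ZMod 2) fun i : Fin n => (R₀ i).pauli n)
    {j : ℕ} (hj : j < n) (hlead : ∀ i < j, Leading n (n - 1 - i) (T.row i))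
    (hx : ∀ i < j, (T.row j).x (n - 1 - i) = false) :
    ∃ q ≤ n - 1 - j, ((T.row j).x q || (T.row j).z q) = true := by
  by_contra! hc
  obtain ⟨Φ, hΦ, hΦr⟩ := hT.linear
  have hindT : LinearIndependent (ZMod 2) fun i : Fin (j + 1) => (T.row i).pauli n := by
    have h₁ : LinearIndependent (ZMod 2) fun i : Fin n => (T.row i).pauli n := by
      have e : (fun i : Fin n => (T.row i).pauli n) = Φ ∘ fun i : Fin n => (R₀ i).pauli n :=
        funext fun i => hΦr i (by omega)
      rw [e]
      exact hind.map' Φ (LinearMap.ker_eq_bot.2 hΦ)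
    exact h₁.comp (fun i : Fin (j + 1) => (⟨i, by omega⟩ : Fin n)) fun a b h => by
      simpa [Fin.ext_iff] using h
  -- If row `j` vanished on the first `n - j` qubits, rows `0, …, j` would all lie in the space `W`
  -- of `z` strings supported on the last `j` qubits. The map `π` is injective on `W`, so `j + 1`
  -- independent vectors would fit into dimension `j`.
  let π : Pauli n →ₗ[ZMod 2] (Fin j → ZMod 2) :=
    { toFun := fun p i => (p ⟨n - 1 - i, by omega⟩).2
      map_add' := fun _ _ => rfl
      map_smul' := fun _ _ => rfl }
  let W : Submodule (ZMod 2) (Pauli n) :=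
    { carrier := {p | ∀ q : Fin n, (p q).1 = 0 ∧ ((q : ℕ) ≤ n - 1 - j → (p q).2 = 0)}
      add_mem' := by
        intro p p' hp hp' q
        exact ⟨by simp [(hp q).1, (hp' q).1], fun h => by simp [(hp q).2 h, (hp' q).2 h]⟩
      zero_mem' := fun q => ⟨rfl, fun _ => rfl⟩
      smul_mem' := by
        intro c p hp q
        exact ⟨by simp [(hp q).1], fun h => by simp [(hp q).2 h]⟩ }
  have hmem : ∀ i : Fin (j + 1), (T.row i).pauli n ∈ W := by
    intro i q
    rcases (Nat.lt_succ_iff.1 i.2).lt_or_eq with hi | hi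
    · have hl := hlead i hi
      exact ⟨by simp [Row.pauli, hl.x_eq_false q q.2], fun h => by
        simp [Row.pauli, hl.z_of_lt q (by omega)]⟩
    · rw [hi]
      by_cases hq : (q : ℕ) ≤ n - 1 - j
      · have := hc q hq
        simp only [ne_eq, Bool.or_eq_true, not_or, Bool.not_eq_true] at this
        exact ⟨by simp [Row.pauli, this.1], fun _ => by simp [Row.pauli, this.2]⟩
      · have e : (q : ℕ) = n - 1 - (n - 1 - q) := by omega
        have := hx (n - 1 - q) (by omega)
        rw [← e] at this
        exact ⟨by simp [Row.pauli, this], fun h => absurd h hq⟩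
  have hindW : LinearIndependent (ZMod 2) fun i : Fin (j + 1) => π ((T.row i).pauli n) := by
    have h₁ : LinearIndependent (ZMod 2)
        fun i : Fin (j + 1) => (⟨(T.row i).pauli n, hmem i⟩ : W) :=
      LinearIndependent.of_comp W.subtype hindT
    have h₂ := h₁.map' (π.comp W.subtype) (LinearMap.ker_eq_bot.2 ?_)
    · exact h₂
    · rintro ⟨p, hp⟩ ⟨p', hp'⟩ h
      apply Subtype.ext
      funext q
      refine Prod.ext ((hp q).1.trans (hp' q).1.symm) ?_
      by_cases hq : (q : ℕ) ≤ n - 1 - j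
      · exact ((hp q).2 hq).trans ((hp' q).2 hq).symm
      · have := congrFun h ⟨n - 1 - q, by omega⟩
        have e : (⟨n - 1 - (n - 1 - q), by omega⟩ : Fin n) = q := Fin.ext (by simp; omega)
        simpa [π, e] using this
  have := hindW.fintype_card_le_finrank
  simp at this

/-- Diagonal rows with distinct leading qubits determine the label. -/
theorem injective_of_leading {T : Tableau n}
    (hlead : ∀ i < n, Leading n (n - 1 - i) (T.row i)) (b b' : ℕ → Bool)
    (h : ∀ j < n, (T.row j).syndrome n b = (T.row j).syndrome n b') : ∀ q < n, b q = b' q := by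
  suffices ∀ i < n, b (n - 1 - i) = b' (n - 1 - i) by
    intro q hq
    have e : q = n - 1 - (n - 1 - q) := by omega
    rw [e]
    exact this _ (by omega)
  intro i
  induction i using Nat.strong_induction_on with
  | _ i ih =>
    intro hi
    have hl := hlead i hi
    have h₁ := h i hi
    simp only [Row.syndrome, Bool.xor_right_inj] at h₁
    have h₂ : parity (fun q => ((T.row i).z q && b q) ^^ ((T.row i).z q && b' q)) n = false := by
      rw [parity_xor, h₁, Bool.xor_self]
    -- Back substitution: row `i` has no `z` bits before its leading qubit, and beyond it the two
    -- labels agree by induction, so the equation isolates the leading bit.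
    rw [parity_eq_of_unique (p := n - 1 - i) (by omega)] at h₂
    · simpa [hl.z_self] using h₂
    · intro q hq hne
      rcases hne.lt_or_gt with hlt | hgt
      · simp [hl.z_of_lt q hlt]
      · have e : q = n - 1 - (n - 1 - q) := by omega
        have := ih (n - 1 - q) (by omega) (by omega)
        rw [← e] at this
        simp [this]

end Tableau

/-! ### Diagonalization of the generators and the labels of the list members. -/

namespace Prog

open Cmd Tableau

variable (O : Oracle) (σ : Memory) {n : ℕ}

/-- Stage `j` turns generator `j` into a `z` string beginning at `n - 1 - j`. Commutation with the
earlier generators excludes `x` bits beyond this pivot, independence guarantees something to work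
with on the qubits up to it, and the gates used there do not affect the earlier generators. -/
theorem diagonalize_spec {m Λ : ℕ} {R₀ : ℕ → Row} (hn : σ.reg 0 = n) (hm : σ.reg 10 = m)
    (hΛ : σ.reg 2 = Λ) (hnm : n ≤ m) (hT : Conjugated m R₀ (σ.tableau n))
    (hcomm : ∀ i < n, ∀ j < n, ∀ ψ : Label n → ℂ,
      (R₀ i).act ((R₀ j).act ψ) = (R₀ j).act ((R₀ i).act ψ))
    (hind : LinearIndependent (ZMod 2) fun i : Fin n => (R₀ i).pauli n) :
    Conjugated m R₀ ((diagonalize.exec O σ).tableau n) ∧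
      ∀ i < n, Leading n (n - 1 - i) (((diagonalize.exec O σ).tableau n).row i) := by
  rw [diagonalize, exec_seq]
  set σ₁ := (setN 11 (.var 0)).exec O σ with hσ₁
  have hT₁ : σ₁.tableau n = σ.tableau n := Memory.tableau_setReg _ _ (by decide)
  have hn₁ : σ₁.reg 0 = n := by simp [hσ₁, hn]
  set b : Cmd := setN 11 (.pred (.var 11)) ;; clearZ ;; reduce ;; setN 21 (.var 11) ;; gateH with hb
  have key := loop_inv O (x := 12) (y := 0) (b := b) (fun j τ => τ.reg 11 = n - j ∧
      Conjugated m R₀ (τ.tableau n) ∧ ∀ i < j, Leading n (n - 1 - i) ((τ.tableau n).row i)) σ₁ ?_ ?_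
  · rw [hn₁] at key
    exact key.2
  · rw [Memory.tableau_setReg _ _ (by decide), hT₁]
    exact ⟨by simp [hσ₁, hn], hT, by omega⟩
  · intro j hj τ hF hτ ⟨ih₁, ih₂, ih₃⟩
    rw [hn₁] at hj
    rw [Memory.tableau_setReg _ _ (by decide)]
    have e₀ : τ.reg 0 = n := (hF.reg 0 rfl).trans hn₁
    have e₂ : τ.reg 2 = Λ := (hF.reg 2 rfl).trans (by simpa [hσ₁] using hΛ)
    have e₁₀ : τ.reg 10 = m := (hF.reg 10 rfl).trans (by simpa [hσ₁] using hm)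
    set p := n - 1 - j with hp
    rw [hb, exec_seq, exec_seq, exec_seq, exec_seq]
    set τ₁ := (setN 11 (.pred (.var 11))).exec O τ with hτ₁
    have f₁ : τ₁.reg 11 = p := by simp [hτ₁, ih₁]; omega
    have f₂ : ∀ x, x ≠ 11 → τ₁.reg x = τ.reg x := fun x hx => by simp [hτ₁, hx]
    have f₃ : τ₁.tableau n = τ.tableau n := Memory.tableau_setReg _ _ (by decide)
    have hx := ih₂.x_eq_false hnm hcomm hj ih₃
    obtain ⟨q₀, hq₀, hq₀'⟩ := ih₂.exists_ne hnm hind hj ih₃ hx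
    obtain ⟨g₁, g₂⟩ := clearZ_spec O τ₁ (n := n) (m := m) (Λ := Λ) (p := p) (i := j)
      (by rw [f₂ _ (by decide), e₀]) (by rw [f₂ _ (by decide), e₁₀]) (by rw [f₂ _ (by decide), e₂])
      f₁ (by rw [f₂ _ (by decide), hτ]) (by omega)
    rw [f₃] at g₁ g₂
    have G := exec_frame O clearZ τ₁
    set τ₂ := clearZ.exec O τ₁ with hτ₂
    have f₄ : ∀ x ∈ [0, 2, 10, 12], τ₂.reg x = τ.reg x := by
      intro x hx
      rw [G.reg x (by fin_cases hx <;> rfl), f₂ x (by fin_cases hx <;> decide)]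
    have f₅ : τ₂.reg 11 = p := (G.reg 11 rfl).trans f₁
    obtain ⟨h₁, h₂⟩ := reduce_spec O τ₂ (n := n) (m := m) (Λ := Λ) (p := p) (i := j)
      (by rw [f₄ _ (by simp), e₀]) (by rw [f₄ _ (by simp), e₁₀]) (by rw [f₄ _ (by simp), e₂])
      f₅ (by omega) (by rw [f₄ _ (by simp), hτ]) (by omega)
      ⟨q₀, hq₀, by rw [(g₂ q₀ (by omega) hq₀).2, hq₀']⟩
    have H := exec_frame O reduce τ₂
    set τ₃ := reduce.exec O τ₂ with hτ₃
    have f₆ : ∀ x ∈ [0, 2, 10, 12], τ₃.reg x = τ.reg x := by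
      intro x hx
      rw [H.reg x (by fin_cases hx <;> rfl), f₄ x hx]
    have f₇ : τ₃.reg 11 = p := (H.reg 11 rfl).trans f₅
    set τ₄ := (setN 21 (.var 11)).exec O τ₃ with hτ₄
    have f₈ : ∀ x, x ≠ 21 → τ₄.reg x = τ₃.reg x := fun x hx => by simp [hτ₄, hx]
    have f₉ : τ₄.reg 21 = p := by simp [hτ₄, f₇]
    have f₀ : τ₄.tableau n = τ₃.tableau n := Memory.tableau_setReg _ _ (by decide)
    have k := gateH_step O τ₄ (n := n) (by omega)
    have kF := exec_frame O gateH τ₄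
    have e₁₀' : τ₄.reg 10 = m := by rw [f₈ _ (by decide), f₆ _ (by simp), e₁₀]
    have e₂' : τ₄.reg 2 = Λ := by rw [f₈ _ (by decide), f₆ _ (by simp), e₂]
    have st := k.step e₁₀' e₂' (P := fun u => u.Within p) f₉.le
    rw [f₀] at st
    have hall : Steps m Λ (fun u : Gate n => u.Within p) (τ.tableau n)
        ((gateH.exec O τ₄).tableau n) :=
      (g₁.trans (h₁.mono fun _ h => h.1)).tail st
    refine ⟨?_, ih₂.steps hall, fun i hi => ?_⟩
    · rw [Memory.setReg_reg, if_neg (by decide), kF.reg 11 rfl, f₈ _ (by decide), f₇]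
      omega
    rcases (Nat.lt_succ_iff.1 hi).lt_or_eq with hi | rfl
    · have hl := ih₃ i hi
      rw [hall.conj_eq_self (fun _ h => h) (by omega) (fun q hq => hl.x_eq_false q (by omega))
        fun q hq => hl.z_of_lt q (by omega)]
      exact hl
    · have hz₂ : ∀ q ≤ p, ((τ₂.tableau n).row i).z q = false := fun q hq => (g₂ q (by omega) hq).1
      have hz₃ : ∀ q ≤ p, ((τ₃.tableau n).row i).z q = false := by
        rw [h₁.z_eq_self (by omega) hz₂]
        exact hz₂
      have hr : ((gateH.exec O τ₄).tableau n).row i = _ := k.row i (by omega)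
      have hr' : τ₄.row i = (τ₃.tableau n).row i := by rw [← f₀]; rfl
      rw [hr'] at hr
      have hxz : ∀ q, (((gateH.exec O τ₄).tableau n).row i).x q =
          (if q = p then ((τ₃.tableau n).row i).z p else ((τ₃.tableau n).row i).x q) := by
        intro q
        rw [hr]
        simp [Gate.conj, f₉, Function.update_apply]
      have hzx : ∀ q, (((gateH.exec O τ₄).tableau n).row i).z q =
          (if q = p then ((τ₃.tableau n).row i).x p else ((τ₃.tableau n).row i).z q) := by
        intro q
        rw [hr]
        simp [Gate.conj, f₉, Function.update_apply]
      refine ⟨fun q hq => ?_, fun q hq => ?_, ?_⟩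
      · rw [hxz]
        split_ifs with e
        · exact hz₃ p le_rfl
        · by_cases hqp : q ≤ p
          · rw [h₂ q hqp]
            simp [e]
          · rw [h₁.x_of_lt (fun _ h => h.1) (by omega) (by omega),
              g₁.x_of_lt (fun _ h => h) (by omega) (by omega)]
            have := hx (n - 1 - q) (by omega)
            rwa [show n - 1 - (n - 1 - q) = q by omega] at this
      · rw [hzx, if_neg (by omega)]
        exact hz₃ q (by omega)
      · rw [hzx, if_pos rfl, h₂ p le_rfl]
        simp

theorem parity_loop {v x y : ℕ} {e : NExp} (hvx : v ≠ x) (f : ℕ → Bool)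
    (h : ∀ i < σ.reg y, ∀ τ, Frame (loop x y (setN v (.xor (.var v) e))) σ τ → τ.reg x = i →
      toBit (e.eval τ) = f i) :
    toBit (((loop x y (setN v (.xor (.var v) e))).exec O σ).reg v) =
      (toBit (σ.reg v) ^^ parity f (σ.reg y)) := by
  refine loop_inv O (fun j τ => toBit (τ.reg v) = (toBit (σ.reg v) ^^ parity f j)) σ ?_ ?_
  · simp [hvx, parity]
  · intro j hj τ hF hτ ih
    have := h j hj τ hF hτ
    simp [hvx, NExp.toBit_xor, ih, this, parity]

/-- Back substitution. When row `j` is reached, the label bit at its leading qubit is still 0, and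
setting it to the discrepancy in equation `j` solves this equation. The earlier equations do not
involve that bit, since their rows begin at later qubits. -/
theorem solveRow_spec {l : ℕ} (hn : σ.reg 0 = n) (hl : σ.reg 13 = l)
    (hlead : ∀ i < n, Leading n (n - 1 - i) ((σ.tableau n).row i)) :
    (∀ j < n, ((σ.tableau n).row j).syndrome n ((solveRow.exec O σ).bit 9 l) = σ.bit 5 l j) ∧
      ∀ l' ≠ l, (solveRow.exec O σ).bit 9 l' = σ.bit 9 l' := by
  rw [solveRow, exec_seq, exec_seq]
  set b₀ : Cmd := setA 9 (.var 13) (.var 14) (.lit 0) with hb₀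
  have h₀ := loop_inv O (x := 14) (y := 0) (b := b₀)
    (fun j τ => (∀ q < j, τ.bit 9 l q = false) ∧ ∀ l' ≠ l, τ.bit 9 l' = σ.bit 9 l') σ
    ⟨by omega, fun _ _ => rfl⟩ (by
      intro j hj τ hF hτ ⟨ih₁, ih₂⟩
      have h13 : τ.reg 13 = l := (hF.reg 13 rfl).trans hl
      refine ⟨fun q hq => ?_, fun l' hl' => ?_⟩
      · by_cases hqj : q = j
        · simp [hb₀, Memory.bit, hτ, h13, hqj]
        · have := ih₁ q (by omega)
          simp [hb₀, Memory.bit, hτ, h13, hqj] at this ⊢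
          exact this
      · rw [← ih₂ l' hl']
        funext q
        simp [hb₀, Memory.bit, h13, hl'])
  rw [hn] at h₀
  have F₀ := exec_frame O (loop 14 0 b₀) σ
  set σ₀ := (loop 14 0 b₀).exec O σ with hσ₀
  set σ₁ := (setN 11 (.var 0)).exec O σ₀ with hσ₁
  have hn₁ : σ₁.reg 0 = n := by simp [hσ₁, F₀.reg 0 rfl, hn]
  have hl₁ : σ₁.reg 13 = l := by simp [hσ₁, F₀.reg 13 rfl, hl]
  have hrow₁ : ∀ i, σ₁.row i = σ.row i := fun i => by
    ext q <;> simp [hσ₁, Memory.row, Memory.bit, F₀.arr 0 rfl, F₀.arr 1 rfl,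
        F₀.arr 2 rfl]
  set b : Cmd := setN 11 (.pred (.var 11)) ;;
    setN 25 (.xor (.arr 5 (.var 13) (.var 12)) (sBit 12)) ;;
    loop 14 0 (setN 25 (.xor (.var 25) (.and (zBit 12 14) (.arr 9 (.var 13) (.var 14))))) ;;
    setA 9 (.var 13) (.var 11) (.var 25) with hb
  have key := loop_inv O (x := 12) (y := 0) (b := b) (fun j τ => τ.reg 11 = n - j ∧
      (∀ q < n - j, τ.bit 9 l q = false) ∧
      (∀ i < j, (σ.row i).syndrome n (τ.bit 9 l) = σ.bit 5 l i) ∧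
      ∀ l' ≠ l, τ.bit 9 l' = σ.bit 9 l') σ₁ ⟨by simp [hσ₁, F₀.reg 0 rfl, hn], h₀.1, by omega, h₀.2⟩ ?_
  · rw [hn₁] at key
    exact key.2.2
  · intro j hj τ hF hτ ⟨ih₁, ih₂, ih₃, ih₄⟩
    rw [hn₁] at hj
    have h0 : τ.reg 0 = n := (hF.reg 0 rfl).trans hn₁
    have h13 : τ.reg 13 = l := (hF.reg 13 rfl).trans hl₁
    have hrow : ∀ i, τ.row i = σ.row i := fun i => by
      rw [← hrow₁ i]
      ext q <;> simp [Memory.row, Memory.bit, hF.arr 0 rfl, hF.arr 1 rfl,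
        hF.arr 2 rfl]
    have h5 : τ.arr 5 = σ.arr 5 := (hF.arr 5 rfl).trans (F₀.arr 5 rfl)
    set p := n - 1 - j with hp
    have hl := hlead j hj
    set v : Bool := σ.bit 5 l j ^^ (σ.row j).syndrome n (τ.bit 9 l) with hv
    have hout : ∀ l' q, (b.exec O τ).bit 9 l' q = if l' = l ∧ q = p then v else τ.bit 9 l' q := by
      intro l' q
      rw [hb, exec_seq, exec_seq, exec_seq]
      set τ₁ := (setN 25 (.xor (.arr 5 (.var 13) (.var 12)) (sBit 12))).exec O
        ((setN 11 (.pred (.var 11))).exec O τ) with hτ₁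
      have F₁ := exec_frame O (loop 14 0 (setN 25 (.xor (.var 25)
        (.and (zBit 12 14) (.arr 9 (.var 13) (.var 14)))))) τ₁
      have hpar := parity_loop O τ₁ (v := 25) (x := 14) (y := 0)
        (e := .and (zBit 12 14) (.arr 9 (.var 13) (.var 14))) (by decide)
        (fun q => (σ.row j).z q && τ.bit 9 l q) (by
          intro i hi υ hυ hυ'
          have r12 : υ.reg 12 = j := (hυ.reg 12 rfl).trans (by simp [hτ₁, hτ])
          have r13 : υ.reg 13 = l := (hυ.reg 13 rfl).trans (by simp [hτ₁, h13])
          have a1 : υ.arr 1 = τ.arr 1 := hυ.arr 1 rfl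
          have a9 : υ.arr 9 = τ.arr 9 := hυ.arr 9 rfl
          rw [NExp.toBit_and, ← hrow j]
          simp [zBit, r12, r13, a1, a9, hυ', Memory.row, Memory.bit])
      set τ₂ := (loop 14 0 (setN 25 (.xor (.var 25)
        (.and (zBit 12 14) (.arr 9 (.var 13) (.var 14)))))).exec O τ₁ with hτ₂
      have r11 : τ₂.reg 11 = p := (F₁.reg 11 rfl).trans (by simp [hτ₁, ih₁]; omega)
      have r13 : τ₂.reg 13 = l := (F₁.reg 13 rfl).trans (by simp [hτ₁, h13])
      have a9 : τ₂.arr 9 = τ.arr 9 := F₁.arr 9 rfl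
      have r0 : τ₁.reg 0 = n := by simp [hτ₁, h0]
      have hval : toBit (τ₁.reg 25) = (σ.bit 5 l j ^^ (σ.row j).s) := by
        rw [← hrow j]
        simp [hτ₁, NExp.toBit_xor, h13, hτ, h5, Memory.bit, sBit, Memory.row]
      rw [r0, hval] at hpar
      have hv' : toBit (τ₂.reg 25) = v := by
        rw [hpar, hv, Row.syndrome, Bool.xor_assoc]
      simp only [Memory.bit, exec_setA, Memory.setArr_arr, NExp.eval_var, r11, r13, a9, true_and]
      split_ifs <;> simp [hv']
    have hbl : (b.exec O τ).bit 9 l = Function.update (τ.bit 9 l) p (τ.bit 9 l p ^^ v) := by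
      funext q
      rw [hout]
      simp [Function.update_apply, ih₂ p (by omega)]
    have hFb := exec_frame O b τ
    have hreg : (b.exec O τ).reg 11 = n - (j + 1) := by
      rw [hb, exec_seq, exec_seq, exec_seq]
      simp only [exec_setA, Memory.setArr_reg]
      rw [(exec_frame O _ _).reg 11 rfl]
      simp [ih₁]
      omega
    refine ⟨by simpa using hreg, fun q hq => ?_, fun i hi => ?_, fun l' hl' => ?_⟩
    · change (b.exec O τ).bit 9 l q = false
      rw [hout, if_neg (by omega)]
      exact ih₂ q (by omega)
    · change (σ.row i).syndrome n ((b.exec O τ).bit 9 l) = _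
      rw [hbl, Row.syndrome, parity_update (by omega)]
      rcases (Nat.lt_succ_iff.1 hi).lt_or_eq with hi | rfl
      · have hz : (σ.row i).z p = false := (hlead i (by omega)).z_of_lt p (by omega)
        rw [hz, Bool.false_and, Bool.xor_false]
        exact ih₃ i hi
      · have hz : (σ.row i).z p = true := hl.z_self
        rw [hz, Bool.true_and, hv, Row.syndrome]
        cases (σ.row i).s <;> cases parity (fun q => (σ.row i).z q && τ.bit 9 l q) n <;> simp
    · change (b.exec O τ).bit 9 l' = _
      rw [← ih₄ l' hl']
      funext q
      rw [hout, if_neg (by tauto)]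

theorem solve_spec {m Λ : ℕ} {R₀ : ℕ → Row} (hn : σ.reg 0 = n)
    (hΛ : σ.reg 2 = Λ) (hT : Conjugated m R₀ (σ.tableau n))
    (hlead : ∀ i < n, Leading n (n - 1 - i) ((σ.tableau n).row i)) :
    Conjugated m R₀ ((solve.exec O σ).tableau n) ∧
      Diagonal n Λ (σ.bit 5) ((solve.exec O σ).tableau n) := by
  have hF := exec_frame O solve σ
  have hrow : ((solve.exec O σ).tableau n).row = (σ.tableau n).row := by
    funext i
    ext q <;> simp [Memory.tableau, Memory.row, Memory.bit, hF.arr 0 rfl, hF.arr 1 rfl,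
        hF.arr 2 rfl]
  have hg : ((solve.exec O σ).tableau n).gates = (σ.tableau n).gates :=
    gates_congr (hF.reg 20 rfl) (hF.arr 8 rfl)
  refine ⟨⟨by rw [hrow, hg]; exact hT.act, by rw [hrow]; exact hT.linear⟩, ?_⟩
  refine ⟨fun j hj q hq => by rw [hrow]; exact (hlead j hj).x_eq_false q hq, ?_, ?_⟩
  · rw [hrow]
    have key := loop_inv O (x := 13) (y := 2) (b := solveRow) (fun l₀ τ => ∀ l < l₀, ∀ j < n,
      ((σ.tableau n).row j).syndrome n (τ.bit 9 l) = σ.bit 5 l j) σ (by omega) ?_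
    · rw [hΛ] at key
      exact key
    · intro l₀ hl₀ τ hG hτ ih l hl
      have hrow' : (τ.tableau n).row = (σ.tableau n).row := by
        funext i
        ext q <;> simp [Memory.tableau, Memory.row, Memory.bit, hG.arr 0 rfl, hG.arr 1 rfl,
        hG.arr 2 rfl]
      have h5 : τ.bit 5 = σ.bit 5 := by funext i j; simp [Memory.bit, hG.arr 5 rfl]
      obtain ⟨h₁, h₂⟩ := solveRow_spec O τ (n := n) ((hG.reg 0 rfl).trans hn) hτ
        (by rw [hrow']; exact hlead)
      rw [hrow', h5] at h₁
      change ∀ j < n, ((σ.tableau n).row j).syndrome n ((solveRow.exec O τ).bit 9 l) = σ.bit 5 l j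
      rcases (Nat.lt_succ_iff.1 hl).lt_or_eq with hl | rfl
      · rw [h₂ l hl.ne]
        exact ih l hl
      · exact h₁
  · intro b b' h
    exact injective_of_leading (T := σ.tableau n) hlead b b' (by rwa [hrow] at h)

end Prog

/-! ### Confining the perturbation to the last qubits. -/

namespace Prog

open Cmd Tableau

variable (O : Oracle) (σ : Memory) {n : ℕ}

theorem hasX_spec {p i : ℕ} (hn : σ.reg 0 = n) (hp : σ.reg 11 = p) (hi : σ.reg 12 = i) :
    (hasX.exec O σ).reg 26 = 0 ↔ ∀ q < n, q < p → ((σ.tableau n).row i).x q = false := by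
  rw [hasX, exec_seq]
  set σ₁ := (setN 26 (.lit 0)).exec O σ with hσ₁
  have hT : σ₁.tableau n = σ.tableau n := Memory.tableau_setReg _ _ (by decide)
  have hn₁ : σ₁.reg 0 = n := by simp [hσ₁, hn]
  rw [← hn₁]
  refine loop_inv O (fun j τ => τ.reg 26 = 0 ↔
    ∀ q < j, q < p → ((σ.tableau n).row i).x q = false) σ₁ (by simp [hσ₁]) ?_
  intro j hj τ hF hτ ih
  have e₁ : τ.reg 12 = i := (hF.reg 12 rfl).trans (by simp [hσ₁, hi])
  have e₂ : τ.reg 11 = p := (hF.reg 11 rfl).trans (by simp [hσ₁, hp])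
  have e₃ : τ.tableau n = σ.tableau n := by
    rw [← hT]
    refine Memory.tableau_congr (hF.reg 20 rfl) fun a ha => ?_
    fin_cases ha <;> exact hF.arr _ rfl
  have hx : τ.arr 0 i j = 0 ↔ ((σ.tableau n).row i).x j = false := by
    rw [← e₃]
    exact bit_row_x τ i j
  by_cases hjp : j < p
  · rw [exec_ite_pos (by simpa [hτ, e₂] using hjp)]
    by_cases hxj : ((σ.tableau n).row i).x j = true
    · rw [exec_ite_neg (by simp [xBit, e₁, hτ, hx, hxj])]
      simp only [exec_setN, Memory.setReg_reg, NExp.eval_lit]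
      simp only [show (26 : ℕ) ≠ 27 by decide, if_false, if_true, one_ne_zero, false_iff]
      exact fun h => by simp [h j (by omega) hjp] at hxj
    · rw [exec_ite_pos (by simpa [xBit, e₁, hτ, hx] using hxj)]
      simp only [exec_skip, Memory.setReg_reg, show (26 : ℕ) ≠ 27 by decide, if_false, ih]
      refine ⟨fun h q hq hqp => ?_, fun h q hq hqp => h q (by omega) hqp⟩
      rcases (Nat.lt_succ_iff.1 hq).lt_or_eq with hq | rfl
      · exact h q hq hqp
      · simpa using hxj
  · rw [exec_ite_neg (by simpa [hτ, e₂] using hjp)]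
    simp only [exec_skip, Memory.setReg_reg, show (26 : ℕ) ≠ 27 by decide, if_false, ih]
    exact ⟨fun h q hq hqp => h q (by omega) hqp, fun h q hq hqp => h q (by omega) hqp⟩

end Prog

namespace Tableau

variable {n m Λ : ℕ}

/-- The `x` parts of the first `i` rows are supported on the last `r` qubits, and `piv a` is a
row with leading `x` bit at `n - 1 - a`. -/
structure Compressed (n i r : ℕ) (piv : ℕ → ℕ) (T : Tableau n) : Prop where
  le : r ≤ n
  x_eq_false : ∀ j < i, ∀ q < n - r, (T.row j).x q = false
  pivot_lt : ∀ a < r, piv a < i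
  pivot_self : ∀ a < r, (T.row (piv a)).x (n - 1 - a) = true
  pivot_of_lt : ∀ a < r, ∀ q < n - 1 - a, (T.row (piv a)).x q = false

/-- The `x` bits of the pivot rows at the last `r` qubits form a triangular matrix with ones on the
diagonal. As conjugation is linear on unsigned strings, the independence passes back to the original
rows. -/
theorem Compressed.linearIndependent {r : ℕ} {piv : ℕ → ℕ} {T : Tableau n} {R₀ : ℕ → Row}
    (h : Compressed n m r piv T) (hT : Conjugated m R₀ T) :
    LinearIndependent (ZMod 2) fun a : Fin r => (R₀ (piv a)).pauli n := by
  obtain ⟨Φ, -, hΦr⟩ := hT.linear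
  have hr := h.le
  let π : Pauli n →ₗ[ZMod 2] (Fin r → ZMod 2) :=
    { toFun := fun p b => (p ⟨n - 1 - b, by omega⟩).1
      map_add' := fun _ _ => rfl
      map_smul' := fun _ _ => rfl }
  refine LinearIndependent.of_comp (π ∘ₗ Φ) ?_
  let A : Matrix (Fin r) (Fin r) (ZMod 2) := fun a => π ((T.row (piv a)).pauli n)
  have e : (π ∘ₗ Φ) ∘ (fun a : Fin r => (R₀ (piv a)).pauli n) = A.row := by
    funext a
    simp only [Function.comp_apply, LinearMap.comp_apply, ← hΦr _ (h.pivot_lt a a.2)]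
    rfl
  rw [e]
  refine Matrix.linearIndependent_rows_of_det_ne_zero (A := A) ?_
  rw [Matrix.det_of_isLowerTriangular A]
  · rw [Finset.prod_eq_one]
    · exact one_ne_zero
    · intro a _
      simp [A, π, Row.pauli, h.pivot_self a a.2]
  · intro a b hab
    have hab' : (a : ℕ) < b := hab
    simp [A, π, Row.pauli, h.pivot_of_lt a a.2 (n - 1 - b) (by omega)]

end Tableau

namespace Prog

open Cmd Tableau

variable (O : Oracle) (σ : Memory) {n : ℕ}

/-- The rows already treated have no `x` bits on the first `n - r` qubits, so CNOTs there do not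
change their `x` parts. A row that does have such bits is reduced to the bit at `n - 1 - r` and
becomes a pivot row. As only CNOTs occur, the generators stay diagonal. -/
theorem compress_spec {m Λ : ℕ} {L : ℕ → ℕ → Bool} {R₀ : ℕ → Row} (hn : σ.reg 0 = n)
    (hm : σ.reg 10 = m) (hΛ : σ.reg 2 = Λ) (hnm : n ≤ m) (h4 : σ.reg 4 = 0)
    (hT : Conjugated m R₀ (σ.tableau n)) (hD : Diagonal n Λ L (σ.tableau n)) :
    (compress.exec O σ).reg 11 = n - (compress.exec O σ).reg 4 ∧
      Conjugated m R₀ ((compress.exec O σ).tableau n) ∧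
      Diagonal n Λ L ((compress.exec O σ).tableau n) ∧
      ∃ piv, Compressed n m ((compress.exec O σ).reg 4) piv ((compress.exec O σ).tableau n) := by
  rw [compress, exec_seq]
  set σ₁ := (setN 11 (.var 0)).exec O σ with hσ₁
  have hT₁ : σ₁.tableau n = σ.tableau n := Memory.tableau_setReg _ _ (by decide)
  have hm₁ : σ₁.reg 10 = m := by simp [hσ₁, hm]
  rw [← hT₁] at hT hD
  set b : Cmd := hasX ;; ite (.eq (.var 26) (.lit 0)) skip
      (setN 11 (.pred (.var 11)) ;; reduce ;; setN 4 (.succ (.var 4))) with hb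
  have key := loop_inv O (x := 12) (y := 10) (b := b) (fun i τ => τ.reg 11 = n - τ.reg 4 ∧
      Conjugated m R₀ (τ.tableau n) ∧ Diagonal n Λ L (τ.tableau n) ∧
      ∃ piv, Compressed n i (τ.reg 4) piv (τ.tableau n)) σ₁ ?_ ?_
  · rwa [hm₁] at key
  · rw [Memory.tableau_setReg _ _ (by decide)]
    refine ⟨by simp [hσ₁, hn, h4], hT, hD, id, ?_⟩
    have : (σ₁.setReg 12 0).reg 4 = 0 := by simp [hσ₁, h4]
    rw [this]
    exact ⟨by omega, by omega, by omega, by omega, by omega⟩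
  · intro i hi τ hF hτ ⟨ih₁, ih₂, ih₃, piv, ih₄⟩
    rw [hm₁] at hi
    rw [Memory.tableau_setReg _ _ (by decide), Memory.setReg_reg, Memory.setReg_reg,
      if_neg (by decide), if_neg (by decide)]
    have e₀ : τ.reg 0 = n := (hF.reg 0 rfl).trans (by simp [hσ₁, hn])
    have e₂ : τ.reg 2 = Λ := (hF.reg 2 rfl).trans (by simp [hσ₁, hΛ])
    have e₁₀ : τ.reg 10 = m := (hF.reg 10 rfl).trans hm₁
    have hx := hasX_spec O τ e₀ rfl hτ
    have G := exec_frame O hasX τ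
    rw [hb, exec_seq]
    set τ₁ := hasX.exec O τ with hτ₁
    have t₁ : τ₁.tableau n = τ.tableau n := by
      refine Memory.tableau_congr (G.reg 20 rfl) fun a ha => ?_
      fin_cases ha <;> exact G.arr _ rfl
    set r := τ.reg 4 with hr
    by_cases h26 : τ₁.reg 26 = 0
    · rw [exec_ite_pos (by simpa using h26), exec_skip, t₁, G.reg 4 rfl, G.reg 11 rfl]
      refine ⟨ih₁, ih₂, ih₃, piv, ih₄.le, fun j hj q hq => ?_,
        fun a ha => (ih₄.pivot_lt a ha).trans (by omega), ih₄.pivot_self, ih₄.pivot_of_lt⟩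
      rcases (Nat.lt_succ_iff.1 hj).lt_or_eq with hj | rfl
      · exact ih₄.x_eq_false j hj q hq
      · exact hx.1 h26 q (by omega) (by omega)
    · have hx' := mt hx.2 h26
      push Not at hx'
      obtain ⟨q₀, hq₀, hq₁, hq₂⟩ := hx'
      rw [exec_ite_neg (by simpa using h26), exec_seq, exec_seq]
      set τ₂ := (setN 11 (.pred (.var 11))).exec O τ₁ with hτ₂
      have t₂ : τ₂.tableau n = τ.tableau n := (Memory.tableau_setReg _ _ (by decide)).trans t₁
      have f₂ : ∀ x, x ≠ 11 → τ₂.reg x = τ₁.reg x := fun x hx => by simp [hτ₂, hx]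
      have f₁ : τ₂.reg 11 = n - 1 - r := by
        simp [hτ₂, G.reg 11 rfl, ih₁]
        omega
      obtain ⟨g₁, g₂⟩ := reduce_spec O τ₂ (n := n) (m := m) (Λ := Λ) (p := n - 1 - r) (i := i)
        (by rw [f₂ _ (by decide), G.reg 0 rfl, e₀]) (by rw [f₂ _ (by decide), G.reg 10 rfl, e₁₀])
        (by rw [f₂ _ (by decide), G.reg 2 rfl, e₂]) f₁ (by omega)
        (by rw [f₂ _ (by decide), G.reg 12 rfl, hτ]) hi
        ⟨q₀, by omega, by rw [t₂]; simpa using hq₂⟩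
      rw [t₂] at g₁
      have F := exec_frame O reduce τ₂
      set τ₃ := reduce.exec O τ₂ with hτ₃
      have t₃ : ((setN 4 (.succ (.var 4))).exec O τ₃).tableau n = τ₃.tableau n :=
        Memory.tableau_setReg _ _ (by decide)
      have r₃ : τ₃.reg 4 = r := by rw [F.reg 4 rfl, f₂ _ (by decide), G.reg 4 rfl]
      have r₄ : ((setN 4 (.succ (.var 4))).exec O τ₃).reg 4 = r + 1 := by simp [r₃]
      have r₅ : ((setN 4 (.succ (.var 4))).exec O τ₃).reg 11 = n - 1 - r := by
        rw [exec_setN, Memory.setReg_reg, if_neg (by decide), F.reg 11 rfl, f₁]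
      rw [t₃, r₄, r₅]
      have hle := ih₄.le
      have hxs : ∀ j < i, ((τ₃.tableau n).row j).x = ((τ.tableau n).row j).x := fun j hj =>
        g₁.x_eq_self (by omega) fun q hq => ih₄.x_eq_false j hj q (by omega)
      refine ⟨by omega, ih₂.steps g₁, g₁.induct (Diagonal n Λ L)
        (fun _ _ h hD => hD.step (fun _ h => h.2) hnm h) ih₃, Function.update piv r i, by omega,
        fun j hj q hq => ?_, fun a ha => ?_, fun a ha => ?_, fun a ha q hq => ?_⟩
      · rcases (Nat.lt_succ_iff.1 hj).lt_or_eq with hj | rfl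
        · rw [hxs j hj]
          exact ih₄.x_eq_false j hj q (by omega)
        · rw [g₂ q (by omega)]
          simp
          omega
      · rcases (Nat.lt_succ_iff.1 ha).lt_or_eq with ha | rfl
        · rw [Function.update_of_ne ha.ne]
          exact (ih₄.pivot_lt a ha).trans (by omega)
        · simp
      · rcases (Nat.lt_succ_iff.1 ha).lt_or_eq with ha | rfl
        · rw [Function.update_of_ne ha.ne, hxs _ (ih₄.pivot_lt a ha)]
          exact ih₄.pivot_self a ha
        · rw [Function.update_self, g₂ _ le_rfl]
          simp
      · rcases (Nat.lt_succ_iff.1 ha).lt_or_eq with ha | rfl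
        · rw [Function.update_of_ne ha.ne, hxs _ (ih₄.pivot_lt a ha)]
          exact ih₄.pivot_of_lt a ha q hq
        · rw [Function.update_self, g₂ _ hq.le]
          simp
          omega

theorem copyRows_spec {k : ℕ} (hn : σ.reg 0 = n) (hk : σ.reg 1 = k) :
    (copyRows.exec O σ).reg 10 = n + k ∧ ∀ i < n + k, ∀ q < n,
      (copyRows.exec O σ).arr 0 i q = (if i < n then σ.arr 0 i q else σ.arr 3 (i - n) q) ∧
      (copyRows.exec O σ).arr 1 i q = (if i < n then σ.arr 1 i q else σ.arr 4 (i - n) q) := by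
  rw [copyRows, exec_seq]
  set σ₁ := (setN 10 (.var 0)).exec O σ with hσ₁
  have hk₁ : σ₁.reg 1 = k := by simp [hσ₁, hk]
  set b₀ : Cmd := setA 0 (.var 10) (.var 14) (.arr 3 (.var 13) (.var 14)) ;;
      setA 1 (.var 10) (.var 14) (.arr 4 (.var 13) (.var 14)) with hb₀
  have key := loop_inv O (x := 13) (y := 1) (b := loop 14 0 b₀ ;; setN 10 (.succ (.var 10)))
    (fun j τ => τ.reg 10 = n + j ∧ ∀ i < n + j, ∀ q < n,
      τ.arr 0 i q = (if i < n then σ.arr 0 i q else σ.arr 3 (i - n) q) ∧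
      τ.arr 1 i q = (if i < n then σ.arr 1 i q else σ.arr 4 (i - n) q)) σ₁ ?_ ?_
  · rwa [hk₁] at key
  · refine ⟨by simp [hσ₁, hn], fun i hi q _ => ?_⟩
    simp [hσ₁, show i < n by omega]
  · intro j _ τ hF hτ ⟨ih₁, ih₂⟩
    have e₀ : τ.reg 0 = n := (hF.reg 0 rfl).trans (by simp [hσ₁, hn])
    have a₃ : τ.arr 3 = σ.arr 3 := hF.arr 3 rfl
    have a₄ : τ.arr 4 = σ.arr 4 := hF.arr 4 rfl
    have h := loop_inv O (x := 14) (y := 0) (b := b₀) (fun q₀ υ => ∀ i q, (i < n + j →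
      υ.arr 0 i q = τ.arr 0 i q ∧ υ.arr 1 i q = τ.arr 1 i q) ∧ (i = n + j → q < q₀ →
      υ.arr 0 i q = σ.arr 3 j q ∧ υ.arr 1 i q = σ.arr 4 j q)) τ
      (fun i q => ⟨fun _ => ⟨rfl, rfl⟩, by omega⟩) (by
        intro q₀ _ υ hG hυ ihυ i q
        have e₁₀ : υ.reg 10 = n + j := (hG.reg 10 rfl).trans ih₁
        have e₁₃ : υ.reg 13 = j := (hG.reg 13 rfl).trans hτ
        have b₃ : υ.arr 3 = σ.arr 3 := (hG.arr 3 rfl).trans a₃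
        have b₄ : υ.arr 4 = σ.arr 4 := (hG.arr 4 rfl).trans a₄
        refine ⟨fun hi => ?_, fun hi hq => ?_⟩
        · simp [hb₀, e₁₀, hi.ne, (ihυ i q).1 hi]
        · by_cases hqq : q = q₀
          · simp [hb₀, e₁₀, e₁₃, hυ, hi, hqq, b₃, b₄]
          · simpa [hb₀, e₁₀, e₁₃, hυ, hi, hqq] using (ihυ i q).2 hi (by omega))
    rw [e₀] at h
    have G := exec_frame O (loop 14 0 b₀) τ
    refine ⟨by simp [G.reg 10 rfl, ih₁]; omega, fun i hi q hq => ?_⟩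
    simp only [exec_seq, exec_setN, Memory.setReg_arr]
    by_cases hij : i < n + j
    · obtain ⟨h₁, h₂⟩ := (h i q).1 hij
      rw [h₁, h₂]
      exact ih₂ i hij q hq
    · obtain ⟨h₁, h₂⟩ := (h i q).2 (by omega) hq
      rw [h₁, h₂, if_neg (by omega), if_neg (by omega), show i - n = j by omega]
      exact ⟨rfl, rfl⟩

/-- Conjugation accumulates gates on the right: the gate found last acts first on a vector, whereas
the output lists the gates in the order of application. -/
theorem writeCircuit_spec : circuit n (writeCircuit.exec O σ) = (σ.gates n).reverse := by
  set Γ := σ.reg 20 with hΓ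
  rw [writeCircuit, exec_seq, exec_seq]
  set σ₁ := (setN 21 (.var 20)).exec O σ with hσ₁
  have hΓ₁ : σ₁.reg 20 = Γ := by simp [hσ₁, hΓ]
  set b : Cmd := setN 21 (.pred (.var 21)) ;;
    setA 6 (.var 23) (.lit 0) (.arr 8 (.var 21) (.lit 0)) ;;
    setA 6 (.var 23) (.lit 1) (.arr 8 (.var 21) (.lit 1)) ;;
    setA 6 (.var 23) (.lit 2) (.arr 8 (.var 21) (.lit 2)) with hb
  have key := loop_inv O (x := 23) (y := 20) (b := b) (fun t τ => τ.reg 21 = Γ - t ∧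
    ∀ t' < t, ∀ c < 3, τ.arr 6 t' c = σ.arr 8 (Γ - 1 - t') c) σ₁ ⟨by simp [hσ₁, hΓ], by omega⟩ (by
      intro t ht τ hF hτ ⟨ih₁, ih₂⟩
      have a₈ : τ.arr 8 = σ.arr 8 := hF.arr 8 rfl
      refine ⟨by simp [hb, ih₁]; omega, fun t' ht' c hc => ?_⟩
      by_cases htt : t' = t
      · subst htt
        rw [show Γ - 1 - t' = Γ - t' - 1 by omega]
        interval_cases c <;> simp [hb, hτ, ih₁, a₈]
      · have := ih₂ t' (by omega) c hc
        simpa [hb, hτ, htt] using this)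
  rw [hΓ₁] at key
  have F := exec_frame O (loop 23 20 b) σ₁
  have h5 : ((setN 5 (.var 20)).exec O ((loop 23 20 b).exec O σ₁)).reg 5 = Γ := by
    simp [F.reg 20 rfl, hΓ₁]
  simp only [circuit, h5, Memory.gates, ← hΓ]
  apply List.ext_getElem
  · simp
  · intro t h₁ h₂
    simp only [List.length_map, List.length_range] at h₁
    simp only [List.getElem_reverse, List.getElem_map, List.getElem_range, List.length_map,
      List.length_range, exec_setN, Memory.setReg_arr]
    rw [key.2 t h₁ 0 (by omega), key.2 t h₁ 1 (by omega), key.2 t h₁ 2 (by omega)]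

end Prog

/-- A label as a function on all natural numbers. -/
def Label.extend {n : ℕ} (a : Label n) (q : ℕ) : Bool := if h : q < n then a ⟨q, h⟩ else false

theorem Label.extend_val {n : ℕ} (a : Label n) (q : Fin n) : Label.extend a q = a q := by
  simp [Label.extend]

/-- The action of a circuit as a linear map. -/
def circuitLinear {n : ℕ} (l : List (Gate n)) : (Label n → ℂ) →ₗ[ℂ] (Label n → ℂ) where
  toFun := circuitAct l
  map_add' ψ φ := by
    induction l with
    | nil => rfl
    | cons u l ih => exact (congrArg u.act ih).trans (u.act_add _ _)
  map_smul' c ψ := by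
    induction l with
    | nil => rfl
    | cons u l ih => exact (congrArg u.act ih).trans (u.act_smul _ _)

theorem circuitLinear_apply {n : ℕ} (l : List (Gate n)) (ψ : Label n → ℂ) :
    circuitLinear l ψ = circuitAct l ψ := rfl

/-- The syndrome of a label. -/
def Tableau.syndrome {n : ℕ} (T : Tableau n) (a : Label n) : Label n :=
  fun j => (T.row j).syndrome n (Label.extend a)

/-! ### The Hamiltonian in the reduced frame and its blocks. -/

namespace Model

variable {n k : ℕ} (M : Model n k)

/-- The tableau represents the model in a frame in which the generators are diagonal and the
perturbation acts on the last `r` qubits. -/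
structure Reduced (Λ : ℕ) (L : ℕ → ℕ → Bool) (r : ℕ) (T : Tableau n) : Prop where
  le : r ≤ n
  le_dimK : r ≤ M.dimK
  generator : ∀ (j : Fin n) (ψ : Label n → ℂ),
    (M.g j).mulVec (circuitAct T.gates ψ) = circuitAct T.gates ((T.row j).act ψ)
  perturbation : ∀ (i : Fin k) (ψ : Label n → ℂ),
    (M.P i).matrix.mulVec (circuitAct T.gates ψ) = circuitAct T.gates ((T.row (n + i)).act ψ)
  diagonal : T.Diagonal n Λ L
  x_eq_false : ∀ i < n + k, ∀ q < n - r, (T.row i).x q = false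

/-- The perturbation in the frame of a tableau. -/
def framePerturbation (T : Tableau n) (ψ : Label n → ℂ) : Label n → ℂ :=
  ∑ i : Fin k, (M.γ i : ℂ) • (T.row (n + i)).act ψ

/-- The Hamiltonian in the frame of a tableau. -/
def frameH (T : Tableau n) (ψ : Label n → ℂ) : Label n → ℂ :=
  (fun a => (M.energy (T.syndrome a) : ℂ) * ψ a) + M.framePerturbation T ψ

namespace Reduced

variable {M} {Λ r : ℕ} {L : ℕ → ℕ → Bool} {T : Tableau n}

/-- The circuit carries each basis vector to a joint eigenvector of the generators whose syndrome is
that of the label, and `H₀_mulVec` gives its energy. The general case follows by linearity. -/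
theorem H₀_circuit (h : M.Reduced Λ L r T) (ψ : Label n → ℂ) :
    M.H₀.mulVec (circuitAct T.gates ψ) =
      circuitAct T.gates fun a => (M.energy (T.syndrome a) : ℂ) * ψ a := by
  have hb : ∀ b : Label n, M.H₀.mulVec (circuitAct T.gates (Pi.single b 1)) =
      (M.energy (T.syndrome b) : ℂ) • circuitAct T.gates (Pi.single b 1) := by
    intro b
    refine M.H₀_mulVec _ _ fun j => ?_
    rw [h.generator, ← circuitLinear_apply, ← circuitLinear_apply, ← map_smul]
    congr 1
    funext a
    rw [Row.act_of_x_eq_false (h.diagonal.x_eq_false j j.2)]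
    by_cases hab : a = b
    · subst hab
      rfl
    · simp [hab]
  have e : ∀ φ : Label n → ℂ, circuitAct T.gates φ =
      ∑ b, φ b • circuitAct T.gates (Pi.single b 1) := by
    intro φ
    conv_lhs => rw [pi_eq_sum_univ' φ, ← circuitLinear_apply, map_sum]
    refine Finset.sum_congr rfl fun b _ => ?_
    rw [map_smul]
    rfl
  rw [e ψ, e fun a => (M.energy (T.syndrome a) : ℂ) * ψ a, Matrix.mulVec_sum]
  refine Finset.sum_congr rfl fun b _ => ?_
  rw [Matrix.mulVec_smul, hb, smul_smul, mul_comm]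

theorem δH_circuit (h : M.Reduced Λ L r T) (ψ : Label n → ℂ) :
    M.δH.mulVec (circuitAct T.gates ψ) = circuitAct T.gates (M.framePerturbation T ψ) := by
  rw [δH, Matrix.sum_mulVec, framePerturbation, ← circuitLinear_apply T.gates (∑ i, _), map_sum]
  refine Finset.sum_congr rfl fun i _ => ?_
  rw [Matrix.smul_mulVec, h.perturbation, map_smul]
  rfl

theorem H_circuit (h : M.Reduced Λ L r T) (ψ : Label n → ℂ) :
    M.H.mulVec (circuitAct T.gates ψ) = circuitAct T.gates (M.frameH T ψ) := by
  rw [H, Matrix.add_mulVec, h.H₀_circuit, h.δH_circuit, frameH, ← circuitLinear_apply,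
    ← circuitLinear_apply, ← circuitLinear_apply, map_add]

theorem asOperator_H (h : M.Reduced Λ L r T) (ψ : Qubits n) :
    asOperator M.H (circuitIsometry T.gates ψ) =
      circuitIsometry T.gates (WithLp.toLp 2 (M.frameH T ψ)) := by
  rw [circuitIsometry_apply, circuitIsometry_apply, ← h.H_circuit]
  rfl

/-- The frame is related to the original space by an isometry, so the operator norm bound carries
over. -/
theorem norm_framePerturbation (h : M.Reduced Λ L r T) (ψ : Label n → ℂ) :
    ‖WithLp.toLp 2 (M.framePerturbation T ψ)‖ ≤ M.normδH * ‖WithLp.toLp 2 ψ‖ := by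
  have := (asOperator M.δH).le_opNorm (circuitIsometry T.gates (WithLp.toLp 2 ψ))
  rw [LinearIsometry.norm_map] at this
  refine le_trans (le_of_eq ?_) this
  rw [← (circuitIsometry T.gates).norm_map, circuitIsometry_apply, circuitIsometry_apply,
    ← h.δH_circuit]
  rfl

/-- Rows of the tableau preserve the blocks. -/
theorem move_eq (h : M.Reduced Λ L r T) {i : ℕ} (hi : i < n + k) (a : Label n) {q : Fin n}
    (hq : (q : ℕ) < n - r) : (T.row i).move a q = a q := by
  simp [Row.move, h.x_eq_false i hi q hq]

theorem frameH_apply (T : Tableau n) (ψ : Label n → ℂ) (a : Label n) : M.frameH T ψ a =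
    (M.energy (T.syndrome a) : ℂ) * ψ a + ∑ i : Fin k, (M.γ i : ℂ) *
      ((T.row (n + i)).phase a * ψ ((T.row (n + i)).move a)) := by
  simp [frameH, framePerturbation, Row.act]

/-- The labels that agree with `x` on the first `n - r` qubits. -/
def _root_.StabPert.InBlock (n r : ℕ) (x : ℕ → Bool) (a : Label n) : Prop :=
  ∀ q : Fin n, (q : ℕ) < n - r → a q = x q

theorem inBlock_move (h : M.Reduced Λ L r T) {i : ℕ} (hi : i < n + k) (a : Label n)
    (x : ℕ → Bool) : InBlock n r x ((T.row i).move a) ↔ InBlock n r x a := by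
  refine forall_congr' fun q => ?_
  refine ⟨fun h' hq => ?_, fun h' hq => ?_⟩
  · rw [← h' hq, h.move_eq hi a hq]
  · rw [← h' hq, h.move_eq hi a hq]

open Classical in
/-- The component of a vector in a block. -/
def _root_.StabPert.blockPart (r : ℕ) (x : ℕ → Bool) (ψ : Label n → ℂ) : Label n → ℂ :=
  fun a => if InBlock n r x a then ψ a else 0

/-- The unperturbed part is diagonal and the perturbing strings keep the first `n - r` bits of a
label, so the Hamiltonian commutes with the projection to a block. -/
theorem frameH_blockPart (h : M.Reduced Λ L r T) (x : ℕ → Bool) (ψ : Label n → ℂ) :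
    M.frameH T (blockPart r x ψ) = blockPart r x (M.frameH T ψ) := by
  classical
  funext a
  rw [frameH_apply]
  by_cases ha : InBlock n r x a
  · rw [blockPart, if_pos ha, blockPart, if_pos ha, frameH_apply]
    congr 1
    refine Finset.sum_congr rfl fun i _ => ?_
    rw [blockPart, if_pos ((h.inBlock_move (by omega) a x).2 ha)]
  · rw [blockPart, if_neg ha, blockPart, if_neg ha, mul_zero, zero_add]
    refine Finset.sum_eq_zero fun i _ => ?_
    rw [blockPart, if_neg (mt (h.inBlock_move (by omega) a x).1 ha), mul_zero, mul_zero]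

/-- A block that meets an eigenvector contains a label whose unperturbed energy is close to the
eigenvalue. -/
theorem exists_energy_near (h : M.Reduced Λ L r T) {E : ℝ} {ψ : Label n → ℂ}
    (hψ : M.frameH T ψ = (E : ℂ) • ψ) {a₀ : Label n} (ha₀ : ψ a₀ ≠ 0) {x : ℕ → Bool}
    (hx : InBlock n r x a₀) :
    ∃ a, InBlock n r x a ∧ |M.energy (T.syndrome a) - E| ≤ M.normδH := by
  classical
  by_contra! hc
  set φ := blockPart r x ψ with hφ
  have h₁ : M.frameH T φ = (E : ℂ) • φ := by
    rw [hφ, h.frameH_blockPart, hψ]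
    funext a
    simp [blockPart]
  -- The eigenvalue equation of the block component, with the diagonal part moved to the other side.
  have h₂ : ∀ a, M.framePerturbation T φ a = ((E - M.energy (T.syndrome a) : ℝ) : ℂ) * φ a := by
    intro a
    have := congrFun h₁ a
    simp only [frameH, Pi.add_apply, Pi.smul_apply, smul_eq_mul] at this
    push_cast
    linear_combination this
  have h₃ := h.norm_framePerturbation φ
  have h₀ : 0 ≤ M.normδH := norm_nonneg _
  have h₄ := pow_le_pow_left₀ (norm_nonneg _) h₃ 2
  rw [mul_pow, EuclideanSpace.norm_sq_eq, EuclideanSpace.norm_sq_eq, Finset.mul_sum] at h₄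
  simp only at h₄
  -- Under the negated claim every factor `|E - energy|` in the block exceeds the norm of `δH`, so
  -- the right side has the larger square norm; the inequality is strict at `a₀`, where the
  -- component does not vanish.
  refine absurd h₄ (not_le.2 (Finset.sum_lt_sum (fun a _ => ?_) ⟨a₀, Finset.mem_univ _, ?_⟩))
  · rw [h₂, norm_mul, mul_pow]
    by_cases ha : InBlock n r x a
    · gcongr
      rw [Complex.norm_real, Real.norm_eq_abs, abs_sub_comm]
      exact (hc a ha).le
    · simp [hφ, blockPart, ha]
  · rw [h₂, norm_mul, mul_pow]
    have : 0 < ‖φ a₀‖ ^ 2 := by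
      have : φ a₀ ≠ 0 := by simpa [hφ, blockPart, hx] using ha₀
      positivity
    refine mul_lt_mul_of_pos_right ?_ this
    rw [Complex.norm_real, Real.norm_eq_abs, abs_sub_comm]
    exact pow_lt_pow_left₀ (hc a₀ hx) h₀ two_ne_zero

end Reduced

end Model

/-! ### From the input to a reduced tableau. -/

namespace Prog

open Cmd Tableau

variable {n k : ℕ} (M : Model n k) (E₀ E₁ : ℝ) (Λ : List (Label n)) (O : Oracle)

theorem row_of_lt {σ : Memory} (hσ : σ = copyRows.exec O (M.input E₀ E₁ Λ)) (j : Fin n) :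
    (σ.row j).s = M.sgn j ∧ (∀ q : Fin n, (σ.row j).x q = decide ((M.gen j q).1 ≠ 0)) ∧
      ∀ q : Fin n, (σ.row j).z q = decide ((M.gen j q).2 ≠ 0) := by
  have h := (copyRows_spec O (M.input E₀ E₁ Λ) (n := n) (k := k) rfl rfl).2 j (by omega)
  have h₂ := (exec_frame O copyRows (M.input E₀ E₁ Λ)).arr 2 rfl
  rw [← hσ] at h h₂
  refine ⟨?_, fun q => ?_, fun q => ?_⟩
  · cases hs : M.sgn j <;> simp [Memory.row, Memory.bit, h₂, Model.input, ofBit, hs]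
  · simp [Memory.row, Memory.bit, (h q q.2).1, Model.input, toBit]
  · simp [Memory.row, Memory.bit, (h q q.2).2, Model.input, toBit]

theorem row_of_ge {σ : Memory} (hσ : σ = copyRows.exec O (M.input E₀ E₁ Λ)) (i : Fin k) :
    (σ.row (n + i)).s = false ∧
      (∀ q : Fin n, (σ.row (n + i)).x q = decide ((M.P i q).1 ≠ 0)) ∧
      ∀ q : Fin n, (σ.row (n + i)).z q = decide ((M.P i q).2 ≠ 0) := by
  have h := (copyRows_spec O (M.input E₀ E₁ Λ) (n := n) (k := k) rfl rfl).2 (n + i) (by omega)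
  have h₂ := (exec_frame O copyRows (M.input E₀ E₁ Λ)).arr 2 rfl
  rw [← hσ] at h h₂
  refine ⟨?_, fun q => ?_, fun q => ?_⟩
  · simp [Memory.row, Memory.bit, h₂, Model.input]
  · simp [Memory.row, Memory.bit, (h q q.2).1, Model.input, toBit]
  · simp [Memory.row, Memory.bit, (h q q.2).2, Model.input, toBit]

theorem pauli_eq {p : Pauli n} {R : Row} (hx : ∀ q : Fin n, R.x q = decide ((p q).1 ≠ 0))
    (hz : ∀ q : Fin n, R.z q = decide ((p q).2 ≠ 0)) : R.pauli n = p := by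
  have h : ∀ y : ZMod 2, (if y = 0 then 0 else 1) = y := by decide
  funext q
  simp [Row.pauli, hx, hz, h]

theorem g_mulVec {σ : Memory} (hσ : σ = copyRows.exec O (M.input E₀ E₁ Λ)) (j : Fin n)
    (ψ : Label n → ℂ) : (M.g j).mulVec ψ = (σ.row j).act ψ := by
  obtain ⟨h₁, h₂, h₃⟩ := row_of_lt M E₀ E₁ Λ O hσ j
  rw [Model.g, Matrix.smul_mulVec,
    Pauli.matrix_mulVec (M.gen j) (R := ⟨false, (σ.row j).x, (σ.row j).z⟩) rfl h₂ h₃]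
  funext a
  have e : (⟨false, (σ.row j).x, (σ.row j).z⟩ : Row).move a = (σ.row j).move a := rfl
  simp only [Pi.smul_apply, smul_eq_mul, Row.act, Row.phase, h₁, bitSign, e]
  simp

theorem P_mulVec {σ : Memory} (hσ : σ = copyRows.exec O (M.input E₀ E₁ Λ)) (i : Fin k)
    (ψ : Label n → ℂ) : (M.P i).matrix.mulVec ψ = (σ.row (n + i)).act ψ := by
  obtain ⟨h₁, h₂, h₃⟩ := row_of_ge M E₀ E₁ Λ O hσ i
  exact Pauli.matrix_mulVec (M.P i) h₁ h₂ h₃ ψ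

theorem g_comm (i j : Fin n) : M.g i * M.g j = M.g j * M.g i := by
  simp only [Model.g, smul_mul_assoc, mul_smul_comm, (M.gen_commute i j).eq]
  rw [smul_comm]

/-- The initial rows act as the generators and perturbing strings with the empty circuit; the three
passes then preserve conjugacy and establish triangularity, the labels and the confinement of the
`x` parts in turn. -/
theorem reduction_spec : ∃ r,
    ((copyRows ;; reduction).exec O (M.input E₀ E₁ Λ)).reg 4 = r ∧
    ((copyRows ;; reduction).exec O (M.input E₀ E₁ Λ)).reg 11 = n - r ∧
    M.Reduced Λ.length ((M.input E₀ E₁ Λ).bit 5) r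
      (((copyRows ;; reduction).exec O (M.input E₀ E₁ Λ)).tableau n) := by
  rw [exec_seq, reduction, exec_seq, exec_seq]
  set σ₀ := M.input E₀ E₁ Λ with hσ₀
  set σ := copyRows.exec O σ₀ with hσ
  have F := exec_frame O copyRows σ₀
  have hm : σ.reg 10 = n + k := (copyRows_spec O σ₀ rfl rfl).1
  have hn : σ.reg 0 = n := F.reg 0 rfl
  have hΛ : σ.reg 2 = Λ.length := F.reg 2 rfl
  have hT : Conjugated (n + k) σ.row (σ.tableau n) := by
    have h20 : σ.reg 20 = 0 := F.reg 20 rfl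
    have hg : (σ.tableau n).gates = [] := by simp [Memory.tableau, Memory.gates, h20]
    refine ⟨fun i hi ψ => ?_, LinearMap.id, Function.injective_id, fun i hi => rfl⟩
    rw [hg]
    rfl
  have hcomm : ∀ i < n, ∀ j < n, ∀ ψ : Label n → ℂ,
      (σ.row i).act ((σ.row j).act ψ) = (σ.row j).act ((σ.row i).act ψ) := by
    intro i hi j hj ψ
    have h₁ := fun ψ => g_mulVec M E₀ E₁ Λ O hσ ⟨i, hi⟩ ψ
    have h₂ := fun ψ => g_mulVec M E₀ E₁ Λ O hσ ⟨j, hj⟩ ψ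
    simp only at h₁ h₂
    rw [← h₁, ← h₂, ← h₁, ← h₂, Matrix.mulVec_mulVec, Matrix.mulVec_mulVec, g_comm]
  have hind : LinearIndependent (ZMod 2) fun i : Fin n => (σ.row i).pauli n := by
    have : (fun i : Fin n => (σ.row i).pauli n) = M.gen := by
      funext j
      obtain ⟨-, h₂, h₃⟩ := row_of_lt M E₀ E₁ Λ O hσ j
      exact pauli_eq h₂ h₃
    rw [this]
    exact M.gen_independent
  obtain ⟨d₁, d₂⟩ := diagonalize_spec O σ hn hm hΛ (by omega) hT hcomm hind
  have G := exec_frame O diagonalize σ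
  set σ₁ := diagonalize.exec O σ with hσ₁
  obtain ⟨s₁, s₂⟩ := solve_spec O σ₁ ((G.reg 0 rfl).trans hn) ((G.reg 2 rfl).trans hΛ) d₁ d₂
  have H := exec_frame O solve σ₁
  set σ₂ := solve.exec O σ₁ with hσ₂
  obtain ⟨c₁, c₂, c₃, piv, c₄⟩ := compress_spec O σ₂ (m := n + k)
    ((H.reg 0 rfl).trans ((G.reg 0 rfl).trans hn)) ((H.reg 10 rfl).trans ((G.reg 10 rfl).trans hm))
    ((H.reg 2 rfl).trans ((G.reg 2 rfl).trans hΛ)) (by omega)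
    ((H.reg 4 rfl).trans ((G.reg 4 rfl).trans (F.reg 4 rfl))) s₁ s₂
  set σ₃ := compress.exec O σ₂ with hσ₃
  have h5 : σ₁.bit 5 = σ₀.bit 5 := by
    funext i j
    simp only [Memory.bit, G.arr 5 rfl]
    exact congrArg (fun A => toBit (A i j)) (F.arr 5 rfl)
  rw [h5] at c₃
  refine ⟨_, rfl, c₁, c₄.le, ?_, fun j ψ => ?_, fun i ψ => ?_, c₃, c₄.x_eq_false⟩
  · have hpiv : ∀ a : Fin (σ₃.reg 4), ∃ i : Fin k, piv a = n + i := by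
      intro a
      have h₁ := c₄.pivot_lt a a.2
      have h₂ := c₄.pivot_self a a.2
      have hle := c₄.le
      have h₃ : n ≤ piv a := by
        by_contra hlt
        rw [c₃.x_eq_false _ (by omega) _ (by omega)] at h₂
        cases h₂
      exact ⟨⟨piv a - n, by omega⟩, by simp; omega⟩
    choose f hf using hpiv
    have hli := c₄.linearIndependent c₂
    have e : (fun a : Fin (σ₃.reg 4) => (σ.row (piv a)).pauli n) = fun a => M.P (f a) := by
      funext a
      obtain ⟨-, h₂, h₃⟩ := row_of_ge M E₀ E₁ Λ O hσ (f a)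
      rw [hf]
      exact pauli_eq h₂ h₃
    rw [e] at hli
    have hli' : LinearIndependent (ZMod 2) fun a : Fin (σ₃.reg 4) =>
        (⟨M.P (f a), Submodule.subset_span ⟨f a, rfl⟩⟩ :
          Submodule.span (ZMod 2) (Set.range M.P)) :=
      LinearIndependent.of_comp (Submodule.subtype _) hli
    simpa [Model.dimK] using hli'.fintype_card_le_finrank
  · rw [g_mulVec M E₀ E₁ Λ O hσ]
    exact c₂.act j (by omega) ψ
  · rw [P_mulVec M E₀ E₁ Λ O hσ]
    exact c₂.act (n + i) (by omega) ψ

end Prog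

namespace CExp

variable (σ : Memory) (c d : CExp)

@[simp] theorem eval_zero : (CExp.zero).eval σ = 0 := rfl

@[simp] theorem eval_one : (CExp.one).eval σ = 1 := rfl

@[simp] theorem eval_imag : (CExp.imag).eval σ = Complex.I := rfl

@[simp] theorem eval_var (x : ℕ) : (CExp.var x).eval σ = σ.num x := rfl

@[simp] theorem eval_arr (a : ℕ) (i j : NExp) :
    (CExp.arr a i j).eval σ = σ.numArr a (i.eval σ) (j.eval σ) := rfl

@[simp] theorem eval_add : (c.add d).eval σ = c.eval σ + d.eval σ := rfl

@[simp] theorem eval_sub : (c.sub d).eval σ = c.eval σ - d.eval σ := rfl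

@[simp] theorem eval_mul : (c.mul d).eval σ = c.eval σ * d.eval σ := rfl

@[simp] theorem eval_div : (c.div d).eval σ = c.eval σ / d.eval σ := rfl

@[simp] theorem eval_conj : c.conj.eval σ = starRingEnd ℂ (c.eval σ) := rfl

@[simp] theorem eval_ite (e f : NExp) :
    (CExp.ite e f c d).eval σ = if e.eval σ = f.eval σ then c.eval σ else d.eval σ := rfl

end CExp

/-! ## Binary numbers -/

/-- The number with binary digits `f 0, …, f (r - 1)`, the lowest first. -/
def binary : ℕ → (ℕ → Bool) → ℕ
  | 0, _ => 0
  | r + 1, f => 2 * binary r (fun m => f (m + 1)) + (f 0).toNat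

theorem binary_lt (r : ℕ) (f : ℕ → Bool) : binary r f < 2 ^ r := by
  induction r generalizing f with
  | zero => simp [binary]
  | succ r ih =>
    have := ih fun m => f (m + 1)
    have := (f 0).toNat_le
    simp only [binary, pow_succ]
    omega

theorem testBit_eq (y m : ℕ) : y.testBit m = toBit (y / 2 ^ m % 2) := by
  rw [Nat.testBit_eq_decide_div_mod_eq, toBit]
  have := Nat.mod_two_eq_zero_or_one (y / 2 ^ m)
  rcases this with h | h <;> simp [h]

theorem testBit_binary {r m : ℕ} (hm : m < r) (f : ℕ → Bool) : (binary r f).testBit m = f m := by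
  induction r generalizing f m with
  | zero => omega
  | succ r ih =>
    cases m with
    | zero =>
      rw [testBit_eq, binary, pow_zero, Nat.div_one]
      cases f 0 <;> simp [Nat.add_mod]
    | succ m =>
      rw [← ih (m := m) (by omega) fun m => f (m + 1), testBit_eq, testBit_eq, pow_succ', ←
        Nat.div_div_eq_div_mul]
      congr 3
      simp only [binary]
      have := (f 0).toNat_le
      cases f 0 <;> simp
      omega

theorem binary_testBit {r y : ℕ} (hy : y < 2 ^ r) : binary r y.testBit = y := by
  refine Nat.eq_of_testBit_eq fun m => ?_
  by_cases hm : m < r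
  · exact testBit_binary hm _
  · rw [Nat.testBit_eq_false_of_lt ((binary_lt _ _).trans_le (Nat.pow_le_pow_right two_pos (by omega))),
      Nat.testBit_eq_false_of_lt (hy.trans_le (Nat.pow_le_pow_right two_pos (by omega)))]

theorem binary_congr {r : ℕ} {f g : ℕ → Bool} (h : ∀ m < r, f m = g m) : binary r f = binary r g := by
  induction r generalizing f g with
  | zero => rfl
  | succ r ih =>
    rw [binary, binary, h 0 (by omega), ih fun m hm => h (m + 1) (by omega)]

theorem sum_binary (r : ℕ) (f : ℕ → Bool) :
    ∑ m ∈ Finset.range r, (if f m then 2 ^ m else 0) = binary r f := by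
  induction r generalizing f with
  | zero => rfl
  | succ r ih =>
    rw [Finset.sum_range_succ', binary, ← ih, Finset.mul_sum]
    congr 1
    · refine Finset.sum_congr rfl fun m _ => ?_
      rw [pow_succ']
      split_ifs <;> simp
    · cases f 0 <;> simp

/-- The number of a label in its block. -/
def blockIndex {n : ℕ} (r : ℕ) (a : Label n) : ℕ := binary r fun m => Label.extend a (n - r + m)

/-- The label with number `y` in the block of `x`. -/
def blockLabel (n r : ℕ) (x : ℕ → Bool) (y : ℕ) : Label n :=
  fun q => if (q : ℕ) < n - r then x q else y.testBit (q - (n - r))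

theorem blockIndex_lt {n : ℕ} (r : ℕ) (a : Label n) : blockIndex r a < 2 ^ r := binary_lt _ _

theorem inBlock_blockLabel (n r : ℕ) (x : ℕ → Bool) (y : ℕ) :
    InBlock n r x (blockLabel n r x y) := fun _ hq => if_pos hq

theorem blockIndex_blockLabel {n r : ℕ} (hr : r ≤ n) (x : ℕ → Bool) {y : ℕ} (hy : y < 2 ^ r) :
    blockIndex r (blockLabel n r x y) = y := by
  conv_rhs => rw [← binary_testBit hy]
  refine binary_congr fun m hm => ?_
  rw [Label.extend, dif_pos (by omega), blockLabel]
  simp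

theorem blockLabel_blockIndex {n r : ℕ} {x : ℕ → Bool} {a : Label n}
    (ha : InBlock n r x a) : blockLabel n r x (blockIndex r a) = a := by
  funext q
  rw [blockLabel]
  split_ifs with hq
  · exact (ha q hq).symm
  · rw [blockIndex, testBit_binary (by omega), Label.extend, dif_pos (by omega)]
    congr 1
    exact Fin.ext (by simp; omega)

theorem blockIndex_eq_sum {n r : ℕ} (hr : r ≤ n) (b : Label n) :
    (∑ q : Fin n, if n - r ≤ (q : ℕ) ∧ b q then 2 ^ ((q : ℕ) - (n - r)) else 0) =
      blockIndex r b := by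
  have : ∀ q : Fin n, (if n - r ≤ (q : ℕ) ∧ b q then 2 ^ ((q : ℕ) - (n - r)) else 0) =
      (fun q : ℕ => if n - r ≤ q ∧ Label.extend b q then 2 ^ (q - (n - r)) else 0) q := by
    intro q
    simp [Label.extend_val]
  have hn : Finset.range n = Finset.range ((n - r) + r) := congrArg _ (by omega)
  rw [Finset.sum_congr rfl fun q _ => this q, Fin.sum_univ_eq_sum_range
    (fun q : ℕ => if n - r ≤ q ∧ Label.extend b q then 2 ^ (q - (n - r)) else 0), hn,
    Finset.sum_range_add, blockIndex, ← sum_binary]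
  rw [Finset.sum_eq_zero, zero_add]
  · simp
  · intro q hq
    have := Finset.mem_range.1 hq
    rw [if_neg (by omega)]

theorem productVector_eq {n r : ℕ} (hr : r ≤ n) (x : ℕ → Bool) (φ : ℕ → ℂ) :
    productVector n r x φ = blockPart r x fun b => φ (blockIndex r b) := by
  classical
  funext b
  simp only [productVector, blockPart, blockIndex_eq_sum hr, InBlock]
  congr 1

/-! ## Loops that compute sums and rows of arrays -/

namespace Cmd

variable (O : Oracle) (σ : Memory)

theorem num_loop_sum {v x y : ℕ} {b : Cmd} (f : ℕ → ℂ)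
    (h : ∀ i < σ.reg y, ∀ τ, Frame (loop x y b) σ τ → τ.reg x = i →
      (b.exec O τ).num v = τ.num v + f i) :
    ((loop x y b).exec O σ).num v = σ.num v + ∑ i ∈ Finset.range (σ.reg y), f i := by
  refine loop_inv O (fun j τ => τ.num v = σ.num v + ∑ i ∈ Finset.range j, f i) σ (by simp) ?_
  intro j hj τ hF hτ ih
  rw [Memory.setReg_num, h j hj τ hF hτ, ih, Finset.sum_range_succ, add_assoc]

/-- The body may use that cells not yet reached have their initial contents; this is needed when a
row is updated in place. -/
theorem numArr_loop_fill {a i₀ x y : ℕ} {b : Cmd} (f : ℕ → ℂ)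
    (h : ∀ j < σ.reg y, ∀ τ, Frame (loop x y b) σ τ → τ.reg x = j →
      (∀ i' j', i' ≠ i₀ ∨ j ≤ j' → τ.numArr a i' j' = σ.numArr a i' j') →
      ∀ i' j', (b.exec O τ).numArr a i' j' = if i' = i₀ ∧ j' = j then f j else τ.numArr a i' j')
    (i' j' : ℕ) : ((loop x y b).exec O σ).numArr a i' j' =
      if i' = i₀ ∧ j' < σ.reg y then f j' else σ.numArr a i' j' := by
  revert i' j'
  refine loop_inv O (fun j τ => ∀ i' j', τ.numArr a i' j' =
    if i' = i₀ ∧ j' < j then f j' else σ.numArr a i' j') σ (by simp) ?_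
  intro j hj τ hF hτ ih i' j'
  rw [Memory.setReg_numArr, h j hj τ hF hτ fun i' j' hij => by rw [ih, if_neg (by omega)]]
  by_cases hij : i' = i₀ ∧ j' = j
  · rw [if_pos hij, if_pos (by omega), hij.2]
  · rw [if_neg hij, ih]
    by_cases hij' : i' = i₀ ∧ j' < j
    · rw [if_pos hij', if_pos (by omega)]
    · rw [if_neg hij', if_neg (by omega)]

theorem arr_loop_fill {a i₀ x y : ℕ} {b : Cmd} (f : ℕ → ℕ)
    (h : ∀ j < σ.reg y, ∀ τ, Frame (loop x y b) σ τ → τ.reg x = j →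
      ∀ i' j', (b.exec O τ).arr a i' j' = if i' = i₀ ∧ j' = j then f j else τ.arr a i' j')
    (i' j' : ℕ) : ((loop x y b).exec O σ).arr a i' j' =
      if i' = i₀ ∧ j' < σ.reg y then f j' else σ.arr a i' j' := by
  revert i' j'
  refine loop_inv O (fun j τ => ∀ i' j', τ.arr a i' j' =
    if i' = i₀ ∧ j' < j then f j' else σ.arr a i' j') σ (by simp) ?_
  intro j hj τ hF hτ ih i' j'
  rw [Memory.setReg_arr, h j hj τ hF hτ]
  by_cases hij : i' = i₀ ∧ j' = j
  · rw [if_pos hij, if_pos (by omega), hij.2]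
  · rw [if_neg hij, ih]
    by_cases hij' : i' = i₀ ∧ j' < j
    · rw [if_pos hij', if_pos (by omega)]
    · rw [if_neg hij', if_neg (by omega)]

end Cmd

/-! ### Sizes, tables and the energy window. -/

namespace Prog

open Cmd

variable (O : Oracle) (σ : Memory)

theorem reg_loop_add {x y v : ℕ} {e : NExp} (c : ℕ) (hvx : v ≠ x)
    (h : ∀ τ, Frame (loop x y (setN v e)) σ τ → e.eval τ = τ.reg v + c) :
    ((loop x y (setN v e)).exec O σ).reg v = σ.reg v + c * σ.reg y := by
  refine loop_inv O (fun j τ => τ.reg v = σ.reg v + c * j) σ (by simp [hvx]) ?_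
  intro j hj τ hF hτ ih
  simp [hvx, h τ hF, ih]
  ring

theorem power_spec : (power.exec O σ).reg 30 = 2 ^ σ.reg 4 := by
  rw [power, exec_seq]
  set σ₁ := (setN 30 (.lit 1)).exec O σ with hσ₁
  have h4 : σ₁.reg 4 = σ.reg 4 := by simp [hσ₁]
  rw [← h4]
  refine loop_inv O (fun j τ => τ.reg 30 = 2 ^ j) σ₁ (by simp [hσ₁]) ?_
  intro j hj τ hF hτ ih
  rw [exec_seq, Memory.setReg_reg, if_neg (by decide),
    reg_loop_add O _ 1 (by decide) fun τ _ => rfl]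
  simp [ih, pow_succ]
  ring

theorem sizes_spec {N : ℕ} (hN : σ.reg 30 = N) : (sizes.exec O σ).reg 31 = N + 1 ∧
    (sizes.exec O σ).reg 32 = 3 * N ∧ (sizes.exec O σ).reg 33 = 2 := by
  have F := exec_frame O (loop 13 30 (setN 32 (.succ (.succ (.var 32)))))
    ((setN 32 (.var 30)).exec O ((setN 31 (.succ (.var 30))).exec O σ))
  have h := reg_loop_add O ((setN 32 (.var 30)).exec O ((setN 31 (.succ (.var 30))).exec O σ))
    (x := 13) (y := 30) (v := 32) (e := .succ (.succ (.var 32))) 2 (by decide) fun τ _ => rfl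
  have h31 := F.reg 31 rfl
  simp only [sizes, exec_seq] at h h31 ⊢
  simp only [exec_setN (x := 33), Memory.setReg_reg]
  refine ⟨?_, ?_, by simp⟩
  · rw [if_neg (by decide), h31]
    simp [hN]
  · rw [if_neg (by decide), h]
    simp [hN]
    ring

theorem tables_spec {N : ℕ} (hN : σ.reg 30 = N) : ∀ y < N,
    (tables.exec O σ).arr 10 0 y = 2 * y ∧ (tables.exec O σ).arr 11 0 y = y / 2 ∧
      (tables.exec O σ).arr 12 0 y = y % 2 := by
  simp only [tables, exec_seq]
  set σ₁ := (setN 34 (.lit 0)).exec O σ with hσ₁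
  set b₁ : Cmd := setA 10 (.lit 0) (.var 13) (.var 34) ;; setN 34 (.succ (.succ (.var 34))) with hb₁
  have key₁ := loop_inv O (x := 13) (y := 30) (b := b₁) (fun j τ => τ.reg 34 = 2 * j ∧
    ∀ y < j, τ.arr 10 0 y = 2 * y) σ₁ (by simp [hσ₁]) (by
      intro j _ τ hF hτ ⟨ih₁, ih₂⟩
      refine ⟨by simp [hb₁, ih₁]; ring, fun y hy => ?_⟩
      by_cases hyj : y = j
      · simp [hb₁, ih₁, hτ, hyj]
      · simpa [hb₁, hτ, hyj] using ih₂ y (by omega))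
  have F₁ := exec_frame O (loop 13 30 b₁) σ₁
  set σ₂ := (loop 13 30 b₁).exec O σ₁ with hσ₂
  set σ₃ := (setN 35 (.lit 0)).exec O ((setN 34 (.lit 0)).exec O σ₂) with hσ₃
  set b₂ : Cmd := setA 11 (.lit 0) (.var 13) (.var 34) ;;
    setA 12 (.lit 0) (.var 13) (.var 35) ;;
    ite (.eq (.var 35) (.lit 0)) (setN 35 (.lit 1))
      (setN 35 (.lit 0) ;; setN 34 (.succ (.var 34))) with hb₂
  have key₂ := loop_inv O (x := 13) (y := 30) (b := b₂) (fun j τ => τ.reg 34 = j / 2 ∧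
    τ.reg 35 = j % 2 ∧ ∀ y < j, τ.arr 11 0 y = y / 2 ∧ τ.arr 12 0 y = y % 2) σ₃
    (by simp [hσ₃]) (by
      intro j _ τ hF hτ ⟨ih₁, ih₂, ih₃⟩
      set τ₁ := (setA 12 (.lit 0) (.var 13) (.var 35)).exec O
        ((setA 11 (.lit 0) (.var 13) (.var 34)).exec O τ) with hτ₁
      have a : ∀ y < j + 1, τ₁.arr 11 0 y = y / 2 ∧ τ₁.arr 12 0 y = y % 2 := by
        intro y hy
        by_cases hyj : y = j
        · simp [hτ₁, ih₁, ih₂, hτ, hyj]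
        · simpa [hτ₁, hτ, hyj] using ih₃ y (by omega)
      have r₁ : τ₁.reg 34 = j / 2 := by simp [hτ₁, ih₁]
      have r₂ : τ₁.reg 35 = j % 2 := by simp [hτ₁, ih₂]
      rw [hb₂, exec_seq, exec_seq, ← hτ₁]
      by_cases hj : j % 2 = 0
      · rw [exec_ite_pos (by simp [r₂, hj])]
        refine ⟨?_, ?_, a⟩
        · simp [r₁]; omega
        · simp; omega
      · rw [exec_ite_neg (by simp [r₂, hj])]
        refine ⟨?_, ?_, a⟩
        · simp [r₁]; omega
        · simp; omega)
  have F₂ := exec_frame O (loop 13 30 b₂) σ₃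
  have n₁ : σ₁.reg 30 = N := by simp [hσ₁, hN]
  have n₃ : σ₃.reg 30 = N := by simp [hσ₃, F₁.reg 30 rfl, n₁]
  rw [n₁] at key₁
  rw [n₃] at key₂
  intro y hy
  refine ⟨?_, key₂.2.2 y hy⟩
  rw [F₂.arr 10 rfl]
  exact key₁.2 y hy

/-- A query for a member of the list. -/
theorem exec_query {n k : ℕ} (M : Model n k) (x a : ℕ) (i : NExp) (s : Label n)
    (h : ∀ q : Fin n, σ.bit a (i.eval σ) q = s q) :
    (query x a i).exec M.oracle σ = σ.setNum x (M.energy s : ℂ) := by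
  have : (fun q : Fin n => toBit (σ.arr a (i.eval σ) q)) = s := funext h
  simp only [exec]
  congr 2
  exact congrArg M.energy this

/-- Both ends are energies of list members. When the list consists of all states with energy in some
interval, the window between these ends therefore recognizes the list members by their energies, and
the norm of `δH` is never computed. -/
theorem window_spec {n k : ℕ} (M : Model n k) (L : ℕ → Label n) (h0 : 0 < σ.reg 2)
    (hL : ∀ l < σ.reg 2, ∀ q : Fin n, σ.bit 5 l q = L l q) :
    ∃ lo hi : ℝ, (window.exec M.oracle σ).num 2 = lo ∧ (window.exec M.oracle σ).num 3 = hi ∧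
      (∃ l < σ.reg 2, M.energy (L l) = lo) ∧ (∃ l < σ.reg 2, M.energy (L l) = hi) ∧
      ∀ l < σ.reg 2, lo ≤ M.energy (L l) ∧ M.energy (L l) ≤ hi := by
  rw [window, exec_seq, exec_seq, exec_query σ M 2 5 (.lit 0) (L 0) (hL 0 h0),
    exec_query (σ.setNum 2 (M.energy (L 0) : ℂ)) M 3 5 (.lit 0) (L 0) (hL 0 h0)]
  set σ₁ := (σ.setNum 2 (M.energy (L 0) : ℂ)).setNum 3 (M.energy (L 0) : ℂ) with hσ₁
  have h2 : σ₁.reg 2 = σ.reg 2 := rfl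
  have := loop_inv M.oracle (x := 13) (y := 2) (b := query 4 5 (.var 13) ;;
    ite (.le (.var 4) (.var 2)) (setC 2 (.var 4)) skip ;;
    ite (.le (.var 3) (.var 4)) (setC 3 (.var 4)) skip) (fun j τ => ∃ lo hi : ℝ,
      τ.num 2 = lo ∧ τ.num 3 = hi ∧
      (∃ l < σ.reg 2, M.energy (L l) = lo) ∧ (∃ l < σ.reg 2, M.energy (L l) = hi) ∧
      ∀ l < j, lo ≤ M.energy (L l) ∧ M.energy (L l) ≤ hi) σ₁
    ⟨_, _, by simp [hσ₁], by simp [hσ₁], ⟨0, h0, rfl⟩, ⟨0, h0, rfl⟩, by omega⟩ (by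
      intro j hj τ hF hτ ⟨lo, hi, ih₁, ih₂, ih₃, ih₄, ih₅⟩
      rw [h2] at hj
      have a₅ : τ.arr 5 = σ.arr 5 := hF.arr 5 rfl
      rw [exec_seq, exec_seq, exec_query τ M 4 5 _ (L j) (fun q => by
        have := hL j hj q
        rw [NExp.eval_var, hτ]
        simpa only [Memory.bit, a₅] using this)]
      set E := M.energy (L j) with hE
      set τ₁ := (Cmd.ite (.le (.var 4) (.var 2)) (setC 2 (.var 4)) skip).exec M.oracle
        (τ.setNum 4 (E : ℂ)) with hτ₁
      have n₂ : τ₁.num 2 = (min E lo : ℝ) := by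
        by_cases h : E ≤ lo
        · rw [hτ₁, exec_ite_pos (by simpa [ih₁] using h), min_eq_left h]
          simp
        · rw [hτ₁, exec_ite_neg (by simpa [ih₁] using h), min_eq_right (by linarith)]
          simp [ih₁]
      have F := exec_frame M.oracle (Cmd.ite (.le (.var 4) (.var 2)) (setC 2 (.var 4)) skip)
        (τ.setNum 4 (E : ℂ))
      have n₃ : τ₁.num 3 = hi := by rw [F.num 3 rfl]; simp [ih₂]
      have n₄ : τ₁.num 4 = E := by rw [F.num 4 rfl]; simp
      refine ⟨min E lo, max hi E, ?_, ?_, ?_, ?_, ?_⟩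
      · rw [Memory.setReg_num, (exec_frame M.oracle _ τ₁).num 2 rfl, n₂]
      · by_cases h : hi ≤ E
        · rw [exec_ite_pos (by simpa [n₃, n₄] using h), max_eq_right h]
          simp [n₄]
        · rw [exec_ite_neg (by simpa [n₃, n₄] using h), max_eq_left (by linarith)]
          simp [n₃]
      · rcases min_choice E lo with h | h
        · exact ⟨j, hj, h.symm⟩
        · rwa [h]
      · rcases max_choice hi E with h | h
        · rwa [h]
        · exact ⟨j, hj, h.symm⟩
      · intro l hl
        rcases (Nat.lt_succ_iff.1 hl).lt_or_eq with hl | rfl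
        · exact ⟨(min_le_right _ _).trans (ih₅ l hl).1, (ih₅ l hl).2.trans (le_max_left _ _)⟩
        · exact ⟨min_le_left _ _, le_max_right _ _⟩)
  rwa [h2] at this

end Prog

/-! ## Blocks -/

/-- The data with which the blocks are processed. -/
structure Setting (n k : ℕ) where
  M : Model n k
  E₀ : ℝ
  E₁ : ℝ
  lo : ℝ
  hi : ℝ
  r : ℕ
  len : ℕ
  L : ℕ → ℕ → Bool
  T : Tableau n
  reduced : M.Reduced len L r T

namespace Setting

variable {n k : ℕ} (S : Setting n k)

/-- The dimension of a block. -/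
def N : ℕ := 2 ^ S.r

/-- The coefficients of the perturbation. -/
def gamma (i : ℕ) : ℂ := if h : i < k then (S.M.γ ⟨i, h⟩ : ℂ) else 0

/-- The memory holds the data. -/
structure Ready (σ : Memory) : Prop where
  n_eq : σ.reg 0 = n
  k_eq : σ.reg 1 = k
  len_eq : σ.reg 2 = S.len
  r_eq : σ.reg 4 = S.r
  p_eq : σ.reg 11 = n - S.r
  N_eq : σ.reg 30 = S.N
  N_succ : σ.reg 31 = S.N + 1
  N_three : σ.reg 32 = 3 * S.N
  two : σ.reg 33 = 2
  tableau : σ.tableau n = S.T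
  circuit : circuit n σ = S.T.gates.reverse
  list : ∀ l < S.len, ∀ j < n, σ.bit 5 l j = S.L l j
  double : ∀ y < S.N, σ.arr 10 0 y = 2 * y
  half : ∀ y < S.N, σ.arr 11 0 y = y / 2
  parity : ∀ y < S.N, σ.arr 12 0 y = y % 2
  E₀_eq : σ.num 0 = S.E₀
  E₁_eq : σ.num 1 = S.E₁
  lo_eq : σ.num 2 = S.lo
  hi_eq : σ.num 3 = S.hi
  gamma : ∀ i < k, σ.numArr 0 0 i = S.gamma i

/-- The command does not change the data. -/
def _root_.StabPert.Cmd.keeps (c : Cmd) : Bool :=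
  [0, 1, 2, 4, 5, 11, 20, 30, 31, 32, 33].all (fun x => !c.wr x) &&
    [0, 1, 2, 5, 6, 8, 9, 10, 11, 12].all (fun a => !c.wrArr a) &&
    [0, 1, 2, 3].all (fun x => !c.wrNum x) && !c.wrNumArr 0

/-- For a concrete command the hypothesis `c.keeps = true` holds by `rfl`, so the data is carried
through the program without further work. -/
theorem Ready.frame {S : Setting n k} {σ τ : Memory} (h : S.Ready σ) {c : Cmd}
    (hF : c.Frame σ τ) (hc : c.keeps = true) : S.Ready τ := by
  simp only [Cmd.keeps, List.all_cons, List.all_nil, Bool.and_true, Bool.and_eq_true,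
    Bool.not_eq_true'] at hc
  obtain ⟨⟨⟨⟨r₀, r₁, r₂, r₄, r₅, r₁₁, r₂₀, r₃₀, r₃₁, r₃₂, r₃₃⟩, a₀, a₁, a₂, a₅, a₆, a₈, a₉, a₁₀,
    a₁₁, a₁₂⟩, n₀, n₁, n₂, n₃⟩, hg⟩ := hc
  constructor
  · rw [hF.reg _ r₀, h.n_eq]
  · rw [hF.reg _ r₁, h.k_eq]
  · rw [hF.reg _ r₂, h.len_eq]
  · rw [hF.reg _ r₄, h.r_eq]
  · rw [hF.reg _ r₁₁, h.p_eq]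
  · rw [hF.reg _ r₃₀, h.N_eq]
  · rw [hF.reg _ r₃₁, h.N_succ]
  · rw [hF.reg _ r₃₂, h.N_three]
  · rw [hF.reg _ r₃₃, h.two]
  · rw [← h.tableau]
    refine Memory.tableau_congr (hF.reg _ r₂₀) fun a ha => ?_
    fin_cases ha
    exacts [hF.arr _ a₀, hF.arr _ a₁, hF.arr _ a₂, hF.arr _ a₈, hF.arr _ a₉]
  · rw [← h.circuit]
    simp only [StabPert.circuit, hF.reg _ r₅, hF.arr _ a₆]
  · simpa only [Memory.bit, hF.arr _ a₅] using h.list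
  · simpa only [hF.arr _ a₁₀] using h.double
  · simpa only [hF.arr _ a₁₁] using h.half
  · simpa only [hF.arr _ a₁₂] using h.parity
  · rw [hF.num _ n₀, h.E₀_eq]
  · rw [hF.num _ n₁, h.E₁_eq]
  · rw [hF.num _ n₂, h.lo_eq]
  · rw [hF.num _ n₃, h.hi_eq]
  · simpa only [hF.numArr _ hg] using h.gamma

/-- The unperturbed energies of a block. -/
def energy (x : ℕ → Bool) (y : ℕ) : ℝ :=
  S.M.energy (S.T.syndrome (blockLabel n S.r x y))

/-- The contribution of a perturbing Pauli string to the matrix of a block. -/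
def term (x : ℕ → Bool) (i y y' : ℕ) : ℂ :=
  if blockIndex S.r ((S.T.row (n + i)).move (blockLabel n S.r x y)) = y' then
    S.gamma i * (S.T.row (n + i)).phase (blockLabel n S.r x y) else 0

/-- The matrix of a block. -/
def entry (x : ℕ → Bool) (y y' : ℕ) : ℂ :=
  (if y = y' then (S.energy x y : ℂ) else 0) + ∑ i ∈ Finset.range k, S.term x i y y'

/-- The vector with given components in a block. -/
def blockVector (x : ℕ → Bool) (φ : ℕ → ℂ) : Label n → ℂ :=
  blockPart S.r x fun b => φ (blockIndex S.r b)

variable {S}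

theorem blockVector_blockLabel (x : ℕ → Bool) (φ : ℕ → ℂ) {y : ℕ} (hy : y < S.N) :
    S.blockVector x φ (blockLabel n S.r x y) = φ y := by
  rw [blockVector, blockPart, if_pos (inBlock_blockLabel _ _ _ _),
    blockIndex_blockLabel S.reduced.le x hy]

/-- Numbering the labels of a block by the binary value of their last `r` bits turns the Hamiltonian
on the block into the matrix `entry`; a perturbing string has a single nonzero entry in each row. -/
theorem frameH_blockVector (x : ℕ → Bool) (φ : ℕ → ℂ) :
    S.M.frameH S.T (S.blockVector x φ) =
      S.blockVector x fun y => ∑ y' ∈ Finset.range S.N, S.entry x y y' * φ y' := by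
  conv_lhs => rw [blockVector, S.reduced.frameH_blockPart]
  funext a
  by_cases ha : InBlock n S.r x a
  · have hlt : blockIndex S.r a < S.N := blockIndex_lt S.r a
    rw [blockVector, blockPart, blockPart, if_pos ha, if_pos ha, Model.Reduced.frameH_apply]
    simp only [entry, add_mul, Finset.sum_add_distrib, ite_mul, zero_mul, Finset.sum_ite_eq,
      Finset.mem_range]
    rw [if_pos hlt, energy, blockLabel_blockIndex ha]
    congr 1
    simp only [Finset.sum_mul, term, ite_mul, zero_mul]
    rw [Finset.sum_comm]
    have : ∀ i : Fin k, (S.M.γ i : ℂ) * ((S.T.row (n + i)).phase a *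
        φ (blockIndex S.r ((S.T.row (n + i)).move a))) =
        (fun i => S.gamma i * ((S.T.row (n + i)).phase a *
          φ (blockIndex S.r ((S.T.row (n + i)).move a)))) (i : ℕ) := fun i => by simp [gamma]
    rw [Finset.sum_congr rfl fun i _ => this i, Fin.sum_univ_eq_sum_range
      (fun i => S.gamma i * ((S.T.row (n + i)).phase a *
          φ (blockIndex S.r ((S.T.row (n + i)).move a))))]
    refine Finset.sum_congr rfl fun i _ => ?_
    have hmem : ∀ b : Label n, blockIndex S.r b ∈ Finset.range S.N := fun b =>
      Finset.mem_range.2 (blockIndex_lt _ _)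
    rw [Finset.sum_ite_eq, if_pos (hmem _), blockLabel_blockIndex ha, mul_assoc]
  · simp [blockVector, blockPart, ha]

end Setting

/-! ### Labels, energies and representatives of blocks. -/

namespace Prog

open Cmd

variable {n k : ℕ} {S : Setting n k} {σ : Memory}

theorem blockLabels_spec (O : Oracle) (h : S.Ready σ) {l : ℕ} (hl : σ.reg 12 = l) :
    ∀ y < S.N, ∀ q : Fin n, (blockLabels.exec O σ).bit 13 y q =
      blockLabel n S.r (S.T.label l) y q := by
  rw [← h.N_eq]
  refine loop_inv O (fun j τ => ∀ y < j, ∀ q : Fin n, τ.bit 13 y q =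
    blockLabel n S.r (S.T.label l) y q) σ (by omega) ?_
  intro y hy τ hF hτ ih
  rw [h.N_eq] at hy
  have R := h.frame hF rfl
  rw [exec_seq]
  set τ₁ := (setN 34 (.var 13)).exec O τ with hτ₁
  have R₁ : S.Ready τ₁ := R.frame (exec_frame O _ τ) rfl
  set b : Cmd := ite (.lt (.var 14) (.var 11))
      (setA 13 (.var 13) (.var 14) (.arr 9 (.var 12) (.var 14)))
      (setA 13 (.var 13) (.var 14) (.arr 12 (.lit 0) (.var 34)) ;;
        setN 34 (.arr 11 (.lit 0) (.var 34))) with hb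
  -- Register 34 is `y` with the binary digits already written shifted out; the truncated
  -- subtraction makes the exponent 0 as long as the counter is among the first `n - r` qubits.
  have key := loop_inv O (x := 14) (y := 0) (b := b) (fun q₀ υ =>
      υ.reg 34 = y / 2 ^ (q₀ - (n - S.r)) ∧ (∀ y' < y, ∀ q, υ.bit 13 y' q = τ.bit 13 y' q) ∧
      ∀ q < q₀, υ.bit 13 y q = if q < n - S.r then S.T.label l q else y.testBit (q - (n - S.r)))
    τ₁ ⟨by simp [hτ₁, hτ], fun _ _ _ => rfl, by omega⟩ (by
      intro q₀ _ υ hG hυ ⟨ih₁, ih₂, ih₃⟩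
      have Rυ := R₁.frame hG rfl
      have e₁₂ : υ.reg 12 = l := (hG.reg 12 rfl).trans ((by simp [hτ₁] : τ₁.reg 12 =
        τ.reg 12).trans ((hF.reg 12 rfl).trans hl))
      have e₁₃ : υ.reg 13 = y := (hG.reg 13 rfl).trans (by simp [hτ₁, hτ])
      have e₁₁ := Rυ.p_eq
      have hlt : y / 2 ^ (q₀ - (n - S.r)) < S.N := (Nat.div_le_self _ _).trans_lt hy
      by_cases hq : q₀ < n - S.r
      · rw [hb, exec_ite_pos (by simpa [hυ, e₁₁] using hq)]
        refine ⟨?_, fun y' hy' q => ?_, fun q hqq => ?_⟩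
        · simp [ih₁, show q₀ - (n - S.r) = 0 by omega, show q₀ + 1 - (n - S.r) = 0 by omega]
        · rw [← ih₂ y' hy' q]
          simp [Memory.bit, e₁₃, hy'.ne]
        · by_cases hqe : q = q₀
          · rw [← Rυ.tableau, hqe, if_pos hq]
            simp [Memory.bit, Memory.tableau, e₁₂, e₁₃, hυ]
          · rw [← ih₃ q (by omega)]
            simp [Memory.bit, e₁₃, hυ, hqe]
      · rw [hb, exec_ite_neg (by simpa [hυ, e₁₁] using hq)]
        refine ⟨?_, fun y' hy' q => ?_, fun q hqq => ?_⟩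
        · simp [ih₁, Rυ.half _ hlt, Nat.div_div_eq_div_mul, ← pow_succ]
          congr 2
          omega
        · rw [← ih₂ y' hy' q]
          simp [Memory.bit, e₁₃, hy'.ne]
        · by_cases hqe : q = q₀
          · rw [hqe, if_neg hq, testBit_eq, ← Rυ.parity _ hlt]
            simp [Memory.bit, e₁₃, hυ, ih₁]
          · rw [← ih₃ q (by omega)]
            simp [Memory.bit, e₁₃, hυ, hqe])
  rw [R₁.n_eq] at key
  intro y' hy' q
  change ((loop 14 0 b).exec O τ₁).bit 13 y' q = _
  rcases (Nat.lt_succ_iff.1 hy').lt_or_eq with hy' | rfl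
  · rw [key.2.1 y' hy', ih y' hy']
  · rw [key.2.2 q q.2, blockLabel]

theorem blockEnergies_spec (h : S.Ready σ) {x : ℕ → Bool}
    (hb : ∀ y < S.N, ∀ q : Fin n, σ.bit 13 y q = blockLabel n S.r x y q) :
    ∀ y < S.N, (∀ j : Fin n, (blockEnergies.exec S.M.oracle σ).bit 14 y j =
        S.T.syndrome (blockLabel n S.r x y) j) ∧
      (blockEnergies.exec S.M.oracle σ).numArr 3 0 y = S.energy x y := by
  rw [← h.N_eq]
  refine loop_inv S.M.oracle (fun j τ => ∀ y < j, (∀ j : Fin n, τ.bit 14 y j =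
      S.T.syndrome (blockLabel n S.r x y) j) ∧ τ.numArr 3 0 y = S.energy x y) σ (by omega) ?_
  intro y hy τ hF hτ ih
  rw [h.N_eq] at hy
  have R := h.frame hF rfl
  have a₁₃ : τ.arr 13 = σ.arr 13 := hF.arr 13 rfl
  set b : Cmd := setN 25 (sBit 14) ;;
      loop 15 0 (setN 25 (.xor (.var 25) (.and (zBit 14 15) (.arr 13 (.var 13) (.var 15))))) ;;
      setA 14 (.var 13) (.var 14) (.var 25) with hb'
  have key := loop_inv S.M.oracle (x := 14) (y := 0) (b := b) (fun j υ =>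
      (∀ y' < y, υ.arr 14 y' = τ.arr 14 y') ∧ ∀ i < j, υ.bit 14 y i =
        (S.T.row i).syndrome n (Label.extend (blockLabel n S.r x y)))
    τ ⟨fun _ _ => rfl, by omega⟩ (by
      intro j hj υ hG hυ ⟨ih₁, ih₂⟩
      have Rυ := R.frame hG rfl
      have e₁₃ : υ.reg 13 = y := (hG.reg 13 rfl).trans hτ
      have b₁₃ : υ.arr 13 = σ.arr 13 := (hG.arr 13 rfl).trans a₁₃
      have hrow : υ.row = S.T.row := by rw [← Rυ.tableau]; rfl
      rw [hb', exec_seq, exec_seq]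
      set υ₁ := (setN 25 (sBit 14)).exec S.M.oracle υ with hυ₁
      have hpar := parity_loop S.M.oracle υ₁ (v := 25) (x := 15) (y := 0)
        (e := .and (zBit 14 15) (.arr 13 (.var 13) (.var 15))) (by decide)
        (fun q => (S.T.row j).z q && Label.extend (blockLabel n S.r x y) q) (by
          intro q hq ρ hρ hρ'
          have hq' : q < n := by simpa [hυ₁, Rυ.n_eq] using hq
          have r14 : ρ.reg 14 = j := (hρ.reg 14 rfl).trans (by simp [hυ₁, hυ])
          have r13 : ρ.reg 13 = y := (hρ.reg 13 rfl).trans (by simp [hυ₁, e₁₃])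
          have c1 : ρ.arr 1 = υ.arr 1 := hρ.arr 1 rfl
          have c13 : ρ.arr 13 = σ.arr 13 := (hρ.arr 13 rfl).trans b₁₃
          have := hb y hy ⟨q, hq'⟩
          rw [NExp.toBit_and, ← hrow, Label.extend, dif_pos hq', ← this]
          simp [zBit, r14, r13, c1, c13, hρ', Memory.row, Memory.bit])
      have F := exec_frame S.M.oracle (loop 15 0 (setN 25 (.xor (.var 25)
        (.and (zBit 14 15) (.arr 13 (.var 13) (.var 15)))))) υ₁
      set υ₂ := (loop 15 0 (setN 25 (.xor (.var 25)
        (.and (zBit 14 15) (.arr 13 (.var 13) (.var 15)))))).exec S.M.oracle υ₁ with hυ₂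
      have hval : toBit (υ₂.reg 25) =
          (S.T.row j).syndrome n (Label.extend (blockLabel n S.r x y)) := by
        rw [hpar, Row.syndrome, ← hrow]
        simp [hυ₁, sBit, hυ, Memory.row, Memory.bit, Rυ.n_eq]
      have r13 : υ₂.reg 13 = y := (F.reg 13 rfl).trans (by simp [hυ₁, e₁₃])
      have r14 : υ₂.reg 14 = j := (F.reg 14 rfl).trans (by simp [hυ₁, hυ])
      have c14 : υ₂.arr 14 = υ.arr 14 := F.arr 14 rfl
      refine ⟨fun y' hy' => ?_, fun i hi => ?_⟩
      · rw [← ih₁ y' hy']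
        funext i
        simp [r13, hy'.ne, c14]
      · by_cases hij : i = j
        · rw [hij, ← hval]
          simp [Memory.bit, r13, r14]
        · rw [← ih₂ i (by omega)]
          simp [Memory.bit, r13, r14, hij, c14])
  rw [R.n_eq] at key
  have F := exec_frame S.M.oracle (loop 14 0 b) τ
  rw [exec_seq, exec_seq]
  set τ₁ := (loop 14 0 b).exec S.M.oracle τ with hτ₁
  have e₁₃ : τ₁.reg 13 = y := (F.reg 13 rfl).trans hτ
  have a₃ : τ₁.numArr 3 = τ.numArr 3 := F.numArr 3 rfl
  rw [exec_query τ₁ S.M 4 14 (.var 13) (S.T.syndrome (blockLabel n S.r x y)) (fun j => by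
    rw [NExp.eval_var, e₁₃]
    exact key.2 j j.2)]
  intro y' hy'
  by_cases hyy : y' = y
  · subst hyy
    refine ⟨fun j => key.2 j j.2, ?_⟩
    simp [e₁₃, Setting.energy]
  · refine ⟨fun j => ?_, ?_⟩
    · rw [← (ih y' (by omega)).1 j]
      exact congrArg (fun A => toBit (A j)) (key.1 y' (by omega))
    · rw [← (ih y' (by omega)).2]
      simp [e₁₃, hyy, a₃]

/-- Register 36 records that a label with energy in the window has been met, so that later ones are
ignored; register 37 records whether the syndrome of that label is the list member. This costs time
linear in the block and in `n`, and no comparison with the other list members. -/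
theorem isFirst_spec (O : Oracle) (h : S.Ready σ) {l : ℕ} (hl : σ.reg 12 = l) {e : ℕ → ℝ}
    (he : ∀ y < S.N, σ.numArr 3 0 y = e y) :
    (isFirst.exec O σ).reg 37 ≠ 0 ↔ ∃ y < S.N, (S.lo ≤ e y ∧ e y ≤ S.hi) ∧
      (∀ y' < y, ¬ (S.lo ≤ e y' ∧ e y' ≤ S.hi)) ∧ ∀ j < n, σ.bit 14 y j = σ.bit 5 l j := by
  rw [isFirst, exec_seq, exec_seq]
  set σ₁ := (setN 37 (.lit 0)).exec O ((setN 36 (.lit 0)).exec O σ) with hσ₁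
  have R₁ : S.Ready σ₁ := h.frame (exec_frame O (setN 36 (.lit 0) ;; setN 37 (.lit 0)) σ) rfl
  rw [← h.N_eq, show σ.reg 30 = σ₁.reg 30 by simp [hσ₁]]
  refine (loop_inv O (fun j τ => (τ.reg 36 = 0 ↔ ∀ y < j, ¬ (S.lo ≤ e y ∧ e y ≤ S.hi)) ∧
    (τ.reg 37 ≠ 0 ↔ ∃ y < j, (S.lo ≤ e y ∧ e y ≤ S.hi) ∧
      (∀ y' < y, ¬ (S.lo ≤ e y' ∧ e y' ≤ S.hi)) ∧ ∀ j < n, σ.bit 14 y j = σ.bit 5 l j))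
      σ₁ (by simp [hσ₁]) ?_).2
  intro y hy τ hF hτ ⟨ih₁, ih₂⟩
  rw [R₁.N_eq] at hy
  have R := R₁.frame hF rfl
  have e₁₂ : τ.reg 12 = l := (hF.reg 12 rfl).trans (by simp [hσ₁, hl])
  have a₃ : τ.numArr 3 0 y = e y := by
    rw [hF.numArr 3 rfl]
    exact he y hy
  have a₅ : τ.arr 5 = σ.arr 5 := hF.arr 5 rfl
  have a₁₄ : τ.arr 14 = σ.arr 14 := hF.arr 14 rfl
  simp only [Memory.setReg_reg, show (36 : ℕ) ≠ 13 by decide, show (37 : ℕ) ≠ 13 by decide,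
    if_false]
  have same : ∀ P : ℕ → Prop, ¬ P y → ((∃ y' < y + 1, P y') ↔ ∃ y' < y, P y') := by
    intro P hP
    constructor
    · rintro ⟨y', hy', hp⟩
      have : y' ≠ y := by rintro rfl; exact hP hp
      exact ⟨y', by omega, hp⟩
    · rintro ⟨y', hy', hp⟩
      exact ⟨y', by omega, hp⟩
  by_cases h36 : τ.reg 36 = 0
  · have hno := ih₁.1 h36
    rw [exec_ite_pos (by simpa using h36)]
    by_cases hin : S.lo ≤ e y ∧ e y ≤ S.hi
    · rw [exec_ite_pos (by simpa [hτ, R.lo_eq, a₃] using hin.1),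
        exec_ite_pos (by simpa [hτ, R.hi_eq, a₃] using hin.2), exec_seq, exec_seq]
      set τ₁ := (setN 37 (.lit 1)).exec O ((setN 36 (.lit 1)).exec O τ) with hτ₁
      have Rτ₁ : S.Ready τ₁ := R.frame (exec_frame O (setN 36 (.lit 1) ;; setN 37 (.lit 1)) τ) rfl
      set b : Cmd := ite (.eq (.xor (.arr 14 (.var 13) (.var 14)) (.arr 5 (.var 12) (.var 14)))
              (.lit 0)) skip (setN 37 (.lit 0)) with hb
      have key := loop_inv O (x := 14) (y := 0) (b := b) (fun j υ =>
        υ.reg 37 ≠ 0 ↔ ∀ i < j, σ.bit 14 y i = σ.bit 5 l i) τ₁ (by simp [hτ₁]) (by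
          intro j _ υ hG hυ ihυ
          have r₁₂ : υ.reg 12 = l := (hG.reg 12 rfl).trans (by simp [hτ₁, e₁₂])
          have r₁₃ : υ.reg 13 = y := (hG.reg 13 rfl).trans (by simp [hτ₁, hτ])
          have b₅ : υ.arr 5 = σ.arr 5 := (hG.arr 5 rfl).trans a₅
          have b₁₄ : υ.arr 14 = σ.arr 14 := (hG.arr 14 rfl).trans a₁₄
          have hx : (NExp.xor (.arr 14 (.var 13) (.var 14)) (.arr 5 (.var 12) (.var 14))).eval υ = 0
              ↔ σ.bit 14 y j = σ.bit 5 l j := by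
            rw [← toBit_eq_false, NExp.toBit_xor]
            simp [r₁₂, r₁₃, hυ, b₅, b₁₄, Memory.bit]
          by_cases hxe : σ.bit 14 y j = σ.bit 5 l j
          · rw [hb, exec_ite_pos (by simpa using hx.2 hxe)]
            simp only [exec_skip, Memory.setReg_reg, show (37 : ℕ) ≠ 14 by decide, if_false, ihυ]
            refine ⟨fun H i hi => ?_, fun H i hi => H i (by omega)⟩
            rcases (Nat.lt_succ_iff.1 hi).lt_or_eq with hi | rfl
            exacts [H i hi, hxe]
          · rw [hb, exec_ite_neg (by simpa using mt hx.1 hxe)]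
            simp only [exec_setN, Memory.setReg_reg, show (37 : ℕ) ≠ 14 by decide, if_false,
              if_true, NExp.eval_lit, ne_eq, not_true_eq_false, false_iff]
            exact fun H => hxe (H j (by omega)))
      rw [Rτ₁.n_eq] at key
      have h36' : ((loop 14 0 b).exec O τ₁).reg 36 ≠ 0 := by
        rw [(exec_frame O _ _).reg 36 rfl]
        simp [hτ₁]
      refine ⟨iff_of_false h36' fun H => H y (by omega) hin, key.trans ?_⟩
      constructor
      · exact fun H => ⟨y, by omega, hin, hno, H⟩
      · rintro ⟨y', hy', hin', hno', H⟩
        have : y' = y := by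
          rcases (Nat.lt_succ_iff.1 hy').lt_or_eq with hlt | rfl
          exacts [absurd hin' (hno y' hlt), rfl]
        subst this
        exact H
    · have hskip : (ite (.le (.var 2) (.arr 3 (.lit 0) (.var 13)))
          (ite (.le (.arr 3 (.lit 0) (.var 13)) (.var 3))
          (setN 36 (.lit 1) ;;
            setN 37 (.lit 1) ;;
            loop 14 0 (ite (.eq (.xor (.arr 14 (.var 13) (.var 14)) (.arr 5 (.var 12) (.var 14)))
              (.lit 0)) skip (setN 37 (.lit 0))))
          skip) skip : Cmd).exec O τ = τ := by
        by_cases hl : S.lo ≤ e y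
        · rw [exec_ite_pos (by simpa [hτ, R.lo_eq, a₃] using hl),
            exec_ite_neg (by simpa [hτ, R.hi_eq, a₃] using fun H => hin ⟨hl, H⟩), exec_skip]
        · rw [exec_ite_neg (by simpa [hτ, R.lo_eq, a₃] using hl), exec_skip]
      rw [hskip, same _ fun H => hin H.1]
      refine ⟨ih₁.trans ⟨fun H y' hy' => ?_, fun H y' hy' => H y' (by omega)⟩, ih₂⟩
      rcases (Nat.lt_succ_iff.1 hy').lt_or_eq with hy' | rfl
      exacts [H y' hy', hin]
  · have hsome := mt ih₁.2 h36
    rw [exec_ite_neg (by simpa using h36), exec_skip, same _ fun H => hsome H.2.1]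
    exact ⟨iff_of_false h36 fun H => hsome fun y' hy' => H y' (by omega), ih₂⟩

end Prog

/-! ### The matrix of a block. -/

namespace Prog

open Cmd

variable {n k : ℕ} {S : Setting n k} {σ : Memory}

theorem phaseProd_spec (O : Oracle) (h : S.Ready σ) {y i : ℕ} (hy : σ.reg 13 = y)
    (hi : σ.reg 38 = i) {a : Label n} (ha : ∀ q : Fin n, σ.bit 13 y q = a q) :
    (phaseProd.exec O σ).num 6 =
      σ.num 5 * ∏ q : Fin n, phaseFactor ((S.T.row i).x q) ((S.T.row i).z q) (a q) := by
  rw [phaseProd, exec_seq]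
  set σ₁ := (setC 6 (.var 5)).exec O σ with hσ₁
  have R₁ : S.Ready σ₁ := h.frame (exec_frame O (setC 6 (.var 5)) σ) rfl
  have key := loop_inv O (x := 14) (y := 0) (b := setC 6 (.mul (.var 6)
      (.ite (zBit 38 14) (.lit 0) .one (.mul (.ite (xBit 38 14) (.lit 0) .one (.sub .zero .imag))
      (.ite (.arr 13 (.var 13) (.var 14)) (.lit 0) .one (.sub .zero .one)))))) (fun j τ =>
    τ.num 6 = σ.num 5 * ∏ q ∈ Finset.range j,
      phaseFactor ((S.T.row i).x q) ((S.T.row i).z q) (a.extend q)) σ₁ (by simp [hσ₁]) (by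
      intro j hj τ hF hτ ih
      rw [R₁.n_eq] at hj
      have R := R₁.frame hF rfl
      have hrow : τ.row = S.T.row := by rw [← R.tableau]; rfl
      have e₁₃ : τ.reg 13 = y := (hF.reg 13 rfl).trans (by simp [hσ₁, hy])
      have e₃₈ : τ.reg 38 = i := (hF.reg 38 rfl).trans (by simp [hσ₁, hi])
      have a₁₃ : τ.arr 13 = σ.arr 13 := hF.arr 13 rfl
      rw [Finset.prod_range_succ, ← mul_assoc, ← ih, Memory.setReg_num, exec_setC,
        Memory.setNum_num, if_pos rfl, CExp.eval_mul, CExp.eval_var]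
      congr 1
      have hb := ha ⟨j, hj⟩
      rw [Label.extend, dif_pos hj, ← hb, ← hrow, phaseFactor]
      simp only [Memory.row, Memory.bit, CExp.eval_ite, CExp.eval_mul, CExp.eval_one, CExp.eval_sub,
        CExp.eval_zero, CExp.eval_imag, zBit, xBit, NExp.eval_arr, NExp.eval_var, NExp.eval_lit,
        e₁₃, e₃₈, hτ, a₁₃, zero_sub, toBit_eq_true, ne_eq, ite_not])
  rw [R₁.n_eq] at key
  rw [key, ← Fin.prod_univ_eq_prod_range
    (fun q => phaseFactor ((S.T.row i).x q) ((S.T.row i).z q) (a.extend q))]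
  simp [Label.extend_val]

theorem target_spec (O : Oracle) (h : S.Ready σ) {y i : ℕ} (hy : σ.reg 13 = y)
    (hi : σ.reg 38 = i) {a : Label n} (ha : ∀ q : Fin n, σ.bit 13 y q = a q) :
    (target.exec O σ).reg 34 = blockIndex S.r ((S.T.row i).move a) := by
  rw [target, exec_seq, exec_seq]
  set σ₁ := (setN 35 (.var 0)).exec O ((setN 34 (.lit 0)).exec O σ) with hσ₁
  have R₁ : S.Ready σ₁ := h.frame (exec_frame O (setN 34 (.lit 0) ;; setN 35 (.var 0)) σ) rfl
  have hr := S.reduced.le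
  set f : ℕ → Bool := fun m => Label.extend ((S.T.row i).move a) (n - S.r + m) with hf
  -- Horner evaluation from the last qubit downwards: after `t` rounds register 34 is the number
  -- formed by the last `min t r` bits of the moved label, and qubits before `n - r` are skipped.
  have key := loop_inv O (x := 14) (y := 0) (b :=
    setN 35 (.pred (.var 35)) ;;
    ite (.lt (.var 35) (.var 11)) skip
      (setN 34 (.arr 10 (.lit 0) (.var 34)) ;;
        ite (.eq (.xor (.arr 13 (.var 13) (.var 35)) (xBit 38 35)) (.lit 0)) skip
          (setN 34 (.succ (.var 34))))) (fun t τ => τ.reg 35 = n - t ∧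
    τ.reg 34 = binary (min t S.r) fun m => f (S.r - min t S.r + m)) σ₁
    (by simp [hσ₁, h.n_eq, binary]) (by
      intro t ht τ hF hτ ⟨ih₁, ih₂⟩
      rw [R₁.n_eq] at ht
      have R := R₁.frame hF rfl
      rw [exec_seq]
      set τ₁ := (setN 35 (.pred (.var 35))).exec O τ with hτ₁
      have r₃₅ : τ₁.reg 35 = n - (t + 1) := by simp [hτ₁, ih₁]; omega
      have r₁₁ : τ₁.reg 11 = n - S.r := by simp [hτ₁, R.p_eq]
      have r₃₄ : τ₁.reg 34 = τ.reg 34 := by simp [hτ₁]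
      by_cases htr : t < S.r
      · rw [exec_ite_neg (by simp [r₃₅, r₁₁]; omega), exec_seq]
        rw [min_eq_left htr.le] at ih₂
        rw [min_eq_left (by omega)]
        have hlt : τ.reg 34 < S.N := by
          rw [ih₂]
          exact (binary_lt _ _).trans_le (Nat.pow_le_pow_right two_pos htr.le)
        set τ₂ := (setN 34 (.arr 10 (.lit 0) (.var 34))).exec O τ₁ with hτ₂
        have q₃₄ : τ₂.reg 34 = 2 * τ.reg 34 := by
          rw [← R.double _ hlt]
          simp [hτ₂, hτ₁]
        have q₃₅ : τ₂.reg 35 = n - (t + 1) := by simp [hτ₂, r₃₅]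
        have q₁₃ : τ₂.reg 13 = y := by simp [hτ₂, hτ₁, hF.reg 13 rfl, hσ₁, hy]
        have q₃₈ : τ₂.reg 38 = i := by simp [hτ₂, hτ₁, hF.reg 38 rfl, hσ₁, hi]
        have a₁₃ : τ₂.arr 13 = σ.arr 13 := hF.arr 13 rfl
        have a₀ : τ₂.arr 0 = τ.arr 0 := rfl
        have hrow : τ.row = S.T.row := by rw [← R.tableau]; rfl
        have hbit : toBit ((NExp.xor (.arr 13 (.var 13) (.var 35)) (xBit 38 35)).eval τ₂) =
            f (S.r - (t + 1)) := by
          rw [NExp.toBit_xor]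
          simp only [hf, show n - S.r + (S.r - (t + 1)) = n - (t + 1) by omega, xBit, NExp.eval_arr,
            NExp.eval_var, q₁₃, q₃₅, q₃₈, a₁₃, a₀]
          rw [Label.extend, dif_pos (by omega), Row.move, ← ha, ← hrow]
          rfl
        have e : binary (t + 1) (fun m => f (S.r - (t + 1) + m)) =
            2 * τ.reg 34 + (f (S.r - (t + 1))).toNat := by
          rw [binary, ih₂]
          simp only [add_zero]
          congr 3
          funext m
          congr 1
          omega
        rw [e]
        by_cases hx : f (S.r - (t + 1)) = true
        · rw [exec_ite_neg (by
            rw [Test.holds_eq, NExp.eval_lit, ← toBit_eq_false, hbit, hx]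
            simp)]
          simp [q₃₅, q₃₄, hx]
        · rw [exec_ite_pos (by
            rw [Test.holds_eq, NExp.eval_lit, ← toBit_eq_false, hbit]
            simpa using hx)]
          simp [q₃₅, q₃₄, Bool.eq_false_iff.2 hx]
      · rw [exec_ite_pos (by simp [r₃₅, r₁₁]; omega)]
        rw [min_eq_right (by omega)] at ih₂ ⊢
        simp [r₃₅, r₃₄, ih₂])
  rw [R₁.n_eq] at key
  rw [key.2, min_eq_right hr, blockIndex]
  simp [hf]

/-- A perturbing string adds a single entry to row `y`, at the column found by `target`. Hence each
string costs about `N * n` steps instead of `N ^ 2` times the cost of an entry. -/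
theorem blockMatrix_spec (O : Oracle) (h : S.Ready σ) {x : ℕ → Bool}
    (hb : ∀ y < S.N, ∀ q : Fin n, σ.bit 13 y q = blockLabel n S.r x y q)
    (he : ∀ y < S.N, σ.numArr 3 0 y = S.energy x y) :
    ∀ y < S.N, ∀ y' < S.N, (blockMatrix.exec O σ).numArr 4 y y' = S.entry x y y' := by
  rw [blockMatrix, exec_seq, exec_seq, exec_seq]
  set b₀ : Cmd := setCA 4 (.var 13) (.var 14) .zero with hb₀
  have k₀ := loop_inv O (x := 13) (y := 30) (b := loop 14 30 b₀)
    (fun j τ => ∀ y < j, ∀ y' < S.N, τ.numArr 4 y y' = 0) σ (by omega) (by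
      intro j hj τ hF hτ ih y hy y' hy'
      have R := h.frame hF rfl
      have := numArr_loop_fill O τ (a := 4) (i₀ := j) (x := 14) (y := 30) (b := b₀) (fun _ => 0) (by
        intro y _ υ hG hυ _ i' j'
        simp [hb₀, hυ, hG.reg 13 rfl, hτ]) y y'
      rw [R.N_eq] at this
      rw [Memory.setReg_numArr, this]
      by_cases hyj : y = j
      · simp [hyj, hy']
      · rw [if_neg (by omega)]
        exact ih y (by omega) y' hy')
  rw [h.N_eq] at k₀
  have F₀ := exec_frame O (loop 13 30 (loop 14 30 b₀)) σ
  set σ₀ := (loop 13 30 (loop 14 30 b₀)).exec O σ with hσ₀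
  have R₀ : S.Ready σ₀ := h.frame F₀ rfl
  set b₁ : Cmd := setCA 4 (.var 13) (.var 13) (.arr 3 (.lit 0) (.var 13)) with hb₁
  have k₁ := loop_inv O (x := 13) (y := 30) (b := b₁) (fun j τ => ∀ y < S.N, ∀ y' < S.N,
      τ.numArr 4 y y' = if y = y' ∧ y < j then (S.energy x y : ℂ) else 0) σ₀
      (fun y hy y' hy' => by simp [k₀ y hy y' hy']) (by
      intro j hj τ hF hτ ih y hy y' hy'
      rw [R₀.N_eq] at hj
      have a₃ : τ.numArr 3 0 j = S.energy x j := by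
        rw [hF.numArr 3 rfl, F₀.numArr 3 rfl, he j hj]
      simp only [hb₁, exec_setCA, Memory.setReg_numArr, Memory.setNumArr_numArr, NExp.eval_var, hτ,
        true_and, CExp.eval_arr, NExp.eval_lit, a₃]
      by_cases hyj : y = j ∧ y' = j
      · simp [hyj]
      · rw [if_neg hyj, ih y hy y' hy']
        congr 1
        simp only [eq_iff_iff]
        constructor
        · exact fun H => ⟨H.1, by omega⟩
        · exact fun H => ⟨H.1, by omega⟩)
  rw [R₀.N_eq] at k₁
  have F₁ := exec_frame O (loop 13 30 b₁) σ₀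
  set σ₁ := (loop 13 30 b₁).exec O σ₀ with hσ₁
  have R₁ : S.Ready σ₁ := R₀.frame F₁ rfl
  set σ₂ := (setN 38 (.var 0)).exec O σ₁ with hσ₂
  have R₂ : S.Ready σ₂ := R₁.frame (exec_frame O (setN 38 (.var 0)) σ₁) rfl
  set b₂ : Cmd := phaseProd ;; target ;;
      setCA 4 (.var 13) (.var 34) (.add (.arr 4 (.var 13) (.var 34)) (.var 6)) with hb₂
  have k₂ := loop_inv O (x := 15) (y := 1) (b := setC 5 (.ite (sBit 38) (.lit 0)
      (.arr 0 (.lit 0) (.var 15)) (.sub .zero (.arr 0 (.lit 0) (.var 15)))) ;;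
      loop 13 30 b₂ ;; setN 38 (.succ (.var 38))) (fun i τ => τ.reg 38 = n + i ∧
      ∀ y < S.N, ∀ y' < S.N, τ.numArr 4 y y' = (if y = y' then (S.energy x y : ℂ) else 0) +
        ∑ i ∈ Finset.range i, S.term x i y y') σ₂ ?_ ?_
  · rw [R₂.k_eq] at k₂
    exact k₂.2
  · refine ⟨by simp [hσ₂, R₁.n_eq], fun y hy y' hy' => ?_⟩
    rw [Finset.range_zero, Finset.sum_empty, add_zero, Memory.setReg_numArr, hσ₂, exec_setN,
      Memory.setReg_numArr, k₁ y hy y' hy']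
    simp [hy]
  · intro i hi τ hF hτ ⟨ih₁, ih₂⟩
    rw [R₂.k_eq] at hi
    have R := R₂.frame hF rfl
    rw [exec_seq, exec_seq]
    set τ₁ := (setC 5 (.ite (sBit 38) (.lit 0)
      (.arr 0 (.lit 0) (.var 15)) (.sub .zero (.arr 0 (.lit 0) (.var 15))))).exec O τ with hτ₁
    have Rτ₁ : S.Ready τ₁ := R.frame (exec_frame O (setC 5 _) τ) rfl
    have hrow : τ.row = S.T.row := by rw [← R.tableau]; rfl
    have n₅ : τ₁.num 5 = S.gamma i * bitSign (S.T.row (n + i)).s := by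
      rw [← R.gamma i hi, ← hrow]
      simp only [hτ₁, exec_setC, Memory.setNum_num, if_true, CExp.eval_ite, sBit, NExp.eval_arr,
        NExp.eval_lit, NExp.eval_var, ih₁, CExp.eval_arr, hτ, CExp.eval_sub, CExp.eval_zero,
        Memory.row, Memory.bit, bitSign, toBit_eq_true]
      by_cases h0 : τ.arr 2 0 (n + i) = 0 <;> simp [h0]
    have a₁₃ : τ₁.arr 13 = σ.arr 13 := (hF.arr 13 rfl).trans ((F₁.arr 13 rfl).trans (F₀.arr 13 rfl))
    have key := loop_inv O (x := 13) (y := 30) (b := b₂) (fun j υ => ∀ y < S.N, ∀ y' < S.N,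
      υ.numArr 4 y y' = τ₁.numArr 4 y y' + if y < j then S.term x i y y' else 0) τ₁
      (fun y _ y' _ => by simp) (by
        intro j hj υ hG hυ ihυ y hy y' hy'
        rw [Rτ₁.N_eq] at hj
        have Rυ := Rτ₁.frame hG rfl
        have r₃₈ : υ.reg 38 = n + i := (hG.reg 38 rfl).trans (by simp [hτ₁, ih₁])
        have hbit : ∀ q : Fin n, υ.bit 13 j q = blockLabel n S.r x j q := by
          intro q
          rw [← hb j hj q]
          simp [Memory.bit, hG.arr 13 rfl, a₁₃]
        have hp := phaseProd_spec O Rυ hυ r₃₈ hbit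
        have Fp := exec_frame O phaseProd υ
        have Rp : S.Ready (phaseProd.exec O υ) := Rυ.frame Fp rfl
        have ht := target_spec O Rp (y := j) (i := n + i) (a := blockLabel n S.r x j)
          ((Fp.reg 13 rfl).trans hυ) ((Fp.reg 38 rfl).trans r₃₈) (fun q => by
            rw [← hbit q]
            simp [Memory.bit, Fp.arr 13 rfl])
        have Ft := exec_frame O target (phaseProd.exec O υ)
        have n₆ : (target.exec O (phaseProd.exec O υ)).num 6 =
            S.gamma i * (S.T.row (n + i)).phase (blockLabel n S.r x j) := by
          rw [Ft.num 6 rfl, hp, hG.num 5 rfl, n₅, Row.phase, mul_assoc]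
        have r₁₃ : (target.exec O (phaseProd.exec O υ)).reg 13 = j :=
          (Ft.reg 13 rfl).trans ((Fp.reg 13 rfl).trans hυ)
        have A₄ : (target.exec O (phaseProd.exec O υ)).numArr 4 = υ.numArr 4 :=
          (Ft.numArr 4 rfl).trans (Fp.numArr 4 rfl)
        simp only [hb₂, exec_seq, exec_setCA, Memory.setReg_numArr, Memory.setNumArr_numArr,
          NExp.eval_var, CExp.eval_add, CExp.eval_arr, CExp.eval_var, r₁₃, ht, n₆, A₄, true_and]
        by_cases hyj : y = j
        · subst hyj
          simp only [true_and, Setting.term, eq_comm (a := y')]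
          rw [ihυ y hy y' hy', if_neg (lt_irrefl y), if_pos (Nat.lt_succ_self y)]
          split_ifs with hh
          · rw [hh, ihυ y hy y' hy', if_neg (lt_irrefl y), add_zero]
          · rfl
        · rw [if_neg (by tauto), ihυ y hy y' hy']
          congr 1
          by_cases hlt : y < j
          · rw [if_pos hlt, if_pos (by omega)]
          · rw [if_neg hlt, if_neg (by omega)])
    rw [Rτ₁.N_eq] at key
    have G := exec_frame O (loop 13 30 b₂) τ₁
    refine ⟨?_, fun y hy y' hy' => ?_⟩
    · have e : ((loop 13 30 b₂).exec O τ₁).reg 38 = n + i :=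
        (G.reg 38 rfl).trans (by simp [hτ₁, ih₁])
      rw [Memory.setReg_reg, if_neg (by decide), exec_setN, Memory.setReg_reg, if_pos rfl,
        NExp.eval_succ, NExp.eval_var, e, add_assoc]
    · rw [Memory.setReg_numArr, exec_setN, Memory.setReg_numArr, key y hy y' hy', if_pos hy,
        Finset.sum_range_succ, ← add_assoc, ← ih₂ y hy y' hy']
      rfl

end Prog

/-! ## The Lanczos process with restarts -/

open Polynomial

/-- The index at which the chain of `t` begins, if `c` marks the indices that continue a chain. -/
def chainStart (c : ℕ → Bool) : ℕ → ℕ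
  | 0 => 0
  | t + 1 => if c (t + 1) then chainStart c t else t + 1

theorem chainStart_le (c : ℕ → Bool) (t : ℕ) : chainStart c t ≤ t := by
  induction t with
  | zero => exact le_rfl
  | succ t ih =>
    rw [chainStart]
    split_ifs <;> omega

theorem chainStart_of_le {c : ℕ → Bool} {t t' : ℕ} (h₁ : chainStart c t ≤ t') (h₂ : t' ≤ t) :
    chainStart c t' = chainStart c t := by
  induction t with
  | zero => rw [Nat.le_zero.1 h₂]
  | succ t ih =>
    rcases h₂.lt_or_eq with h₂ | rfl
    · rw [chainStart] at h₁ ⊢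
      split_ifs with hc
      · rw [if_pos hc] at h₁
        exact ih h₁ (by omega)
      · rw [if_neg hc] at h₁
        omega
    · rfl

theorem chainStart_self (c : ℕ → Bool) (t : ℕ) : chainStart c (chainStart c t) = chainStart c t :=
  chainStart_of_le le_rfl (chainStart_le c t)

theorem chainStart_succ {c : ℕ → Bool} {t : ℕ} (h : c (t + 1) = true) :
    chainStart c (t + 1) = chainStart c t := by rw [chainStart, if_pos h]

theorem eq_true_of_chainStart_lt {c : ℕ → Bool} {t : ℕ} (h : chainStart c t < t) : c t = true := by
  cases t with
  | zero => omega
  | succ t =>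
    rw [chainStart] at h
    split_ifs at h with hc
    · exact hc
    · omega

/-- The Lanczos polynomials. -/
def lanczosPoly (a b : ℕ → ℝ) (c : ℕ → Bool) : ℕ → ℝ[X] × ℝ[X]
  | 0 => (1, (X - C (a 0)) * 1 - C (b 0) * 1)
  | t + 1 =>
    -- The second component is the continuation of the recurrence beyond the current index. A
    -- restart discards it and begins again with 1; the coefficients `b` used later vanish at
    -- restarts, so that nothing of the previous chain enters.
    let p := if c (t + 1) then (lanczosPoly a b c t).2 else 1
    (p, (X - C (a (t + 1))) * p - C (b (t + 1)) * (lanczosPoly a b c t).1)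

section

variable (a b : ℕ → ℝ) (c : ℕ → Bool)

theorem lanczosPoly_snd (t : ℕ) : (lanczosPoly a b c t).2 =
    (X - C (a t)) * (lanczosPoly a b c t).1 - C (b t) * (lanczosPoly a b c (t - 1)).1 := by
  cases t <;> rfl

theorem lanczosPoly_of_true {t : ℕ} (h : c (t + 1) = true) :
    (lanczosPoly a b c (t + 1)).1 = (lanczosPoly a b c t).2 := by
  simp [lanczosPoly, h]

theorem lanczosPoly_of_false {t : ℕ} (h : c t = false) : (lanczosPoly a b c t).1 = 1 := by
  cases t with
  | zero => rfl
  | succ t => simp [lanczosPoly, h]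

theorem lanczosPoly_chainStart (t : ℕ) : (lanczosPoly a b c (chainStart c t)).1 = 1 := by
  by_cases h : chainStart c t = 0
  · rw [h]
    rfl
  · obtain ⟨s, hs⟩ := Nat.exists_eq_succ_of_ne_zero h
    apply lanczosPoly_of_false
    have h₁ := chainStart_self c t
    rw [hs, Nat.succ_eq_add_one, chainStart] at h₁
    rw [hs]
    by_contra hc
    rw [if_pos (by simpa using hc)] at h₁
    have := chainStart_le c s
    omega

/-- The factor `X - C (a t)` raises the degree by one and keeps the polynomial monic, and the
subtracted term has lower degree. At a restart that term is absent by `hb`; this matters since the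
preceding polynomial then belongs to another chain. -/
theorem lanczosPoly_degree (hb : ∀ t, c t = false → b t = 0) (t : ℕ) :
    (lanczosPoly a b c t).1.Monic ∧ (lanczosPoly a b c t).1.natDegree = t - chainStart c t ∧
    (lanczosPoly a b c t).2.Monic ∧
      (lanczosPoly a b c t).2.natDegree = t - chainStart c t + 1 := by
  have aux : ∀ {p q : ℝ[X]} {d : ℕ} (α β : ℝ), p.Monic → p.natDegree = d →
      (β ≠ 0 → q.natDegree ≤ d) → ((X - C α) * p - C β * q).Monic ∧
        ((X - C α) * p - C β * q).natDegree = d + 1 := by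
    intro p q d α β hp hd hq
    have h₁ : ((X - C α) * p).Monic := (monic_X_sub_C α).mul hp
    have h₂ : ((X - C α) * p).natDegree = d + 1 := by
      rw [(monic_X_sub_C α).natDegree_mul hp, natDegree_X_sub_C, hd, add_comm]
    have h₃ : (C β * q).degree < ((X - C α) * p).degree := by
      rw [degree_eq_natDegree h₁.ne_zero, h₂]
      by_cases hβ : β = 0
      · simp [hβ]
      · refine (degree_le_natDegree).trans_lt ?_
        have := (natDegree_C_mul_le β q).trans (hq hβ)
        exact_mod_cast Nat.lt_succ_of_le this
    exact ⟨h₁.sub_of_left h₃, (natDegree_eq_of_degree_eq (degree_sub_eq_left_of_degree_lt h₃)).trans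
      h₂⟩
  induction t with
  | zero =>
    have := aux (p := 1) (q := 1) (d := 0) (a 0) (b 0) monic_one natDegree_one (by simp)
    exact ⟨monic_one, natDegree_one, this⟩
  | succ t ih =>
    have hle := chainStart_le c t
    have key : (lanczosPoly a b c (t + 1)).1.Monic ∧
        (lanczosPoly a b c (t + 1)).1.natDegree = t + 1 - chainStart c (t + 1) := by
      by_cases h : c (t + 1) = true
      · rw [lanczosPoly_of_true _ _ _ h, chainStart_succ h]
        exact ⟨ih.2.2.1, by rw [ih.2.2.2]; omega⟩
      · rw [lanczosPoly_of_false _ _ _ (by simpa using h), chainStart, if_neg h]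
        exact ⟨monic_one, by simp⟩
    refine ⟨key.1, key.2, ?_⟩
    rw [lanczosPoly_snd]
    refine aux _ _ key.1 key.2 fun hβ => ?_
    have h : c (t + 1) = true := by
      by_contra h
      exact hβ (hb _ (by simpa using h))
    rw [Nat.add_sub_cancel, ih.2.1, chainStart_succ h]
    omega

end

variable {E : Type*} [NormedAddCommGroup E] [InnerProductSpace ℂ E]

/-- As many nonzero orthogonal vectors as the dimension form a basis, so only 0 is orthogonal to all
of them. -/
theorem ext_of_orthogonal [FiniteDimensional ℂ E] {u : ℕ → E} {N : ℕ} (h₀ : ∀ t < N, u t ≠ 0)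
    (h : ∀ t < N, ∀ t' < N, t ≠ t' → inner ℂ (u t) (u t') = 0)
    (hN : Module.finrank ℂ E = N) {x y : E}
    (hxy : ∀ j < N, inner ℂ (u j) x = inner ℂ (u j) y) : x = y := by
  rw [← sub_eq_zero]
  by_cases hN0 : N = 0
  · have : Subsingleton E := Module.finrank_zero_iff.1 (hN.trans hN0)
    exact Subsingleton.elim _ _
  have : Nonempty (Fin N) := ⟨⟨0, by omega⟩⟩
  have hi : LinearIndependent ℂ fun t : Fin N => u t :=
    linearIndependent_of_ne_zero_of_inner_eq_zero (fun t => h₀ t t.2) fun s t hst =>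
      h s s.2 t t.2 fun e => hst (Fin.ext e)
  have hs := hi.span_eq_top_of_card_eq_finrank (by simp [hN])
  have h₁ : ∀ z ∈ Submodule.span ℂ (Set.range fun t : Fin N => u t), inner ℂ z (x - y) = 0 := by
    intro z hz
    induction hz using Submodule.span_induction with
    | mem z hz =>
      obtain ⟨t, rfl⟩ := hz
      rw [inner_sub_right, hxy t t.2, sub_self]
    | zero => exact inner_zero_left _
    | add z w _ _ hz hw => rw [inner_add_left, hz, hw, add_zero]
    | smul a z _ hz => rw [inner_smul_left, hz, mul_zero]
  exact inner_self_eq_zero.1 (h₁ (x - y) (hs ▸ Submodule.mem_top))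

/-- The first `τ` vectors of a Lanczos process with restarts: an orthogonal family, in which the
vectors with `c` arise from their predecessors. -/
structure Lanczos (A : E →ₗ[ℂ] E) (u : ℕ → E) (c : ℕ → Bool) (τ : ℕ) : Prop where
  ne_zero : ∀ t < τ, u t ≠ 0
  orthogonal : ∀ t < τ, ∀ t' < τ, t ≠ t' → inner ℂ (u t) (u t') = 0
  start : 0 < τ → c 0 = false
  next : ∀ t, t + 1 < τ →
    A (u t) - (if c (t + 1) then u (t + 1) else 0) ∈ Submodule.span ℂ (u '' Set.Iic t)

/-! ### The three-term recurrence, its polynomials and the eigenvectors of a chain. -/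

namespace Lanczos

variable {A : E →ₗ[ℂ] E} {u : ℕ → E} {c : ℕ → Bool} {τ N : ℕ}

theorem linearIndependent (h : Lanczos A u c τ) :
    LinearIndependent ℂ fun t : Fin τ => u t :=
  linearIndependent_of_ne_zero_of_inner_eq_zero (fun t => h.ne_zero t t.2) fun s t hst =>
    h.orthogonal s s.2 t t.2 fun e => hst (Fin.ext e)

theorem inner_eq_zero (h : Lanczos A u c τ) {j t : ℕ} (hj : j < τ) (ht : t < j) {x : E}
    (hx : x ∈ Submodule.span ℂ (u '' Set.Iic t)) : inner ℂ (u j) x = 0 := by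
  induction hx using Submodule.span_induction with
  | mem x hx =>
    obtain ⟨s, hs, rfl⟩ := hx
    have hs' : s ≤ t := hs
    exact h.orthogonal j hj s (by omega) (by omega)
  | zero => exact inner_zero_right _
  | add x y _ _ hx hy => rw [inner_add_right, hx, hy, add_zero]
  | smul a x _ hx => rw [inner_smul_right, hx, mul_zero]

theorem ext [FiniteDimensional ℂ E] (h : Lanczos A u c N) (hN : Module.finrank ℂ E = N) {x y : E}
    (hxy : ∀ j < N, inner ℂ (u j) x = inner ℂ (u j) y) : x = y :=
  ext_of_orthogonal h.ne_zero h.orthogonal hN hxy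

/-- The diagonal coefficients. -/
def _root_.StabPert.lanczosDiag (A : E →ₗ[ℂ] E) (u : ℕ → E) (t : ℕ) : ℝ :=
  (inner ℂ (u t) (A (u t))).re / ‖u t‖ ^ 2

/-- The off-diagonal coefficients. -/
def _root_.StabPert.lanczosOff (u : ℕ → E) (c : ℕ → Bool) (t : ℕ) : ℝ :=
  if c t then ‖u t‖ ^ 2 / ‖u (t - 1)‖ ^ 2 else 0

theorem norm_ne_zero (h : Lanczos A u c N) {t : ℕ} (ht : t < N) : ((‖u t‖ : ℂ)) ^ 2 ≠ 0 := by
  simpa using h.ne_zero t ht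

theorem inner_self' (t : ℕ) : inner ℂ (u t) (u t) = (‖u t‖ : ℂ) ^ 2 := inner_self_eq_norm_sq_to_K _

theorem diag_mul (hA : A.IsSymmetric) (h : Lanczos A u c N) {t : ℕ} (ht : t < N) :
    (lanczosDiag A u t : ℂ) * (‖u t‖ : ℂ) ^ 2 = inner ℂ (u t) (A (u t)) := by
  rw [lanczosDiag]
  push_cast
  rw [div_mul_cancel₀ _ (h.norm_ne_zero ht)]
  exact hA.coe_re_inner_self_apply (u t)

/-- By `next`, applying `A` to `u t` reaches at most one vector beyond index `t`, and only within a
chain: the matrix is of Hessenberg form. -/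
theorem inner_apply_of_lt (h : Lanczos A u c N) {j t : ℕ} (hj : j < N) (hjt : t < j) :
    inner ℂ (u j) (A (u t)) = if j = t + 1 ∧ c j then (‖u j‖ : ℂ) ^ 2 else 0 := by
  have := h.inner_eq_zero hj hjt (h.next t (by omega))
  rw [inner_sub_right, sub_eq_zero] at this
  rw [this]
  by_cases hjt' : j = t + 1
  · subst hjt'
    by_cases hc : c (t + 1) = true
    · simp [hc]
    · simp [hc]
  · have e : (if j = t + 1 ∧ c j = true then (‖u j‖ : ℂ) ^ 2 else 0) = 0 :=
      if_neg fun H => hjt' H.1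
    rw [e]
    split_ifs
    · exact h.orthogonal j hj (t + 1) (by omega) hjt'
    · exact inner_zero_right _

/-- The three-term recurrence. -/
theorem three_term [FiniteDimensional ℂ E] (hA : A.IsSymmetric) (h : Lanczos A u c N) (hN : Module.finrank ℂ E = N)
    {t : ℕ} (ht : t < N) : A (u t) =
      (if t + 1 < N ∧ c (t + 1) then u (t + 1) else 0) + (lanczosDiag A u t : ℂ) • u t +
        (lanczosOff u c t : ℂ) • u (t - 1) := by
  refine h.ext hN fun j hj => ?_
  have h0 : c 0 = false := h.start (by omega)
  have e : ∀ i < N, inner ℂ (u j) (u i) = if j = i then (‖u j‖ : ℂ) ^ 2 else 0 := by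
    intro i hi
    split_ifs with hij
    · rw [← hij, inner_self']
    · exact h.orthogonal j hj i hi hij
  have e₁ : inner ℂ (u j) (if t + 1 < N ∧ c (t + 1) then u (t + 1) else 0) =
      if j = t + 1 ∧ c j then (‖u j‖ : ℂ) ^ 2 else 0 := by
    by_cases h₁ : t + 1 < N
    · by_cases h₂ : c (t + 1) = true
      · rw [if_pos ⟨h₁, h₂⟩, e _ h₁]
        by_cases h₃ : j = t + 1
        · simp [h₃, h₂]
        · simp [h₃]
      · rw [if_neg (by tauto), inner_zero_right, if_neg]
        rintro ⟨rfl, h₃⟩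
        exact h₂ h₃
    · rw [if_neg (by tauto), inner_zero_right, if_neg (by omega)]
  rw [inner_add_right, inner_add_right, inner_smul_right, inner_smul_right, e₁, e t ht,
    e (t - 1) (by omega)]
  -- Both sides are compared along each `u j`. For `j > t` the Hessenberg form decides, `j = t` is
  -- the definition of the diagonal coefficient, and `j < t` reduces by symmetry of `A` to the
  -- Hessenberg form with the indices exchanged.
  rcases lt_trichotomy t j with hjt | rfl | hjt
  · rw [h.inner_apply_of_lt hj hjt, if_neg (by omega : ¬ j = t), if_neg (by omega : ¬ j = t - 1)]
    simp
  · rw [if_neg (by omega : ¬ (t = t + 1 ∧ _)), if_pos rfl, h.diag_mul hA ht, zero_add,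
      left_eq_add]
    -- For `t = 0` the truncated predecessor is `u 0` itself; its coefficient vanishes because index
    -- 0 does not continue a chain.
    by_cases h₁ : t = 0
    · subst h₁
      simp [lanczosOff, h0]
    · rw [if_neg (by omega), mul_zero]
  · rw [if_neg (by omega : ¬ (j = t + 1 ∧ _)), if_neg (by omega : ¬ j = t), mul_zero, zero_add,
      zero_add, ← hA (u j) (u t), ← inner_conj_symm, h.inner_apply_of_lt ht hjt]
    by_cases h₁ : j = t - 1
    · rw [if_pos h₁, lanczosOff]
      have h₂ : t = j + 1 := by omega
      by_cases hc : c t = true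
      · rw [if_pos ⟨h₂, hc⟩, if_pos hc, ← h₁]
        push_cast
        rw [div_mul_cancel₀ _ (h.norm_ne_zero hj)]
        simp
      · rw [if_neg (by tauto), if_neg hc]
        simp
    · rw [if_neg (by omega), if_neg h₁]
      simp

variable (A u c) in
/-- The polynomials of a Lanczos process. -/
def _root_.StabPert.lanczosPolys : ℕ → ℝ[X] × ℝ[X] :=
  lanczosPoly (lanczosDiag A u) (lanczosOff u c) c

theorem _root_.StabPert.lanczosPolys_snd (t : ℕ) : (lanczosPolys A u c t).2 =
    (X - C (lanczosDiag A u t)) * (lanczosPolys A u c t).1 -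
      C (lanczosOff u c t) * (lanczosPolys A u c (t - 1)).1 := lanczosPoly_snd _ _ _ t

theorem _root_.StabPert.lanczosPolys_of_true {t : ℕ} (h : c (t + 1) = true) :
    (lanczosPolys A u c (t + 1)).1 = (lanczosPolys A u c t).2 := lanczosPoly_of_true _ _ _ h

theorem _root_.StabPert.lanczosPolys_chainStart (t : ℕ) :
    (lanczosPolys A u c (chainStart c t)).1 = 1 := lanczosPoly_chainStart _ _ _ t

/-- The last index of a chain. -/
structure _root_.StabPert.IsChainEnd (c : ℕ → Bool) (N s e : ℕ) : Prop where
  lt : e < N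
  start : chainStart c e = s
  le : ∀ t < N, chainStart c t = s → t ≤ e

theorem _root_.StabPert.IsChainEnd.not_next {s e : ℕ} (h : IsChainEnd c N s e) :
    ¬ (e + 1 < N ∧ c (e + 1) = true) := by
  rintro ⟨h₁, h₂⟩
  have := h.le (e + 1) h₁ ((chainStart_succ h₂).trans h.start)
  omega

theorem _root_.StabPert.IsChainEnd.mem_iff {s e : ℕ} (h : IsChainEnd c N s e) {t : ℕ}
    (ht : t < N) : chainStart c t = s ↔ s ≤ t ∧ t ≤ e := by
  refine ⟨fun hs => ⟨hs ▸ chainStart_le c t, h.le t ht hs⟩, fun ⟨h₁, h₂⟩ => ?_⟩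
  rw [chainStart_of_le (h.start ▸ h₁) h₂, h.start]

/-- The components of the vectors of a chain along an eigenvector. -/
theorem inner_eigenvector [FiniteDimensional ℂ E] (hA : A.IsSymmetric) (h : Lanczos A u c N)
    (hN : Module.finrank ℂ E = N) {s e : ℕ} (hs : IsChainEnd c N s e) {f : E} {μ : ℝ}
    (hf : A f = (μ : ℂ) • f) :
    (∀ t, s ≤ t → t ≤ e → inner ℂ f (u t) =
      (((lanczosPolys A u c t).1.eval μ : ℝ) : ℂ) * inner ℂ f (u s)) ∧
    (((lanczosPolys A u c e).2.eval μ : ℝ) : ℂ) * inner ℂ f (u s) = 0 := by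
  have hlt := hs.lt
  have hse : s ≤ e := hs.start ▸ chainStart_le c e
  -- Pairing the three-term recurrence with the eigenvector shows that its components obey the
  -- recurrence of the polynomials at `μ`.
  have hrec : ∀ t < N, (μ : ℂ) * inner ℂ f (u t) =
      (if t + 1 < N ∧ c (t + 1) then inner ℂ f (u (t + 1)) else 0) +
      (lanczosDiag A u t : ℂ) * inner ℂ f (u t) +
        (lanczosOff u c t : ℂ) * inner ℂ f (u (t - 1)) := by
    intro t ht
    have : inner ℂ (A f) (u t) = inner ℂ f (A (u t)) := hA f (u t)
    rw [hf, inner_smul_left, Complex.conj_ofReal, h.three_term hA hN ht, inner_add_right,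
      inner_add_right, inner_smul_right, inner_smul_right] at this
    rw [this]
    split_ifs <;> simp
  -- The second clause is the claim for the preceding index, multiplied by the off-diagonal
  -- coefficient. In this form it also holds at the start of the chain, where that coefficient is 0.
  have hP : ∀ t, s ≤ t → t ≤ e → inner ℂ f (u t) =
      (((lanczosPolys A u c t).1.eval μ : ℝ) : ℂ) * inner ℂ f (u s) ∧
      (lanczosOff u c t : ℂ) * inner ℂ f (u (t - 1)) = (lanczosOff u c t : ℂ) *
        ((((lanczosPolys A u c (t - 1)).1.eval μ : ℝ) : ℂ) * inner ℂ f (u s)) := by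
    intro t hst
    induction t, hst using Nat.le_induction with
    | base =>
      intro _
      have h₁ : (lanczosPolys A u c s).1 = 1 := by
        rw [← hs.start]
        exact lanczosPolys_chainStart _
      have h₂ : c s = false := by
        by_contra hc
        cases s with
        | zero => exact hc (h.start (by omega))
        | succ s =>
          have h₃ := chainStart_self c e
          rw [hs.start, chainStart, if_pos (by simpa using hc)] at h₃
          have := chainStart_le c s
          omega
      exact ⟨by rw [h₁]; simp, by simp [lanczosOff, h₂]⟩
    | succ t hst ih =>
      intro hte
      obtain ⟨ih₁, ih₂⟩ := ih (by omega)
      have hc : c (t + 1) = true := by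
        apply eq_true_of_chainStart_lt
        rw [(hs.mem_iff (by omega)).2 ⟨by omega, hte⟩]
        omega
      refine ⟨?_, by rw [Nat.add_sub_cancel, ih₁]⟩
      have := hrec t (by omega)
      rw [if_pos ⟨by omega, hc⟩, ih₂, ih₁] at this
      rw [lanczosPolys_of_true hc, lanczosPolys_snd]
      simp only [eval_sub, eval_mul, eval_X, eval_C]
      push_cast
      linear_combination -this
  refine ⟨fun t h₁ h₂ => (hP t h₁ h₂).1, ?_⟩
  have := hrec e hlt
  obtain ⟨h₁, h₂⟩ := hP e hse le_rfl
  rw [if_neg hs.not_next, h₂, h₁] at this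
  rw [lanczosPolys_snd]
  simp only [eval_sub, eval_mul, eval_X, eval_C]
  push_cast
  linear_combination this

/-- The final polynomial of a chain has as many distinct real roots as the chain has members. -/
theorem roots_nodup [FiniteDimensional ℂ E] (hA : A.IsSymmetric) (h : Lanczos A u c N) (hN : Module.finrank ℂ E = N)
    {s e : ℕ} (hs : IsChainEnd c N s e) :
    (lanczosPolys A u c e).2.roots.Nodup ∧ (lanczosPolys A u c e).2.roots.card = e - s + 1 := by
  classical
  set Q := (lanczosPolys A u c e).2 with hQ
  obtain ⟨-, -, hmon, hdeg⟩ := lanczosPoly_degree (lanczosDiag A u) (lanczosOff u c) c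
    (fun t ht => by simp [lanczosOff, ht]) e
  rw [hs.start] at hdeg
  have hmon' : Q.Monic := hmon
  have hlt := hs.lt
  have hse : s ≤ e := hs.start ▸ chainStart_le c e
  set f := hA.eigenvectorBasis hN
  set μ := hA.eigenvalues hN
  have hf : ∀ i, A (f i) = (μ i : ℂ) • f i := fun i => hA.apply_eigenvectorBasis hN i
  have key := fun i => inner_eigenvector hA h hN hs (hf i)
  -- The eigenvalues seen by the first vector of the chain. By `inner_eigenvector` each of them is a
  -- root of `Q`, so it remains to show that there are at least as many as the degree of `Q`.
  set Λ : Finset ℝ := (Finset.univ.filter fun i => inner ℂ (f i) (u s) ≠ 0).image μ with hΛ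
  have hroots : Λ ⊆ Q.roots.toFinset := by
    intro x hx
    simp only [hΛ, Finset.mem_image, Finset.mem_filter, Finset.mem_univ, true_and] at hx
    obtain ⟨i, hi, rfl⟩ := hx
    rw [Multiset.mem_toFinset, mem_roots hmon'.ne_zero, IsRoot.def]
    have := (key i).2
    exact_mod_cast (mul_eq_zero.1 this).resolve_right hi
  have hcard : e - s + 1 ≤ Λ.card := by
    -- The spectral components of the first vector of the chain. Each vector of the chain is a
    -- combination of these, with the values of its polynomial as coefficients, so its `e - s + 1`
    -- independent vectors need at least that many spectral components.
    let z : ℝ → E := fun x => ∑ i with μ i = x, inner ℂ (f i) (u s) • f i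
    let w : Fin (e - s + 1) → E := fun t => u (s + t)
    have hw : LinearIndependent ℂ w :=
      h.linearIndependent.comp (fun t : Fin (e - s + 1) => (⟨s + t, by omega⟩ : Fin N))
        fun t t' htt => by simpa [Fin.ext_iff] using htt
    have hmem : Set.range w ⊆ Submodule.span ℂ (Λ.image z : Set E) := by
      rintro _ ⟨t, rfl⟩
      have e₁ : w t = ∑ x ∈ Λ, (((lanczosPolys A u c (s + t)).1.eval x : ℝ) : ℂ) • z x := by
        conv_lhs => rw [← f.sum_repr' (w t)]
        have e₂ : ∀ i, inner ℂ (f i) (w t) • f i =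
            ((((lanczosPolys A u c (s + t)).1.eval (μ i) : ℝ) : ℂ) * inner ℂ (f i) (u s)) • f i :=
          fun i => by rw [← (key i).1 (s + t) (by omega) (by omega)]
        rw [Finset.sum_congr rfl fun i _ => e₂ i]
        simp only [z, Finset.smul_sum]
        rw [← Finset.sum_filter_add_sum_filter_not Finset.univ
          (fun i => inner ℂ (f i) (u s) ≠ 0), Finset.sum_eq_zero (s := Finset.univ.filter
            fun i => ¬ (inner ℂ (f i) (u s) ≠ 0)) (fun i hi => by
              have := (Finset.mem_filter.1 hi).2
              rw [not_not] at this
              rw [this, mul_zero, zero_smul]), add_zero,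
          ← Finset.sum_fiberwise_of_maps_to (g := μ) (t := Λ) (fun i hi =>
            Finset.mem_image_of_mem _ hi)]
        refine Finset.sum_congr rfl fun x _ => ?_
        rw [← Finset.sum_filter_of_ne (s := Finset.univ.filter fun i => μ i = x)
          (p := fun i => inner ℂ (f i) (u s) ≠ 0)]
        · rw [Finset.filter_filter, Finset.filter_filter]
          simp only [and_comm]
          refine Finset.sum_congr rfl fun i hi => ?_
          rw [(Finset.mem_filter.1 hi).2.1, smul_smul]
        · intro i _ hi h0
          exact hi (by rw [h0, zero_smul, smul_zero])
      rw [e₁]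
      exact Submodule.sum_mem _ fun x hx => Submodule.smul_mem _ _
        (Submodule.subset_span (by simpa using ⟨x, hx, rfl⟩))
    have h₁ := finrank_span_eq_card hw
    rw [Fintype.card_fin] at h₁
    rw [← h₁]
    exact (Submodule.finrank_mono (Submodule.span_le.2 hmem)).trans
      ((finrank_span_finset_le_card _).trans Finset.card_image_le)
  have h₁ := Finset.card_le_card hroots
  have h₂ := Multiset.toFinset_card_le Q.roots
  have h₃ := card_roots' Q
  have h₄ : Q.natDegree = e - s + 1 := hdeg
  exact ⟨Multiset.toFinset_card_eq_card_iff_nodup.1 (by omega), by omega⟩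

/-- The eigenvectors in the span of a chain. -/
def _root_.StabPert.lanczosVector (A : E →ₗ[ℂ] E) (u : ℕ → E) (c : ℕ → Bool) (N s : ℕ) (x : ℝ) :
    E :=
  ∑ t ∈ Finset.range N, if chainStart c t = s then
    (((lanczosPolys A u c t).1.eval x / ‖u t‖ ^ 2 : ℝ) : ℂ) • u t else 0

theorem inner_lanczosVector (h : Lanczos A u c N) {s j : ℕ} {x : ℝ} (hj : j < N) :
    inner ℂ (u j) (lanczosVector A u c N s x) =
      if chainStart c j = s then (((lanczosPolys A u c j).1.eval x : ℝ) : ℂ) else 0 := by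
  rw [lanczosVector, inner_sum, Finset.sum_eq_single j]
  · split_ifs
    · rw [inner_smul_right, inner_self']
      push_cast
      rw [div_mul_cancel₀ _ (h.norm_ne_zero hj)]
    · exact inner_zero_right _
  · intro t ht htj
    split_ifs
    · rw [inner_smul_right, h.orthogonal j hj t (Finset.mem_range.1 ht) htj.symm, mul_zero]
    · exact inner_zero_right _
  · intro hj'
    exact absurd (Finset.mem_range.2 hj) hj'

/-- Its inner product with the first vector of the chain is the value of the constant polynomial 1.
-/
theorem lanczosVector_ne_zero (h : Lanczos A u c N) {s e : ℕ} (hs : IsChainEnd c N s e) (x : ℝ) :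
    lanczosVector A u c N s x ≠ 0 := by
  intro h0
  have hse : s ≤ e := hs.start ▸ chainStart_le c e
  have hss : chainStart c s = s := by rw [← hs.start, chainStart_self]
  have := h.inner_lanczosVector (s := s) (x := x) (hse.trans_lt hs.lt)
  rw [h0, inner_zero_right, if_pos hss, ← hss, lanczosPolys_chainStart] at this
  simp at this

/-- By symmetry of `A` and the three-term recurrence, the components along `u j` of both sides agree
by the recurrence of the polynomials at `x`. At the end of the chain the missing next component is
the value of the last polynomial, which is 0. -/
theorem apply_lanczosVector [FiniteDimensional ℂ E] (hA : A.IsSymmetric) (h : Lanczos A u c N)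
    (hN : Module.finrank ℂ E = N) {s e : ℕ} (hs : IsChainEnd c N s e) {x : ℝ}
    (hx : (lanczosPolys A u c e).2.eval x = 0) :
    A (lanczosVector A u c N s x) = (x : ℂ) • lanczosVector A u c N s x := by
  refine h.ext hN fun j hj => ?_
  rw [inner_smul_right, ← hA (u j), h.three_term hA hN hj, inner_add_left, inner_add_left,
    inner_smul_left, inner_smul_left, Complex.conj_ofReal, Complex.conj_ofReal,
    h.inner_lanczosVector hj, h.inner_lanczosVector (j := j - 1) (by omega)]
  have hsnd := congrArg (fun p => ((eval x p : ℝ) : ℂ))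
    (lanczosPolys_snd (A := A) (u := u) (c := c) j)
  simp only [eval_sub, eval_mul, eval_X, eval_C, Complex.ofReal_sub, Complex.ofReal_mul] at hsnd
  have e₁ : inner ℂ (if j + 1 < N ∧ c (j + 1) then u (j + 1) else 0)
      (lanczosVector A u c N s x) =
      if chainStart c j = s then (((lanczosPolys A u c j).2.eval x : ℝ) : ℂ) else 0 := by
    by_cases hc : j + 1 < N ∧ c (j + 1) = true
    · rw [if_pos hc, h.inner_lanczosVector hc.1, chainStart_succ hc.2,
        lanczosPolys_of_true hc.2]
    · rw [if_neg hc, inner_zero_left]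
      split_ifs with hj'
      · have : j = e := by
          have h₁ := (hs.mem_iff hj).1 hj'
          by_contra hne
          have h₂ := hs.lt
          refine hc ⟨by omega, eq_true_of_chainStart_lt ?_⟩
          rw [(hs.mem_iff (by omega)).2 ⟨by omega, by omega⟩]
          omega
        rw [this, hx]
        simp
      · rfl
  have e₂ : (lanczosOff u c j : ℂ) * (if chainStart c (j - 1) = s then
      (((lanczosPolys A u c (j - 1)).1.eval x : ℝ) : ℂ) else 0) = if chainStart c j = s then
      (lanczosOff u c j : ℂ) * (((lanczosPolys A u c (j - 1)).1.eval x : ℝ) : ℂ) else 0 := by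
    by_cases hc : c j = true
    · cases j with
      | zero => rw [h.start hj] at hc; cases hc
      | succ j =>
        rw [chainStart_succ hc, Nat.add_sub_cancel]
        split_ifs <;> simp
    · simp [lanczosOff, hc]
  rw [e₁, e₂]
  split_ifs
  · linear_combination hsnd
  · simp

theorem inner_lanczosVector_of_ne (h : Lanczos A u c N) {s s' : ℕ} (hss : s ≠ s') (x x' : ℝ) :
    inner ℂ (lanczosVector A u c N s x) (lanczosVector A u c N s' x') = 0 := by
  conv_lhs => rw [lanczosVector, sum_inner]
  refine Finset.sum_eq_zero fun t ht => ?_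
  split_ifs with hc
  · rw [inner_smul_left, h.inner_lanczosVector (Finset.mem_range.1 ht), if_neg (by omega), mul_zero]
  · exact inner_zero_left _

end Lanczos


theorem inner_eq_zero_of_eigenvalue_ne
    {A : E →ₗ[ℂ] E} (hA : A.IsSymmetric) {v w : E} {x y : ℝ} (hv : A v = (x : ℂ) • v)
    (hw : A w = (y : ℂ) • w) (hxy : x ≠ y) : inner ℂ v w = 0 := by
  have := hA v w
  rw [hv, hw, inner_smul_left, inner_smul_right, Complex.conj_ofReal, ← sub_eq_zero, ← sub_mul]
    at this
  refine (mul_eq_zero.1 this).resolve_left ?_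
  exact sub_ne_zero.2 (by exact_mod_cast hxy)

/-! ## The Lanczos program -/

section

variable {E : Type*} [NormedAddCommGroup E] [InnerProductSpace ℂ E]

theorem image_Iio_congr {α : Type*} {u u' : ℕ → α} {τ : ℕ} (h : ∀ t < τ, u' t = u t) :
    u' '' Set.Iio τ = u '' Set.Iio τ := Set.image_congr fun t ht => h t ht

/-- The state of a Lanczos process in which the vectors `b` serve as starting vectors. -/
structure LanczosState (A : E →ₗ[ℂ] E) (b u : ℕ → E) (c : ℕ → Bool) (τ : ℕ) (act : Bool) (e : ℕ) :
    Prop where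
  lanczos : Lanczos A u c τ
  closed : act = false → ∀ t, t + 1 = τ → A (u t) ∈ Submodule.span ℂ (u '' Set.Iio τ)
  active : act = true → 0 < τ
  covered : ∀ i < e, b i ∈ Submodule.span ℂ (u '' Set.Iio τ)

namespace LanczosState

variable {A : E →ₗ[ℂ] E} {b u u' : ℕ → E} {c c' : ℕ → Bool} {τ e : ℕ} {act : Bool} {w : E}

/-- The candidate brings nothing new: a running chain becomes invariant and ends, or the tried
starting vector is covered. -/
theorem step_closed (h : LanczosState A b u c τ act e)
    (hv : (if act then A (u (τ - 1)) else b e) ∈ Submodule.span ℂ (u '' Set.Iio τ)) :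
    LanczosState A b u c τ false (if act then e else e + 1) where
  lanczos := h.lanczos
  closed _ t ht := by
    cases act
    · exact h.closed rfl t ht
    · subst ht
      simpa using hv
  active := by simp
  covered i hi := by
    cases act
    · rcases (Nat.lt_succ_iff.1 hi).lt_or_eq with hi | rfl
      · exact h.covered i hi
      · simpa using hv
    · exact h.covered i hi

/-- The orthogonal remainder is appended. In a running chain `hvw` is precisely the condition
`next`; for a new chain `next` requires that the previous chain be closed, which is the field
`closed`. -/
theorem step_append (h : LanczosState A b u c τ act e) (hw0 : w ≠ 0)
    (hw : ∀ s < τ, inner ℂ (u s) w = 0)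
    (hvw : (if act then A (u (τ - 1)) else b e) - w ∈ Submodule.span ℂ (u '' Set.Iio τ))
    (hu : ∀ t < τ, u' t = u t) (huw : u' τ = w) (hc : ∀ t < τ, c' t = c t) (hca : c' τ = act) :
    LanczosState A b u' c' (τ + 1) true (if act then e else e + 1) := by
  have hmono : Submodule.span ℂ (u '' Set.Iio τ) ≤ Submodule.span ℂ (u' '' Set.Iio (τ + 1)) := by
    rw [← image_Iio_congr hu]
    exact Submodule.span_mono (Set.image_mono fun t ht =>
      lt_trans (Set.mem_Iio.1 ht) (Nat.lt_succ_self _))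
  have hwm : w ∈ Submodule.span ℂ (u' '' Set.Iio (τ + 1)) :=
    Submodule.subset_span ⟨τ, Set.mem_Iio.2 (Nat.lt_succ_self τ), huw⟩
  refine ⟨⟨fun t ht => ?_, fun t ht t' ht' hne => ?_, fun _ => ?_, fun t ht => ?_⟩, by simp, by simp,
    fun i hi => ?_⟩
  · rcases (Nat.lt_succ_iff.1 ht).lt_or_eq with ht | rfl
    · rw [hu t ht]
      exact h.lanczos.ne_zero t ht
    · rwa [huw]
  · rcases (Nat.lt_succ_iff.1 ht).lt_or_eq with ht | rfl <;>
      rcases (Nat.lt_succ_iff.1 ht').lt_or_eq with ht' | rfl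
    · rw [hu t ht, hu t' ht']
      exact h.lanczos.orthogonal t ht t' ht' hne
    · rw [hu t ht, huw, hw t ht]
    · rw [hu t' ht', huw, ← inner_conj_symm, hw t' ht', map_zero]
    · exact absurd rfl hne
  · by_cases h0 : τ = 0
    · subst h0
      rw [hca]
      cases act
      · rfl
      · exact absurd (h.active rfl) (lt_irrefl 0)
    · rw [hc 0 (by omega)]
      exact h.lanczos.start (by omega)
  · have hI : Set.Iic t = Set.Iio (t + 1) := by
      ext
      simp
    rcases (Nat.lt_succ_iff.1 ht).lt_or_eq with ht | ht
    · have := h.lanczos.next t ht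
      rw [hc _ ht, hu _ ht, hu t (by omega), hI, image_Iio_congr fun s hs => hu s (by omega), ← hI]
      exact this
    · rw [hI, ht, image_Iio_congr hu, hca, huw, hu t (by omega)]
      subst ht
      cases act
      · simpa using h.closed rfl t rfl
      · simpa using hvw
  · cases act
    · rcases (Nat.lt_succ_iff.1 hi).lt_or_eq with hi | rfl
      · exact hmono (h.covered i hi)
      · simpa using add_mem (hmono hvw) hwm
    · exact hmono (h.covered i hi)

end LanczosState

theorem Lanczos.le_finrank [FiniteDimensional ℂ E] {A : E →ₗ[ℂ] E} {u : ℕ → E} {c : ℕ → Bool}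
    {τ : ℕ} (h : Lanczos A u c τ) : τ ≤ Module.finrank ℂ E := by
  simpa using h.linearIndependent.fintype_card_le_finrank

end

/-- The vector with given components. -/
def vec (N : ℕ) (f : ℕ → ℂ) : EuclideanSpace ℂ (Fin N) := WithLp.toLp 2 fun y => f y

/-- The operator with given matrix. -/
def matrixOp (N : ℕ) (B : ℕ → ℕ → ℂ) : EuclideanSpace ℂ (Fin N) →ₗ[ℂ] EuclideanSpace ℂ (Fin N) :=
  Matrix.toEuclideanLin (Matrix.of fun y y' : Fin N => B y y')

section

variable {N : ℕ}

theorem vec_congr {f g : ℕ → ℂ} (h : ∀ y < N, f y = g y) : vec N f = vec N g := by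
  ext y
  exact h y y.2

theorem vec_add (f g : ℕ → ℂ) : vec N f + vec N g = vec N fun y => f y + g y := rfl

theorem vec_sub (f g : ℕ → ℂ) : vec N f - vec N g = vec N fun y => f y - g y := rfl

theorem vec_smul (a : ℂ) (f : ℕ → ℂ) : a • vec N f = vec N fun y => a * f y := rfl

theorem inner_vec (f g : ℕ → ℂ) :
    inner ℂ (vec N f) (vec N g) = ∑ y ∈ Finset.range N, starRingEnd ℂ (f y) * g y := by
  rw [EuclideanSpace.inner_eq_star_dotProduct, dotProduct, ← Fin.sum_univ_eq_sum_range
    (fun y => starRingEnd ℂ (f y) * g y)]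
  exact Finset.sum_congr rfl fun y _ => mul_comm _ _

theorem norm_vec_sq (f : ℕ → ℂ) : ((‖vec N f‖ : ℂ)) ^ 2 =
    ∑ y ∈ Finset.range N, starRingEnd ℂ (f y) * f y := by
  rw [← inner_vec]
  exact (inner_self_eq_norm_sq_to_K (𝕜 := ℂ) (vec N f)).symm

theorem matrixOp_vec (B : ℕ → ℕ → ℂ) (f : ℕ → ℂ) :
    matrixOp N B (vec N f) = vec N fun y => ∑ y' ∈ Finset.range N, B y y' * f y' := by
  ext y
  rw [matrixOp, Matrix.toLpLin_apply]
  simp only [vec, Matrix.mulVec, dotProduct, Matrix.of_apply]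
  exact Fin.sum_univ_eq_sum_range (fun y' => B y y' * f y') N

end

/-! ### The Lanczos process carried out by the program. -/

namespace Prog

open Cmd

variable {N : ℕ} (O : Oracle) (σ : Memory)

theorem applyMatrix_spec (hN : σ.reg 30 = N) {t y s : ℕ} (ht : t ≠ 14) (hy : σ.reg 13 = y)
    (hs : σ.reg t = s) : ((applyMatrix t).exec O σ).num 6 =
      ∑ y' ∈ Finset.range N, σ.numArr 4 y y' * σ.numArr 5 s y' := by
  rw [applyMatrix, exec_seq, num_loop_sum O _ fun y' => σ.numArr 4 y y' * σ.numArr 5 s y']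
  · simp [hN]
  · intro i _ τ hF hτ
    have e₁ : τ.reg 13 = y := (hF.reg 13 rfl).trans hy
    have e₂ : τ.reg t = s := (hF.reg t (by simp [wr, ht.symm])).trans hs
    have e₃ : τ.numArr 4 = σ.numArr 4 := hF.numArr 4 rfl
    have e₄ : τ.numArr 5 = σ.numArr 5 := hF.numArr 5 rfl
    simp [e₁, e₂, e₃, e₄, hτ]

theorem squareNorm_spec (hN : σ.reg 30 = N) (a : ℕ) : ((squareNorm a).exec O σ).num 6 =
    ((‖vec N (σ.numArr a 0)‖ ^ 2 : ℝ) : ℂ) := by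
  rw [squareNorm, exec_seq, num_loop_sum O _ fun y =>
    starRingEnd ℂ (σ.numArr a 0 y) * σ.numArr a 0 y]
  · push_cast
    rw [norm_vec_sq]
    simp [hN]
  · intro i _ τ hF hτ
    have e : τ.numArr a = σ.numArr a := hF.numArr a rfl
    simp [e, hτ]

/-- The vector from which the next Lanczos vector is made. -/
theorem candidate_spec (hN : σ.reg 30 = N) :
    vec N ((candidate.exec O σ).numArr 7 0) = (if toBit (σ.reg 41) then
        matrixOp N (σ.numArr 4) (vec N (σ.numArr 5 (σ.reg 40 - 1)))
      else vec N fun y => if σ.reg 42 = y then 1 else 0) ∧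
    (candidate.exec O σ).reg 42 = if toBit (σ.reg 41) then σ.reg 42 else σ.reg 42 + 1 := by
  by_cases hact : σ.reg 41 = 0
  · rw [candidate, exec_ite_pos (by simpa using hact)]
    have hb : toBit (σ.reg 41) = false := toBit_eq_false.2 hact
    rw [hb]
    have F := exec_frame O (loop 13 30 (setCA 7 (.lit 0) (.var 13)
      (.ite (.var 42) (.var 13) .one .zero))) σ
    rw [if_neg Bool.false_ne_true, if_neg Bool.false_ne_true]
    refine ⟨vec_congr fun y hy => ?_, by simp [F.reg 42 rfl]⟩
    rw [exec_seq, exec_setN, Memory.setReg_numArr,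
      numArr_loop_fill O σ (a := 7) (i₀ := 0) fun y => if σ.reg 42 = y then 1 else 0]
    · simp [hN, hy]
    · intro j _ τ hF hτ _ i' j'
      simp [hτ, hF.reg 42 rfl]
  · rw [candidate, exec_ite_neg (by simpa using hact)]
    have hb : toBit (σ.reg 41) = true := toBit_eq_true.2 hact
    rw [hb, exec_seq]
    set σ₁ := (setN 43 (.pred (.var 40))).exec O σ with hσ₁
    have F := exec_frame O (loop 13 30 (applyMatrix 43 ;; setCA 7 (.lit 0) (.var 13) (.var 6))) σ₁
    rw [if_pos rfl, if_pos rfl]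
    refine ⟨?_, (F.reg 42 rfl).trans (by simp [hσ₁])⟩
    rw [matrixOp_vec]
    refine vec_congr fun y hy => ?_
    rw [numArr_loop_fill O σ₁ (a := 7) (i₀ := 0) fun y =>
      ∑ y' ∈ Finset.range N, σ.numArr 4 y y' * σ.numArr 5 (σ.reg 40 - 1) y']
    · simp [hσ₁, hN, hy]
    · intro j _ τ hF hτ _ i' j'
      have h30 : τ.reg 30 = N := (hF.reg 30 rfl).trans (by simp [hσ₁, hN])
      have h43 : τ.reg 43 = σ.reg 40 - 1 := (hF.reg 43 rfl).trans (by simp [hσ₁])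
      have e₃ : τ.numArr 4 = σ.numArr 4 := hF.numArr 4 rfl
      have e₄ : τ.numArr 5 = σ.numArr 5 := hF.numArr 5 rfl
      have F' := exec_frame O (applyMatrix 43) τ
      have h13 : ((applyMatrix 43).exec O τ).reg 13 = j := (F'.reg 13 rfl).trans hτ
      have h7 : ((applyMatrix 43).exec O τ).numArr 7 = τ.numArr 7 := F'.numArr 7 rfl
      rw [exec_seq, exec_setCA]
      simp [h13, h7, applyMatrix_spec O τ h30 (by decide : 43 ≠ 14) hτ h43, e₃, e₄]

theorem orthogonalize_spec (hN : σ.reg 30 = N) {T : ℕ} (hT : σ.reg 40 = T) (hTN : T ≤ N)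
    {u : ℕ → EuclideanSpace ℂ (Fin N)} (hu : ∀ s, u s = vec N (σ.numArr 5 s))
    (h0 : ∀ s < T, u s ≠ 0) (ho : ∀ s < T, ∀ s' < T, s ≠ s' → inner ℂ (u s) (u s') = 0)
    (hn : ∀ s < T, σ.numArr 6 0 s = ((‖u s‖ ^ 2 : ℝ) : ℂ)) :
    vec N (σ.numArr 7 0) - vec N ((orthogonalize.exec O σ).numArr 7 0) ∈
        Submodule.span ℂ (u '' Set.Iio T) ∧
      ∀ s < T, inner ℂ (u s) (vec N ((orthogonalize.exec O σ).numArr 7 0)) = 0 := by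
  have key := loop_inv O (x := 16) (y := 30) (b := ite (.lt (.var 16) (.var 40))
    (setC 6 .zero ;;
      loop 13 30 (setC 6 (.add (.var 6)
        (.mul (.conj (.arr 5 (.var 16) (.var 13))) (.arr 7 (.lit 0) (.var 13))))) ;;
      setC 6 (.div (.var 6) (.arr 6 (.lit 0) (.var 16))) ;;
      loop 13 30 (setCA 7 (.lit 0) (.var 13)
        (.sub (.arr 7 (.lit 0) (.var 13)) (.mul (.var 6) (.arr 5 (.var 16) (.var 13))))))
    skip) (fun s τ => vec N (σ.numArr 7 0) - vec N (τ.numArr 7 0) ∈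
        Submodule.span ℂ (u '' Set.Iio T) ∧
      ∀ s' < s, s' < T → inner ℂ (u s') (vec N (τ.numArr 7 0)) = 0) σ (by simp) ?_
  · refine ⟨key.1, fun s hs => key.2 s (by omega) hs⟩
  intro s hs τ hF hτ ⟨ih₁, ih₂⟩
  rw [hN] at hs
  have h30 : τ.reg 30 = N := (hF.reg 30 rfl).trans hN
  have h40 : τ.reg 40 = T := (hF.reg 40 rfl).trans hT
  have e₅ : τ.numArr 5 = σ.numArr 5 := hF.numArr 5 rfl
  have e₆ : τ.numArr 6 = σ.numArr 6 := hF.numArr 6 rfl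
  by_cases hsT : s < T
  · rw [exec_ite_pos (by simpa [hτ, h40] using hsT), exec_seq, exec_seq, exec_seq]
    have g₁ := num_loop_sum O ((setC 6 .zero).exec O τ) (v := 6) (x := 13) (y := 30)
      (b := setC 6 (.add (.var 6)
        (.mul (.conj (.arr 5 (.var 16) (.var 13))) (.arr 7 (.lit 0) (.var 13)))))
      (fun y => starRingEnd ℂ (σ.numArr 5 s y) * τ.numArr 7 0 y) (by
        intro y _ υ hG hυ
        have r : υ.reg 16 = s := (hG.reg 16 rfl).trans hτ
        have a₅ : υ.numArr 5 = σ.numArr 5 := (hG.numArr 5 rfl).trans e₅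
        have a₇ : υ.numArr 7 = τ.numArr 7 := hG.numArr 7 rfl
        simp [r, a₅, a₇, hυ])
    have F₁ := exec_frame O (loop 13 30 (setC 6 (.add (.var 6)
        (.mul (.conj (.arr 5 (.var 16) (.var 13))) (.arr 7 (.lit 0) (.var 13))))))
        ((setC 6 .zero).exec O τ)
    set τ₁ := (loop 13 30 (setC 6 (.add (.var 6)
        (.mul (.conj (.arr 5 (.var 16) (.var 13))) (.arr 7 (.lit 0) (.var 13)))))).exec O
        ((setC 6 .zero).exec O τ)
    have n₁ : τ₁.num 6 = inner ℂ (u s) (vec N (τ.numArr 7 0)) := by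
      rw [g₁, hu, inner_vec]
      simp [h30]
    have r₁₆ : τ₁.reg 16 = s := (F₁.reg 16 rfl).trans hτ
    have a₆ : τ₁.numArr 6 = σ.numArr 6 := (F₁.numArr 6 rfl).trans e₆
    have a₅ : τ₁.numArr 5 = σ.numArr 5 := (F₁.numArr 5 rfl).trans e₅
    have a₇ : τ₁.numArr 7 = τ.numArr 7 := F₁.numArr 7 rfl
    have r₃₀ : τ₁.reg 30 = N := (F₁.reg 30 rfl).trans h30
    set ζ : ℂ := inner ℂ (u s) (vec N (τ.numArr 7 0)) / ((‖u s‖ ^ 2 : ℝ) : ℂ) with hζ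
    set τ₂ := (setC 6 (.div (.var 6) (.arr 6 (.lit 0) (.var 16)))).exec O τ₁ with hτ₂
    have n₂ : τ₂.num 6 = ζ := by simp [hτ₂, n₁, r₁₆, a₆, hn s hsT, hζ]
    have hres : vec N (((loop 13 30 (setCA 7 (.lit 0) (.var 13)
        (.sub (.arr 7 (.lit 0) (.var 13)) (.mul (.var 6) (.arr 5 (.var 16) (.var 13)))))).exec O
        τ₂).numArr 7 0) = vec N (τ.numArr 7 0) - ζ • u s := by
      rw [hu, vec_smul, vec_sub]
      refine vec_congr fun y hy => ?_
      rw [numArr_loop_fill O τ₂ (a := 7) (i₀ := 0) fun y =>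
        τ.numArr 7 0 y - ζ * σ.numArr 5 s y]
      · simp [hτ₂, r₃₀, hy]
      · intro j _ υ hG hυ hsame i' j'
        have b₁ : υ.reg 16 = s := (hG.reg 16 rfl).trans r₁₆
        have b₂ : υ.num 6 = ζ := (hG.num 6 rfl).trans n₂
        have b₃ : υ.numArr 5 = σ.numArr 5 := (hG.numArr 5 rfl).trans a₅
        have b₄ : υ.numArr 7 0 j = τ.numArr 7 0 j := by
          rw [hsame 0 j (by omega)]
          exact congrFun (congrFun a₇ 0) j
        simp [b₁, b₂, b₃, b₄, hυ]
    rw [Memory.setReg_numArr, hres]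
    have hus : u s ∈ Submodule.span ℂ (u '' Set.Iio T) := Submodule.subset_span ⟨s, hsT, rfl⟩
    refine ⟨?_, fun s' hs' hs'T => ?_⟩
    · rw [← sub_add]
      exact add_mem ih₁ (Submodule.smul_mem _ _ hus)
    · rw [inner_sub_right, inner_smul_right]
      rcases (Nat.lt_succ_iff.1 hs').lt_or_eq with hs' | rfl
      · rw [ih₂ s' hs' hs'T, ho s' hs'T s hsT (by omega), mul_zero, sub_zero]
      · have hne : (((‖u s'‖ ^ 2 : ℝ)) : ℂ) ≠ 0 := by simpa using h0 s' hs'T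
        rw [inner_self_eq_norm_sq_to_K, hζ, sub_eq_zero]
        simp only [Complex.ofReal_pow] at hne ⊢
        exact (div_mul_cancel₀ _ hne).symm
  · rw [exec_ite_neg (by simpa [hτ, h40] using hsT), exec_skip]
    exact ⟨ih₁, fun s' hs' hs'T => ih₂ s' (by omega) hs'T⟩

/-- A round stores a new vector, consumes a starting vector or ends a chain; as a chain can end only
after a vector was stored, `3 * N` rounds are enough to exhaust the standard basis or to fill the
space. -/
theorem lanczos_spec (hN : σ.reg 30 = N) (h3 : σ.reg 32 = 3 * N) :
    Lanczos (matrixOp N (σ.numArr 4)) (fun t => vec N ((lanczos.exec O σ).numArr 5 t))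
      (fun t => toBit ((lanczos.exec O σ).arr 15 0 t)) N ∧
    ∀ t < N, (lanczos.exec O σ).numArr 6 0 t =
      ((‖vec N ((lanczos.exec O σ).numArr 5 t)‖ ^ 2 : ℝ) : ℂ) := by
  rw [lanczos, exec_seq, exec_seq, exec_seq]
  set σ₁ := (setN 42 (.lit 0)).exec O ((setN 41 (.lit 0)).exec O ((setN 40 (.lit 0)).exec O σ))
    with hσ₁
  set b : ℕ → EuclideanSpace ℂ (Fin N) := fun i => vec N fun y => if i = y then 1 else 0 with hb
  have key := loop_inv O (x := 15) (y := 32)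
    (b := candidate ;; orthogonalize ;; squareNorm 7 ;; append) (fun it τ =>
      LanczosState (matrixOp N (σ.numArr 4)) b (fun t => vec N (τ.numArr 5 t))
        (fun t => toBit (τ.arr 15 0 t)) (τ.reg 40) (toBit (τ.reg 41)) (τ.reg 42) ∧
      (∀ t < τ.reg 40, τ.numArr 6 0 t = ((‖vec N (τ.numArr 5 t)‖ ^ 2 : ℝ) : ℂ)) ∧
      -- The potential that counts rounds: a stored vector is worth two, one for its own round and
      -- one for a later round that ends its chain; a starting vector is worth one.
      it + (toBit (τ.reg 41)).toNat ≤ 2 * τ.reg 40 + τ.reg 42) σ₁ ?_ ?_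
  · obtain ⟨K₁, K₂, K₃⟩ := key
    set τ := (loop 15 32 (candidate ;; orthogonalize ;; squareNorm 7 ;; append)).exec O σ₁
    have hle := K₁.lanczos.le_finrank
    rw [finrank_euclideanSpace_fin] at hle
    have h32 : σ₁.reg 32 = 3 * N := by simp [hσ₁, h3]
    rw [h32] at K₃
    -- With fewer than `N` vectors the count forces all standard basis vectors to have been tried,
    -- hence covered, and then the vectors found span the whole space.
    have hT : τ.reg 40 = N := by
      by_contra hne
      have htop : (⊤ : Submodule ℂ (EuclideanSpace ℂ (Fin N))) ≤
          Submodule.span ℂ ((fun t => vec N (τ.numArr 5 t)) '' Set.Iio (τ.reg 40)) := by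
        rw [← (EuclideanSpace.basisFun (Fin N) ℂ).toBasis.span_eq, Submodule.span_le]
        rintro _ ⟨i, rfl⟩
        have hi : (EuclideanSpace.basisFun (Fin N) ℂ).toBasis i = b i := by
          rw [OrthonormalBasis.coe_toBasis, EuclideanSpace.basisFun_apply, hb]
          ext y
          simp [vec, Fin.ext_iff, eq_comm]
        rw [hi]
        exact K₁.covered i (by omega)
      have h₁ := Submodule.finrank_mono htop
      have hset : ((fun t => vec N (τ.numArr 5 t)) '' Set.Iio (τ.reg 40)) =
          (((Finset.range (τ.reg 40)).image fun t => vec N (τ.numArr 5 t) : Finset _) :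
            Set (EuclideanSpace ℂ (Fin N))) := by
        simp
      rw [finrank_top, finrank_euclideanSpace_fin, hset] at h₁
      have h₂ := h₁.trans ((finrank_span_finset_le_card (R := ℂ) _).trans Finset.card_image_le)
      rw [Finset.card_range] at h₂
      omega
    rw [hT] at K₁ K₂
    exact ⟨K₁.lanczos, K₂⟩
  · have e₁ : (σ₁.setReg 15 0).reg 40 = 0 := by simp [hσ₁]
    have e₂ : (σ₁.setReg 15 0).reg 41 = 0 := by simp [hσ₁]
    have e₃ : (σ₁.setReg 15 0).reg 42 = 0 := by simp [hσ₁]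
    rw [e₁, e₂, e₃]
    exact ⟨⟨⟨by omega, by omega, by omega, by omega⟩, by omega, by simp [toBit], by omega⟩,
      by omega, by simp [toBit]⟩
  · intro it hit τ hF hτ ⟨ih₁, ih₂, ih₃⟩
    have h30 : τ.reg 30 = N := (hF.reg 30 rfl).trans (by simp [hσ₁, hN])
    have e₄ : τ.numArr 4 = σ.numArr 4 := hF.numArr 4 rfl
    have hle := ih₁.lanczos.le_finrank
    rw [finrank_euclideanSpace_fin] at hle
    rw [exec_seq, exec_seq, exec_seq]
    obtain ⟨c₁, c₂⟩ := candidate_spec O τ h30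
    have F₁ := exec_frame O candidate τ
    set τ₁ := candidate.exec O τ
    have a₅ : τ₁.numArr 5 = τ.numArr 5 := F₁.numArr 5 rfl
    have a₆ : τ₁.numArr 6 = τ.numArr 6 := F₁.numArr 6 rfl
    have a₄₀ : τ₁.reg 40 = τ.reg 40 := F₁.reg 40 rfl
    have a₄₁ : τ₁.reg 41 = τ.reg 41 := F₁.reg 41 rfl
    have a₁₅ : τ₁.arr 15 = τ.arr 15 := F₁.arr 15 rfl
    obtain ⟨o₁, o₂⟩ := orthogonalize_spec O τ₁ ((F₁.reg 30 rfl).trans h30) a₄₀ hle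
      (u := fun t => vec N (τ.numArr 5 t)) (fun s => by rw [a₅]) ih₁.lanczos.ne_zero
      ih₁.lanczos.orthogonal (fun s hs => by rw [a₆, ih₂ s hs])
    have F₂ := exec_frame O orthogonalize τ₁
    set τ₂ := orthogonalize.exec O τ₁
    have b₅ : τ₂.numArr 5 = τ.numArr 5 := (F₂.numArr 5 rfl).trans a₅
    have b₆ : τ₂.numArr 6 = τ.numArr 6 := (F₂.numArr 6 rfl).trans a₆
    have b₄₀ : τ₂.reg 40 = τ.reg 40 := (F₂.reg 40 rfl).trans a₄₀
    have b₄₁ : τ₂.reg 41 = τ.reg 41 := (F₂.reg 41 rfl).trans a₄₁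
    have b₁₅ : τ₂.arr 15 = τ.arr 15 := (F₂.arr 15 rfl).trans a₁₅
    have b₃₀ : τ₂.reg 30 = N := (F₂.reg 30 rfl).trans ((F₁.reg 30 rfl).trans h30)
    have hn := squareNorm_spec O τ₂ b₃₀ 7
    have F₃ := exec_frame O (squareNorm 7) τ₂
    set τ₃ := (squareNorm 7).exec O τ₂
    have d₅ : τ₃.numArr 5 = τ.numArr 5 := (F₃.numArr 5 rfl).trans b₅
    have d₆ : τ₃.numArr 6 = τ.numArr 6 := (F₃.numArr 6 rfl).trans b₆
    have d₇ : τ₃.numArr 7 = τ₂.numArr 7 := F₃.numArr 7 rfl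
    have d₄₀ : τ₃.reg 40 = τ.reg 40 := (F₃.reg 40 rfl).trans b₄₀
    have d₄₁ : τ₃.reg 41 = τ.reg 41 := (F₃.reg 41 rfl).trans b₄₁
    have d₁₅ : τ₃.arr 15 = τ.arr 15 := (F₃.arr 15 rfl).trans b₁₅
    have d₄₂ : τ₃.reg 42 = if toBit (τ.reg 41) then τ.reg 42 else τ.reg 42 + 1 :=
      (F₃.reg 42 rfl).trans ((F₂.reg 42 rfl).trans c₂)
    have d₃₀ : τ₃.reg 30 = N := (F₃.reg 30 rfl).trans b₃₀
    set w := vec N (τ₂.numArr 7 0) with hw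
    set T := τ.reg 40
    rw [c₁] at o₁
    rw [← e₄] at ih₁ ⊢
    simp only [Memory.setReg_reg, Memory.setReg_arr, Memory.setReg_numArr,
      show (40 : ℕ) ≠ 15 by decide, show (41 : ℕ) ≠ 15 by decide, show (42 : ℕ) ≠ 15 by decide,
      if_false]
    by_cases hw0 : w = 0
    · rw [append, exec_ite_pos (by simp [hn, hw0])]
      rw [hw0, sub_zero] at o₁
      have := ih₁.step_closed o₁
      simp only [exec_setN, Memory.setReg_reg, Memory.setReg_arr, Memory.setReg_numArr, d₅, d₆,
        d₄₀, d₁₅, d₄₂, show (40 : ℕ) ≠ 41 by decide, show (42 : ℕ) ≠ 41 by decide, if_false,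
        if_true, NExp.eval_lit]
      refine ⟨this, ih₂, ?_⟩
      rw [show toBit 0 = false from rfl]
      revert ih₃
      generalize toBit (τ.reg 41) = act
      cases act <;> simp <;> omega
    · have hpos : 0 < ‖w‖ ^ 2 := by positivity
      rw [append, exec_ite_neg (by
        simp only [Test.holds_le, CExp.eval_var, CExp.eval_zero, hn, Complex.ofReal_re,
          Complex.zero_re]
        exact not_le.2 hpos)]
      have hfill := numArr_loop_fill O τ₃ (a := 5) (i₀ := T) (x := 13) (y := 30)
        (b := setCA 5 (.var 40) (.var 13) (.arr 7 (.lit 0) (.var 13))) (τ₂.numArr 7 0) (by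
          intro j _ υ hG hυ _ i' j'
          simp [hG.reg 40 rfl, d₄₀, hυ, hG.numArr 7 rfl, d₇])
      rw [d₃₀] at hfill
      have F₄ := exec_frame O (loop 13 30 (setCA 5 (.var 40) (.var 13) (.arr 7 (.lit 0) (.var 13))))
        τ₃
      simp only [exec_seq]
      set τ₄ := (loop 13 30 (setCA 5 (.var 40) (.var 13) (.arr 7 (.lit 0) (.var 13)))).exec O τ₃
      have g₆ : τ₄.numArr 6 = τ.numArr 6 := (F₄.numArr 6 rfl).trans d₆
      have g₄₀ : τ₄.reg 40 = T := (F₄.reg 40 rfl).trans d₄₀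
      have g₄₁ : τ₄.reg 41 = τ.reg 41 := (F₄.reg 41 rfl).trans d₄₁
      have g₁₅ : τ₄.arr 15 = τ.arr 15 := (F₄.arr 15 rfl).trans d₁₅
      have g₄₂ := (F₄.reg 42 rfl).trans d₄₂
      have gn : τ₄.num 6 = ((‖w‖ ^ 2 : ℝ) : ℂ) := (F₄.num 6 rfl).trans hn
      have v₁ : ∀ t < T, vec N (τ₄.numArr 5 t) = vec N (τ.numArr 5 t) := fun t ht =>
        vec_congr fun y _ => by rw [hfill, if_neg (by omega), d₅]
      have v₂ : vec N (τ₄.numArr 5 T) = w :=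
        vec_congr fun y hy => by rw [hfill, if_pos ⟨rfl, hy⟩]
      have := ih₁.step_append (u' := fun t => vec N (τ₄.numArr 5 t))
        (c' := fun t => toBit (if t = T then τ.reg 41 else τ.arr 15 0 t)) hw0 o₂ o₁ v₁ v₂
        (fun t ht => by simp [ht.ne]) (by simp)
      simp only [exec_setN, exec_setA, exec_setCA, Memory.setReg_reg, Memory.setReg_arr,
        Memory.setReg_numArr, Memory.setNumArr_numArr, Memory.setNumArr_reg, Memory.setNumArr_arr,
        Memory.setArr_reg, Memory.setArr_arr, Memory.setArr_numArr, NExp.eval_lit, NExp.eval_var,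
        NExp.eval_succ, CExp.eval_var,
        g₆, g₄₀, g₄₁, g₁₅, g₄₂, gn, show (40 : ℕ) ≠ 41 by decide, show (42 : ℕ) ≠ 41 by decide,
        show (42 : ℕ) ≠ 40 by decide, show (41 : ℕ) ≠ 40 by decide, true_and, if_false, if_true]
      refine ⟨this, fun t ht => ?_, ?_⟩
      · by_cases htT : t = T
        · rw [if_pos htT, htT]
          exact congrArg (fun v => ((‖v‖ ^ 2 : ℝ) : ℂ)) v₂.symm
        · rw [if_neg htT, ih₂ t (by omega)]
          exact congrArg (fun v => ((‖v‖ ^ 2 : ℝ) : ℂ)) (v₁ t (by omega)).symm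
      · rw [show toBit 1 = true from rfl]
        revert ih₃
        generalize toBit (τ.reg 41) = act
        cases act <;> simp
        all_goals omega

end Prog

open Polynomial

/-! ## Eigenvalues and eigenvectors from the Lanczos polynomials -/

section

variable {E : Type*} [NormedAddCommGroup E] [InnerProductSpace ℂ E]

/-- The eigenvalue with number `t`, if `ce` gives the last indices of the chains. -/
def lanczosValue (A : E →ₗ[ℂ] E) (u : ℕ → E) (c : ℕ → Bool) (ce : ℕ → ℕ) (t : ℕ) : ℝ :=
  ((lanczosPolys A u c (ce (chainStart c t))).2.roots.sort (· ≤ ·)).getD (t - chainStart c t) 0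

/-- The eigenvector with number `t`. -/
def lanczosEigenvector (A : E →ₗ[ℂ] E) (u : ℕ → E) (c : ℕ → Bool) (N : ℕ) (ce : ℕ → ℕ) (t : ℕ) :
    E :=
  lanczosVector A u c N (chainStart c t) (lanczosValue A u c ce t)

namespace Lanczos

variable [FiniteDimensional ℂ E] {A : E →ₗ[ℂ] E} {u : ℕ → E} {c : ℕ → Bool} {N : ℕ} {ce : ℕ → ℕ}

/-- The position of `t` in its chain is smaller than the number of roots, so the default value in
`lanczosValue` is never taken. -/
theorem lt_length_roots (hA : A.IsSymmetric) (h : Lanczos A u c N)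
    (hN : Module.finrank ℂ E = N) (hce : ∀ t < N, IsChainEnd c N (chainStart c t)
      (ce (chainStart c t))) {t : ℕ} (ht : t < N) : t - chainStart c t <
        ((lanczosPolys A u c (ce (chainStart c t))).2.roots.sort (· ≤ ·)).length := by
  have := (hce t ht).le t ht rfl
  rw [Multiset.length_sort, (h.roots_nodup hA hN (hce t ht)).2]
  omega

theorem apply_eigenvector (hA : A.IsSymmetric) (h : Lanczos A u c N)
    (hN : Module.finrank ℂ E = N) (hce : ∀ t < N, IsChainEnd c N (chainStart c t)
      (ce (chainStart c t))) {t : ℕ} (ht : t < N) : A (lanczosEigenvector A u c N ce t) =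
      (lanczosValue A u c ce t : ℂ) • lanczosEigenvector A u c N ce t := by
  refine h.apply_lanczosVector hA hN (hce t ht) ?_
  have hl := h.lt_length_roots hA hN hce ht
  have hm := List.getElem_mem hl
  rw [← List.getD_eq_getElem _ 0 hl, Multiset.mem_sort] at hm
  exact isRoot_of_mem_roots hm

theorem eigenvector_ne_zero (h : Lanczos A u c N) (hce : ∀ t < N, IsChainEnd c N (chainStart c t)
      (ce (chainStart c t))) {t : ℕ} (ht : t < N) : lanczosEigenvector A u c N ce t ≠ 0 :=
  h.lanczosVector_ne_zero (hce t ht) _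

/-- Within a chain the eigenvalues differ because the roots are simple; vectors of different chains
are combinations of disjoint parts of an orthogonal family. -/
theorem eigenvector_orthogonal (hA : A.IsSymmetric) (h : Lanczos A u c N)
    (hN : Module.finrank ℂ E = N) (hce : ∀ t < N, IsChainEnd c N (chainStart c t)
      (ce (chainStart c t))) {t t' : ℕ} (ht : t < N) (ht' : t' < N) (hne : t ≠ t') :
    inner ℂ (lanczosEigenvector A u c N ce t) (lanczosEigenvector A u c N ce t') = 0 := by
  by_cases hs : chainStart c t = chainStart c t'
  · refine inner_eq_zero_of_eigenvalue_ne hA (h.apply_eigenvector hA hN hce ht)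
      (h.apply_eigenvector hA hN hce ht') ?_
    have hl := h.lt_length_roots hA hN hce ht
    have hl' := h.lt_length_roots hA hN hce ht'
    have hnd : ((lanczosPolys A u c (ce (chainStart c t))).2.roots.sort (· ≤ ·)).Nodup := by
      rw [← Multiset.coe_nodup, Multiset.sort_eq]
      exact (h.roots_nodup hA hN (hce t ht)).1
    have h₁ := chainStart_le c t
    have h₂ := chainStart_le c t'
    rw [lanczosValue, lanczosValue, ← hs, List.getD_eq_getElem _ _ hl,
      List.getD_eq_getElem _ _ (by rwa [← hs] at hl'), ne_eq, hnd.getElem_inj_iff]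
    omega
  · exact h.inner_lanczosVector_of_ne hs _ _

/-- The eigenvectors found are all. -/
theorem eigenvector_complete (hA : A.IsSymmetric) (h : Lanczos A u c N)
    (hN : Module.finrank ℂ E = N) (hce : ∀ t < N, IsChainEnd c N (chainStart c t)
      (ce (chainStart c t))) {φ : E} {μ : ℝ} (hφ : A φ = (μ : ℂ) • φ) :
    φ ∈ Submodule.span ℂ {w | ∃ t < N, lanczosValue A u c ce t = μ ∧
      lanczosEigenvector A u c N ce t = w} := by
  set w := lanczosEigenvector A u c N ce with hw
  have hw0 : ∀ t < N, w t ≠ 0 := fun t ht => h.eigenvector_ne_zero hce ht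
  have hwo : ∀ t < N, ∀ t' < N, t ≠ t' → inner ℂ (w t) (w t') = 0 := fun t ht t' ht' =>
    h.eigenvector_orthogonal hA hN hce ht ht'
  -- The expansion in the orthogonal basis of eigenvectors, from which the terms with other
  -- eigenvalues drop out since they are orthogonal to `φ`.
  have e : φ = ∑ t ∈ Finset.range N, if lanczosValue A u c ce t = μ then
      (inner ℂ (w t) φ / inner ℂ (w t) (w t)) • w t else 0 := by
    refine ext_of_orthogonal hw0 hwo hN fun j hj => ?_
    rw [inner_sum, Finset.sum_eq_single j]
    · split_ifs with hμ
      · rw [inner_smul_right, div_mul_cancel₀ _ (inner_self_ne_zero.2 (hw0 j hj))]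
      · rw [inner_zero_right]
        exact inner_eq_zero_of_eigenvalue_ne hA (h.apply_eigenvector hA hN hce hj) hφ hμ
    · intro t ht htj
      split_ifs
      · rw [inner_smul_right, hwo j hj t (Finset.mem_range.1 ht) htj.symm, mul_zero]
      · exact inner_zero_right _
    · intro hj'
      exact absurd (Finset.mem_range.2 hj) hj'
  rw [e]
  refine Submodule.sum_mem _ fun t ht => ?_
  split_ifs with hμ
  · exact Submodule.smul_mem _ _ (Submodule.subset_span ⟨t, Finset.mem_range.1 ht, hμ, rfl⟩)
  · exact zero_mem _

theorem lanczosPolys_degree_lt {t : ℕ} (ht : t < N) :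
    (lanczosPolys A u c t).1.natDegree < N + 1 ∧ (lanczosPolys A u c t).2.natDegree < N + 1 := by
  obtain ⟨-, h₁, -, h₂⟩ := lanczosPoly_degree (lanczosDiag A u) (lanczosOff u c) c
    (fun t ht => by simp [lanczosOff, ht]) t
  exact ⟨h₁.trans_lt (by omega), h₂.trans_lt (by omega)⟩

end Lanczos

end

/-- The bound `d` may exceed the degree, the extra coefficients being 0; so all chains can share the
bound `N`. -/
theorem realRoot_eq (p : ℝ[X]) {c : ℕ → ℝ} {d : ℕ} (hd : p.natDegree < d + 1)
    (hc : ∀ t < d + 1, c t = p.coeff t) (j : ℕ) :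
    realRoot c d j = (p.roots.sort (· ≤ ·)).getD j 0 := by
  have : (∑ t ∈ Finset.range (d + 1), C (c t) * X ^ t : ℝ[X]) = p := by
    conv_rhs => rw [p.as_sum_range' (d + 1) hd]
    refine Finset.sum_congr rfl fun t ht => ?_
    rw [hc t (Finset.mem_range.1 ht), C_mul_X_pow_eq_monomial]
  rw [realRoot, this]

/-- The square root is the second smallest root of `X ^ 2 - x ^ 2`. As roots count with
multiplicity, this is right for `x = 0` as well. -/
theorem realRoot_sq_sub (c : ℕ → ℝ) {x : ℝ} (hx : 0 ≤ x) (h₀ : c 0 = -x ^ 2) (h₁ : c 1 = 0)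
    (h₂ : c 2 = 1) : realRoot c 2 1 = x := by
  have hp : (∑ t ∈ Finset.range (2 + 1), C (c t) * X ^ t : ℝ[X]) =
      (X - C (-x)) * (X - C x) := by
    simp only [Finset.sum_range_succ, Finset.sum_range_zero, h₀, h₁, h₂, map_neg, map_pow,
      map_zero, map_one]
    ring
  have hr : ((X - C (-x)) * (X - C x) : ℝ[X]).roots = -x ::ₘ {x} := by
    rw [roots_mul (mul_ne_zero (X_sub_C_ne_zero _) (X_sub_C_ne_zero _)), roots_X_sub_C,
      roots_X_sub_C, Multiset.singleton_add]
  rw [realRoot, hp, hr, Multiset.sort_cons]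
  · simp
  · intro b hb
    rw [Multiset.mem_singleton] at hb
    linarith

/-- The memory holds the result of the Lanczos process. -/
structure LanczosMemory {N : ℕ} (A : EuclideanSpace ℂ (Fin N) →ₗ[ℂ] EuclideanSpace ℂ (Fin N))
    (u : ℕ → EuclideanSpace ℂ (Fin N)) (c : ℕ → Bool) (σ : Memory) : Prop where
  N_eq : σ.reg 30 = N
  N_succ : σ.reg 31 = N + 1
  vectors : ∀ t < N, vec N (σ.numArr 5 t) = u t
  norms : ∀ t < N, σ.numArr 6 0 t = ((‖u t‖ ^ 2 : ℝ) : ℂ)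

/-- The memory holds the Lanczos polynomials. -/
structure PolynomialMemory {N : ℕ} (A : EuclideanSpace ℂ (Fin N) →ₗ[ℂ] EuclideanSpace ℂ (Fin N))
    (u : ℕ → EuclideanSpace ℂ (Fin N)) (c : ℕ → Bool) (ce : ℕ → ℕ) (σ : Memory) : Prop
    extends LanczosMemory A u c σ where
  fst : ∀ t < N, ∀ j ≤ N, σ.numArr 10 t j = (((lanczosPolys A u c t).1.coeff j : ℝ) : ℂ)
  snd : ∀ t < N, ∀ j ≤ N, σ.numArr 11 t j = (((lanczosPolys A u c t).2.coeff j : ℝ) : ℂ)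
  start : ∀ t < N, σ.arr 16 0 t = chainStart c t
  rank : ∀ t < N, σ.arr 18 0 t = t - chainStart c t
  chainEnd : ∀ t < N, σ.arr 17 0 (chainStart c t) = ce (chainStart c t)

/-- The command does not change the result of the Lanczos process. -/
def Cmd.keepsLanczos (c : Cmd) : Bool :=
  [30, 31].all (fun x => !c.wr x) && [16, 17, 18].all (fun a => !c.wrArr a) &&
    [5, 6, 10, 11].all fun a => !c.wrNumArr a

theorem PolynomialMemory.frame {N : ℕ} {A : EuclideanSpace ℂ (Fin N) →ₗ[ℂ] EuclideanSpace ℂ (Fin N)}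
    {u : ℕ → EuclideanSpace ℂ (Fin N)} {c : ℕ → Bool} {ce : ℕ → ℕ} {σ τ : Memory}
    (h : PolynomialMemory A u c ce σ) {b : Cmd} (hF : b.Frame σ τ) (hb : b.keepsLanczos = true) :
    PolynomialMemory A u c ce τ := by
  simp only [Cmd.keepsLanczos, List.all_cons, List.all_nil, Bool.and_true, Bool.and_eq_true,
    Bool.not_eq_true'] at hb
  obtain ⟨⟨⟨r₃₀, r₃₁⟩, a₁₆, a₁₇, a₁₈⟩, n₅, n₆, n₁₀, n₁₁⟩ := hb
  refine ⟨⟨?_, ?_, ?_, ?_⟩, ?_, ?_, ?_, ?_, ?_⟩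
  · rw [hF.reg _ r₃₀, h.N_eq]
  · rw [hF.reg _ r₃₁, h.N_succ]
  · simpa only [hF.numArr _ n₅] using h.vectors
  · simpa only [hF.numArr _ n₆] using h.norms
  · simpa only [hF.numArr _ n₁₀] using h.fst
  · simpa only [hF.numArr _ n₁₁] using h.snd
  · simpa only [hF.arr _ a₁₆] using h.start
  · simpa only [hF.arr _ a₁₈] using h.rank
  · simpa only [hF.arr _ a₁₇] using h.chainEnd

theorem Cmd.loop_inv_of_eq (O : Oracle) {x y N : ℕ} {b : Cmd} {σ : Memory} (hN : σ.reg y = N)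
    (I : ℕ → Memory → Prop) (h0 : I 0 (σ.setReg x 0))
    (hs : ∀ j < N, ∀ τ, Frame (loop x y b) σ τ → τ.reg x = j → I j τ →
      I (j + 1) ((b.exec O τ).setReg x (j + 1))) : I N ((loop x y b).exec O σ) := by
  subst hN
  exact loop_inv O I σ h0 hs

/-! ### Lanczos polynomials, eigenvalues and eigenvectors computed by the program. -/

namespace Prog

open Cmd

variable {N : ℕ} (O : Oracle) (σ : Memory)

@[simp] theorem exec_root (x a : ℕ) (i : NExp) (d : ℕ) (j : NExp) : (root x a i d j).exec O σ =
    σ.setNum x ((realRoot (fun t => (σ.numArr a (i.eval σ) t).re) (σ.reg d) (j.eval σ) : ℝ) : ℂ) :=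
  rfl

theorem diagCoeff_spec (hN : σ.reg 30 = N) {t : ℕ} (ht : σ.reg 15 = t) :
    (diagCoeff.exec O σ).num 7 = inner ℂ (vec N (σ.numArr 5 t))
      (matrixOp N (σ.numArr 4) (vec N (σ.numArr 5 t))) / σ.numArr 6 0 t := by
  rw [diagCoeff, exec_seq, exec_seq]
  have key := num_loop_sum O ((setC 7 .zero).exec O σ) (v := 7) (x := 13) (y := 30)
    (b := applyMatrix 15 ;;
      setC 7 (.add (.var 7) (.mul (.conj (.arr 5 (.var 15) (.var 13))) (.var 6))))
    (fun y => starRingEnd ℂ (σ.numArr 5 t y) *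
      ∑ y' ∈ Finset.range N, σ.numArr 4 y y' * σ.numArr 5 t y') (by
      intro y _ τ hF hτ
      have r₃₀ : τ.reg 30 = N := (hF.reg 30 rfl).trans hN
      have r₁₅ : τ.reg 15 = t := (hF.reg 15 rfl).trans ht
      have a₄ : τ.numArr 4 = σ.numArr 4 := hF.numArr 4 rfl
      have a₅ : τ.numArr 5 = σ.numArr 5 := hF.numArr 5 rfl
      have F := exec_frame O (applyMatrix 15) τ
      have h := applyMatrix_spec O τ r₃₀ (by decide : 15 ≠ 14) hτ r₁₅
      simp [h, F.num 7 rfl, F.reg 15 rfl, F.reg 13 rfl, F.numArr 5 rfl, r₁₅, hτ, a₄, a₅])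
  have F := exec_frame O (loop 13 30 (applyMatrix 15 ;;
      setC 7 (.add (.var 7) (.mul (.conj (.arr 5 (.var 15) (.var 13))) (.var 6)))))
      ((setC 7 .zero).exec O σ)
  rw [matrixOp_vec, inner_vec, exec_setC, Memory.setNum_num, if_pos rfl, CExp.eval_div,
    CExp.eval_var, key, CExp.eval_arr, F.numArr 6 rfl, NExp.eval_var, F.reg 15 rfl]
  simp [hN, ht]

/-- Registers 44 and 45 follow the start of the current chain and the position in it. The cell of
array 17 at the start of a chain is overwritten in each round of that chain, so in the end it holds
the last index. -/
theorem polynomials_spec {A : EuclideanSpace ℂ (Fin N) →ₗ[ℂ] EuclideanSpace ℂ (Fin N)}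
    {u : ℕ → EuclideanSpace ℂ (Fin N)} {c : ℕ → Bool} (hA : A.IsSymmetric) (hL : Lanczos A u c N)
    (h : LanczosMemory A u c σ) (hB : matrixOp N (σ.numArr 4) = A)
    (hc : ∀ t < N, toBit (σ.arr 15 0 t) = c t) :
    ∃ ce : ℕ → ℕ, (∀ t < N, IsChainEnd c N (chainStart c t) (ce (chainStart c t))) ∧
      PolynomialMemory A u c ce (polynomials.exec O σ) := by
  have FF := exec_frame O polynomials σ
  suffices H : ∀ t < N, (∀ j ≤ N, (polynomials.exec O σ).numArr 10 t j =
        (((lanczosPolys A u c t).1.coeff j : ℝ) : ℂ) ∧ (polynomials.exec O σ).numArr 11 t j =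
        (((lanczosPolys A u c t).2.coeff j : ℝ) : ℂ)) ∧
      (polynomials.exec O σ).arr 16 0 t = chainStart c t ∧
      (polynomials.exec O σ).arr 18 0 t = t - chainStart c t ∧
      IsChainEnd c N (chainStart c t) ((polynomials.exec O σ).arr 17 0 (chainStart c t)) by
    refine ⟨(polynomials.exec O σ).arr 17 0, fun t ht => (H t ht).2.2.2, ⟨⟨?_, ?_, ?_, ?_⟩,
      fun t ht j hj => ((H t ht).1 j hj).1, fun t ht j hj => ((H t ht).1 j hj).2,
      fun t ht => (H t ht).2.1, fun t ht => (H t ht).2.2.1, fun t ht => rfl⟩⟩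
    · rw [FF.reg 30 rfl, h.N_eq]
    · rw [FF.reg 31 rfl, h.N_succ]
    · rw [FF.numArr 5 rfl]
      exact h.vectors
    · rw [FF.numArr 6 rfl]
      exact h.norms
  rw [polynomials, exec_seq, exec_seq]
  set σ₁ := (setN 45 (.lit 0)).exec O ((setN 44 (.lit 0)).exec O σ) with hσ₁
  have r₁ : σ₁.reg 30 = N := by simp [hσ₁, h.N_eq]
  -- Chain ends are stated relative to the indices below `τ₀` treated so far; after the last round
  -- they are ends relative to `N`.
  refine (loop_inv_of_eq O r₁ (fun τ₀ τ => (∀ t, t + 1 = τ₀ → τ.reg 44 = chainStart c t ∧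
      τ.reg 45 = t - chainStart c t) ∧ ∀ t < τ₀, (∀ j ≤ N, τ.numArr 10 t j =
        (((lanczosPolys A u c t).1.coeff j : ℝ) : ℂ) ∧ τ.numArr 11 t j =
        (((lanczosPolys A u c t).2.coeff j : ℝ) : ℂ)) ∧
      τ.arr 16 0 t = chainStart c t ∧ τ.arr 18 0 t = t - chainStart c t ∧
      IsChainEnd c τ₀ (chainStart c t) (τ.arr 17 0 (chainStart c t))) ⟨by omega, by omega⟩ ?_).2
  intro t ht τ hF hτ ⟨ih₁, ih₂⟩
  have h30 : τ.reg 30 = N := (hF.reg 30 rfl).trans r₁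
  have h31 : τ.reg 31 = N + 1 := (hF.reg 31 rfl).trans (by simp [hσ₁, h.N_succ])
  have e₄ : τ.numArr 4 = σ.numArr 4 := hF.numArr 4 rfl
  have e₅ : τ.numArr 5 = σ.numArr 5 := hF.numArr 5 rfl
  have e₆ : τ.numArr 6 = σ.numArr 6 := hF.numArr 6 rfl
  have e₁₅ : τ.arr 15 = σ.arr 15 := hF.arr 15 rfl
  rw [exec_seq, exec_seq, exec_seq, exec_seq, exec_seq]
  have hd := diagCoeff_spec O τ h30 hτ
  rw [e₄, e₅, e₆, hB, h.vectors t ht, h.norms t ht, ← hL.diag_mul hA ht] at hd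
  push_cast at hd
  rw [mul_div_cancel_right₀ _ (hL.norm_ne_zero ht)] at hd
  have F₁ := exec_frame O diagCoeff τ
  set τ₁ := diagCoeff.exec O τ
  have a₆ : τ₁.numArr 6 = σ.numArr 6 := (F₁.numArr 6 rfl).trans e₆
  have a₁₀ : τ₁.numArr 10 = τ.numArr 10 := F₁.numArr 10 rfl
  have a₁₁ : τ₁.numArr 11 = τ.numArr 11 := F₁.numArr 11 rfl
  have r₁₅ : τ₁.reg 15 = t := (F₁.reg 15 rfl).trans hτ
  have r₃₁ : τ₁.reg 31 = N + 1 := (F₁.reg 31 rfl).trans h31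
  have r₄₄ : τ₁.reg 44 = τ.reg 44 := F₁.reg 44 rfl
  have r₄₅ : τ₁.reg 45 = τ.reg 45 := F₁.reg 45 rfl
  have b₁₅ : toBit (τ₁.arr 15 0 t) = c t := by
    rw [F₁.arr 15 rfl, e₁₅]
    exact hc t ht
  set br : Cmd := ite (.eq (.arr 15 (.lit 0) (.var 15)) (.lit 0))
      (setN 44 (.var 15) ;;
        setN 45 (.lit 0) ;;
        setC 8 .zero ;;
        loop 13 31 (setCA 10 (.var 15) (.var 13) (.ite (.var 13) (.lit 0) .one .zero)))
      (setN 45 (.succ (.var 45)) ;;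
        setC 8 (.div (.arr 6 (.lit 0) (.var 15)) (.arr 6 (.lit 0) (.pred (.var 15)))) ;;
        loop 13 31 (setCA 10 (.var 15) (.var 13) (.arr 11 (.pred (.var 15)) (.var 13)))) with hbr
  have F₂ := exec_frame O br τ₁
  have hbranch : (br.exec O τ₁).reg 44 = chainStart c t ∧
      (br.exec O τ₁).reg 45 = t - chainStart c t ∧
      (br.exec O τ₁).num 8 = (lanczosOff u c t : ℂ) ∧
      ∀ i j, (br.exec O τ₁).numArr 10 i j = if i = t ∧ j < N + 1 then
        (((lanczosPolys A u c t).1.coeff j : ℝ) : ℂ) else τ.numArr 10 i j := by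
    by_cases hct : c t = false
    · have hs : chainStart c t = t := by
        cases t with
        | zero => rfl
        | succ t => rw [chainStart, if_neg (by simp [hct])]
      have hp : (lanczosPolys A u c t).1 = 1 := lanczosPoly_of_false _ _ _ hct
      rw [hbr, exec_ite_pos (by simpa [r₁₅] using toBit_eq_false.1 (b₁₅.trans hct)), exec_seq,
        exec_seq, exec_seq, hs, hp]
      set τ₂ := (setC 8 .zero).exec O ((setN 45 (.lit 0)).exec O
        ((setN 44 (.var 15)).exec O τ₁)) with hτ₂
      have G := exec_frame O (loop 13 31 (setCA 10 (.var 15) (.var 13)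
        (.ite (.var 13) (.lit 0) .one .zero))) τ₂
      refine ⟨(G.reg 44 rfl).trans (by simp [hτ₂, r₁₅]),
        (G.reg 45 rfl).trans (by simp [hτ₂]),
        (G.num 8 rfl).trans (by simp [hτ₂, lanczosOff, hct]), fun i j => ?_⟩
      rw [numArr_loop_fill O τ₂ (a := 10) (i₀ := t)
        (fun j => if j = 0 then 1 else 0)]
      · have : τ₂.reg 31 = N + 1 := by simp [hτ₂, r₃₁]
        have e10 : τ₂.numArr 10 = τ.numArr 10 := a₁₀
        simp only [this, e10, coeff_one]
        congr 1
        split_ifs <;> simp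
      · intro j _ υ hG hυ _ i' j'
        simp [hG.reg 15 rfl, hτ₂, r₁₅, hυ]
    · have hct' : c t = true := by simpa using hct
      have ht0 : t ≠ 0 := by
        rintro rfl
        exact hct (hL.start (by omega))
      obtain ⟨s, rfl⟩ := Nat.exists_eq_succ_of_ne_zero ht0
      obtain ⟨ih₃, ih₄⟩ := ih₁ s rfl
      have hs := chainStart_succ hct'
      have hle := chainStart_le c s
      rw [hbr, exec_ite_neg (by simpa [r₁₅] using toBit_eq_true.1 (b₁₅.trans hct')), exec_seq,
        exec_seq]
      set τ₂ := (setC 8 (.div (.arr 6 (.lit 0) (.var 15)) (.arr 6 (.lit 0)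
        (.pred (.var 15))))).exec O ((setN 45 (.succ (.var 45))).exec O τ₁) with hτ₂
      have G := exec_frame O (loop 13 31 (setCA 10 (.var 15) (.var 13)
        (.arr 11 (.pred (.var 15)) (.var 13)))) τ₂
      refine ⟨(G.reg 44 rfl).trans (by simp [hτ₂, r₄₄, ih₃, hs]),
        (G.reg 45 rfl).trans (by simp [hτ₂, r₄₅, ih₄, hs]; omega),
        (G.num 8 rfl).trans ?_, fun i j => ?_⟩
      · have n₁ := h.norms (s + 1) ht
        have n₂ := h.norms s (by omega)
        simp [hτ₂, r₁₅, a₆, n₁, n₂, lanczosOff, hct']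
      · rw [numArr_loop_fill O τ₂ (a := 10) (i₀ := s + 1) (fun j => τ.numArr 11 s j)]
        · have : τ₂.reg 31 = N + 1 := by simp [hτ₂, r₃₁]
          have e10 : τ₂.numArr 10 = τ.numArr 10 := a₁₀
          simp only [this, e10]
          by_cases hij : i = s + 1 ∧ j < N + 1
          · rw [if_pos hij, if_pos hij, lanczosPolys_of_true hct']
            exact ((ih₂ s (by omega)).1 j (by omega)).2
          · rw [if_neg hij, if_neg hij]
        · intro j _ υ hG hυ _ i' j'
          have e11 : υ.numArr 11 = τ.numArr 11 := (hG.numArr 11 rfl).trans a₁₁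
          simp [hG.reg 15 rfl, hτ₂, r₁₅, hυ, e11]
  obtain ⟨b₁, b₂, b₃, b₄⟩ := hbranch
  set τ₂ := br.exec O τ₁
  have n₇ : τ₂.num 7 = (lanczosDiag A u t : ℂ) := (F₂.num 7 rfl).trans hd
  have q₁₅ : τ₂.reg 15 = t := (F₂.reg 15 rfl).trans r₁₅
  have q₃₁ : τ₂.reg 31 = N + 1 := (F₂.reg 31 rfl).trans r₃₁
  have c₁₁ : τ₂.numArr 11 = τ.numArr 11 := (F₂.numArr 11 rfl).trans a₁₁
  have hfst : ∀ i ≤ t, ∀ j ≤ N, τ₂.numArr 10 i j =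
      (((lanczosPolys A u c i).1.coeff j : ℝ) : ℂ) := by
    intro i hi j hj
    rw [b₄]
    split_ifs with hij
    · rw [hij.1]
    · exact ((ih₂ i (by omega)).1 j hj).1
  set b₅ : Cmd := setCA 11 (.var 15) (.var 13)
      (.sub (.sub (.ite (.var 13) (.lit 0) .zero (.arr 10 (.var 15) (.pred (.var 13))))
        (.mul (.var 7) (.arr 10 (.var 15) (.var 13))))
        (.mul (.var 8) (.arr 10 (.pred (.var 15)) (.var 13)))) with hb₅
  have hfill := numArr_loop_fill O τ₂ (a := 11) (i₀ := t) (x := 13) (y := 31) (b := b₅)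
    (fun j => (((lanczosPolys A u c t).2.coeff j : ℝ) : ℂ)) (by
      intro j hj υ hG hυ _ i' j'
      rw [q₃₁] at hj
      have d₁₅ : υ.reg 15 = t := (hG.reg 15 rfl).trans q₁₅
      have d₇ : υ.num 7 = (lanczosDiag A u t : ℂ) := (hG.num 7 rfl).trans n₇
      have d₈ : υ.num 8 = (lanczosOff u c t : ℂ) := (hG.num 8 rfl).trans b₃
      have d₁₀ : υ.numArr 10 = τ₂.numArr 10 := hG.numArr 10 rfl
      simp only [hb₅, exec_setCA, Memory.setNumArr_numArr, true_and, NExp.eval_var, d₁₅, hυ,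
        CExp.eval_sub, CExp.eval_mul, CExp.eval_ite, CExp.eval_arr, CExp.eval_var, d₇, d₈, d₁₀,
        NExp.eval_pred, NExp.eval_lit, CExp.eval_zero]
      congr 1
      rw [hfst t le_rfl j (by omega), hfst (t - 1) (by omega) j (by omega), lanczosPolys_snd,
        sub_mul, coeff_sub, coeff_sub, coeff_C_mul, coeff_C_mul]
      push_cast
      congr 2
      cases j with
      | zero => simp
      | succ j => rw [if_neg (by omega), Nat.add_sub_cancel, hfst t le_rfl j (by omega),
          coeff_X_mul])
  rw [q₃₁] at hfill
  have F₃ := exec_frame O (loop 13 31 b₅) τ₂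
  set τ₃ := (loop 13 31 b₅).exec O τ₂
  have d₁₅ : τ₃.reg 15 = t := (F₃.reg 15 rfl).trans q₁₅
  have d₄₄ : τ₃.reg 44 = chainStart c t := (F₃.reg 44 rfl).trans b₁
  have d₄₅ : τ₃.reg 45 = t - chainStart c t := (F₃.reg 45 rfl).trans b₂
  have d₁₀ : τ₃.numArr 10 = τ₂.numArr 10 := F₃.numArr 10 rfl
  have d₁₆ : τ₃.arr 16 = τ.arr 16 := (F₃.arr 16 rfl).trans ((F₂.arr 16 rfl).trans (F₁.arr 16 rfl))
  have d₁₇ : τ₃.arr 17 = τ.arr 17 := (F₃.arr 17 rfl).trans ((F₂.arr 17 rfl).trans (F₁.arr 17 rfl))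
  have d₁₈ : τ₃.arr 18 = τ.arr 18 := (F₃.arr 18 rfl).trans ((F₂.arr 18 rfl).trans (F₁.arr 18 rfl))
  refine ⟨fun s hs => ?_, fun s hs => ⟨fun j hj => ⟨?_, ?_⟩, ?_, ?_, ?_⟩⟩
  · obtain rfl : s = t := by omega
    exact ⟨by simp [d₄₄], by simp [d₄₅]⟩
  · change τ₃.numArr 10 s j = _
    rw [d₁₀, hfst s (by omega) j hj]
  · change τ₃.numArr 11 s j = _
    rw [hfill]
    split_ifs with hij
    · rw [hij.1]
    · rw [c₁₁]
      exact ((ih₂ s (by omega)).1 j hj).2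
  · by_cases hst : s = t
    · simp [d₁₅, d₄₄, hst]
    · simp [d₁₅, hst, d₁₆, (ih₂ s (by omega)).2.1]
  · by_cases hst : s = t
    · simp [d₁₅, d₄₅, hst]
    · simp [d₁₅, hst, d₁₈, (ih₂ s (by omega)).2.2.1]
  · have e : (((setA 17 (.lit 0) (.var 44) (.var 15)).exec O
        ((setA 18 (.lit 0) (.var 15) (.var 45)).exec O
          ((setA 16 (.lit 0) (.var 15) (.var 44)).exec O τ₃))).setReg 15 (t + 1)).arr 17 0
          (chainStart c s) =
        if chainStart c s = chainStart c t then t else τ.arr 17 0 (chainStart c s) := by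
      simp [d₁₅, d₄₄, d₁₇]
    rw [e]
    split_ifs with hst
    · exact ⟨by omega, hst.symm, fun t' ht' _ => by omega⟩
    · have hne : s ≠ t := by
        rintro rfl
        exact hst rfl
      obtain ⟨H₁, H₂, H₃⟩ := (ih₂ s (by omega)).2.2.2
      refine ⟨by omega, H₂, fun t' ht' hh => ?_⟩
      rcases (Nat.lt_succ_iff.1 ht').lt_or_eq with ht' | rfl
      · exact H₃ t' ht' hh
      · exact absurd hh.symm hst

section

variable {A : EuclideanSpace ℂ (Fin N) →ₗ[ℂ] EuclideanSpace ℂ (Fin N)}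
  {u : ℕ → EuclideanSpace ℂ (Fin N)} {c : ℕ → Bool} {ce : ℕ → ℕ} {σ : Memory}

theorem eigenvalue_spec (h : PolynomialMemory A u c ce σ)
    (hce : ∀ t < N, IsChainEnd c N (chainStart c t) (ce (chainStart c t))) {t : ℕ} (ht : t < N)
    (h15 : σ.reg 15 = t) : (eigenvalue.exec O σ).reg 44 = chainStart c t ∧
      (eigenvalue.exec O σ).num 7 = (lanczosValue A u c ce t : ℂ) := by
  have hlt := (hce t ht).lt
  refine ⟨by simp [eigenvalue, h15, h.start t ht], ?_⟩
  simp only [eigenvalue, exec_seq, exec_setN, exec_root, Memory.setReg_reg, Memory.setReg_arr,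
    Memory.setReg_numArr, NExp.eval_arr, NExp.eval_lit, NExp.eval_var, Memory.setNum_num, h15,
    h.start t ht, h.rank t ht, h.chainEnd t ht, h.N_eq, if_true, show (15 : ℕ) ≠ 44 by decide,
    show (15 : ℕ) ≠ 46 by decide, show (30 : ℕ) ≠ 46 by decide, show (30 : ℕ) ≠ 44 by decide,
    if_false]
  rw [realRoot_eq _ (Lanczos.lanczosPolys_degree_lt hlt).2 fun j hj => by
    rw [h.snd _ hlt j (by omega), Complex.ofReal_re]]
  rfl

theorem evaluate_spec (h : PolynomialMemory A u c ce σ) {t : ℕ} (ht : t < N)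
    (h16 : σ.reg 16 = t) {x : ℝ} (hx : σ.num 7 = x) :
    (evaluate.exec O σ).num 8 = (((lanczosPolys A u c t).1.eval x : ℝ) : ℂ) := by
  rw [evaluate, exec_seq, exec_seq]
  set σ₁ := (setC 9 .one).exec O ((setC 8 .zero).exec O σ) with hσ₁
  have key := loop_inv O (x := 13) (y := 31)
    (b := setC 8 (.add (.var 8) (.mul (.arr 10 (.var 16) (.var 13)) (.var 9))) ;;
      setC 9 (.mul (.var 9) (.var 7))) (fun j τ => τ.num 9 = (x : ℂ) ^ j ∧ τ.num 8 =
        ∑ i ∈ Finset.range j, ((((lanczosPolys A u c t).1.coeff i : ℝ)) : ℂ) * (x : ℂ) ^ i) σ₁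
    (by simp [hσ₁]) (by
      intro j hj τ hF hτ ⟨ih₁, ih₂⟩
      have hj' : j < N + 1 := by simpa [hσ₁, h.N_succ] using hj
      have r₁₆ : τ.reg 16 = t := (hF.reg 16 rfl).trans (by simp [hσ₁, h16])
      have n₇ : τ.num 7 = x := (hF.num 7 rfl).trans (by simp [hσ₁, hx])
      have a : τ.numArr 10 t j = _ := (congrFun (congrFun (hF.numArr 10 rfl) t) j).trans
        (h.fst t ht j (by omega))
      rw [Finset.sum_range_succ, ← ih₂, pow_succ]
      simp [ih₁, r₁₆, n₇, hτ, a])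
  have e : σ₁.reg 31 = N + 1 := by simp [hσ₁, h.N_succ]
  rw [e] at key
  rw [key.2, eval_eq_sum_range' (Lanczos.lanczosPolys_degree_lt ht).1]
  push_cast
  rfl

theorem eigenvector_spec (h : PolynomialMemory A u c ce σ) {s : ℕ} (h44 : σ.reg 44 = s) {x : ℝ}
    (hx : σ.num 7 = x) : vec N ((eigenvector.exec O σ).numArr 13 0) =
      lanczosVector A u c N s x := by
  rw [eigenvector, exec_seq]
  have F₀ := exec_frame O (loop 13 30 (setCA 13 (.lit 0) (.var 13) .zero)) σ
  have f₀ := numArr_loop_fill O σ (a := 13) (i₀ := 0) (x := 13) (y := 30)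
    (b := setCA 13 (.lit 0) (.var 13) .zero) (fun _ => 0) (by
      intro j _ υ hG hυ _ i' j'
      simp [hυ])
  set σ₁ := (loop 13 30 (setCA 13 (.lit 0) (.var 13) .zero)).exec O σ
  have r₁ : σ₁.reg 30 = N := (F₀.reg 30 rfl).trans h.N_eq
  have key := loop_inv O (x := 16) (y := 30) (b := ite (.eq (.arr 16 (.lit 0) (.var 16)) (.var 44))
    (evaluate ;;
      setC 8 (.div (.var 8) (.arr 6 (.lit 0) (.var 16))) ;;
      loop 13 30 (setCA 13 (.lit 0) (.var 13)
        (.add (.arr 13 (.lit 0) (.var 13)) (.mul (.var 8) (.arr 5 (.var 16) (.var 13))))))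
    skip) (fun j τ => vec N (τ.numArr 13 0) = ∑ t ∈ Finset.range j, if chainStart c t = s then
      (((lanczosPolys A u c t).1.eval x / ‖u t‖ ^ 2 : ℝ) : ℂ) • u t else 0) σ₁ ?_ ?_
  · rw [r₁] at key
    exact key
  · rw [Finset.range_zero, Finset.sum_empty, Memory.setReg_numArr,
      vec_congr (g := fun _ => 0) fun y hy => by rw [f₀, h.N_eq, if_pos ⟨rfl, hy⟩]]
    rfl
  · intro t ht τ hF hτ ih
    rw [r₁] at ht
    have H : PolynomialMemory A u c ce τ := (h.frame F₀ rfl).frame hF rfl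
    have r₄₄ : τ.reg 44 = s := (hF.reg 44 rfl).trans ((F₀.reg 44 rfl).trans h44)
    have n₇ : τ.num 7 = x := (hF.num 7 rfl).trans ((F₀.num 7 rfl).trans hx)
    rw [Finset.sum_range_succ, ← ih]
    by_cases hs : chainStart c t = s
    · rw [exec_ite_pos (by simpa [hτ, H.start t ht, r₄₄] using hs), if_pos hs, exec_seq, exec_seq]
      have he := evaluate_spec O H ht hτ n₇
      have F₁ := exec_frame O evaluate τ
      set τ₁ := evaluate.exec O τ
      have a₆ : τ₁.numArr 6 0 t = ((‖u t‖ ^ 2 : ℝ) : ℂ) :=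
        (congrFun (congrFun (F₁.numArr 6 rfl) 0) t).trans (H.norms t ht)
      have r₁₆ : τ₁.reg 16 = t := (F₁.reg 16 rfl).trans hτ
      have r₃₀ : τ₁.reg 30 = N := (F₁.reg 30 rfl).trans H.N_eq
      set ζ : ℂ := (((lanczosPolys A u c t).1.eval x / ‖u t‖ ^ 2 : ℝ) : ℂ) with hζ
      set τ₂ := (setC 8 (.div (.var 8) (.arr 6 (.lit 0) (.var 16)))).exec O τ₁ with hτ₂
      have n₈ : τ₂.num 8 = ζ := by simp [hτ₂, he, r₁₆, a₆, hζ]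
      have a₁₃ : τ₂.numArr 13 = τ.numArr 13 := F₁.numArr 13 rfl
      have a₅ : τ₂.numArr 5 = τ.numArr 5 := F₁.numArr 5 rfl
      rw [Memory.setReg_numArr, ← H.vectors t ht, vec_smul, vec_add]
      refine vec_congr fun y hy => ?_
      rw [numArr_loop_fill O τ₂ (a := 13) (i₀ := 0) fun y =>
        τ.numArr 13 0 y + ζ * τ.numArr 5 t y]
      · simp [hτ₂, r₃₀, hy]
      · intro j _ υ hG hυ hsame i' j'
        have k₁ : υ.reg 16 = t := (hG.reg 16 rfl).trans r₁₆
        have k₂ : υ.num 8 = ζ := (hG.num 8 rfl).trans n₈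
        have k₃ : υ.numArr 5 = τ.numArr 5 := (hG.numArr 5 rfl).trans a₅
        have k₄ : υ.numArr 13 0 j = τ.numArr 13 0 j := by
          rw [hsame 0 j (by omega), a₁₃]
        simp [k₁, k₂, k₃, k₄, hυ]
    · rw [exec_ite_neg (by simpa [hτ, H.start t ht, r₄₄] using hs), if_neg hs, add_zero]
      rfl

theorem squareRoot_spec (σ : Memory) (h2 : σ.reg 33 = 2) {x : ℝ} (hx : 0 ≤ x)
    (h6 : σ.num 6 = ((x ^ 2 : ℝ) : ℂ)) : (squareRoot.exec O σ).num 6 = x := by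
  simp only [squareRoot, exec_seq, exec_root, exec_setCA, Memory.setNum_num, if_true,
    Memory.setNumArr_reg, h2, NExp.eval_lit]
  rw [realRoot_sq_sub _ hx] <;> simp [h6]
  rw [← Complex.ofReal_pow, Complex.ofReal_re]

end

end Prog

/-! ## The eigenvectors of the blocks -/

/-- Self-adjointness of signed Pauli strings, entry by entry. -/
theorem Row.conj_phase {n : ℕ} (R : Row) (a : Label n) :
    starRingEnd ℂ (R.phase a) = R.phase (R.move a) := by
  simp only [Row.phase, Row.move, map_mul, map_prod]
  congr 1
  · cases R.s <;> simp
  · refine Finset.prod_congr rfl fun q _ => ?_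
    cases R.x q <;> cases R.z q <;> cases a q <;> simp [phaseFactor]

theorem Row.move_move {n : ℕ} (R : Row) (a : Label n) : R.move (R.move a) = a := by
  funext q
  simp [Row.move]

namespace Setting

variable {n k : ℕ} (S : Setting n k)

/-- The operator of a block. -/
def blockOp (x : ℕ → Bool) : EuclideanSpace ℂ (Fin S.N) →ₗ[ℂ] EuclideanSpace ℂ (Fin S.N) :=
  matrixOp S.N (S.entry x)

/-- The inclusion of a block. -/
def embed (x : ℕ → Bool) : EuclideanSpace ℂ (Fin S.N) →ₗ[ℂ] Qubits n where
  toFun φ := WithLp.toLp 2 (blockPart S.r x fun a => φ ⟨blockIndex S.r a, blockIndex_lt S.r a⟩)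
  map_add' φ φ' := by
    ext a
    by_cases ha : InBlock n S.r x a <;> simp [blockPart, ha]
  map_smul' z φ := by
    ext a
    by_cases ha : InBlock n S.r x a <;> simp [blockPart, ha]

/-- The coefficients of a vector in a block. -/
def restrict (x : ℕ → Bool) (ψ : Label n → ℂ) : EuclideanSpace ℂ (Fin S.N) :=
  vec S.N fun y => ψ (blockLabel n S.r x y)

/-- The frame vector in the output. -/
def frameVector (σ : Memory) (i : ℕ) : Qubits n :=
  S.embed (fun q => toBit (σ.arr 7 i q)) (vec S.N (σ.numArr 1 i))

variable {S}

theorem embed_vec (x : ℕ → Bool) (f : ℕ → ℂ) :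
    S.embed x (vec S.N f) = WithLp.toLp 2 (S.blockVector x f) := rfl

theorem exists_eq_vec (φ : EuclideanSpace ℂ (Fin S.N)) : ∃ f, φ = vec S.N f := by
  refine ⟨fun y => if h : y < S.N then φ ⟨y, h⟩ else 0, ?_⟩
  ext y
  simp [vec]

theorem embed_congr {x x' : ℕ → Bool} (h : ∀ q < n - S.r, x q = x' q)
    (φ : EuclideanSpace ℂ (Fin S.N)) : S.embed x φ = S.embed x' φ := by
  have : ∀ a : Label n, InBlock n S.r x a ↔ InBlock n S.r x' a := fun a =>
    forall_congr' fun q => forall_congr' fun hq => by rw [h q hq]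
  ext a
  by_cases ha : InBlock n S.r x' a
  · simp [embed, blockPart, ha, (this a).2 ha]
  · simp [embed, blockPart, ha, mt (this a).1 ha]

theorem inner_embed (x : ℕ → Bool) (φ φ' : EuclideanSpace ℂ (Fin S.N)) :
    inner ℂ (S.embed x φ) (S.embed x φ') = inner ℂ φ φ' := by
  obtain ⟨f, rfl⟩ := exists_eq_vec φ
  obtain ⟨f', rfl⟩ := exists_eq_vec φ'
  rw [EuclideanSpace.inner_eq_star_dotProduct, EuclideanSpace.inner_eq_star_dotProduct,
    dotProduct, dotProduct]
  symm
  refine Finset.sum_of_injOn (fun y => blockLabel n S.r x y) ?_ (by simp) ?_ ?_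
  · intro y _ y' _ hyy
    have := congrArg (blockIndex S.r) hyy
    simp only [blockIndex_blockLabel S.reduced.le x y.2,
      blockIndex_blockLabel S.reduced.le x y'.2] at this
    exact Fin.ext this
  · intro a _ ha
    have : ¬ InBlock n S.r x a := fun hb =>
      ha ⟨⟨blockIndex S.r a, blockIndex_lt _ _⟩, by simp, blockLabel_blockIndex hb⟩
    simp [embed_vec, blockVector, blockPart, this]
  · intro y _
    simp only [embed_vec, Pi.star_apply]
    rw [blockVector_blockLabel x f y.2, blockVector_blockLabel x f' y.2]
    rfl

theorem inner_embed_of_ne {x x' : ℕ → Bool} {q : ℕ} (hq : q < n - S.r) (h : x q ≠ x' q)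
    (φ φ' : EuclideanSpace ℂ (Fin S.N)) : inner ℂ (S.embed x φ) (S.embed x' φ') = 0 := by
  rw [EuclideanSpace.inner_eq_star_dotProduct, dotProduct]
  refine Finset.sum_eq_zero fun a _ => ?_
  by_cases ha : InBlock n S.r x a
  · have : ¬ InBlock n S.r x' a := fun hb =>
      h ((ha ⟨q, by omega⟩ hq).symm.trans (hb ⟨q, by omega⟩ hq))
    simp [embed, blockPart, this]
  · simp [embed, blockPart, ha]

theorem frameH_embed (x : ℕ → Bool) (φ : EuclideanSpace ℂ (Fin S.N)) :
    S.M.frameH S.T (S.embed x φ) = S.embed x (S.blockOp x φ) := by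
  obtain ⟨f, rfl⟩ := exists_eq_vec φ
  rw [blockOp, matrixOp_vec, embed_vec, embed_vec, frameH_blockVector]

theorem embed_restrict (x : ℕ → Bool) (ψ : Label n → ℂ) :
    S.embed x (S.restrict x ψ) = WithLp.toLp 2 (blockPart S.r x ψ) := by
  rw [restrict, embed_vec]
  ext a
  by_cases ha : InBlock n S.r x a
  · simp [blockVector, blockPart, ha, blockLabel_blockIndex ha]
  · simp [blockVector, blockPart, ha]

/-- The inclusion of a block is injective and intertwines the block operator with the Hamiltonian,
so the equation can be checked after inclusion. -/
theorem blockOp_restrict {x : ℕ → Bool} {ψ : Label n → ℂ} {E : ℝ}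
    (h : S.M.frameH S.T ψ = (E : ℂ) • ψ) :
    S.blockOp x (S.restrict x ψ) = (E : ℂ) • S.restrict x ψ := by
  have hinj : Function.Injective (S.embed x) := by
    rw [injective_iff_map_eq_zero]
    intro φ hφ
    have := inner_embed x φ φ
    rwa [hφ, inner_zero_left, eq_comm, inner_self_eq_zero] at this
  apply hinj
  have h₁ := frameH_embed x (S.restrict x ψ)
  rw [map_smul, embed_restrict]
  rw [embed_restrict] at h₁
  have h₂ := S.reduced.frameH_blockPart x ψ
  ext a
  rw [← congrFun h₁ a]
  simp only [h₂, h, PiLp.smul_apply]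
  simp [blockPart]

/-- Moving labels is an involution, so a string has an entry at `(y, y')` exactly if it has one at
`(y', y)`; the two phases are conjugate, and the coefficients and energies are real. -/
theorem isSymmetric_blockOp (x : ℕ → Bool) : (S.blockOp x).IsSymmetric := by
  rw [blockOp, matrixOp, Matrix.isSymmetric_toEuclideanLin_iff]
  refine Matrix.IsHermitian.ext fun y y' => ?_
  simp only [Matrix.of_apply, entry, star_add, star_sum]
  have hb : ∀ y < S.N, blockIndex S.r (blockLabel n S.r x y) = y := fun y hy =>
    blockIndex_blockLabel S.reduced.le x hy
  congr 1
  · by_cases h : (y : ℕ) = y'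
    · simp [h]
    · simp [h, Ne.symm h]
  · refine Finset.sum_congr rfl fun i hi => ?_
    have hi := Finset.mem_range.1 hi
    have hm : ∀ y y' : Fin S.N, blockIndex S.r ((S.T.row (n + i)).move (blockLabel n S.r x y)) = y' →
        (S.T.row (n + i)).move (blockLabel n S.r x y') = blockLabel n S.r x y := by
      intro y y' h
      rw [← h, blockLabel_blockIndex ((S.reduced.inBlock_move (by omega) _ _).2
        (inBlock_blockLabel n S.r x y)), Row.move_move]
    simp only [term]
    by_cases h : blockIndex S.r ((S.T.row (n + i)).move (blockLabel n S.r x y)) = y'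
    · have h' := hm y y' h
      rw [if_pos h, if_pos (by rw [h', hb y y.2]), star_mul', ← starRingEnd_apply,
        ← starRingEnd_apply, Row.conj_phase, h']
      congr 1
      rw [gamma]
      split_ifs <;> simp
    · rw [if_neg h, if_neg, star_zero]
      intro h'
      exact h (by rw [hm y' y h', hb y' y'.2])

variable (S)

/-- The output vectors `v` with energies `e` are the eigenvectors with energies in the range of the
blocks of the list members in `D`, and of those among the eigenvectors `w`, with eigenvalues `μ`,
of the block of `x` whose number is less than `t`. -/
structure Found (D : Set ℕ) (x : ℕ → Bool) (w : ℕ → EuclideanSpace ℂ (Fin S.N)) (μ : ℕ → ℝ)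
    (t : ℕ) (o : ℕ) (v : ℕ → Qubits n) (e : ℕ → ℂ) : Prop where
  orthonormal : ∀ i < o, ∀ j < o, inner ℂ (v i) (v j) = if i = j then 1 else 0
  eigen : ∀ i < o, ∃ E : ℝ, e i = E ∧ S.E₀ ≤ E ∧ E ≤ S.E₁ ∧
    S.M.frameH S.T (v i) = (E : ℂ) • (v i).ofLp
  inside : ∀ i < o, (∃ d ∈ D, ∃ φ, v i = S.embed (S.T.label d) φ) ∨
    ∃ s < t, ∃ a : ℂ, v i = a • S.embed x (w s)
  new : ∀ s < t, S.E₀ ≤ μ s → μ s ≤ S.E₁ →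
    S.embed x (w s) ∈ Submodule.span ℂ (v '' Set.Iio o)
  complete : ∀ d ∈ D, ∀ (E : ℝ) (ψ : Label n → ℂ), S.E₀ ≤ E → E ≤ S.E₁ →
    S.M.frameH S.T ψ = (E : ℂ) • ψ →
    WithLp.toLp 2 (blockPart S.r (S.T.label d) ψ) ∈ Submodule.span ℂ (v '' Set.Iio o)

variable {S}

namespace Found

variable {D : Set ℕ} {x : ℕ → Bool} {w : ℕ → EuclideanSpace ℂ (Fin S.N)} {μ : ℕ → ℝ} {t o : ℕ}
  {v v' : ℕ → Qubits n} {e e' : ℕ → ℂ}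

theorem change (h : S.Found D x w μ 0 o v e) (x' : ℕ → Bool)
    (w' : ℕ → EuclideanSpace ℂ (Fin S.N)) (μ' : ℕ → ℝ) : S.Found D x' w' μ' 0 o v e :=
  ⟨h.orthonormal, h.eigen, fun i hi => Or.inl ((h.inside i hi).resolve_right (by simp)),
    by simp, h.complete⟩

theorem congr (h : S.Found D x w μ t o v e) (hv : ∀ i < o, v' i = v i)
    (he : ∀ i < o, e' i = e i) : S.Found D x w μ t o v' e' := by
  have hi : v' '' Set.Iio o = v '' Set.Iio o := image_Iio_congr hv
  refine ⟨fun i hi j hj => ?_, fun i hi => ?_, fun i hi => ?_, ?_, ?_⟩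
  · rw [hv i hi, hv j hj, h.orthonormal i hi j hj]
  · rw [hv i hi, he i hi]
    exact h.eigen i hi
  · rw [hv i hi]
    exact h.inside i hi
  · rw [hi]
    exact h.new
  · rw [hi]
    exact h.complete

theorem skip (h : S.Found D x w μ t o v e) (hμ : ¬ (S.E₀ ≤ μ t ∧ μ t ≤ S.E₁)) :
    S.Found D x w μ (t + 1) o v e := by
  refine ⟨h.orthonormal, h.eigen, fun i hi => ?_, fun s hs h₀ h₁ => ?_, h.complete⟩
  · rcases h.inside i hi with H | ⟨s, hs, H⟩
    exacts [Or.inl H, Or.inr ⟨s, by omega, H⟩]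
  · rcases (Nat.lt_succ_iff.1 hs).lt_or_eq with hs | rfl
    exacts [h.new s hs h₀ h₁, absurd ⟨h₀, h₁⟩ hμ]

/-- The new vector is orthogonal to those of other blocks because the supports are disjoint, by
`hD`, and to those of its own block because the eigenvectors `w` are orthogonal. -/
theorem append (h : S.Found D x w μ t o v e) (hE₀ : S.E₀ ≤ μ t) (hE₁ : μ t ≤ S.E₁)
    (hD : ∀ d ∈ D, ∃ q < n - S.r, S.T.label d q ≠ x q) (hw0 : w t ≠ 0)
    (hwo : ∀ s < t, inner ℂ (w s) (w t) = 0) (hwe : S.blockOp x (w t) = (μ t : ℂ) • w t)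
    (hv : ∀ i < o, v' i = v i) (he : ∀ i < o, e' i = e i)
    (hvo : v' o = S.embed x ((‖w t‖ : ℂ)⁻¹ • w t)) (heo : e' o = μ t) :
    S.Found D x w μ (t + 1) (o + 1) v' e' := by
  have h' := h.congr hv he
  have hmono : Submodule.span ℂ (v' '' Set.Iio o) ≤ Submodule.span ℂ (v' '' Set.Iio (o + 1)) :=
    Submodule.span_mono (Set.image_mono fun t ht =>
      lt_trans (Set.mem_Iio.1 ht) (Nat.lt_succ_self _))
  have hn : (‖w t‖ : ℂ) ≠ 0 := by simpa using hw0
  have hold : ∀ i < o, inner ℂ (v' i) (v' o) = 0 := by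
    intro i hi
    rw [hvo]
    rcases h'.inside i hi with ⟨d, hd, φ, hφ⟩ | ⟨s, hs, a, ha⟩
    · obtain ⟨q, hq, hne⟩ := hD d hd
      rw [hφ, inner_embed_of_ne hq hne]
    · rw [ha, inner_smul_left, inner_embed, inner_smul_right, hwo s hs, mul_zero, mul_zero]
  refine ⟨fun i hi j hj => ?_, fun i hi => ?_, fun i hi => ?_, fun s hs h₀ h₁ => ?_,
    fun d hd E ψ h₀ h₁ hψ => hmono (h'.complete d hd E ψ h₀ h₁ hψ)⟩
  · rcases (Nat.lt_succ_iff.1 hi).lt_or_eq with hi | rfl <;>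
      rcases (Nat.lt_succ_iff.1 hj).lt_or_eq with hj | rfl
    · exact h'.orthonormal i hi j hj
    · rw [hold i hi, if_neg hi.ne]
    · rw [← inner_conj_symm, hold j hj, map_zero, if_neg hj.ne']
    · rw [if_pos rfl, hvo, inner_embed, inner_smul_left, inner_smul_right,
        inner_self_eq_norm_sq_to_K, map_inv₀, Complex.conj_ofReal]
      field_simp
      simp
  · rcases (Nat.lt_succ_iff.1 hi).lt_or_eq with hi | rfl
    · exact h'.eigen i hi
    · refine ⟨μ t, heo, hE₀, hE₁, ?_⟩
      rw [hvo, frameH_embed, map_smul, hwe, smul_comm, map_smul]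
      rfl
  · rcases (Nat.lt_succ_iff.1 hi).lt_or_eq with hi | rfl
    · rcases h'.inside i hi with H | ⟨s, hs, H⟩
      exacts [Or.inl H, Or.inr ⟨s, by omega, H⟩]
    · exact Or.inr ⟨t, by omega, _, by rw [hvo, map_smul]⟩
  · rcases (Nat.lt_succ_iff.1 hs).lt_or_eq with hs | rfl
    · exact hmono (h'.new s hs h₀ h₁)
    · have : S.embed x (w s) = (‖w s‖ : ℂ) • v' o := by
        rw [hvo, map_smul, smul_smul, mul_inv_cancel₀ hn, one_smul]
      rw [this]
      exact Submodule.smul_mem _ _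
        (Submodule.subset_span ⟨o, Set.mem_Iio.2 (Nat.lt_succ_self o), rfl⟩)

/-- Once the eigenvectors below `t` span every eigenspace of the block, the block is complete: the
part in it of a global eigenvector is an eigenvector of the block with the same eigenvalue. -/
theorem close {l : ℕ} (h : S.Found D (S.T.label l) w μ t o v e)
    (hc : ∀ (φ : EuclideanSpace ℂ (Fin S.N)) (E : ℝ), S.blockOp (S.T.label l) φ = (E : ℂ) • φ →
      φ ∈ Submodule.span ℂ {z | ∃ s < t, μ s = E ∧ w s = z}) :
    S.Found (insert l D) (S.T.label l) w μ 0 o v e := by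
  refine ⟨h.orthonormal, h.eigen, fun i hi => Or.inl ?_, by simp, fun d hd E ψ h₀ h₁ hψ => ?_⟩
  · rcases h.inside i hi with ⟨d, hd, H⟩ | ⟨s, hs, a, ha⟩
    · exact ⟨d, Or.inr hd, H⟩
    · exact ⟨l, Or.inl rfl, a • w s, by rw [ha, map_smul]⟩
  · rcases hd with rfl | hd
    · rw [← embed_restrict]
      have hle : Submodule.span ℂ {z | ∃ s < t, μ s = E ∧ w s = z} ≤
          (Submodule.span ℂ (v '' Set.Iio o)).comap (S.embed (S.T.label d)) := by
        rw [Submodule.span_le]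
        rintro _ ⟨s, hs, rfl, rfl⟩
        exact h.new s hs h₀ h₁
      exact hle (hc _ E (blockOp_restrict hψ))
    · exact h.complete d hd E ψ h₀ h₁ hψ

end Found

/-- The list member `l` is the one that stands for its block. -/
def First (S : Setting n k) (l : ℕ) : Prop :=
  ∃ y < S.N, (S.lo ≤ S.energy (S.T.label l) y ∧ S.energy (S.T.label l) y ≤ S.hi) ∧
    (∀ y' < y, ¬ (S.lo ≤ S.energy (S.T.label l) y' ∧ S.energy (S.T.label l) y' ≤ S.hi)) ∧
    ∀ j : Fin n, S.T.syndrome (blockLabel n S.r (S.T.label l) y) j = S.L l j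

/-- Two representatives with the same first bits would share a block, hence the first label in the
window and its syndrome, against the absence of repetitions in the list. So no block is treated
twice. -/
theorem First.exists_ne (hL : ∀ l < S.len, ∀ l' < S.len, (∀ j < n, S.L l j = S.L l' j) → l = l')
    {l l' : ℕ} (hl : l < S.len) (hl' : l' < S.len) (h : S.First l) (h' : S.First l')
    (hne : l ≠ l') : ∃ q < n - S.r, S.T.label l q ≠ S.T.label l' q := by
  by_contra! H
  have hb : ∀ y, blockLabel n S.r (S.T.label l) y = blockLabel n S.r (S.T.label l') y := by
    intro y
    funext q
    rw [blockLabel, blockLabel]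
    split_ifs with hq
    exacts [H q hq, rfl]
  have he : S.energy (S.T.label l) = S.energy (S.T.label l') := by
    funext y
    rw [energy, energy, hb]
  obtain ⟨y, -, h₁, h₂, h₃⟩ := h
  obtain ⟨y', -, h₁', h₂', h₃'⟩ := h'
  rw [he] at h₁ h₂
  obtain rfl : y = y' := by
    rcases lt_trichotomy y y' with hlt | heq | hlt
    exacts [absurd h₁ (h₂' y hlt), heq, absurd h₁' (h₂ y' hlt)]
  exact hne (hL l hl l' hl' fun j hj => by rw [← h₃ ⟨j, hj⟩, hb, h₃' ⟨j, hj⟩])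

end Setting

/-! ### Output of eigenvectors and the loop over the blocks. -/

namespace Prog

open Cmd

variable {n k : ℕ} {S : Setting n k} {σ : Memory}

theorem writeState_spec (O : Oracle) (h : S.Ready σ) {l : ℕ} (hl : σ.reg 12 = l) {μ : ℝ}
    (hμ : σ.num 7 = μ) {w : EuclideanSpace ℂ (Fin S.N)} (hw : vec S.N (σ.numArr 13 0) = w)
    (hn : σ.num 6 = (‖w‖ : ℂ)) :
    (S.E₀ ≤ μ ∧ μ ≤ S.E₁ → (writeState.exec O σ).reg 3 = σ.reg 3 + 1 ∧
      S.frameVector (writeState.exec O σ) (σ.reg 3) = S.embed (S.T.label l) ((‖w‖ : ℂ)⁻¹ • w) ∧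
      (writeState.exec O σ).numArr 2 0 (σ.reg 3) = μ ∧
      ∀ i < σ.reg 3, S.frameVector (writeState.exec O σ) i = S.frameVector σ i ∧
        (writeState.exec O σ).numArr 2 0 i = σ.numArr 2 0 i) ∧
    (¬ (S.E₀ ≤ μ ∧ μ ≤ S.E₁) → writeState.exec O σ = σ) := by
  rw [writeState]
  constructor
  · rintro ⟨h₀, h₁⟩
    rw [exec_ite_pos (by simpa [hμ, h.E₀_eq] using h₀),
      exec_ite_pos (by simpa [hμ, h.E₁_eq] using h₁), exec_seq, exec_seq, exec_seq]
    set b₁ : Cmd := setA 7 (.var 3) (.var 14) (.arr 9 (.var 12) (.var 14)) with hb₁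
    have f₁ := arr_loop_fill O σ (a := 7) (i₀ := σ.reg 3) (x := 14) (y := 0) (b := b₁)
      (σ.arr 9 l) (by
        intro j _ υ hG hυ i' j'
        simp [hb₁, hG.reg 3 rfl, hG.reg 12 rfl, hυ, hl, hG.arr 9 rfl])
    rw [h.n_eq] at f₁
    have F₁ := exec_frame O (loop 14 0 b₁) σ
    set σ₁ := (loop 14 0 b₁).exec O σ
    have r₃ : σ₁.reg 3 = σ.reg 3 := F₁.reg 3 rfl
    have r₃₀ : σ₁.reg 30 = S.N := (F₁.reg 30 rfl).trans h.N_eq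
    set b₂ : Cmd := setCA 1 (.var 3) (.var 13) (.div (.arr 13 (.lit 0) (.var 13)) (.var 6)) with hb₂
    have f₂ := numArr_loop_fill O σ₁ (a := 1) (i₀ := σ.reg 3) (x := 13) (y := 30) (b := b₂)
      (fun y => σ.numArr 13 0 y / (‖w‖ : ℂ)) (by
        intro j _ υ hG hυ _ i' j'
        have k₁ : υ.reg 3 = σ.reg 3 := (hG.reg 3 rfl).trans r₃
        have k₂ : υ.numArr 13 = σ.numArr 13 := (hG.numArr 13 rfl).trans (F₁.numArr 13 rfl)
        have k₃ : υ.num 6 = (‖w‖ : ℂ) := (hG.num 6 rfl).trans ((F₁.num 6 rfl).trans hn)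
        simp [hb₂, k₁, k₂, k₃, hυ])
    rw [r₃₀] at f₂
    have F₂ := exec_frame O (loop 13 30 b₂) σ₁
    set σ₂ := (loop 13 30 b₂).exec O σ₁
    have q₃ : σ₂.reg 3 = σ.reg 3 := (F₂.reg 3 rfl).trans r₃
    have q₇ : σ₂.num 7 = μ := (F₂.num 7 rfl).trans ((F₁.num 7 rfl).trans hμ)
    have a₂ : σ₂.numArr 2 = σ.numArr 2 := (F₂.numArr 2 rfl).trans (F₁.numArr 2 rfl)
    set σ₃ := (setN 3 (.succ (.var 3))).exec O ((setCA 2 (.lit 0) (.var 3) (.var 7)).exec O σ₂)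
      with hσ₃
    have a₇ : σ₃.arr 7 = σ₁.arr 7 := F₂.arr 7 rfl
    have a₁ : σ₃.numArr 1 = σ₂.numArr 1 := rfl
    have a₁' : σ₁.numArr 1 = σ.numArr 1 := F₁.numArr 1 rfl
    refine ⟨by simp [hσ₃, q₃], ?_, by simp [hσ₃, q₃, q₇], fun i hi => ⟨?_, ?_⟩⟩
    · rw [Setting.frameVector, a₇, a₁, ← hw, vec_smul, vec_congr (f := σ₂.numArr 1 (σ.reg 3))
        (g := fun y => (‖vec S.N (σ.numArr 13 0)‖ : ℂ)⁻¹ * σ.numArr 13 0 y) fun y hy => by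
          rw [f₂, if_pos ⟨rfl, hy⟩, hw, div_eq_inv_mul]]
      refine Setting.embed_congr (fun q hq => ?_) _
      rw [f₁, if_pos ⟨rfl, by omega⟩, ← h.tableau]
      rfl
    · rw [Setting.frameVector, Setting.frameVector, a₇, a₁]
      congr 2
      · funext q
        rw [f₁, if_neg (by omega)]
      · funext y
        rw [f₂, if_neg (by omega), a₁']
    · simp [hσ₃, q₃, hi.ne, a₂]
  · intro hμ'
    by_cases h₀ : S.E₀ ≤ μ
    · rw [exec_ite_pos (by simpa [hμ, h.E₀_eq] using h₀),
        exec_ite_neg (by simpa [hμ, h.E₁_eq] using fun h₁ => hμ' ⟨h₀, h₁⟩), exec_skip]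
    · rw [exec_ite_neg (by simpa [hμ, h.E₀_eq] using h₀), exec_skip]

theorem eigenstates_spec (O : Oracle) (h : S.Ready σ) {l : ℕ} (hl : σ.reg 12 = l)
    {u : ℕ → EuclideanSpace ℂ (Fin S.N)} {c : ℕ → Bool} {ce : ℕ → ℕ} {D : Set ℕ}
    (hLz : Lanczos (S.blockOp (S.T.label l)) u c S.N)
    (hce : ∀ t < S.N, IsChainEnd c S.N (chainStart c t) (ce (chainStart c t)))
    (hP : PolynomialMemory (S.blockOp (S.T.label l)) u c ce σ)
    (hD : ∀ d ∈ D, ∃ q < n - S.r, S.T.label d q ≠ S.T.label l q)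
    (hF : S.Found D (S.T.label l) 0 0 0 (σ.reg 3) (S.frameVector σ) (σ.numArr 2 0)) :
    S.Found (insert l D) (S.T.label l) 0 0 0 ((eigenstates.exec O σ).reg 3)
      (S.frameVector (eigenstates.exec O σ)) ((eigenstates.exec O σ).numArr 2 0) := by
  set A := S.blockOp (S.T.label l) with hA
  have hsym : A.IsSymmetric := Setting.isSymmetric_blockOp _
  have hfin := finrank_euclideanSpace_fin (𝕜 := ℂ) (n := S.N)
  set w := lanczosEigenvector A u c S.N ce with hw
  set μ := lanczosValue A u c ce with hμ
  refine Setting.Found.change (Setting.Found.close (w := w) (μ := μ) (t := S.N) ?_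
    fun φ E hφ => hLz.eigenvector_complete hsym hfin hce hφ) _ _ _
  refine loop_inv_of_eq O h.N_eq (fun t τ => S.Found D (S.T.label l) w μ t (τ.reg 3)
    (S.frameVector τ) (τ.numArr 2 0)) (hF.change _ _ _) ?_
  intro t ht τ hG hτ ih
  have R := h.frame hG rfl
  have H := hP.frame hG rfl
  have r₁₂ : τ.reg 12 = l := (hG.reg 12 rfl).trans hl
  rw [exec_seq, exec_seq, exec_seq, exec_seq]
  obtain ⟨s₁, s₂⟩ := eigenvalue_spec O H hce ht hτ
  have F₁ := exec_frame O eigenvalue τ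
  have H₁ := H.frame F₁ rfl
  set τ₁ := eigenvalue.exec O τ
  have s₃ := eigenvector_spec O H₁ s₁ s₂
  have F₂ := exec_frame O eigenvector τ₁
  set τ₂ := eigenvector.exec O τ₁
  have R₂ := (R.frame F₁ rfl).frame F₂ rfl
  have s₄ := squareNorm_spec O τ₂ R₂.N_eq 13
  have F₃ := exec_frame O (squareNorm 13) τ₂
  have R₃ := R₂.frame F₃ rfl
  set τ₃ := (squareNorm 13).exec O τ₂
  have s₅ := squareRoot_spec O τ₃ R₃.two (norm_nonneg _) s₄
  have F₄ := exec_frame O squareRoot τ₃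
  have R₄ := R₃.frame F₄ rfl
  set τ₄ := squareRoot.exec O τ₃
  have e₃ : τ₄.reg 3 = τ.reg 3 := (F₄.reg 3 rfl).trans ((F₃.reg 3 rfl).trans
    ((F₂.reg 3 rfl).trans (F₁.reg 3 rfl)))
  have e₁₂ : τ₄.reg 12 = l := (F₄.reg 12 rfl).trans ((F₃.reg 12 rfl).trans
    ((F₂.reg 12 rfl).trans ((F₁.reg 12 rfl).trans r₁₂)))
  have e₇ : τ₄.num 7 = μ t := (F₄.num 7 rfl).trans ((F₃.num 7 rfl).trans
    ((F₂.num 7 rfl).trans s₂))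
  have a₁₃ : τ₄.numArr 13 = τ₂.numArr 13 := (F₄.numArr 13 rfl).trans (F₃.numArr 13 rfl)
  have a₇ : τ₄.arr 7 = τ.arr 7 := (F₄.arr 7 rfl).trans ((F₃.arr 7 rfl).trans
    ((F₂.arr 7 rfl).trans (F₁.arr 7 rfl)))
  have a₁ : τ₄.numArr 1 = τ.numArr 1 := (F₄.numArr 1 rfl).trans ((F₃.numArr 1 rfl).trans
    ((F₂.numArr 1 rfl).trans (F₁.numArr 1 rfl)))
  have a₂ : τ₄.numArr 2 = τ.numArr 2 := (F₄.numArr 2 rfl).trans ((F₃.numArr 2 rfl).trans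
    ((F₂.numArr 2 rfl).trans (F₁.numArr 2 rfl)))
  have hv : S.frameVector τ₄ = S.frameVector τ := by
    funext i
    rw [Setting.frameVector, Setting.frameVector, a₇, a₁]
  have hwt : vec S.N (τ₄.numArr 13 0) = w t := by
    rw [a₁₃, s₃]
    rfl
  rw [s₃] at s₅
  obtain ⟨k₁, k₂⟩ := writeState_spec O R₄ e₁₂ e₇ hwt s₅
  rw [← e₃, ← hv, ← a₂] at ih
  by_cases hin : S.E₀ ≤ μ t ∧ μ t ≤ S.E₁
  · obtain ⟨m₁, m₂, m₃, m₄⟩ := k₁ hin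
    change S.Found D (S.T.label l) w μ (t + 1) ((writeState.exec O τ₄).reg 3)
      (S.frameVector (writeState.exec O τ₄)) ((writeState.exec O τ₄).numArr 2 0)
    rw [m₁]
    exact ih.append hin.1 hin.2 hD (hLz.eigenvector_ne_zero hce ht)
      (fun s hs => hLz.eigenvector_orthogonal hsym hfin hce (by omega) ht (by omega))
      (hLz.apply_eigenvector hsym hfin hce ht) (fun i hi => (m₄ i hi).1) (fun i hi => (m₄ i hi).2)
      m₂ m₃
  · rw [k₂ hin]
    exact ih.skip hin

theorem matrixOp_congr {N : ℕ} {B B' : ℕ → ℕ → ℂ} (h : ∀ y < N, ∀ y' < N, B y y' = B' y y') :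
    matrixOp N B = matrixOp N B' := by
  rw [matrixOp, matrixOp]
  congr 1
  ext y y'
  exact h y y.2 y' y'.2

theorem solveBlock_spec (O : Oracle) (h : S.Ready σ) {l : ℕ} (hl : σ.reg 12 = l)
    (hb : ∀ y < S.N, ∀ q : Fin n, σ.bit 13 y q = blockLabel n S.r (S.T.label l) y q)
    (he : ∀ y < S.N, σ.numArr 3 0 y = S.energy (S.T.label l) y) {D : Set ℕ}
    (hD : ∀ d ∈ D, ∃ q < n - S.r, S.T.label d q ≠ S.T.label l q)
    (hF : S.Found D (S.T.label l) 0 0 0 (σ.reg 3) (S.frameVector σ) (σ.numArr 2 0)) :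
    S.Found (insert l D) (S.T.label l) 0 0 0 ((solveBlock.exec O σ).reg 3)
      (S.frameVector (solveBlock.exec O σ)) ((solveBlock.exec O σ).numArr 2 0) := by
  rw [solveBlock, exec_seq, exec_seq, exec_seq]
  have hB := blockMatrix_spec O h hb he
  have F₁ := exec_frame O blockMatrix σ
  have R₁ := h.frame F₁ rfl
  set σ₁ := blockMatrix.exec O σ
  have hop : matrixOp S.N (σ₁.numArr 4) = S.blockOp (S.T.label l) := matrixOp_congr hB
  obtain ⟨L₁, L₂⟩ := lanczos_spec O σ₁ R₁.N_eq R₁.N_three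
  have F₂ := exec_frame O lanczos σ₁
  have R₂ := R₁.frame F₂ rfl
  set σ₂ := lanczos.exec O σ₁
  rw [hop] at L₁
  have hop₂ : matrixOp S.N (σ₂.numArr 4) = S.blockOp (S.T.label l) := by
    rw [F₂.numArr 4 rfl, hop]
  obtain ⟨ce, hce, hP⟩ := polynomials_spec O σ₂ (Setting.isSymmetric_blockOp _) L₁
    ⟨R₂.N_eq, R₂.N_succ, fun t _ => rfl, L₂⟩ hop₂ fun t _ => rfl
  have F₃ := exec_frame O polynomials σ₂
  have R₃ := R₂.frame F₃ rfl
  set σ₃ := polynomials.exec O σ₂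
  have e₃ : σ₃.reg 3 = σ.reg 3 := (F₃.reg 3 rfl).trans ((F₂.reg 3 rfl).trans (F₁.reg 3 rfl))
  have e₁₂ : σ₃.reg 12 = l :=
    (F₃.reg 12 rfl).trans ((F₂.reg 12 rfl).trans ((F₁.reg 12 rfl).trans hl))
  have a₇ : σ₃.arr 7 = σ.arr 7 := (F₃.arr 7 rfl).trans ((F₂.arr 7 rfl).trans (F₁.arr 7 rfl))
  have a₁ : σ₃.numArr 1 = σ.numArr 1 :=
    (F₃.numArr 1 rfl).trans ((F₂.numArr 1 rfl).trans (F₁.numArr 1 rfl))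
  have a₂ : σ₃.numArr 2 = σ.numArr 2 :=
    (F₃.numArr 2 rfl).trans ((F₂.numArr 2 rfl).trans (F₁.numArr 2 rfl))
  have hv : S.frameVector σ₃ = S.frameVector σ := by
    funext i
    rw [Setting.frameVector, Setting.frameVector, a₇, a₁]
  rw [← e₃, ← hv, ← a₂] at hF
  exact eigenstates_spec O R₃ e₁₂ L₁ hce hP hD hF

theorem blocks_spec (h : S.Ready σ) (h3 : σ.reg 3 = 0)
    (hL : ∀ l < S.len, ∀ l' < S.len, (∀ j < n, S.L l j = S.L l' j) → l = l') :
    S.Found {l | l < S.len ∧ S.First l} (fun _ => false) 0 0 0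
      ((blocks.exec S.M.oracle σ).reg 3) (S.frameVector (blocks.exec S.M.oracle σ))
      ((blocks.exec S.M.oracle σ).numArr 2 0) := by
  refine loop_inv_of_eq S.M.oracle h.len_eq (fun j τ => S.Found {l | l < j ∧ S.First l}
    (fun _ => false) 0 0 0 (τ.reg 3) (S.frameVector τ) (τ.numArr 2 0)) ?_ ?_
  · have : (σ.setReg 12 0).reg 3 = 0 := by simp [h3]
    rw [this]
    exact ⟨by omega, by omega, by omega, by omega, by simp⟩
  intro l hl τ hG hτ ih
  have R := h.frame hG rfl
  rw [exec_seq, exec_seq, exec_seq]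
  have b₁ := blockLabels_spec S.M.oracle R hτ
  have F₁ := exec_frame S.M.oracle blockLabels τ
  have R₁ := R.frame F₁ rfl
  set τ₁ := blockLabels.exec S.M.oracle τ
  have b₂ := blockEnergies_spec R₁ b₁
  have F₂ := exec_frame S.M.oracle blockEnergies τ₁
  have R₂ := R₁.frame F₂ rfl
  set τ₂ := blockEnergies.exec S.M.oracle τ₁
  have r₁₂ : τ₂.reg 12 = l := (F₂.reg 12 rfl).trans ((F₁.reg 12 rfl).trans hτ)
  have b₃ := isFirst_spec S.M.oracle R₂ r₁₂ fun y hy => (b₂ y hy).2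
  have F₃ := exec_frame S.M.oracle isFirst τ₂
  have R₃ := R₂.frame F₃ rfl
  set τ₃ := isFirst.exec S.M.oracle τ₂
  have hfirst : τ₃.reg 37 ≠ 0 ↔ S.First l := by
    rw [b₃]
    refine exists_congr fun y => and_congr_right fun hy => and_congr_right fun _ =>
      and_congr_right fun _ => ?_
    refine ⟨fun H j => ?_, fun H j hj => ?_⟩
    · rw [← (b₂ y hy).1 j, H j j.2, R₂.list l hl j j.2]
    · rw [R₂.list l hl j hj]
      exact ((b₂ y hy).1 ⟨j, hj⟩).trans (H ⟨j, hj⟩)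
  have e₃ : τ₃.reg 3 = τ.reg 3 := (F₃.reg 3 rfl).trans ((F₂.reg 3 rfl).trans (F₁.reg 3 rfl))
  have e₁₂ : τ₃.reg 12 = l := (F₃.reg 12 rfl).trans r₁₂
  have a₇ : τ₃.arr 7 = τ.arr 7 := (F₃.arr 7 rfl).trans ((F₂.arr 7 rfl).trans (F₁.arr 7 rfl))
  have a₁ : τ₃.numArr 1 = τ.numArr 1 :=
    (F₃.numArr 1 rfl).trans ((F₂.numArr 1 rfl).trans (F₁.numArr 1 rfl))
  have a₂ : τ₃.numArr 2 = τ.numArr 2 :=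
    (F₃.numArr 2 rfl).trans ((F₂.numArr 2 rfl).trans (F₁.numArr 2 rfl))
  have a₃ : τ₃.numArr 3 = τ₂.numArr 3 := F₃.numArr 3 rfl
  have a₁₃ : τ₃.arr 13 = τ₁.arr 13 := (F₃.arr 13 rfl).trans (F₂.arr 13 rfl)
  have hv : S.frameVector τ₃ = S.frameVector τ := by
    funext i
    rw [Setting.frameVector, Setting.frameVector, a₇, a₁]
  rw [← e₃, ← hv, ← a₂] at ih
  have hset_reg : ∀ υ : Memory, (υ.setReg 12 (l + 1)).reg 3 = υ.reg 3 := fun υ => by simp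
  have hset_vec : ∀ υ : Memory, S.frameVector (υ.setReg 12 (l + 1)) = S.frameVector υ := fun _ => rfl
  rw [hset_reg, hset_vec, Memory.setReg_numArr]
  clear_value τ₃
  by_cases hf : S.First l
  · rw [exec_ite_neg (by simpa using hfirst.2 hf)]
    have hset : {l' | l' < l + 1 ∧ S.First l'} = insert l {l' | l' < l ∧ S.First l'} := by
      ext l'
      simp only [Set.mem_ofPred_eq, Set.mem_insert_iff]
      constructor
      · rintro ⟨h₁, h₂⟩
        rcases (Nat.lt_succ_iff.1 h₁).lt_or_eq with h₁ | h₁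
        exacts [Or.inr ⟨h₁, h₂⟩, Or.inl h₁]
      · rintro (rfl | ⟨h₁, h₂⟩)
        exacts [⟨by omega, hf⟩, ⟨by omega, h₂⟩]
    rw [hset]
    refine (solveBlock_spec S.M.oracle R₃ e₁₂ (by simpa only [Memory.bit, a₁₃] using b₁)
      (fun y hy => ?_) (fun d hd => ?_) (ih.change _ _ _)).change _ _ _
    · rw [a₃]
      exact (b₂ y hy).2
    · exact Setting.First.exists_ne hL (hd.1.trans hl) hl hd.2 hf hd.1.ne
  · rw [exec_ite_pos (by simpa using mt hfirst.1 hf), exec_skip]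
    have hset : {l' | l' < l + 1 ∧ S.First l'} = {l' | l' < l ∧ S.First l'} := by
      ext l'
      simp only [Set.mem_ofPred_eq]
      refine and_congr_left fun h₂ => ⟨fun h₁ => ?_, fun h₁ => by omega⟩
      rcases (Nat.lt_succ_iff.1 h₁).lt_or_eq with h₁ | rfl
      exacts [h₁, absurd h₂ hf]
    rw [hset]
    exact ih

end Prog

/-! ## Correctness of the output -/

theorem blockPart_congr {n r : ℕ} {x x' : ℕ → Bool} (h : ∀ q < n - r, x q = x' q)
    (ψ : Label n → ℂ) : blockPart r x ψ = blockPart r x' ψ := by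
  have : ∀ a : Label n, InBlock n r x a ↔ InBlock n r x' a := fun a =>
    forall_congr' fun q => forall_congr' fun hq => by rw [h q hq]
  funext a
  by_cases ha : InBlock n r x' a
  · simp [blockPart, ha, (this a).2 ha]
  · simp [blockPart, ha, mt (this a).1 ha]

theorem InBlock.blockPart_eq {n r : ℕ} {x : ℕ → Bool} {a : Label n} (ha : InBlock n r x a)
    (ψ : Label n → ℂ) : blockPart r x ψ = blockPart r a.extend ψ :=
  blockPart_congr (fun q hq => by rw [Label.extend, dif_pos (by omega)]; exact (ha ⟨q, _⟩ hq).symm) ψ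

/-- A vector is the sum of its block parts. To count each block once, blocks are indexed by bit
sequences that are `false` from `n - r` on. -/
theorem mem_of_blockPart_mem {n r : ℕ} {W : Submodule ℂ (Qubits n)} {ψ : Label n → ℂ}
    (h : ∀ a : Label n, ψ a ≠ 0 → WithLp.toLp 2 (blockPart r a.extend ψ) ∈ W) :
    WithLp.toLp 2 ψ ∈ W := by
  classical
  let X : Finset (ℕ → Bool) := Finset.univ.image fun a : Label n => fun q =>
    decide (q < n - r) && a.extend q
  have hX : ∀ a : Label n, InBlock n r (fun q => decide (q < n - r) && a.extend q) a := by
    intro a q hq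
    simp [hq, Label.extend_val]
  have hsum : WithLp.toLp 2 ψ = ∑ x ∈ X, WithLp.toLp 2 (blockPart r x ψ) := by
    ext a
    rw [WithLp.ofLp_sum, Finset.sum_apply, Finset.sum_eq_single fun q =>
      decide (q < n - r) && a.extend q]
    · simp [blockPart, hX a]
    · intro x hx hne
      obtain ⟨b, -, rfl⟩ := Finset.mem_image.1 hx
      refine if_neg fun H => hne ?_
      funext q
      by_cases hq : q < n - r
      · have h₁ := (hX a) ⟨q, by omega⟩ hq
        have h₂ := H ⟨q, by omega⟩ hq
        exact h₂.symm.trans h₁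
      · simp [hq]
    · intro H
      exact absurd (Finset.mem_image_of_mem _ (Finset.mem_univ a)) H
  rw [hsum]
  refine Submodule.sum_mem _ fun x hx => ?_
  by_cases h0 : ∃ a, InBlock n r x a ∧ ψ a ≠ 0
  · obtain ⟨a, ha, hne⟩ := h0
    rw [ha.blockPart_eq]
    exact h a hne
  · push Not at h0
    have : blockPart r x ψ = 0 := by
      funext a
      by_cases ha : InBlock n r x a
      · simp [blockPart, ha, h0 a ha]
      · simp [blockPart, ha]
    rw [this]
    exact zero_mem _

namespace Model.Reduced

variable {n k : ℕ} {M : Model n k} {Λ r : ℕ} {L : ℕ → ℕ → Bool} {T : Tableau n}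

/-- An eigenvector lies in a subspace that contains its components in all blocks that meet the
enlarged energy window. -/
theorem mem_of_blockPart_mem (h : M.Reduced Λ L r T) {E₀ E₁ E : ℝ} (h₀ : E₀ ≤ E) (h₁ : E ≤ E₁)
    {ψ : Label n → ℂ} (hψ : M.frameH T ψ = (E : ℂ) • ψ) {W : Submodule ℂ (Qubits n)}
    (hW : ∀ a : Label n, T.syndrome a ∈ M.S (E₀ - M.normδH) (E₁ + M.normδH) →
      WithLp.toLp 2 (blockPart r a.extend ψ) ∈ W) : WithLp.toLp 2 ψ ∈ W := by
  refine StabPert.mem_of_blockPart_mem (r := r) fun a₀ ha₀ => ?_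
  obtain ⟨a, ha, hE⟩ := h.exists_energy_near hψ ha₀ (x := a₀.extend)
    fun q _ => (Label.extend_val a₀ q).symm
  rw [abs_le] at hE
  rw [ha.blockPart_eq]
  exact hW a ⟨by linarith, by linarith⟩

theorem exists_frame (h : M.Reduced Λ L r T) {E : ℝ} {ψ : Qubits n}
    (hψ : asOperator M.H ψ = (E : ℂ) • ψ) :
    ∃ φ : Label n → ℂ, M.frameH T φ = (E : ℂ) • φ ∧
      circuitIsometry T.gates (WithLp.toLp 2 φ) = ψ := by
  obtain ⟨φ, rfl⟩ := circuitIsometry_surjective T.gates ψ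
  refine ⟨φ.ofLp, ?_, rfl⟩
  rw [h.asOperator_H, ← map_smul] at hψ
  exact congrArg WithLp.ofLp ((circuitIsometry T.gates).injective hψ)

end Model.Reduced

namespace Setting

variable {n k : ℕ} {S : Setting n k} {σ : Memory}

theorem outputVector_eq (R : S.Ready σ) (i : ℕ) :
    outputVector n σ i = circuitIsometry S.T.gates (S.frameVector σ i) := by
  rw [outputVector, R.circuit, R.r_eq, List.foldl_reverse, productVector_eq S.reduced.le,
    circuitIsometry_apply, frameVector, embed_vec]
  rfl

/-- A block that meets the energy window is represented by a member of the list. -/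
theorem exists_first (hS : ∀ s : Label n, S.lo ≤ S.M.energy s → S.M.energy s ≤ S.hi →
      ∃ l < S.len, ∀ j : Fin n, S.L l j = s j) {a : Label n}
    (h₀ : S.lo ≤ S.M.energy (S.T.syndrome a)) (h₁ : S.M.energy (S.T.syndrome a) ≤ S.hi) :
    ∃ l < S.len, S.First l ∧ ∀ q < n - S.r, S.T.label l q = a.extend q := by
  classical
  -- The least such `y` gives a label whose syndrome is on the list by `hS`; since syndromes
  -- determine labels, it is the label of that list member, which therefore represents the block.
  have hex : ∃ y, y < S.N ∧ S.lo ≤ S.energy a.extend y ∧ S.energy a.extend y ≤ S.hi := by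
    refine ⟨blockIndex S.r a, blockIndex_lt _ _, ?_⟩
    rw [energy, blockLabel_blockIndex fun q _ => (Label.extend_val a q).symm]
    exact ⟨h₀, h₁⟩
  obtain ⟨hy, hin⟩ := Nat.find_spec hex
  have hmin := fun y' (hy' : y' < Nat.find hex) => Nat.find_min hex hy'
  set y := Nat.find hex
  obtain ⟨l, hl, hsl⟩ := hS _ hin.1 hin.2
  have hlab : ∀ q < n, S.T.label l q = (blockLabel n S.r a.extend y).extend q :=
    S.reduced.diagonal.injective _ _ fun j hj => by
      rw [S.reduced.diagonal.syndrome_label l hl j hj]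
      exact hsl ⟨j, hj⟩
  have hagree : ∀ q < n - S.r, S.T.label l q = a.extend q := by
    intro q hq
    rw [hlab q (by omega), Label.extend, dif_pos (by omega), blockLabel, if_pos hq]
  have hb : blockLabel n S.r (S.T.label l) = blockLabel n S.r a.extend := by
    funext y q
    rw [blockLabel, blockLabel]
    split_ifs with hq
    exacts [hagree q hq, rfl]
  have he : S.energy (S.T.label l) = S.energy a.extend := by
    funext y
    rw [energy, energy, hb]
  refine ⟨l, hl, ⟨y, hy, ?_, fun y' hy' H => ?_, fun j => ?_⟩, hagree⟩
  · rw [he]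
    exact hin
  · rw [he] at H
    exact hmin y' hy' ⟨by omega, H⟩
  · rw [hb, ← hsl j]

theorem isOutput (R : S.Ready σ) (hF : S.Found {l | l < S.len ∧ S.First l} (fun _ => false) 0 0 0
      (σ.reg 3) (S.frameVector σ) (σ.numArr 2 0))
    (hwin : ∀ s ∈ S.M.S (S.E₀ - S.M.normδH) (S.E₁ + S.M.normδH),
      S.lo ≤ S.M.energy s ∧ S.M.energy s ≤ S.hi)
    (hS : ∀ s : Label n, S.lo ≤ S.M.energy s → S.M.energy s ≤ S.hi →
      ∃ l < S.len, ∀ j : Fin n, S.L l j = s j) : S.M.IsOutput S.E₀ S.E₁ σ := by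
  have hout := outputVector_eq R
  refine ⟨?_, ?_, fun i => ?_, fun E ψ h₀ h₁ hψ => ?_⟩
  · rw [R.r_eq]
    exact ⟨S.reduced.le, S.reduced.le_dimK⟩
  · rw [orthonormal_iff_ite]
    intro i j
    rw [hout, hout, LinearIsometry.inner_map_map, hF.orthonormal i i.2 j j.2]
    simp [Fin.ext_iff]
  · obtain ⟨E, h₁, h₂, h₃, h₄⟩ := hF.eigen i i.2
    refine ⟨E, h₁, h₂, h₃, ?_⟩
    rw [hout, S.reduced.asOperator_H, h₄, ← map_smul]
    rfl
  · obtain ⟨φ, hφ, rfl⟩ := S.reduced.exists_frame hψ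
    have hmem : WithLp.toLp 2 φ ∈ Submodule.span ℂ (S.frameVector σ '' Set.Iio (σ.reg 3)) := by
      refine S.reduced.mem_of_blockPart_mem h₀ h₁ hφ fun a ha => ?_
      obtain ⟨hlo, hhi⟩ := hwin _ ha
      obtain ⟨l, hl, hfirst, hagree⟩ := exists_first hS hlo hhi
      have := hF.complete l ⟨hl, hfirst⟩ E φ h₀ h₁ hφ
      rwa [blockPart_congr hagree] at this
    have := Submodule.mem_map_of_mem (f := (circuitIsometry S.T.gates).toLinearMap) hmem
    rw [Submodule.map_span] at this
    refine Submodule.span_mono ?_ this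
    rintro _ ⟨_, ⟨i, hi, rfl⟩, rfl⟩
    exact ⟨⟨i, hi⟩, hout i⟩

end Setting

/-! ### Correctness of the whole program. -/

namespace Prog

open Cmd

variable {n k : ℕ} (M : Model n k) (E₀ E₁ : ℝ) (L : List (Label n))

theorem input_bit {l : ℕ} (hl : l < L.length) (j : Fin n) :
    (M.input E₀ E₁ L).bit 5 l j = L[l] j := by
  have : (M.input E₀ E₁ L).arr 5 l j = ofBit (L[l] j) := by simp [Model.input, hl]
  rw [Memory.bit, this]
  cases L[l] j <;> rfl

theorem exists_ready (hL : L ≠ []) : ∃ (S : Setting n k) (σ : Memory), S.M = M ∧ S.E₀ = E₀ ∧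
    S.E₁ = E₁ ∧ S.len = L.length ∧ S.L = (M.input E₀ E₁ L).bit 5 ∧ S.Ready σ ∧ σ.reg 3 = 0 ∧
    main.exec M.oracle (M.input E₀ E₁ L) = blocks.exec M.oracle σ ∧
    (∃ s ∈ L, M.energy s = S.lo) ∧ (∃ s ∈ L, M.energy s = S.hi) ∧
    ∀ s ∈ L, S.lo ≤ M.energy s ∧ M.energy s ≤ S.hi := by
  set O := M.oracle with hO
  set σ₀ := M.input E₀ E₁ L with hσ₀
  obtain ⟨r, hr, hp, hT⟩ := reduction_spec M E₀ E₁ L O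
  rw [← hσ₀] at hr hp hT
  have F₁ := exec_frame O (copyRows ;; reduction) σ₀
  set σ₁ := (copyRows ;; reduction).exec O σ₀ with hσ₁
  have F₂ := exec_frame O writeCircuit σ₁
  have hcirc := writeCircuit_spec (n := n) O σ₁
  set σ₂ := writeCircuit.exec O σ₁ with hσ₂
  have F₃ := exec_frame O power σ₂
  have hpow := power_spec O σ₂
  rw [F₂.reg 4 rfl, hr] at hpow
  set σ₃ := power.exec O σ₂ with hσ₃
  have F₄ := exec_frame O sizes σ₃
  obtain ⟨z₁, z₂, z₃⟩ := sizes_spec O σ₃ hpow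
  set σ₄ := sizes.exec O σ₃ with hσ₄
  have F₅ := exec_frame O tables σ₄
  have htab := tables_spec O σ₄ ((F₄.reg 30 rfl).trans hpow)
  set σ₅ := tables.exec O σ₄ with hσ₅
  have F₆ := exec_frame O window σ₅
  have F₁₅ := exec_frame O (writeCircuit ;; power ;; sizes ;; tables) σ₁
  have F₁₆ := exec_frame O (writeCircuit ;; power ;; sizes ;; tables ;; window) σ₁
  have F₂₆ := exec_frame O (power ;; sizes ;; tables ;; window) σ₂
  have F₃₆ := exec_frame O (sizes ;; tables ;; window) σ₃
  have F₄₆ := exec_frame O (tables ;; window) σ₄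
  simp only [exec_seq, ← hσ₂, ← hσ₃, ← hσ₄, ← hσ₅] at F₁₅ F₁₆ F₂₆ F₃₆ F₄₆
  have hmain : main.exec O σ₀ = blocks.exec O (window.exec O σ₅) := by
    simp only [main, exec_seq, hσ₅, hσ₄, hσ₃, hσ₂, hσ₁]
  have r₀ : σ₀.reg 0 = n := rfl
  have r₁ : σ₀.reg 1 = k := rfl
  have r₂ : σ₀.reg 2 = L.length := rfl
  have r₃ : σ₀.reg 3 = 0 := rfl
  have e₀₀ : σ₀.num 0 = E₀ := rfl
  have e₀₁ : σ₀.num 1 = E₁ := rfl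
  have hgam : ∀ i, (h : i < k) → σ₀.numArr 0 0 i = M.γ ⟨i, h⟩ := fun i h => by
    simp [hσ₀, Model.input, h]
  have hbit : ∀ l (hl : l < L.length) (j : Fin n), σ₀.bit 5 l j = L[l] j :=
    fun l hl j => input_bit M E₀ E₁ L hl j
  clear_value σ₅ σ₄ σ₃ σ₂ σ₁ σ₀ O
  have hlen : σ₅.reg 2 = L.length := (F₁₅.reg 2 rfl).trans ((F₁.reg 2 rfl).trans r₂)
  have a₅ : σ₅.arr 5 = σ₀.arr 5 := (F₁₅.arr 5 rfl).trans (F₁.arr 5 rfl)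
  have hpos : 0 < L.length := List.length_pos_iff.2 hL
  obtain ⟨lo, hi, hlo, hhi, ⟨l₀, hl₀, e₀⟩, ⟨l₁, hl₁, e₁⟩, hall⟩ := window_spec σ₅ M
    (fun l => if h : l < L.length then L[l] else fun _ => false) (by rwa [hlen]) (by
      intro l hl q
      rw [hlen] at hl
      rw [dif_pos hl, ← hbit l hl q]
      simp only [Memory.bit, a₅])
  rw [hlen] at hl₀ hl₁ hall
  rw [← hO] at hlo hhi
  rw [dif_pos hl₀] at e₀
  rw [dif_pos hl₁] at e₁
  set σ₆ := window.exec O σ₅ with hσ₆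
  clear_value σ₆
  refine ⟨⟨M, E₀, E₁, lo, hi, r, L.length, σ₀.bit 5, σ₁.tableau n, hT⟩, σ₆, rfl, rfl, rfl, rfl, rfl,
    ?_, (F₁₆.reg 3 rfl).trans ((F₁.reg 3 rfl).trans r₃), hmain, ⟨_, List.getElem_mem hl₀, e₀⟩,
    ⟨_, List.getElem_mem hl₁, e₁⟩, fun s hs => ?_⟩
  · constructor
    · exact (F₁₆.reg 0 rfl).trans ((F₁.reg 0 rfl).trans r₀)
    · exact (F₁₆.reg 1 rfl).trans ((F₁.reg 1 rfl).trans r₁)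
    · exact (F₁₆.reg 2 rfl).trans ((F₁.reg 2 rfl).trans r₂)
    · exact (F₁₆.reg 4 rfl).trans hr
    · exact (F₁₆.reg 11 rfl).trans hp
    · exact (F₃₆.reg 30 rfl).trans hpow
    · exact (F₄₆.reg 31 rfl).trans z₁
    · exact (F₄₆.reg 32 rfl).trans z₂
    · exact (F₄₆.reg 33 rfl).trans z₃
    · refine Memory.tableau_congr (F₁₆.reg 20 rfl) fun a ha => ?_
      fin_cases ha
      exacts [F₁₆.arr 0 rfl, F₁₆.arr 1 rfl, F₁₆.arr 2 rfl, F₁₆.arr 8 rfl, F₁₆.arr 9 rfl]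
    · have : circuit n σ₆ = circuit n σ₂ := by
        simp only [circuit, F₂₆.reg 5 rfl, F₂₆.arr 6 rfl]
      rw [this, hcirc]
      rfl
    · intro l _ j _
      have : σ₆.arr 5 = σ₀.arr 5 := (F₆.arr 5 rfl).trans a₅
      simp only [Memory.bit, this]
    · intro y hy
      rw [F₆.arr 10 rfl]
      exact (htab y hy).1
    · intro y hy
      rw [F₆.arr 11 rfl]
      exact (htab y hy).2.1
    · intro y hy
      rw [F₆.arr 12 rfl]
      exact (htab y hy).2.2
    · exact (F₁₆.num 0 rfl).trans ((F₁.num 0 rfl).trans e₀₀)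
    · exact (F₁₆.num 1 rfl).trans ((F₁.num 1 rfl).trans e₀₁)
    · exact hlo
    · exact hhi
    · intro i hi
      rw [F₁₆.numArr 0 rfl, F₁.numArr 0 rfl, hgam i hi, Setting.gamma, dif_pos hi]
  · obtain ⟨l, hl, rfl⟩ := List.getElem_of_mem hs
    have := hall l hl
    rwa [dif_pos hl] at this

theorem main_isOutput (hL : L ≠ []) (hnd : L.Nodup)
    (hmem : ∀ s, s ∈ L ↔ s ∈ M.S (E₀ - M.normδH) (E₁ + M.normδH)) :
    M.IsOutput E₀ E₁ (main.exec M.oracle (M.input E₀ E₁ L)) := by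
  obtain ⟨S, σ, rfl, rfl, rfl, hlen, hSL, R, h3, hmain, ⟨s₀, hs₀, e₀⟩, ⟨s₁, hs₁, e₁⟩, hall⟩ :=
    exists_ready M E₀ E₁ L hL
  have hbit : ∀ l (hl : l < L.length) (j : Fin n), S.L l j = L[l] j := fun l hl j => by
    rw [hSL, input_bit S.M S.E₀ S.E₁ L hl j]
  rw [hmain]
  refine Setting.isOutput (R.frame (exec_frame S.M.oracle blocks σ) rfl)
    (blocks_spec R h3 fun l hl l' hl' H => ?_) (fun s hs => hall s ((hmem s).2 hs))
    fun s h₀ h₁ => ?_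
  · rw [hlen] at hl hl'
    exact hnd.getElem_inj_iff.1 (funext fun j => by rw [← hbit l hl j, ← hbit l' hl' j, H j j.2])
  -- The ends of the window are energies of list members and so lie in the enlarged energy interval;
  -- a state with energy between them lies there too and is on the list.
  · have hsL : s ∈ L := (hmem s).2 ⟨((hmem s₀).1 hs₀).1.trans (e₀.trans_le h₀),
      h₁.trans (e₁.symm.trans_le ((hmem s₁).1 hs₁).2)⟩
    obtain ⟨l, hl, rfl⟩ := List.getElem_of_mem hsL
    exact ⟨l, by rwa [hlen], hbit l hl⟩

/-- If no stabilizer eigenstate has energy in the enlarged interval, every solution of an eigenvalue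
equation in question has all block parts 0, so the empty output is complete. -/
theorem input_isOutput (hmem : ∀ s, s ∉ M.S (E₀ - M.normδH) (E₁ + M.normδH)) :
    M.IsOutput E₀ E₁ (M.input E₀ E₁ []) := by
  obtain ⟨r, -, -, hT⟩ := reduction_spec M E₀ E₁ [] M.oracle
  have h3 : (M.input E₀ E₁ []).reg 3 = 0 := rfl
  refine ⟨⟨Nat.zero_le _, Nat.zero_le _⟩, ?_, fun i => absurd i.2 (by simp [h3]),
    fun E ψ h₀ h₁ hψ => ?_⟩
  · rw [orthonormal_iff_ite]
    exact fun i => absurd i.2 (by simp [h3])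
  · obtain ⟨φ, hφ, rfl⟩ := hT.exists_frame hψ
    have h0 : WithLp.toLp 2 φ ∈ (⊥ : Submodule ℂ (Qubits n)) :=
      hT.mem_of_blockPart_mem h₀ h₁ hφ fun a ha => absurd ha (hmem _)
    rw [Submodule.mem_bot] at h0
    rw [h0, map_zero]
    exact zero_mem _

end Prog

/-- The compiled program agrees with the semantics on arrays and low registers only; the output is
read from arrays and from registers up to 5. -/
theorem Model.IsOutput.congr {n k : ℕ} {M : Model n k} {E₀ E₁ : ℝ} {σ τ : Memory} {t : ℕ}
    (h : M.IsOutput E₀ E₁ σ) (ht : 5 < t) (hτ : Below t σ τ) : M.IsOutput E₀ E₁ τ := by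
  have h₃ : τ.reg 3 = σ.reg 3 := hτ.reg 3 (by omega)
  have h₄ : τ.reg 4 = σ.reg 4 := hτ.reg 4 (by omega)
  have h₅ : τ.reg 5 = σ.reg 5 := hτ.reg 5 (by omega)
  have hv : outputVector n τ = outputVector n σ := by
    funext i
    simp only [outputVector, circuit, h₄, h₅, hτ.arr, hτ.numArr]
  obtain ⟨a, b, c, d⟩ := h
  constructor
  · rwa [h₄]
  · rw [hv, h₃]
    exact b
  · rw [hv, h₃, hτ.numArr]
    exact c
  · rw [hv, h₃]
    exact d

/-! ## Running time -/

namespace Prog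

open Cmd

/-- The inner loop is bounded by a register that the program itself writes, so `cost_le` does not
apply. Round `i` takes `O(2 ^ i)` steps, and the geometric sum is of the order of its last term. -/
theorem power_cost (O : Oracle) (σ : Memory) : power.cost O σ ≤ 40 * 2 ^ σ.reg 4 := by
  have key : ∀ i ≤ σ.reg 4, (loopState ((setN 31 (.var 30) ;;
      loop 14 31 (setN 30 (.succ (.var 30)))).exec O) 13 ((setN 30 (.lit 1)).exec O σ) i).reg 30 =
      2 ^ i := by
    intro i hi
    have h := loopState_inv O (x := 13) (y := 4) (b := setN 31 (.var 30) ;;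
      loop 14 31 (setN 30 (.succ (.var 30)))) (fun j τ => τ.reg 30 = 2 ^ j)
      ((setN 30 (.lit 1)).exec O σ) (by simp) (by
        intro j hj τ hF hτ ih
        rw [exec_seq, Memory.setReg_reg, if_neg (by decide),
          reg_loop_add O _ 1 (by decide) fun τ _ => rfl]
        simp [ih, pow_succ]
        ring) i (by simpa using hi)
    exact h
  have hsum : ∀ r, (∑ i ∈ Finset.range r, 20 * 2 ^ i) + 20 = 20 * 2 ^ r := by
    intro r
    induction r with
    | zero => simp
    | succ r ih => rw [Finset.sum_range_succ, pow_succ]; omega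
  have hbound : power.cost O σ ≤ (∑ i ∈ Finset.range (σ.reg 4), 20 * 2 ^ i) + 20 := by
    simp only [power, cost]
    have h4 : ((setN 30 (.lit 1)).exec O σ).reg 4 = σ.reg 4 := by simp
    rw [h4]
    have : ∑ i ∈ Finset.range (σ.reg 4), ((NExp.var 30).cost + 1 + (∑ j ∈ Finset.range
        (((setN 31 (.var 30)).exec O (loopState ((setN 31 (.var 30) ;;
      loop 14 31 (setN 30 (.succ (.var 30)))).exec O) 13 ((setN 30 (.lit 1)).exec O σ) i)).reg 31),
        ((NExp.var 30).succ.cost + 1 + 2) + 2) + 2) ≤ ∑ i ∈ Finset.range (σ.reg 4), 20 * 2 ^ i := by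
      refine Finset.sum_le_sum fun i hi => ?_
      have := key i (Finset.mem_range.1 hi).le
      have hpos : 1 ≤ 2 ^ i := Nat.one_le_two_pow
      rw [exec_setN (x := 31), Memory.setReg_reg, if_pos rfl, NExp.eval_var, this]
      simp only [Finset.sum_const, Finset.card_range, smul_eq_mul, NExp.cost]
      omega
    simp only [NExp.cost] at this ⊢
    omega
  rw [hsum] at hbound
  omega

theorem cost_le_cube (O : Oracle) {S : ℕ → Bool} {B Λ d : ℕ} (hB : 1 ≤ B) (hΛ : 1 ≤ Λ)
    (hw : O.w ≤ B) {c : Cmd} (hc : c.sized S = true ∧ c.degree ≤ d ∧ c.depth ≤ 1) {σ : Memory}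
    (hσ : ∀ y, S y → σ.reg y ≤ B) (h2 : σ.reg 2 ≤ Λ) : c.cost O σ ≤ c.coeff * (B ^ d * Λ) := by
  refine (cost_le O hB hΛ hw c hc.1 σ hσ h2).trans ?_
  have h₁ := Nat.pow_le_pow_right hB hc.2.1
  have h₂ := Nat.pow_le_pow_right hΛ hc.2.2
  rw [pow_one] at h₂
  gcongr

/-- The strings `P i` are distinct elements of an `𝔽₂`-space of dimension `|K|`. -/
theorem card_le_two_pow_dimK {n k : ℕ} (M : Model n k) : k ≤ 2 ^ M.dimK := by
  classical
  have h := Module.card_eq_pow_finrank (K := ZMod 2)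
    (V := Submodule.span (ZMod 2) (Set.range M.P))
  rw [ZMod.card] at h
  rw [Model.dimK, ← h]
  have hinj : Function.Injective fun i : Fin k =>
      (⟨M.P i, Submodule.subset_span ⟨i, rfl⟩⟩ : Submodule.span (ZMod 2) (Set.range M.P)) :=
    fun i j hij => M.P_injective (congrArg Subtype.val hij)
  simpa using Fintype.card_le_of_injective _ hinj

theorem main_cost : ∃ C : ℕ, ∀ {n k : ℕ} (M : Model n k) (E₀ E₁ : ℝ) (L : List (Label n)),
    L ≠ [] → main.cost M.oracle (M.input E₀ E₁ L) ≤
      C * (L.length * (n ^ 3 + 2 ^ (3 * M.dimK))) := by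
  -- Here `864 = 4 * 6 ^ 3`, from `(n + 6 * K) ^ 3 ≤ 4 * (n ^ 3 + (6 * K) ^ 3)`. The other factor
  -- adds up the coefficients of the parts, with 40 for the computation of `2 ^ r`.
  refine ⟨864 * (copyRows.coeff + reduction.coeff + writeCircuit.coeff * (reduction.coeff + 1) + 40 +
    sizes.coeff + (tables ;; window ;; blocks).coeff), ?_⟩
  intro n k M E₀ E₁ L hL
  set O := M.oracle with hO
  set σ₀ := M.input E₀ E₁ L with hσ₀
  set K := 2 ^ M.dimK with hK
  set Λ := L.length with hΛ
  -- Large enough for all loop bounds and degrees: `n`, `k ≤ K`, `n + k`, `N ≤ K`, `N + 1`, `3 * N`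
  -- and 2.
  set B := n + 3 * K + 3 with hB
  have hK1 : 1 ≤ K := Nat.one_le_two_pow
  have hk : k ≤ K := card_le_two_pow_dimK M
  have hΛ1 : 1 ≤ Λ := List.length_pos_iff.2 hL
  have hB1 : 1 ≤ B := by omega
  have hw : O.w ≤ B := by
    change n ≤ B
    omega
  obtain ⟨r, hr, -, hT⟩ := reduction_spec M E₀ E₁ L O
  rw [← hσ₀] at hr
  have hN : 2 ^ r ≤ K := Nat.pow_le_pow_right two_pos hT.le_dimK
  have r₀ : σ₀.reg 0 = n := rfl
  have r₁ : σ₀.reg 1 = k := rfl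
  have r₂ : σ₀.reg 2 = Λ := rfl
  have c₁ := cost_le_cube O (S := fun x => x == 0 || x == 1) hB1 hΛ1 hw (c := copyRows) (d := 3)
    (by decide +kernel) (σ := σ₀) (by
      intro y hy
      simp only [Bool.or_eq_true, beq_iff_eq] at hy
      rcases hy with rfl | rfl <;> omega) r₂.le
  have F₁ := exec_frame O copyRows σ₀
  have h10 := (copyRows_spec (n := n) (k := k) O σ₀ rfl rfl).1
  set σ₁ := copyRows.exec O σ₀ with hσ₁
  have c₂ := cost_le_cube O (S := fun x => x == 0 || x == 1 || x == 10) hB1 hΛ1 hw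
    (c := reduction) (d := 3) (by decide +kernel) (σ := σ₁) (by
      have q₀ : σ₁.reg 0 = n := F₁.reg 0 rfl
      have q₁ : σ₁.reg 1 = k := F₁.reg 1 rfl
      intro y hy
      simp only [Bool.or_eq_true, beq_iff_eq] at hy
      rcases hy with (rfl | rfl) | rfl <;> omega) ((F₁.reg 2 rfl).trans r₂).le
  have h20 := reg_le_cost O 20 reduction (by decide +kernel) σ₁
  rw [F₁.reg 20 rfl, show σ₀.reg 20 = 0 from rfl, zero_add] at h20
  have F₂ := exec_frame O reduction σ₁
  set σ₂ := reduction.exec O σ₁ with hσ₂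
  have hr₂ : σ₂.reg 4 = r := hr
  set X := B ^ 3 * Λ with hX
  have hBX : B ≤ X := by
    calc B = B ^ 1 * 1 := by ring
      _ ≤ B ^ 3 * Λ := by gcongr <;> omega
  -- Copying the circuit is linear in the number of gates, for which the cost of finding them is the
  -- bound. This number is of the order of `X`, not of `B`, so the loop is counted with a larger
  -- base and degree 1.
  have c₃ := cost_le O (S := fun x => x == 20) (B := (reduction.coeff + 1) * X) (Λ := Λ)
    (by nlinarith) hΛ1 (by nlinarith) writeCircuit (by decide +kernel) σ₂ (by
      intro y hy
      simp only [beq_iff_eq] at hy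
      subst hy
      nlinarith) ((F₂.reg 2 rfl).trans ((F₁.reg 2 rfl).trans r₂)).le
  rw [show writeCircuit.degree = 1 by decide +kernel, show writeCircuit.depth = 0 by decide +kernel,
    pow_one, pow_zero, mul_one] at c₃
  have F₃ := exec_frame O writeCircuit σ₂
  set σ₃ := writeCircuit.exec O σ₂ with hσ₃
  have hr₃ : σ₃.reg 4 = r := (F₃.reg 4 rfl).trans hr₂
  have c₄ := power_cost O σ₃
  have hp := power_spec O σ₃
  rw [hr₃] at c₄ hp
  have F₄ := exec_frame O power σ₃
  set σ₄ := power.exec O σ₃ with hσ₄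
  have G := exec_frame O (copyRows ;; reduction ;; writeCircuit ;; power) σ₀
  have G' := exec_frame O (copyRows ;; reduction ;; writeCircuit ;; power ;; sizes) σ₀
  obtain ⟨z₁, z₂, z₃⟩ := sizes_spec O σ₄ hp
  have c₅ := cost_le_cube O (S := fun x => x == 30) hB1 hΛ1 hw (c := sizes) (d := 3)
    (by decide +kernel) (σ := σ₄) (by
      intro y hy
      simp only [beq_iff_eq] at hy
      subst hy
      omega) ((G.reg 2 rfl).trans r₂).le
  have F₅ := exec_frame O sizes σ₄
  set σ₅ := sizes.exec O σ₄ with hσ₅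
  have c₆ := cost_le_cube O
    (S := fun x => x == 0 || x == 1 || x == 30 || x == 31 || x == 32 || x == 33) hB1 hΛ1 hw
    (c := tables ;; window ;; blocks) (d := 3) (by decide +kernel) (σ := σ₅) (by
      have q₀ : σ₅.reg 0 = n := G'.reg 0 rfl
      have q₁ : σ₅.reg 1 = k := G'.reg 1 rfl
      have q₃₀ : σ₅.reg 30 = 2 ^ r := (F₅.reg 30 rfl).trans hp
      intro y hy
      simp only [Bool.or_eq_true, beq_iff_eq] at hy
      rcases hy with ((((rfl | rfl) | rfl) | rfl) | rfl) | rfl <;> omega)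
    ((G'.reg 2 rfl).trans r₂).le
  have hcost : main.cost O σ₀ = copyRows.cost O σ₀ + (reduction.cost O σ₁ + (writeCircuit.cost O σ₂ +
      (power.cost O σ₃ + (sizes.cost O σ₄ + (tables ;; window ;; blocks).cost O σ₅)))) := rfl
  have hXle : X ≤ 864 * (Λ * (n ^ 3 + 2 ^ (3 * M.dimK))) := by
    have e : 2 ^ (3 * M.dimK) = K ^ 3 := by rw [hK, ← pow_mul, mul_comm]
    have h₁ : B ≤ n + 6 * K := by omega
    have h₂ : (n + 6 * K) ^ 3 ≤ 864 * (n ^ 3 + K ^ 3) := by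
      have h := add_pow_le (Nat.zero_le n) (Nat.zero_le (6 * K)) 3
      have : (6 * K) ^ 3 = 216 * K ^ 3 := by ring
      rw [this] at h
      norm_num at h
      omega
    rw [e]
    calc X ≤ (864 * (n ^ 3 + K ^ 3)) * Λ := by
          rw [hX]
          gcongr
          exact (Nat.pow_le_pow_left h₁ 3).trans h₂
      _ = _ := by ring
  have hNX : 40 * 2 ^ r ≤ 40 * X := by omega
  rw [hcost]
  calc _ ≤ (copyRows.coeff + reduction.coeff + writeCircuit.coeff * (reduction.coeff + 1) + 40 +
        sizes.coeff + (tables ;; window ;; blocks).coeff) * X := by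
        rw [← hX] at c₅ c₆
        linarith
    _ ≤ _ := by
        refine (Nat.mul_le_mul_left _ hXle).trans (le_of_eq ?_)
        ring

end Prog

end

end StabPert

theorem theorem3 :
    ∃ (prog : StabPert.Program) (C : ℕ),
      ∀ (n k : ℕ) (M : StabPert.Model n k) (E₀ E₁ : ℝ), E₀ < E₁ →
        ∀ L : List (StabPert.Label n), L.Nodup →
          (∀ s, s ∈ L ↔ s ∈ M.S (E₀ - M.normδH) (E₁ + M.normδH)) →
          ∃ (σ : StabPert.Memory) (t : ℕ),
            StabPert.Run M.oracle prog (M.input E₀ E₁ L) σ t ∧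
            M.IsOutput E₀ E₁ σ ∧
            t ≤ C * (1 + (M.S (E₀ - M.normδH) (E₁ + M.normδH)).ncard
              * (n ^ 3 + 2 ^ (3 * M.dimK))) := by
  obtain ⟨C, hC⟩ := StabPert.Prog.main_cost
  -- The additional 10 pays for the initial test whether the list is empty, and for the `skip` in
  -- that case.
  refine ⟨StabPert.Prog.all.code, C + 10, fun n k M E₀ E₁ _ L hnd hmem => ?_⟩
  obtain ⟨τ, T, hrun, hT, hτ⟩ := StabPert.Cmd.run M.oracle StabPert.Prog.all StabPert.Prog.all_ok
    (M.input E₀ E₁ L) (M.input E₀ E₁ L) (StabPert.Below.refl _ _)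
  have hcard : (M.S (E₀ - M.normδH) (E₁ + M.normδH)).ncard = L.length := by
    classical
    rw [show M.S (E₀ - M.normδH) (E₁ + M.normδH) = (L.toFinset : Set (StabPert.Label n)) by
      ext s; simp [hmem], Set.ncard_coe_finset, List.toFinset_card_of_nodup hnd]
  have hlen : (M.input E₀ E₁ L).reg 2 = L.length := rfl
  have hb : (StabPert.Test.eq (.var 2) (.lit 0)).Holds (M.input E₀ E₁ L) ↔ L = [] := by
    rw [← List.length_eq_zero_iff, ← hlen]
    rfl
  refine ⟨τ, T, hrun, StabPert.Model.IsOutput.congr ?_ (by decide) hτ, hT.trans ?_⟩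
  · by_cases h : L = []
    · rw [StabPert.Prog.all, StabPert.Cmd.exec_ite_pos (hb.2 h), StabPert.Cmd.exec_skip]
      subst h
      exact StabPert.Prog.input_isOutput M E₀ E₁ fun s hs => by simpa using (hmem s).2 hs
    · rw [StabPert.Prog.all, StabPert.Cmd.exec_ite_neg (mt hb.1 h)]
      exact StabPert.Prog.main_isOutput M E₀ E₁ L h hnd hmem
  · rw [hcard, StabPert.Prog.all, StabPert.Cmd.cost]
    split_ifs with h
    · simp only [StabPert.Test.cost, StabPert.NExp.cost, StabPert.Cmd.cost]
      nlinarith [Nat.zero_le ((C + 10) * (L.length * (n ^ 3 + 2 ^ (3 * M.dimK))))]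
    · have := hC M E₀ E₁ L (mt hb.2 h)
      simp only [StabPert.Test.cost, StabPert.NExp.cost]
      nlinarith [Nat.zero_le (L.length * (n ^ 3 + 2 ^ (3 * M.dimK)))]
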